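/- \textbf{Setting.} Fix $d\ge1$, $\mathcal X=[0,1]^d$, $\mathcal O=\mathcal X\times\{0,1\}\times\{0,1\}$, and let $\mu$ be Lebesgue measure times counting measures on $\mathcal O$. Let $O_i=(X_i,A_i,Y_i)$, $i\ge1$, be i.i.d. with law $P^*\ll\mu$, let $P_X^*$ be the law of $X$, and let $\lambda:[0,1]\to\mathbb R_{\ge0}$ be a weight function with derivative $\dot\lambda$. Suppose that $e^*(X)=P^*(A=1\mid X)$ and $q^*_a(X)=\mathbb E^*[Y\mid A=a,X]$ have continuous versions on $\mathcal X$, and fix one such triple $U^*=(q_1^*,q_0^*,e^*)$. For a probability measure $Q$ on $\mathcal X$ and $U=(q_1,q_0,e)$, put $\tau=q_1-q_0$, $p_U(a,y\mid x)=e^a(1-e)^{1-a}q_a^y(1-q_a)^{1-y}$ (functions at $x$), let $\widetilde P(Q,U)$ be the law with $X\sim Q$ and $(A,Y)\mid X=x\sim p_U(\cdot\mid x)$, and set $\Omega(Q,U)=\mathbb E_Q[\lambda(e(X))]$, $\psi(Q,U)=\mathbb E_Q[\lambda(e(X))\tau(X)]/\Omega(Q,U)$, \[\phi=\tfrac{a}{e}(y-q_1)-\tfrac{1-a}{1-e}(y-q_0)+\tau,\]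 \[D^*=\tfrac{\lambda(e)}{\Omega}(\phi-\tau)+\tfrac{\dot\lambda(e)}{\Omega}(\tau-\psi)(a-e),\qquad D^*_{\mathrm{full}}=\tfrac{\lambda(e)}{\Omega}(\phi-\psi)+\tfrac{\dot\lambda(e)}{\Omega}(\tau-\psi)(a-e).\] Write $\psi(P^*)=\psi(P_X^*,U^*)$, and write $D^*_{\mathrm{full}}(\cdot;P^*)$ for $D^*_{\mathrm{full}}$ at $(P_X^*,U^*)$. \textbf{Local bracketing conditions.} For $\eta\in(0,1/4)$ let $\mathfrak c(\eta)$ be the largest $r>0$ with $r\le\min\{\inf\lambda,\eta\}$ and $\max\{\sup\lambda,\sup|\lambda'|,\sup|\lambda''|,\sup|\lambda'''|,\eta\}\le r^{-1}$, where inf and sup are over $[\eta,1-\eta]$. Norms of triples are $\|U\|_\infty=\max\{\|q_1\|_\infty,\|q_0\|_\infty,\|e\|_\infty\}$. A pair $(Q,U_0)$, with $U_0$ a continuous triple, satisfies the local bracketing conditions with constants $(\mathfrak c,c_{\mathrm{init}})$ if there is $\eta\in(0,1/4)$ with $\mathfrak c=\mathfrak c(\eta)$ such that: every continuous $U$ with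 $\|U-U_0\|_\infty\le2\eta$ has values in $[\eta,1-\eta]^3$; $\lambda$ is $C^3$ on $[\eta,1-\eta]$ with $\inf_{[\eta,1-\eta]}\lambda>0$; $Q$ is absolutely continuous or pure point; $c_{\mathrm{init}}\in(0,1)$ and $\widetilde P(Q,U_0)[(D^*(\cdot;Q,U_0))^2]\ge c_{\mathrm{init}}$; $\|U^*-U_0\|_\infty\le\eta$; $\mathbb E_Q[\mathrm{TV}(p_{U^*}(\cdot\mid X),p_{U_0}(\cdot\mid X))]\le\mathfrak c^{10}c_{\mathrm{init}}/600$; and $\bigl|\mathbb E_Q\bigl[\sum_{a,y}D^*((X,a,y);Q,U_0)\,p_{U^*}(a,y\mid X)\bigr]\bigr|\le c_{\mathrm{init}}\delta_{\mathrm{init}}/8$, where $\delta_{\mathrm{init}}=c_{\mathrm{init}}\mathfrak c^{20}/10^6$. \textbf{Estimator.} Let $n=2m$, $I_0=\{1,\dots,m\}$, $I_1=\{m+1,\dots,2m\}$. Nuisance estimators $q_{1,0,s},q_{0,0,s},e_{0,s}$, $s\ge 1$, are measurable maps $\mathcal O^s\to C(\mathcal X;[0,1])$. Let $\hat U^{(k)}_0$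 be the triple computed from fold $I_k$, and let $\hat Q^{(k)}$ be the empirical law of $(X_i)_{i\in I_k}$. Fix constants $\mathfrak c,c_{\mathrm{init}}>0$. When $(\hat Q^{(k)},\hat U_0^{(1-k)})$ satisfies the local bracketing conditions with constants $(\mathfrak c,c_{\mathrm{init}})$, let $t\mapsto\hat U_t^{(k)}$ be the $C^1$ solution in $C(\mathcal X)^3$, $|t|<\mathfrak c^6/8$, of \[\dot q_1=\frac{q_1(1-q_1)\lambda(e)}{\Omega e},\quad\dot q_0=-\frac{q_0(1-q_0)\lambda(e)}{\Omega(1-e)},\quad\dot e=\frac{e(1-e)\dot\lambda(e)}{\Omega}(\tau-\psi)\] (with $\Omega,\psi$ evaluated at $(\hat Q^{(k)},\hat U^{(k)}_t)$) that starts at $\hat U_0^{(1-k)}$ and stays in the closed sup-norm ball of radius $\eta$ about it, $\eta$ being as in the conditions. Let $L^{(k)}(t)=\frac1m\sum_{i\in I_k}\log p_{\hat U_t^{(k)}}(A_i,Y_i\mid X_i)$. Let $\mathcal E^{(k)}$ be the event that the local bracketing conditions hold for $(\hat Q^{(k)},\hat U_0^{(1-k)})$ and $(L^{(k)})'$ has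 a unique zero $\hat t_k$ in $[-\delta_{\mathrm{init}},\delta_{\mathrm{init}}]$. On $\mathcal E^{(k)}$ put $\hat\psi_k=\psi(\hat Q^{(k)},\hat U^{(k)}_{\hat t_k})$ and $\hat D_{\mathrm{CF},i}=D^*_{\mathrm{full}}(O_i;\hat Q^{(k)},\hat U^{(k)}_{\hat t_k})$ for $i\in I_k$; off $\mathcal E^{(k)}$ put both equal to $0$. Set $\hat\psi_{\mathrm{CF}}=\frac12(\hat\psi_0+\hat\psi_1)$ and $\hat\sigma^2_{\mathrm{CF}}=\frac1n\sum_{i=1}^n\hat D_{\mathrm{CF},i}^2$. \textbf{Theorem.} Suppose that, with probability tending to one, $(\hat Q^{(k)},\hat U_0^{(1-k)})$ satisfies the local bracketing conditions with constants $(\mathfrak c,c_{\mathrm{init}})$ for both $k\in\{0,1\}$, and that, as $s\to\infty$, $\|q_{1,0,s}-q_1^*\|_{L^2(P_X^*)}$, $\|q_{0,0,s}-q_0^*\|_{L^2(P_X^*)}$ and $\|e_{0,s}-e^*\|_{L^2(P_X^*)}$ are $o_p(s^{-1/4})$ (estimators computed from $O_1,\dots,O_s$). Then, as $n=2m\to\infty$: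 \[\sqrt n\bigl(\hat\psi_{\mathrm{CF}}-\psi(P^*)\bigr)=\frac1{\sqrt n}\sum_{i=1}^nD^*_{\mathrm{full}}(O_i;P^*)+o_p(1),\] and $D^*_{\mathrm{full}}(\cdot;P^*)$ is the efficient influence function of $\psi$ at $P^*$ in the full model of all laws $P\ll\mu$, so that $\hat\psi_{\mathrm{CF}}$ is efficient in the sense of being asymptotically linear with the efficient influence function. That is, $D^*_{\mathrm{full}}(\cdot;P^*)$ is square integrable with mean zero, lies in the $L^2(P^*)$-closure of the scores of regular submodels, and satisfies $\frac{d}{d\epsilon}\psi(P_\epsilon)|_{\epsilon=0}=\mathbb E^*[D^*_{\mathrm{full}}(O;P^*)h(O)]$ for every regular submodel $(P_\epsilon)$ with $P_0=P^*$ and score $h$. Here a regular submodel is one that is differentiable in quadratic mean at $\epsilon=0$ and whose propensity scores, for all small $|\epsilon|$, take values almost surely in some fixed interval $[\eta,1-\eta]$, $\eta\in(0,1/2)$, on which $\lambda$ is positive and $C^3$. Moreover, \[\hat\sigma^2_{\mathrm{CF}}\xrightarrow{p}\sigma^2=\mathrm{Var}_{P^*}\bigl(D^*_{\mathrm{full}}(O;P^*)\bigr),\qquad\sigma^2>0,\qquad\sqrt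 n\bigl(\hat\psi_{\mathrm{CF}}-\psi(P^*)\bigr)\xrightarrow{d}N(0,\sigma^2),\] and for every $\alpha\in(0,1)$ the probability that $\psi(P^*)$ lies in $\bigl[\hat\psi_{\mathrm{CF}}-z_{1-\alpha/2}\hat\sigma_{\mathrm{CF}}/\sqrt n,\ \hat\psi_{\mathrm{CF}}+z_{1-\alpha/2}\hat\sigma_{\mathrm{CF}}/\sqrt n\bigr]$ tends to $1-\alpha$, where $z_\gamma$ is the $\gamma$-quantile of the standard normal law. -/

import Mathlib

open MeasureTheory ProbabilityTheory Filter Topology Set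
open scoped ENNReal NNReal

namespace WATE

noncomputable section

/-! ### Sample space, nuisance triples and laws -/

/-- The covariate space `[0,1]^d`; its `volume` is Lebesgue measure. -/
abbrev Cov (d : ℕ) := Fin d → unitInterval

/-- An observation `o = (x, a, y)` with binary treatment `a` and binary outcome `y`. -/
abbrev Obs (d : ℕ) := Cov d × Bool × Bool

/-- The numerical value of a binary variable. -/
def val (b : Bool) : ℝ := if b then 1 else 0

/-- The dominating measure: Lebesgue measure times the counting measures. -/
def domMeasure (d : ℕ) : Measure (Obs d) :=
  (volume : Measure (Cov d)).prod (Measure.count.prod Measure.count)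

/-- The marginal law of the covariate. -/
def margX {d : ℕ} (P : Measure (Obs d)) : Measure (Cov d) := P.map Prod.fst

/-- A triple of nuisance functions `(q₁, q₀, e)`. -/
structure Nuis (d : ℕ) where
  q1 : Cov d → ℝ
  q0 : Cov d → ℝ
  e : Cov d → ℝ

/-- Triples `(q₁, q₀, e)` of continuous functions. The norm of this product space is
`max {‖q₁‖_∞, ‖q₀‖_∞, ‖e‖_∞}`. -/
abbrev CNuis (d : ℕ) := C(Cov d, ℝ) × C(Cov d, ℝ) × C(Cov d, ℝ)

/-- The functions underlying a continuous triple. -/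
def CNuis.fn {d : ℕ} (U : CNuis d) : Nuis d := ⟨U.1, U.2.1, U.2.2⟩

/-- `q_a`. -/
def Nuis.q {d : ℕ} (U : Nuis d) (a : Bool) (x : Cov d) : ℝ := if a then U.q1 x else U.q0 x

/-- The blip `q₁ - q₀`. -/
def Nuis.tau {d : ℕ} (U : Nuis d) (x : Cov d) : ℝ := U.q1 x - U.q0 x

/-- `U = (q₁, q₀, e)` is a version of the nuisance functions of the law `P`:
`e(X) = P(A = 1 | X)` and `q_A(X) = E[Y | A, X]`, almost surely. -/
structure IsNuisanceOf {d : ℕ} (P : Measure (Obs d)) (U : Nuis d) : Prop where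
  measurable_q1 : Measurable U.q1
  measurable_q0 : Measurable U.q0
  measurable_e : Measurable U.e
  propensity : (fun o : Obs d => U.e o.1) =ᵐ[P]
    P[fun o : Obs d => val o.2.1 |
      MeasurableSpace.comap (fun o : Obs d => o.1) inferInstance]
  outcome : (fun o : Obs d => U.q o.2.1 o.1) =ᵐ[P]
    P[fun o : Obs d => val o.2.2 |
      MeasurableSpace.comap (fun o : Obs d => (o.1, o.2.1)) inferInstance]

/-- The conditional mass function `p_U(a, y | x)`. -/
def condP {d : ℕ} (U : Nuis d) (a y : Bool) (x : Cov d) : ℝ :=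
  (if a then U.e x else 1 - U.e x) * (if y then U.q a x else 1 - U.q a x)

/-- The law `P̃(Q, U)`: `X ∼ Q`, and `(A, Y)` has mass function `p_U(·, · | x)` given `X = x`. -/
def tildeP {d : ℕ} (Q : Measure (Cov d)) (U : Nuis d) : Measure (Obs d) :=
  (Q.prod (Measure.count.prod Measure.count)).withDensity
    (fun o => ENNReal.ofReal (condP U o.2.1 o.2.2 o.1))

/-! ### The estimand and the influence functions -/

/-- `Ω(Q, U) = E_Q[λ(e(X))]`. -/
def Omega {d : ℕ} (lam : ℝ → ℝ) (Q : Measure (Cov d)) (U : Nuis d) : ℝ :=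
  ∫ x, lam (U.e x) ∂Q

/-- The weighted average treatment effect
`ψ(Q, U) = E_Q[λ(e(X)) (q₁(X) - q₀(X))] / Ω(Q, U)`. -/
def psi {d : ℕ} (lam : ℝ → ℝ) (Q : Measure (Cov d)) (U : Nuis d) : ℝ :=
  (∫ x, lam (U.e x) * U.tau x ∂Q) / Omega lam Q U

/-- The derivative of the weight function, as a function on `[0,1]`. -/
def dotLam (lam : ℝ → ℝ) (t : ℝ) : ℝ := derivWithin lam (Icc 0 1) t

/-- The augmented inverse probability weighted pseudo-outcome. -/
def phi {d : ℕ} (U : Nuis d) (o : Obs d) : ℝ :=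
  val o.2.1 / U.e o.1 * (val o.2.2 - U.q1 o.1)
    - (1 - val o.2.1) / (1 - U.e o.1) * (val o.2.2 - U.q0 o.1) + U.tau o.1

/-- The full-model efficient influence function at `(Q, U)`. -/
def Dfull {d : ℕ} (lam : ℝ → ℝ) (Q : Measure (Cov d)) (U : Nuis d) (o : Obs d) : ℝ :=
  lam (U.e o.1) / Omega lam Q U * (phi U o - psi lam Q U)
    + dotLam lam (U.e o.1) / Omega lam Q U * (U.tau o.1 - psi lam Q U)
        * (val o.2.1 - U.e o.1)

/-- The restricted-model (fixed-marginal) influence function at `(Q, U)`. -/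
def Dstar {d : ℕ} (lam : ℝ → ℝ) (Q : Measure (Cov d)) (U : Nuis d) (o : Obs d) : ℝ :=
  lam (U.e o.1) / Omega lam Q U * (phi U o - U.tau o.1)
    + dotLam lam (U.e o.1) / Omega lam Q U * (U.tau o.1 - psi lam Q U)
        * (val o.2.1 - U.e o.1)

/-! ### The universal least favorable path -/

/-- The vector field `F = (F₁, F₀, F_e)` of the path. -/
def field {d : ℕ} (lam : ℝ → ℝ) (Q : Measure (Cov d)) (U : Nuis d) : Nuis d where
  q1 x := U.q1 x * (1 - U.q1 x) * lam (U.e x) / (Omega lam Q U * U.e x)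
  q0 x := -(U.q0 x * (1 - U.q0 x) * lam (U.e x) / (Omega lam Q U * (1 - U.e x)))
  e x := U.e x * (1 - U.e x) * dotLam lam (U.e x) / Omega lam Q U
    * (U.tau x - psi lam Q U)

/-- `Λ_min = inf λ` over `[η, 1-η]`. -/
def LamMin (lam : ℝ → ℝ) (η : ℝ) : ℝ := sInf (lam '' Icc η (1 - η))

/-- `sup |λ^{(k)}|` over `[η, 1-η]`; for `k = 0` and `λ ≥ 0` this is `Λ_max`. -/
def LamMax (k : ℕ) (lam : ℝ → ℝ) (η : ℝ) : ℝ :=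
  sSup ((fun u => |iteratedDerivWithin k lam (Icc η (1 - η)) u|) '' Icc η (1 - η))

/-- `c` is the largest positive real with `c ≤ min {Λ_min, η}` and
`max {Λ_max, sup |λ'|, sup |λ''|, sup |λ'''|, η} ≤ c⁻¹`. -/
def IsScale (lam : ℝ → ℝ) (η c : ℝ) : Prop :=
  IsGreatest {r : ℝ | 0 < r ∧ r ≤ min (LamMin lam η) η ∧
    max (LamMax 0 lam η) (max (LamMax 1 lam η)
      (max (LamMax 2 lam η) (max (LamMax 3 lam η) η))) ≤ r⁻¹} c

/-- Positivity of the nuisances near `U₀` and smoothness of the weight, with the constant `η`.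
The suprema of `|λ^{(k)}|`, `k ≤ 3`, over the compact `[η, 1-η]` are finite by `smooth`. -/
structure Positivity {d : ℕ} (lam : ℝ → ℝ) (U0 : CNuis d) (η : ℝ) : Prop where
  eta_mem : η ∈ Ioo (0 : ℝ) (1 / 4)
  ball : ∀ U ∈ Metric.closedBall U0 (2 * η), ∀ x,
    U.fn.q1 x ∈ Icc η (1 - η) ∧ U.fn.q0 x ∈ Icc η (1 - η) ∧ U.fn.e x ∈ Icc η (1 - η)
  smooth : ContDiffOn ℝ 3 lam (Icc η (1 - η))
  lamMin_pos : 0 < LamMin lam η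

/-- `𝔱₁ = c⁶ / 8`. -/
def tOne (c : ℝ) : ℝ := c ^ 6 / 8

/-- `δ_init = c_init c²⁰ / 10⁶`, which is also the search radius `𝔱₂`. -/
def deltaInit (c cinit : ℝ) : ℝ := cinit * c ^ 20 / 10 ^ 6

/-- `U` is a `C¹` curve `(-𝔱₁, 𝔱₁) → C([0,1]^d)³` that starts at `U₀`, solves
`dU_t/dt = F(Q, U_t)` and stays in the closed ball of radius `η` about `U₀`. -/
def IsPath {d : ℕ} (lam : ℝ → ℝ) (c : ℝ) (Q : Measure (Cov d)) (U0 : CNuis d)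
    (U : ℝ → CNuis d) : Prop :=
  U 0 = U0 ∧
  (∃ η, Positivity lam U0 η ∧ IsScale lam η c ∧
    ∀ t ∈ Ioo (-tOne c) (tOne c), U t ∈ Metric.closedBall U0 η) ∧
  ∃ V : ℝ → CNuis d, ContinuousOn V (Ioo (-tOne c) (tOne c)) ∧
    ∀ t ∈ Ioo (-tOne c) (tOne c),
      HasDerivAt U (V t) t ∧ (V t).fn = field lam Q (U t).fn

open Classical in
/-- The universal least favorable path from `U₀` with marginal law `Q`
(constant if there is no solution). -/
def path {d : ℕ} (lam : ℝ → ℝ) (c : ℝ) (Q : Measure (Cov d)) (U0 : CNuis d) : ℝ → CNuis d :=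
  if h : ∃ U, IsPath lam c Q U0 U then h.choose else fun _ => U0

/-! ### The local bracketing conditions -/

/-- Total variation distance of `p_U(·|x)` and `p_V(·|x)` on the four-point space. -/
def tvCond {d : ℕ} (U V : Nuis d) (x : Cov d) : ℝ :=
  (1 / 2) * ∑ a : Bool, ∑ y : Bool, |condP U a y x - condP V a y x|

/-- The initial score bias `μ₀`; `p*(·|x) = p_{U*}(·|x)`. -/
def muZero {d : ℕ} (lam : ℝ → ℝ) (Ustar : CNuis d) (Q : Measure (Cov d)) (U0 : CNuis d) : ℝ :=
  ∫ x, ∑ a : Bool, ∑ y : Bool, Dstar lam Q U0.fn (x, a, y) * condP Ustar.fn a y x ∂Q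

/-- The pair `(Q, U₀)` satisfies the local bracketing conditions with constants `(c, c_init)`,
for the weight function `λ` and the true continuous nuisance triple `U*`. -/
def LocalBracketing {d : ℕ} (lam : ℝ → ℝ) (Ustar : CNuis d) (c cinit : ℝ)
    (Q : Measure (Cov d)) (U0 : CNuis d) : Prop :=
  ∃ η : ℝ, Positivity lam U0 η ∧ IsScale lam η c ∧
    (Q ≪ volume ∨ ∃ S : Set (Cov d), S.Countable ∧ Q Sᶜ = 0) ∧
    cinit ∈ Ioo (0 : ℝ) 1 ∧
    cinit ≤ ∫ o, (Dstar lam Q U0.fn o) ^ 2 ∂(tildeP Q U0.fn) ∧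
    Ustar ∈ Metric.closedBall U0 η ∧
    ∫ x, tvCond Ustar.fn U0.fn x ∂Q ≤ c ^ 10 * cinit / 600 ∧
    |muZero lam Ustar Q U0| ≤ cinit * deltaInit c cinit / 8

/-! ### The one-step TMLE on one evaluation fold

`s` is the evaluation fold and `U0` the initial estimate from the other fold. -/

/-- The empirical law of the covariates of a fold. -/
def empX {d m : ℕ} (s : Fin m → Obs d) : Measure (Cov d) :=
  (m : ℝ≥0∞)⁻¹ • ∑ i, Measure.dirac (s i).1

section Fold

variable {d m : ℕ} (lam : ℝ → ℝ) (Ustar : CNuis d) (c cinit : ℝ)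
  (s : Fin m → Obs d) (U0 : CNuis d)

/-- The event that the local bracketing conditions hold for the fold. -/
def GoodFold : Prop := LocalBracketing lam Ustar c cinit (empX s) U0

open Classical in
/-- The targeting path; constant if the local bracketing conditions fail. -/
def foldPath : ℝ → CNuis d :=
  if GoodFold lam Ustar c cinit s U0 then path lam c (empX s) U0 else fun _ => U0

/-- The empirical log-likelihood along the targeting path. -/
def foldLoss (t : ℝ) : ℝ :=
  (1 / (m : ℝ)) * ∑ i, Real.log
    (condP (foldPath lam Ustar c cinit s U0 t).fn (s i).2.1 (s i).2.2 (s i).1)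

/-- The event that the local bracketing conditions hold and the empirical score has a unique
zero in `[-𝔱₂, 𝔱₂]`. -/
def RootFold : Prop :=
  GoodFold lam Ustar c cinit s U0 ∧
    ∃! t : ℝ, t ∈ Icc (-deltaInit c cinit) (deltaInit c cinit) ∧
      deriv (foldLoss lam Ustar c cinit s U0) t = 0

open Classical in
/-- The stopping time `t̂`. -/
def foldTime : ℝ :=
  if h : RootFold lam Ustar c cinit s U0 then h.2.exists.choose else 0

/-- The targeted nuisance estimate `Û†`. -/
def foldTarget : CNuis d :=
  foldPath lam Ustar c cinit s U0 (foldTime lam Ustar c cinit s U0)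

open Classical in
/-- The fold-specific one-step TMLE. -/
def foldPsi : ℝ :=
  if RootFold lam Ustar c cinit s U0 then
    psi lam (empX s) (foldTarget lam Ustar c cinit s U0).fn else 0

open Classical in
/-- The estimated influence function value at the `i`-th observation of the fold. -/
def foldEIF (i : Fin m) : ℝ :=
  if RootFold lam Ustar c cinit s U0 then
    Dfull lam (empX s) (foldTarget lam Ustar c cinit s U0).fn (s i) else 0

end Fold

/-! ### Cross-fitting with two folds of size `m` -/

/-- A nuisance estimator sequence: a continuous triple from every finite sample. -/
abbrev Estimator (d : ℕ) := (n : ℕ) → (Fin n → Obs d) → CNuis d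

/-- Fold `k ∈ {0, 1}` of the sample of size `2m` (observations are numbered from `0`). -/
def fold {d : ℕ} {Ω : Type*} (O : ℕ → Ω → Obs d) (m : ℕ) (k : Fin 2) (ω : Ω) : Fin m → Obs d :=
  fun i => O (k.val * m + i.val) ω

/-- The initial nuisance estimate `Û₀^{(k)}` computed from fold `k`. -/
def initEst {d : ℕ} {Ω : Type*} (est : Estimator d) (O : ℕ → Ω → Obs d) (m : ℕ) (k : Fin 2)
    (ω : Ω) : CNuis d :=
  est m (fold O m k ω)

/-- The cross-fitted one-step TMLE `(ψ̂₀ + ψ̂₁) / 2` based on `2m` observations. -/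
def psiCF {d : ℕ} {Ω : Type*} (lam : ℝ → ℝ) (Ustar : CNuis d) (c cinit : ℝ) (est : Estimator d)
    (O : ℕ → Ω → Obs d) (m : ℕ) (ω : Ω) : ℝ :=
  (1 / 2) * ∑ k : Fin 2,
    foldPsi lam Ustar c cinit (fold O m k ω) (initEst est O m (1 - k) ω)

/-- The plug-in variance estimator based on `2m` observations. -/
def sigmaSqCF {d : ℕ} {Ω : Type*} (lam : ℝ → ℝ) (Ustar : CNuis d) (c cinit : ℝ)
    (est : Estimator d) (O : ℕ → Ω → Obs d) (m : ℕ) (ω : Ω) : ℝ :=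
  (1 / (2 * (m : ℝ))) * ∑ k : Fin 2, ∑ i : Fin m,
    (foldEIF lam Ustar c cinit (fold O m k ω) (initEst est O m (1 - k) ω) i) ^ 2

/-- The `L²(Q)` norm. -/
def l2norm {d : ℕ} (Q : Measure (Cov d)) (f : Cov d → ℝ) : ℝ := (eLpNorm f 2 Q).toReal

/-- `Z_n = o_p(n^{-1/4})`. -/
def IsLittleOpQuarter {Ω : Type*} [MeasurableSpace Ω] (Pr : Measure Ω) (Z : ℕ → Ω → ℝ) : Prop :=
  TendstoInMeasure Pr (fun (n : ℕ) ω => (n : ℝ) ^ (1 / 4 : ℝ) * Z n ω) atTop (fun _ => 0)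

/-- The `γ`-quantile of the standard normal law. -/
def normalQuantile (γ : ℝ) : ℝ := sInf {z : ℝ | γ ≤ cdf (gaussianReal 0 1) z}

/-! ### Efficient influence functions -/

/-- The density of a law with respect to the dominating measure. -/
def dens {d : ℕ} (P : Measure (Obs d)) (o : Obs d) : ℝ := (P.rnDeriv (domMeasure d) o).toReal

/-- `ε ↦ P ε` is, for small `|ε|`, a regular one-dimensional submodel of the full model through
`P₀` with score `h`: the laws are absolutely continuous, their square-root densities are
differentiable in quadratic mean at `0`, and their propensity scores take values in an interval
`[η, 1-η]` on which the weight function is positive and `C³` (so that the estimand is defined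
along the submodel). `U ε` is a version of the nuisance functions of `P ε`. -/
def IsRegularSubmodel {d : ℕ} (lam : ℝ → ℝ) (P0 : Measure (Obs d)) (P : ℝ → Measure (Obs d))
    (U : ℝ → Nuis d) (h : Obs d → ℝ) : Prop :=
  P 0 = P0 ∧ MemLp h 2 P0 ∧ ∫ o, h o ∂P0 = 0 ∧
  (∃ l > 0, ∃ η ∈ Ioo (0 : ℝ) (1 / 2), ContDiffOn ℝ 3 lam (Icc η (1 - η)) ∧
    (∀ u ∈ Icc η (1 - η), 0 < lam u) ∧
    ∀ ε ∈ Ioo (-l) l, IsProbabilityMeasure (P ε) ∧ P ε ≪ domMeasure d ∧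
      IsNuisanceOf (P ε) (U ε) ∧ ∀ᵐ x ∂(margX (P ε)), (U ε).e x ∈ Icc η (1 - η)) ∧
  Tendsto (fun ε : ℝ => (∫⁻ o, ENNReal.ofReal
      ((√(dens (P ε) o) - √(dens P0 o) - ε / 2 * h o * √(dens P0 o)) ^ 2) ∂(domMeasure d))
        / ENNReal.ofReal (ε ^ 2)) (𝓝[≠] 0) (𝓝 0)

/-- `D` is the efficient influence function (canonical gradient) of `ψ` at `P₀` in the full model:
it lies in the tangent space (the `L²` closure of the set of scores), and it represents the
derivative of `ψ` along every regular submodel. -/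
structure IsEIF {d : ℕ} (lam : ℝ → ℝ) (P0 : Measure (Obs d)) (D : Obs d → ℝ) : Prop where
  memLp : MemLp D 2 P0
  mean_zero : ∫ o, D o ∂P0 = 0
  mem_tangent : ∀ δ : ℝ≥0∞, 0 < δ → ∃ P U h, IsRegularSubmodel lam P0 P U h ∧
    eLpNorm (fun o => D o - h o) 2 P0 < δ
  gradient : ∀ P U h, IsRegularSubmodel lam P0 P U h →
    HasDerivAt (fun ε : ℝ => psi lam (margX (P ε)) (U ε)) (∫ o, D o * h o ∂P0) 0

end

end WATE

/-! Everything rests on one estimating function, `mfun`, which is Ω·D_full with ψ as a free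
parameter. Evaluate it at nuisance values u and average it over (A, Y) with nuisance values v. By
the exact identity `sum4_pv_mfun` the result is λ(e_v)(τ_v - ψ) up to products of two nuisance
errors and a Taylor remainder of λ, and `exists_orthogonality` turns this into a quadratic bound.
This Neyman orthogonality is used three times, with u and v in different roles.

Efficiency. Let u be the truth and v the nuisances of another law P₁. Then Ω₁(ψ₁ - ψ) is the P₁-mean
of the estimating function, up to a mean squared nuisance distance that is at most a multiple of the
squared Hellinger distance (`integral_dl_sq_le_hell`). Along a regular submodel this error is O(ε²),
and differentiability in quadratic mean gives the derivative of the P_ε-mean (`hasDerivAt_psi`).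
Membership in the tangent space is direct: the bounded mean-zero function D_full is itself the score
of the tilt with density 1 + εD_full (`isRegularSubmodel_tilt`).

One fold. The evaluation fold enters D* through the empirical covariate law, but D* = α g₀ + β g₁,
where α = 1/Ω and β = -ψ/Ω are scalars and the g_j (`gfun`) are fixed functions of (a, y) and the
nuisance values. Hence only finitely many averages of functions fixed by the training fold have to
be controlled; `Disc` collects them. Let θ bound these deviations and the L² error of the initial
estimate. The path is built so that its score is D* (`hasDerivAt_pv_of`), so the derivative of the
log-likelihood is the empirical mean S(t) of D*. Here S(0) = O(θ), S'(0) ≤ -c_init + O(θ) because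
the conditional mean of the derivative of D* is -E[(D*)²], and S'' is bounded in terms of the scale
alone. So S has a unique root in the search interval, of size O(θ) (`exists_root`).

At the root the empirical mean of the estimating function is (ψ̂ - ψ)N with N within O(θ) of Ω
(`emp_mfun_eq_of_score`). Going back along the path to the initial estimate changes that mean by
O(θ²), because orthogonality makes its derivative conditionally centered
(`exists_emp_mfun_path_le`). The population mean at the initial estimate is O(θ²), again by
orthogonality. What remains in `exists_fold_expansion` is θ² plus the increment of the empirical
process between the initial estimate and the truth.

Probability. Given the training fold, Chebyshev's inequality makes the deviations smaller than κ
m^{-1/4} for every κ > 0. The increment is smaller than κ m^{-1/2}, because its variance is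
controlled by the nuisance error (`whp_deviation`, `whp_small_deviation`). With θ = κ m^{-1/4} and κ
arbitrarily small this is asymptotic linearity. The limit law and the coverage follow from the
central limit theorem by a sandwich of events that needs no measurability of the estimator
(`tendsto_measure_of_sandwich`). -/

namespace WATE

/-! ### Bounds on the weight function -/

/-- `λ` is `C³` on `[b, 1-b]`, bounded below by `c`, with derivatives bounded by `c⁻¹`. -/
structure Weight (lam : ℝ → ℝ) (b c : ℝ) : Prop where
  c_pos : 0 < c
  c_le : c ≤ b
  b_lt : b < 1 / 4
  smooth : ContDiffOn ℝ 3 lam (Icc b (1 - b))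
  lower : ∀ u ∈ Icc b (1 - b), c ≤ lam u
  bd0 : ∀ u ∈ Icc b (1 - b), |lam u| ≤ c⁻¹
  bd1 : ∀ u ∈ Ioo b (1 - b), |dotLam lam u| ≤ c⁻¹
  bd2 : ∀ u ∈ Ioo b (1 - b), |deriv (dotLam lam) u| ≤ c⁻¹
  bd3 : ∀ u ∈ Ioo b (1 - b), |deriv (deriv (dotLam lam)) u| ≤ c⁻¹

theorem dotLam_eq_deriv {lam : ℝ → ℝ} {u : ℝ} (hu : u ∈ Ioo (0 : ℝ) 1) :
    dotLam lam u = deriv lam u :=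
  derivWithin_of_mem_nhds (Icc_mem_nhds hu.1 hu.2)

theorem dotLam_contDiffOn {lam : ℝ → ℝ} {b : ℝ} {n : ℕ} (hb : 0 ≤ b)
    (h : ContDiffOn ℝ (n + 1) lam (Icc b (1 - b))) :
    ContDiffOn ℝ n (dotLam lam) (Ioo b (1 - b)) := by
  have h1 : ContDiffOn ℝ n (deriv lam) (Ioo b (1 - b)) :=
    ((contDiffOn_succ_iff_deriv_of_isOpen isOpen_Ioo).1 (h.mono Ioo_subset_Icc_self)).2.2
  exact h1.congr fun u hu => dotLam_eq_deriv ⟨by linarith [hu.1], by linarith [hu.2]⟩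

theorem hasDerivAt_of_smooth {lam : ℝ → ℝ} {b : ℝ} (hb : 0 ≤ b)
    (h : ContDiffOn ℝ 3 lam (Icc b (1 - b))) {u : ℝ} (hu : u ∈ Ioo b (1 - b)) :
    HasDerivAt lam (dotLam lam u) u ∧ HasDerivAt (dotLam lam) (deriv (dotLam lam) u) u ∧
      HasDerivAt (deriv (dotLam lam)) (deriv (deriv (dotLam lam)) u) u := by
  have hn : Ioo b (1 - b) ∈ 𝓝 u := isOpen_Ioo.mem_nhds hu
  have h1 : ContDiffOn ℝ 2 (dotLam lam) (Ioo b (1 - b)) := dotLam_contDiffOn (n := 2) hb h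
  have h2 : ContDiffOn ℝ 1 (deriv (dotLam lam)) (Ioo b (1 - b)) :=
    ((contDiffOn_succ_iff_deriv_of_isOpen (n := 1) isOpen_Ioo).1
      (by rwa [one_add_one_eq_two])).2.2
  refine ⟨?_, ?_, ?_⟩
  · rw [dotLam_eq_deriv ⟨by linarith [hu.1], by linarith [hu.2]⟩]
    exact ((h.mono Ioo_subset_Icc_self).contDiffAt hn |>.differentiableAt (by norm_num)).hasDerivAt
  · exact ((h1.contDiffAt hn).differentiableAt (by norm_num)).hasDerivAt
  · exact ((h2.contDiffAt hn).differentiableAt (by norm_num)).hasDerivAt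

/-- The scale `c` bounds derivatives taken within [b, 1-b], whereas the influence function uses the
derivative within [0,1]. The two agree only in the open interval, since λ is uncontrolled outside
[b, 1-b]; this is why nuisance values must later stay strictly inside. -/
theorem iteratedDerivWithin_eq_dotLam {lam : ℝ → ℝ} {b : ℝ} (hb : 0 ≤ b) (k : ℕ) {u : ℝ}
    (hu : u ∈ Ioo b (1 - b)) :
    iteratedDerivWithin (k + 1) lam (Icc b (1 - b)) u = deriv^[k] (dotLam lam) u := by
  induction k generalizing u with
  | zero =>
    rw [iteratedDerivWithin_one, Function.iterate_zero, id,
      dotLam_eq_deriv ⟨by linarith [hu.1], by linarith [hu.2]⟩,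
      derivWithin_of_mem_nhds (Icc_mem_nhds hu.1 hu.2)]
  | succ k ih =>
    rw [iteratedDerivWithin_succ, derivWithin_of_mem_nhds (Icc_mem_nhds hu.1 hu.2),
      Function.iterate_succ', Function.comp]
    refine Filter.EventuallyEq.deriv_eq ?_
    filter_upwards [isOpen_Ioo.mem_nhds hu] with v hv using ih hv

theorem le_LamMax {lam : ℝ → ℝ} {b : ℝ} (hb : b < 1 / 4) (h : ContDiffOn ℝ 3 lam (Icc b (1 - b)))
    {k : ℕ} (hk : k ≤ 3) {u : ℝ} (hu : u ∈ Icc b (1 - b)) :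
    |iteratedDerivWithin k lam (Icc b (1 - b)) u| ≤ LamMax k lam b := by
  refine le_csSup ?_ ⟨u, hu, rfl⟩
  refine (isCompact_Icc.image_of_continuousOn ?_).bddAbove
  exact (h.continuousOn_iteratedDerivWithin (by exact_mod_cast hk)
    (uniqueDiffOn_Icc (by linarith))).abs

theorem weight_of_isScale {lam : ℝ → ℝ} {b c : ℝ} (hb : b ∈ Ioo (0 : ℝ) (1 / 4))
    (h : ContDiffOn ℝ 3 lam (Icc b (1 - b))) (hs : IsScale lam b c) : Weight lam b c := by
  obtain ⟨⟨hc, hmin, hmax⟩, -⟩ := hs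
  simp only [le_min_iff, max_le_iff] at hmin hmax
  have key : ∀ k, k + 1 ≤ 3 → ∀ u ∈ Ioo b (1 - b),
      |deriv^[k] (dotLam lam) u| ≤ LamMax (k + 1) lam b := fun k hk u hu => by
    rw [← iteratedDerivWithin_eq_dotLam hb.1.le k hu]
    exact le_LamMax hb.2 h hk (Ioo_subset_Icc_self hu)
  refine ⟨hc, hmin.2, hb.2, h, fun u hu => hmin.1.trans ?_, fun u hu => ?_, fun u hu => ?_,
    fun u hu => ?_, fun u hu => ?_⟩
  · exact csInf_le (isCompact_Icc.image_of_continuousOn h.continuousOn).bddBelow ⟨u, hu, rfl⟩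
  · simpa using (le_LamMax hb.2 h (k := 0) (by norm_num) hu).trans hmax.1
  · exact (key 0 (by norm_num) u hu).trans hmax.2.1
  · exact (key 1 (by norm_num) u hu).trans hmax.2.2.1
  · exact (key 2 (by norm_num) u hu).trans hmax.2.2.2.1

/-! ### The box of nuisance values -/

/-- The values of the triple `U` lie in `[k, 1-k]`. -/
def InBox {d : ℕ} (k : ℝ) (U : CNuis d) : Prop :=
  ∀ x, U.1 x ∈ Icc k (1 - k) ∧ U.2.1 x ∈ Icc k (1 - k) ∧ U.2.2 x ∈ Icc k (1 - k)

theorem InBox.mono {d : ℕ} {k l : ℝ} (h : l ≤ k) {U : CNuis d} (hU : InBox k U) : InBox l U :=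
  fun x => ⟨Icc_subset_Icc h (by linarith) (hU x).1, Icc_subset_Icc h (by linarith) (hU x).2.1,
    Icc_subset_Icc h (by linarith) (hU x).2.2⟩

theorem dist_apply_le {d : ℕ} (U V : CNuis d) (x : Cov d) :
    |U.1 x - V.1 x| ≤ dist U V ∧ |U.2.1 x - V.2.1 x| ≤ dist U V ∧
      |U.2.2 x - V.2.2 x| ≤ dist U V := by
  have h1 : dist U.1 V.1 ≤ dist U V := le_max_left _ _
  have h2 : dist U.2 V.2 ≤ dist U V := le_max_right _ _
  have h3 : dist U.2.1 V.2.1 ≤ dist U.2 V.2 := le_max_left _ _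
  have h4 : dist U.2.2 V.2.2 ≤ dist U.2 V.2 := le_max_right _ _
  have e (f g : C(Cov d, ℝ)) : |f x - g x| ≤ dist f g := by
    rw [← Real.dist_eq]; exact ContinuousMap.dist_apply_le_dist x
  exact ⟨(e _ _).trans h1, (e _ _).trans (h3.trans h2), (e _ _).trans (h4.trans h2)⟩

/-- Shifting the center by the constants ±2η gives triples that are still in the ball of radius 2η,
so positivity at these two triples leaves a margin of 3η at the center. -/
theorem Positivity.inBox_center {d : ℕ} {lam : ℝ → ℝ} {U0 : CNuis d} {η : ℝ}
    (h : Positivity lam U0 η) : InBox (3 * η) U0 := by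
  intro x
  have hη := h.eta_mem.1
  let C : ContinuousMap (Cov d) ℝ := ContinuousMap.const _ (2 * η)
  have hC : ‖C‖ ≤ 2 * η := (ContinuousMap.norm_le _ (by linarith)).2 fun y => by
    simp [C, abs_of_pos hη]
  have hn : ‖((C, C, C) : CNuis d)‖ ≤ 2 * η := by
    simp only [Prod.norm_def]
    exact max_le hC (max_le hC hC)
  have h1 := h.ball (U0 + (C, C, C)) (by
    rw [mem_closedBall_iff_norm]; simpa using hn) x
  have h2 := h.ball (U0 - (C, C, C)) (by
    rw [mem_closedBall_iff_norm]; simpa using hn) x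
  simp only [CNuis.fn, Prod.fst_add, Prod.snd_add, ContinuousMap.add_apply,
    Prod.fst_sub, Prod.snd_sub, ContinuousMap.sub_apply, C, ContinuousMap.const_apply,
    mem_Icc] at h1 h2
  simp only [mem_Icc]
  refine ⟨⟨?_, ?_⟩, ⟨?_, ?_⟩, ⟨?_, ?_⟩⟩ <;> linarith [h1.1.1, h1.1.2, h2.1.1, h2.1.2, h1.2.1.1,
    h1.2.1.2, h2.2.1.1, h2.2.1.2, h1.2.2.1, h1.2.2.2, h2.2.2.1, h2.2.2.2]

theorem Positivity.inBox {d : ℕ} {lam : ℝ → ℝ} {U0 : CNuis d} {η : ℝ}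
    (h : Positivity lam U0 η) {U : CNuis d} (hU : U ∈ Metric.closedBall U0 η) :
    InBox (2 * η) U := by
  intro x
  have h0 := h.inBox_center x
  have h1 := dist_apply_le U U0 x
  have h2 : dist U U0 ≤ η := hU
  simp only [abs_le, mem_Icc] at *
  refine ⟨⟨?_, ?_⟩, ⟨?_, ?_⟩, ⟨?_, ?_⟩⟩ <;> linarith [h1.1.1, h1.1.2, h0.1.1, h0.1.2, h1.2.1.1,
    h1.2.1.2, h0.2.1.1, h0.2.1.2, h1.2.2.1, h1.2.2.2, h0.2.2.1, h0.2.2.2]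

/-- All the scales `η` with the same constant `c` are comparable: one smoothness interval
`[b, 1-b]` contains, with a margin, the values of all triples near any good initial triple. -/
theorem exists_common_box {d : ℕ} {lam : ℝ → ℝ} {c : ℝ} {U1 : CNuis d} {η1 : ℝ}
    (h1 : Positivity lam U1 η1) (hs1 : IsScale lam η1 c) :
    ∃ b k, Weight lam b c ∧ b < k ∧ ∀ (U0 : CNuis d) (η : ℝ), Positivity lam U0 η →
      IsScale lam η c → k ≤ 2 * η := by
  let S : Set ℝ := {η | ∃ U0 : CNuis d, Positivity lam U0 η ∧ IsScale lam η c}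
  have hw : ∀ η ∈ S, Weight lam η c := fun η ⟨U0, hp, hs⟩ =>
    weight_of_isScale hp.eta_mem hp.smooth hs
  have hne : S.Nonempty := ⟨η1, U1, h1, hs1⟩
  have hlow : ∀ η ∈ S, c ≤ η := fun η hη => (hw η hη).c_le
  have hc : 0 < c := (hw η1 ⟨U1, h1, hs1⟩).c_pos
  have hinf : c ≤ sInf S := le_csInf hne hlow
  -- Different samples may satisfy the conditions with different η. With b below 3/2 of the infimum,
  -- k = 4b/3 is below twice the infimum, hence at most 2η for every admissible η.
  obtain ⟨b, hbS, hb⟩ := exists_lt_of_csInf_lt hne (show sInf S < 3 / 2 * sInf S by linarith)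
  refine ⟨b, 4 / 3 * b, hw b hbS, by linarith [hlow b hbS], fun U0 η hp hs => ?_⟩
  have : sInf S ≤ η := csInf_le ⟨c, fun η hη => hlow η hη⟩ ⟨U0, hp, hs⟩
  linarith

end WATE

namespace WATE

/-! ### A calculus of bounded differentiable functions -/

/-- On `I` the function `f` is bounded by `B` and its derivative by `B ρ`; if `s` holds,
its second derivative exists and is bounded by `B ρ²`. -/
structure Bdd (s : Prop) (I : Set ℝ) (f : ℝ → ℝ) (B ρ : ℝ) : Prop where
  diff : ∀ t ∈ I, DifferentiableAt ℝ f t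
  bd0 : ∀ t ∈ I, |f t| ≤ B
  bd1 : ∀ t ∈ I, |deriv f t| ≤ B * ρ
  diff2 : s → ∀ t ∈ I, DifferentiableAt ℝ (deriv f) t
  bd2 : s → ∀ t ∈ I, |deriv (deriv f) t| ≤ B * ρ ^ 2

namespace Bdd

variable {s : Prop} {I : Set ℝ} {f g f1 f2 : ℝ → ℝ} {B C ρ σ : ℝ}

/-- Openness of `I` is what allows the given derivative to be differentiated in place of `deriv f`.
-/
theorem of_hasDerivAt (hI : IsOpen I) (h1 : ∀ t ∈ I, HasDerivAt f (f1 t) t)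
    (h2 : s → ∀ t ∈ I, HasDerivAt f1 (f2 t) t) (b0 : ∀ t ∈ I, |f t| ≤ B)
    (b1 : ∀ t ∈ I, |f1 t| ≤ B * ρ) (b2 : s → ∀ t ∈ I, |f2 t| ≤ B * ρ ^ 2) :
    Bdd s I f B ρ := by
  have e : ∀ t ∈ I, deriv f =ᶠ[𝓝 t] f1 := fun t ht => by
    filter_upwards [hI.mem_nhds ht] with r hr using (h1 r hr).deriv
  have h2' : s → ∀ t ∈ I, HasDerivAt (deriv f) (f2 t) t := fun hs t ht =>
    (h2 hs t ht).congr_of_eventuallyEq (e t ht)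
  exact ⟨fun t ht => (h1 t ht).differentiableAt, b0,
    fun t ht => (h1 t ht).deriv ▸ b1 t ht, fun hs t ht => (h2' hs t ht).differentiableAt,
    fun hs t ht => (h2' hs t ht).deriv ▸ b2 hs t ht⟩

theorem h1 (h : Bdd s I f B ρ) : ∀ t ∈ I, HasDerivAt f (deriv f t) t :=
  fun t ht => (h.diff t ht).hasDerivAt

theorem h2 (h : Bdd s I f B ρ) : s → ∀ t ∈ I, HasDerivAt (deriv f) (deriv (deriv f) t) t :=
  fun hs t ht => (h.diff2 hs t ht).hasDerivAt

theorem const (hI : IsOpen I) (a : ℝ) (hB : |a| ≤ B) (hρ : 0 ≤ ρ) :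
    Bdd s I (fun _ => a) B ρ := by
  have hB0 : 0 ≤ B := (abs_nonneg a).trans hB
  exact of_hasDerivAt (f1 := fun _ => 0) (f2 := fun _ => 0) hI
    (fun t _ => hasDerivAt_const t a) (fun _ t _ => hasDerivAt_const t 0) (fun _ _ => hB)
    (fun _ _ => by simpa using by positivity) (fun _ _ _ => by simpa using by positivity)

theorem mono (h : Bdd s I f B ρ) (hB : B ≤ C) (hρ0 : 0 ≤ ρ) (hρ : ρ ≤ σ) : Bdd s I f C σ := by
  have hC : ∀ t ∈ I, 0 ≤ C := fun t ht => (abs_nonneg _).trans ((h.bd0 t ht).trans hB)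
  refine ⟨h.diff, fun t ht => (h.bd0 t ht).trans hB, fun t ht => (h.bd1 t ht).trans ?_,
    h.diff2, fun hs t ht => (h.bd2 hs t ht).trans ?_⟩
  · exact mul_le_mul hB hρ hρ0 (hC t ht)
  · exact mul_le_mul hB (pow_le_pow_left₀ hρ0 hρ 2) (by positivity) (hC t ht)

theorem add (hI : IsOpen I) (hf : Bdd s I f B ρ) (hg : Bdd s I g C ρ) :
    Bdd s I (fun t => f t + g t) (B + C) ρ := by
  refine of_hasDerivAt hI (fun t ht => (hf.h1 t ht).add (hg.h1 t ht))
    (fun hs t ht => (hf.h2 hs t ht).add (hg.h2 hs t ht)) (fun t ht => ?_) (fun t ht => ?_)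
    (fun hs t ht => ?_)
  · exact (abs_add_le _ _).trans (add_le_add (hf.bd0 t ht) (hg.bd0 t ht))
  · rw [add_mul]
    exact (abs_add_le _ _).trans (add_le_add (hf.bd1 t ht) (hg.bd1 t ht))
  · rw [add_mul]
    exact (abs_add_le _ _).trans (add_le_add (hf.bd2 hs t ht) (hg.bd2 hs t ht))

theorem neg (hI : IsOpen I) (hf : Bdd s I f B ρ) : Bdd s I (fun t => -f t) B ρ :=
  of_hasDerivAt hI (fun t ht => (hf.h1 t ht).neg) (fun hs t ht => (hf.h2 hs t ht).neg)
    (fun t ht => by simpa using hf.bd0 t ht) (fun t ht => by simpa using hf.bd1 t ht)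
    (fun hs t ht => by simpa using hf.bd2 hs t ht)

theorem sub (hI : IsOpen I) (hf : Bdd s I f B ρ) (hg : Bdd s I g C ρ) :
    Bdd s I (fun t => f t - g t) (B + C) ρ := by
  simpa [sub_eq_add_neg] using hf.add hI (hg.neg hI)

/-- The rates add because BC(ρ² + 2ρσ + σ²) = BC(ρ + σ)²: the two-parameter form of `Bdd` is chosen
so that products close up in this way. -/
theorem mul (hI : IsOpen I) (hf : Bdd s I f B ρ) (hg : Bdd s I g C σ) (hρ : 0 ≤ ρ) :
    Bdd s I (fun t => f t * g t) (B * C) (ρ + σ) := by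
  have hB : ∀ t ∈ I, 0 ≤ B := fun t ht => (abs_nonneg _).trans (hf.bd0 t ht)
  have hC : ∀ t ∈ I, 0 ≤ C := fun t ht => (abs_nonneg _).trans (hg.bd0 t ht)
  refine of_hasDerivAt hI (fun t ht => (hf.h1 t ht).mul (hg.h1 t ht))
    (fun hs t ht => ((hf.h2 hs t ht).mul (hg.h1 t ht)).add ((hf.h1 t ht).mul (hg.h2 hs t ht)))
    (fun t ht => ?_) (fun t ht => ?_) (fun hs t ht => ?_)
  · rw [abs_mul]
    exact mul_le_mul (hf.bd0 t ht) (hg.bd0 t ht) (abs_nonneg _) (hB t ht)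
  · have := hB t ht
    have := hC t ht
    calc _ ≤ |deriv f t| * |g t| + |f t| * |deriv g t| := by
          rw [← abs_mul, ← abs_mul]; exact abs_add_le _ _
      _ ≤ (B * ρ) * C + B * (C * σ) := by
          gcongr
          exacts [hf.bd1 t ht, hg.bd0 t ht, hf.bd0 t ht, hg.bd1 t ht]
      _ = _ := by ring
  · have := hB t ht
    have := hC t ht
    calc _ ≤ (|deriv (deriv f) t| * |g t| + |deriv f t| * |deriv g t|)
          + (|deriv f t| * |deriv g t| + |f t| * |deriv (deriv g) t|) := by
          simp only [← abs_mul]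
          exact (abs_add_le _ _).trans (add_le_add (abs_add_le _ _) (abs_add_le _ _))
      _ ≤ (B * ρ ^ 2 * C + (B * ρ) * (C * σ)) + ((B * ρ) * (C * σ) + B * (C * σ ^ 2)) := by
          gcongr
          exacts [hf.bd2 hs t ht, hg.bd0 t ht, hf.bd1 t ht, hg.bd1 t ht, hf.bd1 t ht,
            hg.bd1 t ht, hf.bd0 t ht, hg.bd2 hs t ht]
      _ = _ := by ring

/-- A lower bound R⁻¹ and an upper bound B for the same function force BR ≥ 1; this absorbs the
lower-order term of the second derivative into the rate 2RBρ. -/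
theorem inv (hI : IsOpen I) {R : ℝ} (hR : 0 < R) (hf : Bdd s I f B ρ)
    (hlow : ∀ t ∈ I, R⁻¹ ≤ f t) (hρ : 0 ≤ ρ) : Bdd s I (fun t => (f t)⁻¹) R (2 * R * B * ρ) := by
  have hB : ∀ t ∈ I, 0 ≤ B := fun t ht => (abs_nonneg _).trans (hf.bd0 t ht)
  have hpos : ∀ t ∈ I, 0 < f t := fun t ht => (inv_pos.2 hR).trans_le (hlow t ht)
  have hle : ∀ t ∈ I, (f t)⁻¹ ≤ R := fun t ht => inv_le_of_inv_le₀ hR (hlow t ht)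
  have hBR : ∀ t ∈ I, 1 ≤ B * R := fun t ht => by
    have := (hlow t ht).trans ((le_abs_self _).trans (hf.bd0 t ht))
    rwa [inv_le_iff_one_le_mul₀ hR] at this
  have d1 : ∀ t ∈ I, HasDerivAt (fun t => (f t)⁻¹) (-deriv f t * ((f t)⁻¹ * (f t)⁻¹)) t :=
    fun t ht => by
      refine ((hf.h1 t ht).inv (hpos t ht).ne').congr_deriv ?_
      rw [div_eq_mul_inv, pow_two, mul_inv]
  refine of_hasDerivAt hI d1
    (fun hs t ht => ((hf.h2 hs t ht).neg).mul ((d1 t ht).mul (d1 t ht)))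
    (fun t ht => ?_) (fun t ht => ?_) (fun hs t ht => ?_)
  · rw [abs_of_pos (inv_pos.2 (hpos t ht))]; exact hle t ht
  · have := hB t ht
    have := (inv_pos.2 (hpos t ht)).le
    rw [abs_mul, abs_neg, abs_mul, abs_of_nonneg this]
    calc |deriv f t| * ((f t)⁻¹ * (f t)⁻¹) ≤ (B * ρ) * (R * R) := by
          gcongr
          exacts [hf.bd1 t ht, hle t ht, hle t ht]
      _ ≤ _ := by nlinarith [show 0 ≤ B * ρ * (R * R) by positivity]
  · have hB' := hB t ht
    have hp := (inv_pos.2 (hpos t ht)).le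
    have a0 : |(f t)⁻¹| ≤ R := by rw [abs_of_nonneg hp]; exact hle t ht
    have a1 : |-deriv f t * ((f t)⁻¹ * (f t)⁻¹)| ≤ (B * ρ) * (R * R) := by
      rw [abs_mul, abs_neg, abs_mul]
      gcongr
      exact hf.bd1 t ht
    calc _ ≤ |deriv (deriv f) t| * (|(f t)⁻¹| * |(f t)⁻¹|)
            + |deriv f t| * (|-deriv f t * ((f t)⁻¹ * (f t)⁻¹)| * |(f t)⁻¹|
              + |(f t)⁻¹| * |-deriv f t * ((f t)⁻¹ * (f t)⁻¹)|) := by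
          refine (abs_add_le _ _).trans ?_
          rw [abs_mul, abs_neg, abs_mul, abs_mul ((-deriv f) t), Pi.neg_apply, abs_neg]
          gcongr
          refine (abs_add_le _ _).trans_eq ?_
          rw [abs_mul, abs_mul (f t)⁻¹]
      _ ≤ (B * ρ ^ 2) * (R * R) + (B * ρ) * ((B * ρ) * (R * R) * R + R * ((B * ρ) * (R * R))) := by
          gcongr
          exacts [hf.bd2 hs t ht, hf.bd1 t ht]
      _ = R * R * B * ρ ^ 2 * (1 + 2 * (B * R)) := by ring
      _ ≤ R * R * B * ρ ^ 2 * (4 * (B * R)) := by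
          gcongr
          linarith [hBR t ht]
      _ = _ := by ring

/-- The second derivative of the composition is at most Bρ² + Bρ², which is below B(2ρ)². -/
theorem comp (hI : IsOpen I) {J : Set ℝ} {l l1 l2 : ℝ → ℝ} (hf : Bdd s I f 1 ρ) (hρ : 0 ≤ ρ)
    (hJ : ∀ t ∈ I, f t ∈ J) (hl : ∀ u ∈ J, HasDerivAt l (l1 u) u)
    (hl1 : ∀ u ∈ J, HasDerivAt l1 (l2 u) u) (b0 : ∀ u ∈ J, |l u| ≤ B)
    (b1 : ∀ u ∈ J, |l1 u| ≤ B) (b2 : ∀ u ∈ J, |l2 u| ≤ B) :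
    Bdd s I (fun t => l (f t)) B (2 * ρ) := by
  have hB : ∀ t ∈ I, 0 ≤ B := fun t ht => (abs_nonneg _).trans (b0 _ (hJ t ht))
  refine of_hasDerivAt hI (fun t ht => (hl _ (hJ t ht)).comp t (hf.h1 t ht))
    (fun hs t ht => ((hl1 _ (hJ t ht)).comp t (hf.h1 t ht)).mul (hf.h2 hs t ht))
    (fun t ht => b0 _ (hJ t ht)) (fun t ht => ?_) (fun hs t ht => ?_)
  · have := hB t ht
    rw [abs_mul]
    calc |l1 (f t)| * |deriv f t| ≤ B * (1 * ρ) := by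
          gcongr
          exacts [b1 _ (hJ t ht), hf.bd1 t ht]
      _ ≤ _ := by nlinarith [mul_nonneg this hρ]
  · have := hB t ht
    calc _ ≤ |l2 (f t)| * |deriv f t| * |deriv f t| + |l1 (f t)| * |deriv (deriv f) t| := by
          simp only [← abs_mul]
          exact abs_add_le _ _
      _ ≤ B * (1 * ρ) * (1 * ρ) + B * (1 * ρ ^ 2) := by
          gcongr
          exacts [b2 _ (hJ t ht), hf.bd1 t ht, hf.bd1 t ht, b1 _ (hJ t ht), hf.bd2 hs t ht]
      _ ≤ _ := by nlinarith [mul_nonneg this (sq_nonneg ρ)]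

/-- Constants do not grow with `m`, so all bounds along the path are uniform in the sample and its
size. -/
theorem average (hI : IsOpen I) {m : ℕ} (hm : 0 < m) {F : Fin m → ℝ → ℝ}
    (hF : ∀ i, Bdd s I (F i) B ρ) : Bdd s I (fun t => (1 / (m : ℝ)) * ∑ i, F i t) B ρ := by
  have hm' : (0 : ℝ) < m := by exact_mod_cast hm
  have key : ∀ (v : Fin m → ℝ) (A : ℝ), (∀ i, |v i| ≤ A) → |(1 / (m : ℝ)) * ∑ i, v i| ≤ A := by
    intro v A hv
    rw [abs_mul, abs_of_pos (by positivity)]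
    calc (1 / (m : ℝ)) * |∑ i, v i| ≤ (1 / (m : ℝ)) * ∑ _i : Fin m, A := by
          gcongr
          exact (Finset.abs_sum_le_sum_abs _ _).trans (Finset.sum_le_sum fun i _ => hv i)
      _ = A := by simp; field_simp
  exact of_hasDerivAt hI
    (fun t ht => (HasDerivAt.fun_sum fun i _ => (hF i).h1 t ht).const_mul _)
    (fun hs t ht => (HasDerivAt.fun_sum fun i _ => (hF i).h2 hs t ht).const_mul _)
    (fun t ht => key _ _ fun i => (hF i).bd0 t ht) (fun t ht => key _ _ fun i => (hF i).bd1 t ht)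
    (fun hs t ht => key _ _ fun i => (hF i).bd2 hs t ht)

/-- The mean value inequality is applied to the derivative, and then to r ↦ f r - r f'(0) on the
segment from 0 to t, where the derivative is at most Bρ²|t|. This yields the quadratic remainder
without the factor 1/2, which is not needed. -/
theorem taylor {T : ℝ} (h : Bdd True (Ioo (-T) T) f B ρ) {t : ℝ} (ht : t ∈ Ioo (-T) T) :
    |deriv f t - deriv f 0| ≤ B * ρ ^ 2 * |t| ∧
      |f t - f 0 - t * deriv f 0| ≤ B * ρ ^ 2 * t ^ 2 ∧ |f t - f 0| ≤ B * ρ * |t| := by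
  have h0 : (0 : ℝ) ∈ Ioo (-T) T := ⟨by linarith [ht.1, ht.2], by linarith [ht.1, ht.2]⟩
  have hconv : Convex ℝ (Ioo (-T) T) := convex_Ioo _ _
  have lip : ∀ r ∈ Ioo (-T) T, |deriv f r - deriv f 0| ≤ B * ρ ^ 2 * |r| := fun r hr => by
    simpa using hconv.norm_image_sub_le_of_norm_hasDerivWithin_le
      (fun x hx => (h.h2 trivial x hx).hasDerivWithinAt) (fun x hx => h.bd2 trivial x hx) h0 hr
  refine ⟨lip t ht, ?_, ?_⟩
  · have hA : 0 ≤ B * ρ ^ 2 := (abs_nonneg _).trans (h.bd2 trivial 0 h0)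
    have hsub : uIcc 0 t ⊆ Ioo (-T) T := (convex_Ioo (-T) T).ordConnected.uIcc_subset h0 ht
    have := (convex_uIcc 0 t).norm_image_sub_le_of_norm_hasDerivWithin_le
      (f := fun r => f r - r * deriv f 0) (f' := fun r => deriv f r - 1 * deriv f 0)
      (C := B * ρ ^ 2 * |t|)
      (fun x hx => (((h.h1 x (hsub hx)).sub
        ((hasDerivAt_id x).mul_const (deriv f 0))).hasDerivWithinAt))
      (fun x hx => by
        rw [one_mul]
        refine (lip x (hsub hx)).trans ?_
        have := abs_sub_left_of_mem_uIcc hx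
        simp only [sub_zero] at this
        gcongr)
      left_mem_uIcc right_mem_uIcc
    simp only [Real.norm_eq_abs, zero_mul, sub_zero] at this
    calc _ = |f t - t * deriv f 0 - f 0| := by ring_nf
      _ ≤ _ := this
      _ = _ := by rw [mul_assoc, ← sq, sq_abs]
  · simpa using hconv.norm_image_sub_le_of_norm_hasDerivWithin_le
      (fun x hx => (h.h1 x hx).hasDerivWithinAt) (fun x hx => h.bd1 x hx) h0 ht

end Bdd

end WATE

namespace WATE

/-! ### The building blocks of the influence functions -/

/-- The average of `f` over the sample `s`. -/
noncomputable def emp {d m : ℕ} (s : Fin m → Obs d) (f : Obs d → ℝ) : ℝ :=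
  (1 / (m : ℝ)) * ∑ i, f (s i)

/-- The value at `x` of a continuous triple. -/
def cv {d : ℕ} (U : CNuis d) (x : Cov d) : ℝ × ℝ × ℝ := (U.1 x, U.2.1 x, U.2.2 x)

/-- Functions of the values `u = (q₁, q₀, e)` of a triple such that `D^*` is a combination of the
first two of them, and `D^*_full` of all four, with coefficients free of the observation. -/
noncomputable def gfun (lam : ℝ → ℝ) (j : Fin 4) (a y : Bool) (u : ℝ × ℝ × ℝ) : ℝ :=
  match j with
  | 0 => lam u.2.2 * (val a * u.2.2⁻¹ * (val y - u.1)
      - (1 - val a) * (1 - u.2.2)⁻¹ * (val y - u.2.1))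
      + dotLam lam u.2.2 * (u.1 - u.2.1) * (val a - u.2.2)
  | 1 => dotLam lam u.2.2 * (val a - u.2.2)
  | 2 => lam u.2.2 * (u.1 - u.2.1)
  | 3 => lam u.2.2

/-- The two pointwise vector fields of which the field of the path is a combination. -/
noncomputable def Ffun (lam : ℝ → ℝ) (l : Fin 2) (u : ℝ × ℝ × ℝ) : ℝ × ℝ × ℝ :=
  match l with
  | 0 => (u.1 * (1 - u.1) * lam u.2.2 * u.2.2⁻¹,
      -(u.2.1 * (1 - u.2.1) * lam u.2.2 * (1 - u.2.2)⁻¹),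
      u.2.2 * (1 - u.2.2) * dotLam lam u.2.2 * (u.1 - u.2.1))
  | 1 => (0, 0, u.2.2 * (1 - u.2.2) * dotLam lam u.2.2)

section Coef
variable {d m : ℕ} (lam : ℝ → ℝ) (s : Fin m → Obs d) (U : CNuis d)

/-- The empirical version of `Ω`. -/
noncomputable def om : ℝ := emp s fun o => lam (U.2.2 o.1)

/-- The empirical version of `ψ Ω`. -/
noncomputable def nm : ℝ := emp s fun o => lam (U.2.2 o.1) * (U.1 o.1 - U.2.1 o.1)

/-- `1 / Ω`. -/
noncomputable def al : ℝ := (om lam s U)⁻¹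

/-- `-ψ / Ω`. -/
noncomputable def be : ℝ := -(nm lam s U * al lam s U * al lam s U)

/-- The combined vector field at `x`. -/
noncomputable def vf (x : Cov d) : ℝ × ℝ × ℝ :=
  al lam s U • Ffun lam 0 (cv U x) + be lam s U • Ffun lam 1 (cv U x)

/-- `D^*` at the empirical law of the covariates. -/
noncomputable def Demp (o : Obs d) : ℝ :=
  al lam s U * gfun lam 0 o.2.1 o.2.2 (cv U o.1) + be lam s U * gfun lam 1 o.2.1 o.2.2 (cv U o.1)

end Coef

theorem integral_empX {d m : ℕ} (s : Fin m → Obs d) (f : Cov d → ℝ) :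
    ∫ x, f x ∂(empX s) = emp s fun o => f o.1 := by
  rw [empX, integral_smul_measure, integral_finsetSum_measure]
  · simp [emp]
  · exact fun i _ => integrable_dirac (by simp)

theorem Omega_empX {d m : ℕ} (lam : ℝ → ℝ) (s : Fin m → Obs d) (U : CNuis d) :
    Omega lam (empX s) U.fn = om lam s U := integral_empX _ _

/-- Writing ψ as a product of scalar averages lets the calculus of `Bdd` treat it together with Ω.
-/
theorem psi_empX {d m : ℕ} (lam : ℝ → ℝ) (s : Fin m → Obs d) (U : CNuis d) :
    psi lam (empX s) U.fn = nm lam s U * al lam s U := by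
  rw [psi, Omega_empX, integral_empX, div_eq_mul_inv]; rfl

theorem Dstar_empX {d m : ℕ} (lam : ℝ → ℝ) (s : Fin m → Obs d) (U : CNuis d) (o : Obs d) :
    Dstar lam (empX s) U.fn o = Demp lam s U o := by
  simp only [Dstar, psi_empX, Omega_empX]
  simp only [Demp, phi, be, gfun, cv, Nuis.tau, CNuis.fn, al]
  ring

theorem field_empX {d m : ℕ} (lam : ℝ → ℝ) (s : Fin m → Obs d) (U : CNuis d) (x : Cov d) :
    ((field lam (empX s) U.fn).q1 x, (field lam (empX s) U.fn).q0 x,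
      (field lam (empX s) U.fn).e x) = vf lam s U x := by
  simp only [field, psi_empX, Omega_empX]
  simp only [vf, Ffun, cv, Nuis.tau, CNuis.fn, al, be, Prod.smul_mk, Prod.mk_add_mk, smul_eq_mul, Prod.mk.injEq]
  refine ⟨?_, ?_, ?_⟩
  · rw [div_eq_mul_inv, mul_inv]; ring
  · rw [div_eq_mul_inv, mul_inv]; ring
  · ring

/-! ### Static bounds -/

theorem val_nonneg (a : Bool) : 0 ≤ val a := by cases a <;> simp [val]

theorem val_le_one (a : Bool) : val a ≤ 1 := by cases a <;> simp [val]

theorem abs_emp_le {d m : ℕ} (s : Fin m → Obs d) {f : Obs d → ℝ} {B : ℝ} (hB : 0 ≤ B)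
    (h : ∀ o, |f o| ≤ B) : |emp s f| ≤ B := by
  rcases Nat.eq_zero_or_pos m with rfl | hm
  · simpa [emp] using hB
  have hm' : (0 : ℝ) < m := by exact_mod_cast hm
  rw [emp, abs_mul, abs_of_pos (by positivity)]
  calc (1 / (m : ℝ)) * |∑ i, f (s i)| ≤ (1 / (m : ℝ)) * ∑ _i : Fin m, B := by
        gcongr
        exact (Finset.abs_sum_le_sum_abs _ _).trans (Finset.sum_le_sum fun i _ => h _)
    _ = B := by simp; field_simp

theorem le_emp {d m : ℕ} (hm : 0 < m) (s : Fin m → Obs d) {f : Obs d → ℝ} {B : ℝ}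
    (h : ∀ o, B ≤ f o) : B ≤ emp s f := by
  have hm' : (0 : ℝ) < m := by exact_mod_cast hm
  rw [emp]
  calc B = (1 / (m : ℝ)) * ∑ _i : Fin m, B := by simp; field_simp
    _ ≤ _ := by gcongr; exact h _

namespace Weight

variable {lam : ℝ → ℝ} {b c : ℝ}

theorem R_ge (w : Weight lam b c) : 4 ≤ c⁻¹ := by
  rw [le_inv_comm₀ (by norm_num) w.c_pos]
  linarith [w.c_le, w.b_lt]

theorem hasDerivAt (w : Weight lam b c) {u : ℝ} (hu : u ∈ Ioo b (1 - b)) :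
    HasDerivAt lam (dotLam lam u) u :=
  (hasDerivAt_of_smooth (w.c_pos.le.trans w.c_le) w.smooth hu).1

theorem hasDerivAt_dotLam (w : Weight lam b c) {u : ℝ} (hu : u ∈ Ioo b (1 - b)) :
    HasDerivAt (dotLam lam) (deriv (dotLam lam) u) u :=
  (hasDerivAt_of_smooth (w.c_pos.le.trans w.c_le) w.smooth hu).2.1

theorem hasDerivAt_deriv_dotLam (w : Weight lam b c) {u : ℝ} (hu : u ∈ Ioo b (1 - b)) :
    HasDerivAt (deriv (dotLam lam)) (deriv (deriv (dotLam lam)) u) u :=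
  (hasDerivAt_of_smooth (w.c_pos.le.trans w.c_le) w.smooth hu).2.2

end Weight

section Static

variable {d m : ℕ} {lam : ℝ → ℝ} {b c k : ℝ} {s : Fin m → Obs d} {U : CNuis d}

theorem InBox.e_mem (hU : InBox k U) (hk : b < k) (x : Cov d) : U.2.2 x ∈ Ioo b (1 - b) :=
  ⟨hk.trans_le (hU x).2.2.1, (hU x).2.2.2.trans_lt (by linarith)⟩

theorem om_ge (w : Weight lam b c) (hk : b < k) (hm : 0 < m) (hU : InBox k U) :
    c ≤ om lam s U :=
  le_emp hm s fun o => w.lower _ (Ioo_subset_Icc_self (hU.e_mem hk o.1))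

theorem al_pos (w : Weight lam b c) (hk : b < k) (hm : 0 < m) (hU : InBox k U) :
    0 < al lam s U := inv_pos.2 (w.c_pos.trans_le (om_ge w hk hm hU))

theorem abs_al_le (w : Weight lam b c) (hk : b < k) (hm : 0 < m) (hU : InBox k U) :
    |al lam s U| ≤ c⁻¹ := by
  rw [abs_of_pos (al_pos w hk hm hU)]
  exact inv_anti₀ w.c_pos (om_ge w hk hm hU)

theorem abs_tau_le (hU : InBox k U) (hk : 0 ≤ k) (x : Cov d) : |U.1 x - U.2.1 x| ≤ 1 := by
  obtain ⟨h1, h2, -⟩ := hU x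
  rw [abs_le]
  constructor <;> linarith [h1.1, h1.2, h2.1, h2.2]

theorem abs_be_le (w : Weight lam b c) (hk : b < k) (hm : 0 < m) (hU : InBox k U) :
    |be lam s U| ≤ 2 * c⁻¹ ^ 3 := by
  have h0 := w.c_pos
  have hb := w.c_le
  have h1 : |nm lam s U| ≤ c⁻¹ * 1 := abs_emp_le s (by positivity) fun o => by
    rw [abs_mul]
    have := w.bd0 _ (Ioo_subset_Icc_self (hU.e_mem hk o.1))
    have := abs_tau_le hU (by linarith) o.1
    gcongr
  have h2 := abs_al_le (s := s) w hk hm hU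
  rw [be, abs_neg, abs_mul, abs_mul]
  calc _ ≤ c⁻¹ * 1 * c⁻¹ * c⁻¹ := by gcongr
    _ ≤ _ := by nlinarith [pow_pos (inv_pos.2 h0) 3]

theorem abs_mul_one_sub_le {q : ℝ} (hk : 0 ≤ k) (h : q ∈ Icc k (1 - k)) : |q * (1 - q)| ≤ 1 := by
  have h0 : 0 ≤ q := hk.trans h.1
  have h1 : 0 ≤ 1 - q := by linarith [h.2]
  rw [abs_of_nonneg (by positivity)]
  nlinarith

theorem abs_inv_le {q : ℝ} (hc : 0 < c) (hck : c ≤ k) (h : q ∈ Icc k (1 - k)) :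
    |q⁻¹| ≤ c⁻¹ ∧ |(1 - q)⁻¹| ≤ c⁻¹ := by
  have h0 : c ≤ q := hck.trans h.1
  have h1 : c ≤ 1 - q := by linarith [h.2]
  rw [abs_of_pos (inv_pos.2 (hc.trans_le h0)), abs_of_pos (inv_pos.2 (hc.trans_le h1))]
  exact ⟨inv_anti₀ hc h0, inv_anti₀ hc h1⟩

/-- This is the speed limit of the path; multiplied by the time horizon c⁶/8 it stays below η. -/
theorem abs_vf_le (w : Weight lam b c) (hk : b < k) (hm : 0 < m) (hU : InBox k U) (x : Cov d) :
    |(vf lam s U x).1| ≤ 3 * c⁻¹ ^ 4 ∧ |(vf lam s U x).2.1| ≤ 3 * c⁻¹ ^ 4 ∧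
      |(vf lam s U x).2.2| ≤ 3 * c⁻¹ ^ 4 := by
  have hR := w.R_ge
  have h0 := w.c_pos
  have hk0 : 0 ≤ k := by linarith [w.c_le]
  have ha := abs_al_le (s := s) w hk hm hU
  have hb := abs_be_le (s := s) w hk hm hU
  have hl := w.bd0 _ (Ioo_subset_Icc_self (hU.e_mem hk x))
  have hl1 := w.bd1 _ (hU.e_mem hk x)
  obtain ⟨hi, hi'⟩ := abs_inv_le h0 (by linarith [w.c_le]) (hU x).2.2
  have ht := abs_tau_le hU hk0 x
  have m1 := abs_mul_one_sub_le hk0 (hU x).1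
  have m2 := abs_mul_one_sub_le hk0 (hU x).2.1
  have m3 := abs_mul_one_sub_le hk0 (hU x).2.2
  simp only [vf, Ffun, cv, Prod.smul_mk, Prod.mk_add_mk, smul_eq_mul, mul_zero, add_zero,
    mul_neg, abs_neg]
  set R := c⁻¹
  have p3 : R ^ 3 ≤ 3 * R ^ 4 := by nlinarith [pow_pos (show 0 < R by linarith) 3]
  have p2 : R ^ 2 ≤ R ^ 4 := by nlinarith [pow_pos (show 0 < R by linarith) 2]
  refine ⟨?_, ?_, ?_⟩
  · rw [abs_mul, abs_mul, abs_mul]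
    calc _ ≤ R * (1 * R * R) := by gcongr
      _ ≤ _ := by linarith
  · rw [abs_mul, abs_mul, abs_mul]
    calc _ ≤ R * (1 * R * R) := by gcongr
      _ ≤ _ := by linarith
  · refine (abs_add_le _ _).trans ?_
    rw [abs_mul, abs_mul, abs_mul, abs_mul (be lam s U), abs_mul (_ * _) (dotLam _ _)]
    calc _ ≤ R * (1 * R * 1) + 2 * R ^ 3 * (1 * R) := by gcongr
      _ ≤ _ := by nlinarith

end Static

/-! ### Bounds along the path -/

/-- A solution of the equations of the path that stays in the box. -/
structure GoodPath {d m : ℕ} (lam : ℝ → ℝ) (b k c T : ℝ) (s : Fin m → Obs d)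
    (U : ℝ → CNuis d) : Prop where
  w : Weight lam b c
  hk : b < k
  hm : 0 < m
  box : ∀ t ∈ Ioo (-T) T, InBox k (U t)
  ode : ∀ t ∈ Ioo (-T) T, ∀ x, HasDerivAt (fun t => cv (U t) x) (vf lam s (U t) x) t

section Dynamic

variable {d m : ℕ} {lam : ℝ → ℝ} {b c k : ℝ} {s : Fin m → Obs d} {U : ℝ → CNuis d}
  {I : Set ℝ} {p : Prop} {ρ : ℝ}

/-- Along the curve all coordinates of the triple have bounded derivatives. -/
structure CoordBdd (lam : ℝ → ℝ) (b k c : ℝ) (m : ℕ) (p : Prop) (I : Set ℝ) (U : ℝ → CNuis d)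
    (ρ : ℝ) : Prop where
  w : Weight lam b c
  hk : b < k
  hm : 0 < m
  hI : IsOpen I
  hρ : 0 ≤ ρ
  box : ∀ t ∈ I, InBox k (U t)
  q1 : ∀ x, Bdd p I (fun t => (U t).1 x) 1 ρ
  q0 : ∀ x, Bdd p I (fun t => (U t).2.1 x) 1 ρ
  e : ∀ x, Bdd p I (fun t => (U t).2.2 x) 1 ρ

namespace CoordBdd

theorem lamE (h : CoordBdd lam b k c m p I U ρ) (x : Cov d) :
    Bdd p I (fun t => lam ((U t).2.2 x)) c⁻¹ (2 * ρ) :=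
  (h.e x).comp h.hI (J := Ioo b (1 - b)) h.hρ (fun t ht => (h.box t ht).e_mem h.hk x)
    (fun _ hu => h.w.hasDerivAt hu) (fun _ hu => h.w.hasDerivAt_dotLam hu)
    (fun u hu => h.w.bd0 u (Ioo_subset_Icc_self hu)) h.w.bd1 h.w.bd2

theorem dlamE (h : CoordBdd lam b k c m p I U ρ) (x : Cov d) :
    Bdd p I (fun t => dotLam lam ((U t).2.2 x)) c⁻¹ (2 * ρ) :=
  (h.e x).comp h.hI (J := Ioo b (1 - b)) h.hρ (fun t ht => (h.box t ht).e_mem h.hk x)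
    (fun _ hu => h.w.hasDerivAt_dotLam hu) (fun _ hu => h.w.hasDerivAt_deriv_dotLam hu)
    h.w.bd1 h.w.bd2 h.w.bd3

theorem tau (h : CoordBdd lam b k c m p I U ρ) (x : Cov d) :
    Bdd p I (fun t => (U t).1 x - (U t).2.1 x) 2 ρ :=
  ((h.q1 x).sub h.hI (h.q0 x)).mono (by norm_num) h.hρ le_rfl

/-- The rate is 2·R·R·(2ρ) with R = c⁻¹, from inverting Ω, which lies between c and c⁻¹ and has rate
2ρ. -/
theorem bal (h : CoordBdd lam b k c m p I U ρ) (s : Fin m → Obs d) :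
    Bdd p I (fun t => al lam s (U t)) c⁻¹ (4 * c⁻¹ ^ 2 * ρ) := by
  have h1 : Bdd p I (fun t => om lam s (U t)) c⁻¹ (2 * ρ) :=
    Bdd.average h.hI h.hm fun i => h.lamE _
  have hR := h.w.R_ge
  exact (h1.inv h.hI (by linarith) (fun t ht => by
    rw [inv_inv]; exact om_ge h.w h.hk h.hm (h.box t ht))
    (by linarith [h.hρ])).mono le_rfl (by have := h.hρ; positivity) (by nlinarith)

theorem bbe (h : CoordBdd lam b k c m p I U ρ) (s : Fin m → Obs d) :
    Bdd p I (fun t => be lam s (U t)) (2 * c⁻¹ ^ 3) (9 * c⁻¹ ^ 2 * ρ) := by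
  have hR := h.w.R_ge
  have hρ := h.hρ
  have h1 : Bdd p I (fun t => nm lam s (U t)) (c⁻¹ * 2) (2 * ρ + ρ) :=
    Bdd.average h.hI h.hm fun i => (h.lamE _).mul h.hI (h.tau _) (by linarith)
  refine (((h1.mul h.hI (h.bal s) (by linarith)).mul h.hI (h.bal s) (by positivity)).neg
    h.hI).mono (le_of_eq (by ring)) (by positivity) ?_
  nlinarith [mul_le_mul_of_nonneg_right (show 3 ≤ c⁻¹ ^ 2 by nlinarith) hρ]

theorem inv_e (h : CoordBdd lam b k c m p I U ρ) (x : Cov d) :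
    Bdd p I (fun t => ((U t).2.2 x)⁻¹) c⁻¹ (2 * c⁻¹ * ρ) := by
  have hR := h.w.R_ge
  refine ((h.e x).inv h.hI (R := c⁻¹) (by linarith) (fun t ht => ?_) h.hρ).mono le_rfl
    (by have := h.hρ; positivity) (le_of_eq (by ring))
  rw [inv_inv]
  linarith [h.w.c_le, h.hk, (h.box t ht x).2.2.1]

/-- The general rule for differences would give the bound 2. Since the values lie in (0,1), the
bound stays 1, which keeps the powers of c⁻¹ small. -/
theorem oneSub (h : CoordBdd lam b k c m p I U ρ) {f : CNuis d → ℝ}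
    (hf : Bdd p I (fun t => f (U t)) 1 ρ) (h0 : ∀ t ∈ I, f (U t) ∈ Icc k (1 - k)) :
    Bdd p I (fun t => 1 - f (U t)) 1 ρ := by
  have h1 := (Bdd.const h.hI 1 (B := 1) (by norm_num) h.hρ (s := p)).sub h.hI hf
  refine ⟨h1.diff, fun t ht => ?_, ?_, h1.diff2, ?_⟩
  · have := h0 t ht
    have := h.hk
    have := h.w.c_le
    have := h.w.c_pos
    rw [abs_le]
    constructor <;> linarith [(h0 t ht).1, (h0 t ht).2]
  · simpa using hf.bd1
  · simpa using hf.bd2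

theorem inv_one_sub_e (h : CoordBdd lam b k c m p I U ρ) (x : Cov d) :
    Bdd p I (fun t => (1 - (U t).2.2 x)⁻¹) c⁻¹ (2 * c⁻¹ * ρ) := by
  have hR := h.w.R_ge
  have h1 := h.oneSub (f := fun U => U.2.2 x) (h.e x) fun t ht => (h.box t ht x).2.2
  refine (h1.inv h.hI (R := c⁻¹) (by linarith) (fun t ht => ?_) h.hρ).mono le_rfl
    (by have := h.hρ; positivity) (le_of_eq (by ring))
  rw [inv_inv]
  linarith [h.w.c_le, h.hk, (h.box t ht x).2.2.2]

/-- It serves twice: on a line segment between two triples it yields the Lipschitz constant of the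
field, and along a solution it bounds the second derivative of the coordinates. -/
theorem bvf (h : CoordBdd lam b k c m p I U ρ) (s : Fin m → Obs d) (x : Cov d) :
    Bdd p I (fun t => (vf lam s (U t) x).1) (3 * c⁻¹ ^ 4) (10 * c⁻¹ ^ 2 * ρ) ∧
    Bdd p I (fun t => (vf lam s (U t) x).2.1) (3 * c⁻¹ ^ 4) (10 * c⁻¹ ^ 2 * ρ) ∧
    Bdd p I (fun t => (vf lam s (U t) x).2.2) (3 * c⁻¹ ^ 4) (10 * c⁻¹ ^ 2 * ρ) := by
  have hR := h.w.R_ge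
  have hρ := h.hρ
  have r1 : ρ ≤ c⁻¹ * ρ := by nlinarith
  have r2 : 4 * (c⁻¹ * ρ) ≤ c⁻¹ ^ 2 * ρ := by nlinarith [mul_nonneg (by linarith : 0 ≤ c⁻¹) hρ]
  have p3 : c⁻¹ ^ 3 ≤ 3 * c⁻¹ ^ 4 := by nlinarith [pow_pos (show 0 < c⁻¹ by linarith) 3]
  have p2 : 2 * c⁻¹ ^ 2 ≤ c⁻¹ ^ 4 := by
    nlinarith [mul_nonneg (sq_nonneg c⁻¹) (show 0 ≤ c⁻¹ ^ 2 - 2 by nlinarith)]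
  have o1 := h.oneSub (f := fun U => U.1 x) (h.q1 x) fun t ht => (h.box t ht x).1
  have o0 := h.oneSub (f := fun U => U.2.1 x) (h.q0 x) fun t ht => (h.box t ht x).2.1
  have oe := h.oneSub (f := fun U => U.2.2 x) (h.e x) fun t ht => (h.box t ht x).2.2
  have v1 := (h.bal s).mul h.hI (((((h.q1 x).mul h.hI o1 hρ).mul h.hI (h.lamE x)
    (by positivity)).mul h.hI (h.inv_e x) (by positivity))) (by positivity)
  have v0 := ((h.bal s).mul h.hI (((((h.q0 x).mul h.hI o0 hρ).mul h.hI (h.lamE x)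
    (by positivity)).mul h.hI (h.inv_one_sub_e x) (by positivity))) (by positivity)).neg h.hI
  have e0 := ((h.e x).mul h.hI oe hρ).mul h.hI (h.dlamE x) (by positivity)
  have e1 := (h.bal s).mul h.hI (e0.mul h.hI (h.tau x) (by positivity)) (by positivity)
  have e2 := (h.bbe s).mul h.hI e0 (by positivity)
  simp only [vf, Ffun, cv, Prod.smul_mk, Prod.mk_add_mk, smul_eq_mul, mul_zero, add_zero, mul_neg]
  refine ⟨v1.mono ?_ (by positivity) ?_, v0.mono ?_ (by positivity) ?_,
    ((e1.mono (σ := 10 * c⁻¹ ^ 2 * ρ) le_rfl (by positivity) ?_).add h.hI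
      (e2.mono le_rfl (by positivity) ?_)).mono ?_ (by positivity) le_rfl⟩
  all_goals nlinarith

/-- The building blocks of `D^*` have bounded derivatives along the curve. -/
theorem bgfun (h : CoordBdd lam b k c m p I U ρ) (j : Fin 4) (o : Obs d) :
    Bdd p I (fun t => gfun lam j o.2.1 o.2.2 (cv (U t) o.1)) (5 * c⁻¹ ^ 2) (3 * c⁻¹ * ρ) := by
  have hR := h.w.R_ge
  have hρ := h.hρ
  obtain ⟨x, a, y⟩ := o
  have ha : |val a| ≤ 1 := abs_le.2 ⟨by linarith [val_nonneg a], val_le_one a⟩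
  have ha' : |1 - val a| ≤ 1 := abs_le.2 ⟨by linarith [val_le_one a], by linarith [val_nonneg a]⟩
  have hy : |val y| ≤ 1 := abs_le.2 ⟨by linarith [val_nonneg y], val_le_one y⟩
  have r1 : 4 * ρ ≤ c⁻¹ * ρ := by nlinarith
  have ca (v : ℝ) (hv : |v| ≤ 1) : Bdd p I (fun _ => v) 1 0 := Bdd.const h.hI v hv le_rfl
  have cy : Bdd p I (fun _ => val y) 1 ρ := Bdd.const h.hI _ hy hρ
  have cae : Bdd p I (fun t => val a - (U t).2.2 x) (1 + 1) ρ :=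
    (Bdd.const h.hI _ ha hρ).sub h.hI (h.e x)
  have g2 := (h.dlamE x).mul h.hI cae (by positivity)
  fin_cases j
  · have t1 := ((ca _ ha).mul h.hI (h.inv_e x) le_rfl).mul h.hI (cy.sub h.hI (h.q1 x))
      (by positivity)
    have t0 := ((ca _ ha').mul h.hI (h.inv_one_sub_e x) le_rfl).mul h.hI (cy.sub h.hI (h.q0 x))
      (by positivity)
    have t := (h.lamE x).mul h.hI (t1.sub h.hI t0) (by positivity)
    have t' := ((h.dlamE x).mul h.hI (h.tau x) (by positivity)).mul h.hI cae (by positivity)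
    refine ((t.mono (σ := 3 * c⁻¹ * ρ) le_rfl (by positivity) ?_).add h.hI
      (t'.mono le_rfl (by positivity) ?_)).mono ?_ (by positivity) le_rfl
    all_goals nlinarith
  · exact g2.mono (by nlinarith) (by positivity) (by nlinarith)
  · exact ((h.lamE x).mul h.hI (h.tau x) (by positivity)).mono (by nlinarith) (by positivity)
      (by nlinarith)
  · exact (h.lamE x).mono (by nlinarith) (by positivity) (by nlinarith)

theorem bDemp (h : CoordBdd lam b k c m p I U ρ) (s : Fin m → Obs d) (o : Obs d) :
    Bdd p I (fun t => Demp lam s (U t) o) (15 * c⁻¹ ^ 5) (10 * c⁻¹ ^ 2 * ρ) := by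
  have hR := h.w.R_ge
  have hρ := h.hρ
  have r2 : 4 * (c⁻¹ * ρ) ≤ c⁻¹ ^ 2 * ρ := by nlinarith [mul_nonneg (by linarith : 0 ≤ c⁻¹) hρ]
  have p3 : c⁻¹ ^ 3 ≤ c⁻¹ ^ 5 := pow_le_pow_right₀ (by linarith) (by norm_num)
  refine (((((h.bal s).mul h.hI (h.bgfun 0 o) (by positivity)).mono
    (σ := 10 * c⁻¹ ^ 2 * ρ) le_rfl (by positivity) ?_)).add h.hI
    (((h.bbe s).mul h.hI (h.bgfun 1 o) (by positivity)).mono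
    (σ := 10 * c⁻¹ ^ 2 * ρ) le_rfl (by positivity) ?_)).mono ?_ (by positivity) le_rfl
  all_goals nlinarith

end CoordBdd

end Dynamic

end WATE

namespace WATE

/-! ### Existence of the path -/

/-- The solution of the Picard–Lindelöf theorem, with the ball in which it stays. -/
theorem exists_picard_mem_closedBall {E : Type*} [NormedAddCommGroup E] [NormedSpace ℝ E]
    [CompleteSpace E] {f : ℝ → E → E} {tmin tmax : ℝ} {t₀ : Icc tmin tmax} {x₀ : E}
    {a L K : ℝ≥0} (hf : IsPicardLindelof f t₀ x₀ a 0 L K) :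
    ∃ α : ℝ → E, α t₀ = x₀ ∧ Continuous α ∧ (∀ t, α t ∈ Metric.closedBall x₀ a) ∧
      ∀ t ∈ Icc tmin tmax, HasDerivWithinAt α (f t (α t)) (Icc tmin tmax) t := by
  have hx : x₀ ∈ Metric.closedBall x₀ ((0 : ℝ≥0) : ℝ) := Metric.mem_closedBall_self le_rfl
  obtain ⟨α, hα⟩ := ODE.FunSpace.exists_isFixedPt_next hf hx
  refine ⟨α.compProj, by rw [ODE.FunSpace.compProj_val, ← hα, ODE.FunSpace.next_apply₀],
    α.continuous_compProj, fun _ => α.compProj_mem_closedBall hf.mul_max_le, fun t ht => ?_⟩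
  apply ODE.hasDerivWithinAt_picard_Icc t₀.2 hf.continuousOn_uncurry
    α.continuous_compProj.continuousOn (fun _ _ => α.compProj_mem_closedBall hf.mul_max_le)
    x₀ ht |>.congr_of_mem _ ht
  intro t' ht'
  nth_rw 1 [← hα]
  rw [ODE.FunSpace.compProj_of_mem ht', ODE.FunSpace.next_apply]

section Existence

variable {d m : ℕ} {lam : ℝ → ℝ} {b c k : ℝ} {s : Fin m → Obs d}

theorem continuous_vf (w : Weight lam b c) (hk : b < k) {U : CNuis d} (hU : InBox k U) :
    Continuous (vf lam s U) := by
  have hb := w.c_le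
  have hc := w.c_pos
  have he : ∀ x, U.2.2 x ∈ Ioo b (1 - b) := hU.e_mem hk
  have c0 : Continuous fun x => lam (U.2.2 x) := continuous_iff_continuousAt.2 fun x =>
    (w.hasDerivAt (he x)).continuousAt.comp U.2.2.continuous.continuousAt
  have c1 : Continuous fun x => dotLam lam (U.2.2 x) := continuous_iff_continuousAt.2 fun x =>
    (w.hasDerivAt_dotLam (he x)).continuousAt.comp U.2.2.continuous.continuousAt
  have i0 : Continuous fun x => (U.2.2 x)⁻¹ :=
    U.2.2.continuous.inv₀ fun x => by linarith [(he x).1]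
  have i1 : Continuous fun x => (1 - U.2.2 x)⁻¹ :=
    (continuous_const.sub U.2.2.continuous).inv₀ fun x =>
      (sub_pos.2 (by linarith [(he x).2] : U.2.2 x < 1)).ne'
  have h1 := U.1.continuous
  have h0 := U.2.1.continuous
  have h2 := U.2.2.continuous
  have e0 : Continuous fun x => U.2.2 x * (1 - U.2.2 x) * dotLam lam (U.2.2 x) :=
    (h2.mul (continuous_const.sub h2)).mul c1
  have f0 : Continuous fun x => Ffun lam 0 (cv U x) :=
    ((((h1.mul (continuous_const.sub h1)).mul c0).mul i0)).prodMk
      ((((h0.mul (continuous_const.sub h0)).mul c0).mul i1).neg.prodMk (e0.mul (h1.sub h0)))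
  have f1 : Continuous fun x => Ffun lam 1 (cv U x) :=
    continuous_const.prodMk (continuous_const.prodMk e0)
  exact (f0.const_smul (al lam s U)).add (f1.const_smul (be lam s U))

open Classical in
/-- The vector field of the path, as a map of the space of continuous triples. -/
noncomputable def fieldC (lam : ℝ → ℝ) (s : Fin m → Obs d) (U : CNuis d) : CNuis d :=
  if h : Continuous (vf lam s U) then
    (⟨fun x => (vf lam s U x).1, continuous_fst.comp h⟩,
      ⟨fun x => (vf lam s U x).2.1, continuous_fst.comp (continuous_snd.comp h)⟩,
      ⟨fun x => (vf lam s U x).2.2, continuous_snd.comp (continuous_snd.comp h)⟩) else 0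

theorem cv_fieldC {U : CNuis d} (h : Continuous (vf lam s U)) (x : Cov d) :
    cv (fieldC lam s U) x = vf lam s U x := by
  rw [fieldC, dif_pos h]; rfl

theorem norm_le_of_cv {V : CNuis d} {B : ℝ} (hB : 0 ≤ B)
    (h : ∀ x, |(cv V x).1| ≤ B ∧ |(cv V x).2.1| ≤ B ∧ |(cv V x).2.2| ≤ B) : ‖V‖ ≤ B :=
  max_le ((ContinuousMap.norm_le _ hB).2 fun x => (h x).1)
    (max_le ((ContinuousMap.norm_le _ hB).2 fun x => (h x).2.1)
      ((ContinuousMap.norm_le _ hB).2 fun x => (h x).2.2))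

/-- The coordinates move linearly on the segment from `U` to `V`, with speed at most the distance,
so the first-order part of the calculus bounds the derivative of the field there. The second-order
part is switched off by taking `False` as the proposition. -/
theorem lipschitz_vf (w : Weight lam b c) (hk : b < k) (hm : 0 < m) {U V : CNuis d}
    (hU : InBox k U) (hV : InBox k V) (x : Cov d) :
    |(vf lam s V x).1 - (vf lam s U x).1| ≤ 3 * c⁻¹ ^ 4 * (10 * c⁻¹ ^ 2 * dist V U) ∧
    |(vf lam s V x).2.1 - (vf lam s U x).2.1| ≤ 3 * c⁻¹ ^ 4 * (10 * c⁻¹ ^ 2 * dist V U) ∧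
    |(vf lam s V x).2.2 - (vf lam s U x).2.2| ≤ 3 * c⁻¹ ^ 4 * (10 * c⁻¹ ^ 2 * dist V U) := by
  set ρ := dist V U
  have hρ : 0 ≤ ρ := dist_nonneg
  -- Two-sided derivatives at the endpoints require an open parameter interval. Overshooting [0,1]
  -- by ε moves a coordinate by at most (k-b)/2, so the values remain in the box at the midpoint
  -- (k+b)/2 > b.
  set ε := (k - b) / 2 / (ρ + 1)
  have hε : 0 < ε := by simp only [ε]; have : 0 < k - b := by linarith
                        positivity
  have hερ : ε * ρ ≤ (k - b) / 2 := by
    have : ε * (ρ + 1) = (k - b) / 2 := by simp only [ε]; field_simp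
    nlinarith
  let γ : ℝ → CNuis d := fun r => U + r • (V - U)
  have aux : ∀ u v r : ℝ, u ∈ Icc k (1 - k) → v ∈ Icc k (1 - k) → |v - u| ≤ ρ →
      r ∈ Ioo (-ε) (1 + ε) → u + r * (v - u) ∈ Icc ((k + b) / 2) (1 - (k + b) / 2) := by
    intro u v r hu hv huv hr
    obtain ⟨h1, h2⟩ := abs_le.1 huv
    rcases lt_or_ge r 0 with h | h
    · have a1 : -(ε * ρ) ≤ r * (v - u) := by nlinarith [hr.1]
      have a2 : r * (v - u) ≤ ε * ρ := by nlinarith [hr.1]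
      constructor <;> linarith [hu.1, hu.2]
    · rcases le_or_gt r 1 with h' | h'
      · constructor <;> nlinarith [hu.1, hu.2, hv.1, hv.2]
      · have a1 : -(ε * ρ) ≤ (r - 1) * (v - u) := by nlinarith [hr.2]
        have a2 : (r - 1) * (v - u) ≤ ε * ρ := by nlinarith [hr.2]
        constructor <;> linarith [hv.1, hv.2]
  have bd : ∀ (f : CNuis d → ℝ), (∀ r, f (γ r) = f U + r * (f V - f U)) →
      f U ∈ Icc k (1 - k) → f V ∈ Icc k (1 - k) → |f V - f U| ≤ ρ →
      Bdd False (Ioo (-ε) (1 + ε)) (fun r => f (γ r)) 1 ρ := by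
    intro f hf hu hv huv
    have hb := w.c_le
    have hc := w.c_pos
    simp only [hf]
    refine Bdd.of_hasDerivAt (f1 := fun _ => f V - f U) (f2 := fun _ => 0) isOpen_Ioo
      (fun r _ => by simpa using ((hasDerivAt_id r).mul_const (f V - f U)).const_add (f U))
      (fun h => h.elim) (fun r hr => ?_) (fun r _ => by simpa using huv) (fun h => h.elim)
    have := aux _ _ r hu hv huv hr
    rw [abs_le]
    constructor <;> linarith [this.1, this.2]
  have dd := dist_apply_le V U
  have C : CoordBdd lam b ((k + b) / 2) c m False (Ioo (-ε) (1 + ε)) γ ρ :=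
    { w := w
      hk := by linarith
      hm := hm
      hI := isOpen_Ioo
      hρ := hρ
      box := fun r hr x => ⟨aux _ _ r (hU x).1 (hV x).1 (dd x).1 hr,
        aux _ _ r (hU x).2.1 (hV x).2.1 (dd x).2.1 hr,
        aux _ _ r (hU x).2.2 (hV x).2.2 (dd x).2.2 hr⟩
      q1 := fun x => bd (fun U => U.1 x) (fun _ => rfl) (hU x).1 (hV x).1 (dd x).1
      q0 := fun x => bd (fun U => U.2.1 x) (fun _ => rfl) (hU x).2.1 (hV x).2.1 (dd x).2.1
      e := fun x => bd (fun U => U.2.2 x) (fun _ => rfl) (hU x).2.2 (hV x).2.2 (dd x).2.2 }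
  have key : ∀ f : CNuis d → ℝ, Bdd False (Ioo (-ε) (1 + ε)) (fun t => f (γ t)) (3 * c⁻¹ ^ 4)
      (10 * c⁻¹ ^ 2 * ρ) → |f V - f U| ≤ 3 * c⁻¹ ^ 4 * (10 * c⁻¹ ^ 2 * ρ) := fun f hf => by
    have := (convex_Ioo (-ε) (1 + ε)).norm_image_sub_le_of_norm_hasDerivWithin_le
      (fun r hr => (hf.h1 r hr).hasDerivWithinAt) (fun r hr => hf.bd1 r hr)
      (x := 0) (y := 1) ⟨by linarith, by linarith⟩ ⟨by linarith, by linarith⟩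
    simpa [γ] using this
  obtain ⟨h1, h2, h3⟩ := C.bvf s x
  exact ⟨key (fun U => (vf lam s U x).1) h1, key (fun U => (vf lam s U x).2.1) h2,
    key (fun U => (vf lam s U x).2.2) h3⟩

theorem exists_isPath (hm : 0 < m) {U0 : CNuis d} {η : ℝ} (hp : Positivity lam U0 η)
    (hs : IsScale lam η c) : ∃ U, IsPath lam c (empX s) U0 U := by
  have w := weight_of_isScale hp.eta_mem hp.smooth hs
  have hc := w.c_pos
  have hη : 0 < η := hp.eta_mem.1
  have hk : η < 2 * η := by linarith
  have hT : 0 < tOne c := by rw [tOne]; positivity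
  obtain ⟨a, ha⟩ : ∃ a : ℝ≥0, (a : ℝ) = η := ⟨⟨η, hη.le⟩, rfl⟩
  obtain ⟨L, hL⟩ : ∃ L : ℝ≥0, (L : ℝ) = 3 * c⁻¹ ^ 4 := ⟨⟨3 * c⁻¹ ^ 4, by positivity⟩, rfl⟩
  obtain ⟨K, hK⟩ : ∃ K : ℝ≥0, (K : ℝ) = 3 * c⁻¹ ^ 4 * (10 * c⁻¹ ^ 2) :=
    ⟨⟨3 * c⁻¹ ^ 4 * (10 * c⁻¹ ^ 2), by positivity⟩, rfl⟩
  have hbox : ∀ U ∈ Metric.closedBall U0 a, InBox (2 * η) U :=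
    fun U hU => hp.inBox (by rwa [ha] at hU)
  have hcont : ∀ U ∈ Metric.closedBall U0 a, Continuous (vf lam s U) :=
    fun U hU => continuous_vf w hk (hbox U hU)
  have hlip : LipschitzOnWith K (fieldC lam s) (Metric.closedBall U0 a) := by
    refine LipschitzOnWith.of_dist_le_mul fun V hV U hU => ?_
    rw [dist_eq_norm]
    refine norm_le_of_cv (by positivity) fun x => ?_
    have h := lipschitz_vf (s := s) w hk hm (hbox U hU) (hbox V hV) x
    rw [← cv_fieldC (hcont V hV), ← cv_fieldC (hcont U hU), ← mul_assoc, ← hK] at h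
    exact h
  have h0 : (0 : ℝ) ∈ Icc (-tOne c) (tOne c) := ⟨by linarith, hT.le⟩
  have hpl : IsPicardLindelof (fun _ => fieldC lam s) (tmin := -tOne c) (tmax := tOne c)
      ⟨0, h0⟩ U0 a 0 L K := by
    refine IsPicardLindelof.of_time_independent (fun U hU => ?_) hlip ?_
    · refine norm_le_of_cv (by positivity) fun x => ?_
      rw [cv_fieldC (hcont U hU), hL]
      exact abs_vf_le w hk hm (hbox U hU) x
    · rw [hL, ha]
      simp only [sub_zero, zero_sub, neg_neg, max_self, NNReal.coe_zero]
      have h4 := w.R_ge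
      have hcη := w.c_le
      have hc1 : c < 1 / 4 := hcη.trans_lt w.b_lt
      rw [tOne]
      -- Distance travelled up to the time c⁶/8; it is below η because c ≤ η and c < 1/4.
      have : 3 * c⁻¹ ^ 4 * (c ^ 6 / 8) = 3 / 8 * c ^ 2 := by field_simp
      rw [this]
      nlinarith
  obtain ⟨α, hα0, hαc, hαm, hder⟩ := exists_picard_mem_closedBall hpl
  refine ⟨α, hα0, ⟨η, hp, hs, fun t _ => ha ▸ hαm t⟩, fun t => fieldC lam s (α t),
    ?_, fun t ht => ⟨?_, ?_⟩⟩
  · exact hlip.continuousOn.comp hαc.continuousOn fun t _ => hαm t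
  · exact (hder t (Ioo_subset_Icc_self ht)).hasDerivAt (Icc_mem_nhds ht.1 ht.2)
  · have h1 := cv_fieldC (hcont _ (hαm t))
    have h2 := field_empX lam s (α t)
    have h3 : ∀ A B : Nuis d, (∀ x, (A.q1 x, A.q0 x, A.e x) = (B.q1 x, B.q0 x, B.e x)) →
        A = B := by
      rintro ⟨a1, a2, a3⟩ ⟨b1, b2, b3⟩ h
      simp only [Prod.mk.injEq] at h
      congr 1 <;> funext x
      exacts [(h x).1, (h x).2.1, (h x).2.2]
    exact h3 _ _ fun x => (h1 x).trans (h2 x).symm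

/-- Evaluation at `x` of a continuous triple, as a continuous linear map. -/
noncomputable def cvL (x : Cov d) : CNuis d →L[ℝ] ℝ × ℝ × ℝ :=
  let ev : C(Cov d, ℝ) →L[ℝ] ℝ := ContinuousMap.evalCLM ℝ x
  (ev.comp (ContinuousLinearMap.fst ℝ _ _)).prod
    ((ev.comp ((ContinuousLinearMap.fst ℝ _ _).comp (ContinuousLinearMap.snd ℝ _ _))).prod
      (ev.comp ((ContinuousLinearMap.snd ℝ _ _).comp (ContinuousLinearMap.snd ℝ _ _))))

/-- The path is an arbitrary choice among the solutions and may come with its own η. A box parameter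
k below all admissible 2η covers every such choice, so uniqueness of the solution is not needed. -/
theorem goodPath_of_isPath (hm : 0 < m) (w : Weight lam b c) (hbk : b < k)
    (hk : ∀ (U0 : CNuis d) (η : ℝ), Positivity lam U0 η → IsScale lam η c → k ≤ 2 * η)
    {U0 : CNuis d} {U : ℝ → CNuis d} (h : IsPath lam c (empX s) U0 U) :
    GoodPath lam b k c (tOne c) s U := by
  obtain ⟨-, ⟨η, hp, hs, hball⟩, V, -, hV⟩ := h
  refine ⟨w, hbk, hm, fun t ht => (hp.inBox (hball t ht)).mono (hk U0 η hp hs),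
    fun t ht x => ?_⟩
  have h1 := (cvL x).hasFDerivAt.comp_hasDerivAt t (hV t ht).1
  have h2 := (hV t ht).2
  refine h1.congr_deriv ?_
  rw [← field_empX, ← h2]
  rfl

/-- A bootstrap: the differential equation alone gives the first-order bounds (`p` false); once the
field is known to be differentiable along the curve, the same argument gives the second-order ones.
-/
theorem GoodPath.coordBdd_aux {T : ℝ} {U : ℝ → CNuis d} (h : GoodPath lam b k c T s U)
    {p : Prop} {ρ : ℝ} (h0 : 3 * c⁻¹ ^ 4 ≤ ρ)
    (h1 : p → ∀ x, (∀ t ∈ Ioo (-T) T, DifferentiableAt ℝ (fun t => vf lam s (U t) x) t) ∧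
      ∀ t ∈ Ioo (-T) T, |deriv (fun t => (vf lam s (U t) x).1) t| ≤ ρ ^ 2 ∧
        |deriv (fun t => (vf lam s (U t) x).2.1) t| ≤ ρ ^ 2 ∧
        |deriv (fun t => (vf lam s (U t) x).2.2) t| ≤ ρ ^ 2) :
    CoordBdd lam b k c m p (Ioo (-T) T) U ρ := by
  have hR := h.w.R_ge
  have hb := h.w.c_le
  have hc := h.w.c_pos
  have hk := h.hk
  have hle : ∀ q ∈ Icc k (1 - k), |q| ≤ 1 := fun q hq =>
    abs_le.2 ⟨by linarith [hq.1], by linarith [hq.2]⟩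
  refine ⟨h.w, h.hk, h.hm, isOpen_Ioo, (by positivity : (0 : ℝ) ≤ 3 * c⁻¹ ^ 4).trans h0, h.box,
    fun x => ?_, fun x => ?_, fun x => ?_⟩
  · refine Bdd.of_hasDerivAt isOpen_Ioo
      (fun t ht => (ContinuousLinearMap.fst ℝ ℝ (ℝ × ℝ)).hasFDerivAt.comp_hasDerivAt t
        (h.ode t ht x)) (f2 := fun t => deriv (fun t => (vf lam s (U t) x).1) t)
      (fun hp t ht => ((h1 hp x).1 t ht).fst.hasDerivAt) (fun t ht => hle _ (h.box t ht x).1)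
      (fun t ht => ?_) (fun hp t ht => ?_)
    · rw [one_mul]
      exact (abs_vf_le h.w h.hk h.hm (h.box t ht) x).1.trans h0
    · rw [one_mul]
      exact ((h1 hp x).2 t ht).1
  · refine Bdd.of_hasDerivAt isOpen_Ioo
      (fun t ht => ((ContinuousLinearMap.fst ℝ ℝ ℝ).comp
        (ContinuousLinearMap.snd ℝ ℝ (ℝ × ℝ))).hasFDerivAt.comp_hasDerivAt t
        (h.ode t ht x)) (f2 := fun t => deriv (fun t => (vf lam s (U t) x).2.1) t)
      (fun hp t ht => ((h1 hp x).1 t ht).snd.fst.hasDerivAt)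
      (fun t ht => hle _ (h.box t ht x).2.1) (fun t ht => ?_) (fun hp t ht => ?_)
    · rw [one_mul]
      exact (abs_vf_le h.w h.hk h.hm (h.box t ht) x).2.1.trans h0
    · rw [one_mul]
      exact ((h1 hp x).2 t ht).2.1
  · refine Bdd.of_hasDerivAt isOpen_Ioo
      (fun t ht => ((ContinuousLinearMap.snd ℝ ℝ ℝ).comp
        (ContinuousLinearMap.snd ℝ ℝ (ℝ × ℝ))).hasFDerivAt.comp_hasDerivAt t
        (h.ode t ht x)) (f2 := fun t => deriv (fun t => (vf lam s (U t) x).2.2) t)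
      (fun hp t ht => ((h1 hp x).1 t ht).snd.snd.hasDerivAt)
      (fun t ht => hle _ (h.box t ht x).2.2) (fun t ht => ?_) (fun hp t ht => ?_)
    · rw [one_mul]
      exact (abs_vf_le h.w h.hk h.hm (h.box t ht) x).2.2.trans h0
    · rw [one_mul]
      exact ((h1 hp x).2 t ht).2.2

/-- With the first-order rate 3R⁴, R = c⁻¹, the field has derivative at most 3R⁴·10R²·3R⁴ = 90R¹⁰
along the curve, and 10R⁵ is a rate whose square exceeds this. -/
theorem GoodPath.coordBdd {T : ℝ} {U : ℝ → CNuis d} (h : GoodPath lam b k c T s U) :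
    CoordBdd lam b k c m True (Ioo (-T) T) U (10 * c⁻¹ ^ 5) := by
  have hR := h.w.R_ge
  have hR0 : 0 < c⁻¹ := by linarith
  have C0 : CoordBdd lam b k c m False (Ioo (-T) T) U (3 * c⁻¹ ^ 4) :=
    h.coordBdd_aux le_rfl fun h => h.elim
  have e : 3 * c⁻¹ ^ 4 * (10 * c⁻¹ ^ 2 * (3 * c⁻¹ ^ 4)) ≤ (10 * c⁻¹ ^ 5) ^ 2 := by
    nlinarith [pow_pos hR0 10]
  refine h.coordBdd_aux (by nlinarith [pow_pos hR0 4]) fun _ x => ?_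
  obtain ⟨h1, h2, h3⟩ := C0.bvf s x
  exact ⟨fun t ht => (h1.diff t ht).prodMk ((h2.diff t ht).prodMk (h3.diff t ht)),
    fun t ht => ⟨(h1.bd1 t ht).trans e, (h2.bd1 t ht).trans e, (h3.bd1 t ht).trans e⟩⟩

end Existence

end WATE

namespace WATE

/-! ### The score property of the path -/

/-- The mass function of `(A, Y)` given nuisance values `u = (q₁, q₀, e)`. -/
noncomputable def pv (u : ℝ × ℝ × ℝ) (a y : Bool) : ℝ :=
  (if a then u.2.2 else 1 - u.2.2) *
    (if y then (if a then u.1 else u.2.1) else 1 - (if a then u.1 else u.2.1))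

/-- The values at `x` of a triple. -/
def nv {d : ℕ} (U : Nuis d) (x : Cov d) : ℝ × ℝ × ℝ := (U.q1 x, U.q0 x, U.e x)

/-- The sum over the four values of `(A, Y)`. -/
def sum4 (f : Bool → Bool → ℝ) : ℝ := f true true + f true false + (f false true + f false false)

theorem sum_bool_eq_sum4 (f : Bool → Bool → ℝ) : ∑ a : Bool, ∑ y : Bool, f a y = sum4 f := by
  simp [sum4]

/-- The set of nuisance values with all coordinates in `[k, 1-k]`. -/
def Bx (k : ℝ) : Set (ℝ × ℝ × ℝ) := Icc k (1 - k) ×ˢ (Icc k (1 - k) ×ˢ Icc k (1 - k))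

theorem InBox.cv_mem {d : ℕ} {k : ℝ} {U : CNuis d} (h : InBox k U) (x : Cov d) : cv U x ∈ Bx k :=
  ⟨(h x).1, (h x).2.1, (h x).2.2⟩

theorem pv_mem {u : ℝ × ℝ × ℝ} (hu : u ∈ Bx 0) (a y : Bool) : pv u a y ∈ Icc (0 : ℝ) 1 := by
  obtain ⟨⟨h1, h1'⟩, ⟨h2, h2'⟩, ⟨h3, h3'⟩⟩ := hu
  have key : ∀ p q : ℝ, 0 ≤ p → p ≤ 1 → 0 ≤ q → q ≤ 1 → p * q ∈ Icc (0 : ℝ) 1 :=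
    fun p q hp hp' hq hq' => ⟨mul_nonneg hp hq, mul_le_one₀ hp' hq hq'⟩
  cases a <;> cases y <;> simp only [pv] <;> apply key <;> simp <;> linarith

theorem sum4_pv (u : ℝ × ℝ × ℝ) : sum4 (pv u) = 1 := by
  simp only [sum4, pv, if_true, Bool.false_eq_true, if_false]
  ring

theorem Bx_mono {k l : ℝ} (h : l ≤ k) : Bx k ⊆ Bx l :=
  prod_mono (Icc_subset_Icc h (by linarith))
    (prod_mono (Icc_subset_Icc h (by linarith)) (Icc_subset_Icc h (by linarith)))

/-- The weights come from `v` and the function from `u`: the result is linear in the errors and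
vanishes at u = v. -/
theorem sum4_pv_gfun_zero {lam : ℝ → ℝ} {u v : ℝ × ℝ × ℝ} :
    sum4 (fun a y => pv v a y * gfun lam 0 a y u) = lam u.2.2 * (v.2.2 * u.2.2⁻¹ * (v.1 - u.1)
      - (1 - v.2.2) * (1 - u.2.2)⁻¹ * (v.2.1 - u.2.1))
      + dotLam lam u.2.2 * (u.1 - u.2.1) * (v.2.2 - u.2.2) := by
  simp [sum4, pv, gfun, val]
  ring

theorem sum4_pv_gfun_one {lam : ℝ → ℝ} {u v : ℝ × ℝ × ℝ} :
    sum4 (fun a y => pv v a y * gfun lam 1 a y u) = dotLam lam u.2.2 * (v.2.2 - u.2.2) := by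
  simp [sum4, pv, gfun, val]
  ring

theorem sum4_pv_Demp {d m : ℕ} {lam : ℝ → ℝ} (s : Fin m → Obs d) (U : CNuis d) (x : Cov d) :
    sum4 (fun a y => pv (cv U x) a y * Demp lam s U (x, a, y)) = 0 := by
  have h0 := sum4_pv_gfun_zero (lam := lam) (u := cv U x) (v := cv U x)
  have h1 := sum4_pv_gfun_one (lam := lam) (u := cv U x) (v := cv U x)
  simp only [sub_self, mul_zero, add_zero] at h0 h1
  simp only [sum4, Demp] at *
  linear_combination al lam s U * h0 + be lam s U * h1

section Path

variable {d m : ℕ} {lam : ℝ → ℝ} {b c k T : ℝ} {s : Fin m → Obs d} {U : ℝ → CNuis d}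

/-- The field carries the factors q(1-q) and e(1-e) because a Bernoulli log-likelihood with
parameter e has derivative (a-e)e'/(e(1-e)). These factors cancel, and the score in the direction of
the field is exactly α g₀ + β g₁, that is D*. -/
theorem hasDerivAt_pv_of {q1 q0 e : ℝ → ℝ} {v : ℝ × ℝ × ℝ} {t : ℝ} (h1 : HasDerivAt q1 v.1 t)
    (h0 : HasDerivAt q0 v.2.1 t) (he : HasDerivAt e v.2.2 t) {α β : ℝ}
    (hv : v = α • Ffun lam 0 (q1 t, q0 t, e t) + β • Ffun lam 1 (q1 t, q0 t, e t))
    (hne : e t ≠ 0) (hne' : 1 - e t ≠ 0) (a y : Bool) :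
    HasDerivAt (fun t => pv (q1 t, q0 t, e t) a y)
      (pv (q1 t, q0 t, e t) a y * (α * gfun lam 0 a y (q1 t, q0 t, e t)
        + β * gfun lam 1 a y (q1 t, q0 t, e t))) t := by
  subst hv
  simp only [Ffun, Prod.smul_mk, Prod.mk_add_mk, smul_eq_mul, mul_zero, add_zero] at h1 h0 he
  cases a <;> cases y <;> simp only [pv, gfun, val, if_true, Bool.false_eq_true, if_false]
  · exact ((he.const_sub 1).mul (h0.const_sub 1)).congr_deriv (by field_simp; ring)
  · exact ((he.const_sub 1).mul h0).congr_deriv (by field_simp; ring)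
  · exact (he.mul (h1.const_sub 1)).congr_deriv (by field_simp; ring)
  · exact (he.mul h1).congr_deriv (by field_simp; ring)

theorem GoodPath.k_pos (h : GoodPath lam b k c T s U) : 0 < k := by
  linarith [h.w.c_pos, h.w.c_le, h.hk]

theorem GoodPath.hasDerivAt_pv (h : GoodPath lam b k c T s U) {t : ℝ} (ht : t ∈ Ioo (-T) T)
    (x : Cov d) (a y : Bool) :
    HasDerivAt (fun t => pv (cv (U t) x) a y)
      (pv (cv (U t) x) a y * Demp lam s (U t) (x, a, y)) t := by
  have hk := h.k_pos
  have he := (h.box t ht x).2.2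
  have ho := h.ode t ht x
  exact hasDerivAt_pv_of (q1 := fun t => (U t).1 x) (q0 := fun t => (U t).2.1 x)
    (e := fun t => (U t).2.2 x)
    ((ContinuousLinearMap.fst ℝ ℝ (ℝ × ℝ)).hasFDerivAt.comp_hasDerivAt t ho)
    (((ContinuousLinearMap.fst ℝ ℝ ℝ).comp
        (ContinuousLinearMap.snd ℝ ℝ (ℝ × ℝ))).hasFDerivAt.comp_hasDerivAt t ho)
    (((ContinuousLinearMap.snd ℝ ℝ ℝ).comp
        (ContinuousLinearMap.snd ℝ ℝ (ℝ × ℝ))).hasFDerivAt.comp_hasDerivAt t ho) rfl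
    (by linarith [he.1] : 0 < (U t).2.2 x).ne' (sub_pos.2 (by linarith [he.2])).ne' a y

theorem pv_pos {u : ℝ × ℝ × ℝ} {k : ℝ} (hk : 0 < k) (hu : u ∈ Bx k) (a y : Bool) :
    k ^ 2 ≤ pv u a y := by
  obtain ⟨⟨h1, h1'⟩, ⟨h2, h2'⟩, ⟨h3, h3'⟩⟩ := hu
  have key : ∀ p q : ℝ, k ≤ p → k ≤ q → k ^ 2 ≤ p * q := fun p q hp hq => by nlinarith
  cases a <;> cases y <;> simp only [pv] <;> apply key <;> simp <;> linarith

/-- The derivative of `D^*` along the path has conditional mean `-E[(D^*)²]`. -/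
theorem GoodPath.sum4_pv_deriv_Demp (h : GoodPath lam b k c T s U) {t : ℝ}
    (ht : t ∈ Ioo (-T) T) (x : Cov d) :
    sum4 (fun a y => pv (cv (U t) x) a y * deriv (fun t => Demp lam s (U t) (x, a, y)) t)
      = -sum4 (fun a y => pv (cv (U t) x) a y * Demp lam s (U t) (x, a, y) ^ 2) := by
  have hd : ∀ a y, HasDerivAt (fun t => pv (cv (U t) x) a y * Demp lam s (U t) (x, a, y))
      (pv (cv (U t) x) a y * Demp lam s (U t) (x, a, y) * Demp lam s (U t) (x, a, y)
        + pv (cv (U t) x) a y * deriv (fun t => Demp lam s (U t) (x, a, y)) t) t := fun a y =>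
    (h.hasDerivAt_pv ht x a y).mul ((h.coordBdd.bDemp s (x, a, y)).h1 t ht)
  have h1 := ((hd true true).add (hd true false)).add ((hd false true).add (hd false false))
  have h2 : HasDerivAt (fun _ : ℝ => (0 : ℝ)) 0 t := hasDerivAt_const t 0
  -- The conditional mean of D* under its own nuisances is zero at all times, so the product rule
  -- yields a relation between the derivative and the square.
  have h3 := h1.unique (h2.congr_of_eventuallyEq (Eventually.of_forall fun r => by
    simpa [sum4] using sum4_pv_Demp (lam := lam) s (U r) x))
  simp only [sum4]
  linear_combination h3

/-- The log-likelihood along the path has the empirical mean of `D^*` as derivative. -/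
theorem GoodPath.hasDerivAt_loglik (h : GoodPath lam b k c T s U) {t : ℝ}
    (ht : t ∈ Ioo (-T) T) :
    HasDerivAt (fun t => (1 / (m : ℝ)) * ∑ i, Real.log
      (condP (U t).fn (s i).2.1 (s i).2.2 (s i).1)) (emp s (Demp lam s (U t))) t := by
  refine (HasDerivAt.fun_sum fun i _ => ?_).const_mul _
  have hp : 0 < pv (cv (U t) (s i).1) (s i).2.1 (s i).2.2 :=
    (pow_pos h.k_pos 2).trans_le (pv_pos h.k_pos ((h.box t ht).cv_mem _) _ _)
  refine ((h.hasDerivAt_pv ht (s i).1 (s i).2.1 (s i).2.2).log hp.ne').congr_deriv ?_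
  field_simp

/-! ### Derivatives of the building blocks -/

/-- The derivative of `gfun j` in the direction of the field `Ffun l`. -/
noncomputable def hfun (lam : ℝ → ℝ) (j : Fin 4) (l : Fin 2) (a y : Bool) (u : ℝ × ℝ × ℝ) : ℝ :=
  fderiv ℝ (gfun lam j a y) u (Ffun lam l u)

theorem contDiffOn_gfun (w : Weight lam b c) (j : Fin 4) (a y : Bool) :
    ContDiffOn ℝ 1 (gfun lam j a y) {u | u.2.2 ∈ Ioo b (1 - b)} := by
  have hb := w.c_le
  have hc := w.c_pos
  set S : Set (ℝ × ℝ × ℝ) := {u | u.2.2 ∈ Ioo b (1 - b)}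
  have e : ContDiffOn ℝ 1 (fun u : ℝ × ℝ × ℝ => u.2.2) S := by fun_prop
  have q1 : ContDiffOn ℝ 1 (fun u : ℝ × ℝ × ℝ => u.1) S := by fun_prop
  have q0 : ContDiffOn ℝ 1 (fun u : ℝ × ℝ × ℝ => u.2.1) S := by fun_prop
  have l0 : ContDiffOn ℝ 1 (fun u : ℝ × ℝ × ℝ => lam u.2.2) S :=
    ((w.smooth.mono Ioo_subset_Icc_self).of_le (by norm_num)).comp e fun u hu => hu
  have l1 : ContDiffOn ℝ 1 (fun u : ℝ × ℝ × ℝ => dotLam lam u.2.2) S :=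
    ((dotLam_contDiffOn (n := 2) (by linarith) w.smooth).of_le (by norm_num)).comp e
      fun u hu => hu
  have i0 : ContDiffOn ℝ 1 (fun u : ℝ × ℝ × ℝ => (u.2.2)⁻¹) S :=
    e.inv fun u hu => (by linarith [hu.1] : 0 < u.2.2).ne'
  have i1 : ContDiffOn ℝ 1 (fun u : ℝ × ℝ × ℝ => (1 - u.2.2)⁻¹) S :=
    (contDiffOn_const.sub e).inv fun u hu => (sub_pos.2 (by linarith [hu.2] : u.2.2 < 1)).ne'
  have k : ∀ r : ℝ, ContDiffOn ℝ 1 (fun _ : ℝ × ℝ × ℝ => r) S := fun r => contDiffOn_const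
  fin_cases j
  · exact (l0.mul ((((k (val a)).mul i0).mul ((k (val y)).sub q1)).sub
      (((k (1 - val a)).mul i1).mul ((k (val y)).sub q0)))).add
      ((l1.mul (q1.sub q0)).mul ((k (val a)).sub e))
  · exact l1.mul ((k (val a)).sub e)
  · exact l0.mul (q1.sub q0)
  · exact l0

theorem isOpen_strip : IsOpen {u : ℝ × ℝ × ℝ | u.2.2 ∈ Ioo b (1 - b)} :=
  isOpen_Ioo.preimage (continuous_snd.comp continuous_snd)

theorem Bx_subset_strip (hk : b < k) : Bx k ⊆ {u : ℝ × ℝ × ℝ | u.2.2 ∈ Ioo b (1 - b)} :=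
  fun _ hu => ⟨hk.trans_le hu.2.2.1, hu.2.2.2.trans_lt (by linarith)⟩

theorem differentiableAt_gfun (w : Weight lam b c) (j : Fin 4) (a y : Bool) {u : ℝ × ℝ × ℝ}
    (hu : u.2.2 ∈ Ioo b (1 - b)) : DifferentiableAt ℝ (gfun lam j a y) u :=
  ((contDiffOn_gfun w j a y).contDiffAt (isOpen_strip.mem_nhds hu)).differentiableAt one_ne_zero

theorem continuousOn_Ffun (w : Weight lam b c) (l : Fin 2) :
    ContinuousOn (Ffun lam l) {u | u.2.2 ∈ Ioo b (1 - b)} := by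
  have hb := w.c_le
  have hc := w.c_pos
  set S : Set (ℝ × ℝ × ℝ) := {u | u.2.2 ∈ Ioo b (1 - b)}
  have e : ContinuousOn (fun u : ℝ × ℝ × ℝ => u.2.2) S := by fun_prop
  have q1 : ContinuousOn (fun u : ℝ × ℝ × ℝ => u.1) S := by fun_prop
  have q0 : ContinuousOn (fun u : ℝ × ℝ × ℝ => u.2.1) S := by fun_prop
  have l0 : ContinuousOn (fun u : ℝ × ℝ × ℝ => lam u.2.2) S :=
    (w.smooth.continuousOn.mono Ioo_subset_Icc_self).comp e fun u hu => hu
  have l1 : ContinuousOn (fun u : ℝ × ℝ × ℝ => dotLam lam u.2.2) S :=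
    (dotLam_contDiffOn (n := 2) (by linarith) w.smooth).continuousOn.comp e fun u hu => hu
  have i0 : ContinuousOn (fun u : ℝ × ℝ × ℝ => (u.2.2)⁻¹) S :=
    e.inv₀ fun u hu => (by linarith [hu.1] : 0 < u.2.2).ne'
  have i1 : ContinuousOn (fun u : ℝ × ℝ × ℝ => (1 - u.2.2)⁻¹) S :=
    (continuousOn_const.sub e).inv₀ fun u hu =>
      (sub_pos.2 (by linarith [hu.2] : u.2.2 < 1)).ne'
  have k : ∀ r : ℝ, ContinuousOn (fun _ : ℝ × ℝ × ℝ => r) S := fun r => continuousOn_const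
  have e0 := (e.mul ((k 1).sub e)).mul l1
  fin_cases l
  · exact (((q1.mul ((k 1).sub q1)).mul l0).mul i0).prodMk
      (((((q0.mul ((k 1).sub q0)).mul l0).mul i1).neg).prodMk (e0.mul (q1.sub q0)))
  · exact (k 0).prodMk ((k 0).prodMk e0)

theorem continuousOn_hfun (w : Weight lam b c) (j : Fin 4) (l : Fin 2) (a y : Bool) :
    ContinuousOn (hfun lam j l a y) {u | u.2.2 ∈ Ioo b (1 - b)} :=
  ((contDiffOn_gfun w j a y).continuousOn_fderiv_of_isOpen isOpen_strip le_rfl).clm_apply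
    (continuousOn_Ffun w l)

/-- The sample enters the derivative only through the scalars α and β; the functions `hfun` are
fixed, so their averages can be handled conditionally on the training fold. -/
theorem GoodPath.deriv_gfun (h : GoodPath lam b k c T s U) {t : ℝ} (ht : t ∈ Ioo (-T) T)
    (j : Fin 4) (o : Obs d) :
    deriv (fun t => gfun lam j o.2.1 o.2.2 (cv (U t) o.1)) t =
      al lam s (U t) * hfun lam j 0 o.2.1 o.2.2 (cv (U t) o.1) +
        be lam s (U t) * hfun lam j 1 o.2.1 o.2.2 (cv (U t) o.1) := by
  have h1 := (differentiableAt_gfun h.w j o.2.1 o.2.2 (u := cv (U t) o.1)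
    ((h.box t ht).e_mem h.hk o.1)).hasFDerivAt
  have h2 := (h1.comp_hasDerivAt t (h.ode t ht o.1)).deriv
  rw [Function.comp_def] at h2
  rw [h2, vf, map_add, map_smul, map_smul]
  rfl

/-! ### Uniform constants on the box -/

/-- The `ℓ¹` distance of nuisance values. -/
noncomputable def dl (u v : ℝ × ℝ × ℝ) : ℝ := |u.1 - v.1| + |u.2.1 - v.2.1| + |u.2.2 - v.2.2|

theorem dl_nonneg (u v : ℝ × ℝ × ℝ) : 0 ≤ dl u v := by unfold dl; positivity

theorem norm_sub_le_dl (u v : ℝ × ℝ × ℝ) : ‖u - v‖ ≤ dl u v := by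
  simp only [Prod.norm_def, dl, Prod.fst_sub, Prod.snd_sub, Real.norm_eq_abs]
  have := abs_nonneg (u.1 - v.1)
  have := abs_nonneg (u.2.1 - v.2.1)
  have := abs_nonneg (u.2.2 - v.2.2)
  refine max_le ?_ (max_le ?_ ?_) <;> linarith

theorem isCompact_Bx (k : ℝ) : IsCompact (Bx k) :=
  isCompact_Icc.prod (isCompact_Icc.prod isCompact_Icc)

/-- Compactness of the box suffices here: the asymptotic argument needs constants that are uniform
over samples and triples, not explicit ones. The Lipschitz bound also uses convexity of the box. -/
theorem exists_bound_gfun (w : Weight lam b c) (hk : b < k) :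
    ∃ M, 1 ≤ M ∧ (∀ j a y, ∀ u ∈ Bx k, |gfun lam j a y u| ≤ M) ∧
      (∀ j l a y, ∀ u ∈ Bx k, |hfun lam j l a y u| ≤ M) ∧
      ∀ j a y, ∀ u ∈ Bx k, ∀ v ∈ Bx k, |gfun lam j a y u - gfun lam j a y v| ≤ M * dl u v := by
  have hs := Bx_subset_strip hk
  choose M1 hM1 using fun (p : Fin 4 × Bool × Bool) => (isCompact_Bx k).exists_bound_of_continuousOn
    ((contDiffOn_gfun w p.1 p.2.1 p.2.2).continuousOn.mono hs)
  choose M2 hM2 using fun (p : Fin 4 × Fin 2 × Bool × Bool) =>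
    (isCompact_Bx k).exists_bound_of_continuousOn
    ((continuousOn_hfun w p.1 p.2.1 p.2.2.1 p.2.2.2).mono hs)
  choose M3 hM3 using fun (p : Fin 4 × Bool × Bool) => (isCompact_Bx k).exists_bound_of_continuousOn
    (((contDiffOn_gfun w p.1 p.2.1 p.2.2).continuousOn_fderiv_of_isOpen isOpen_strip le_rfl).mono hs)
  have b1 : ∀ p, |M1 p| ≤ ∑ p, |M1 p| := fun p =>
    Finset.single_le_sum (f := fun p => |M1 p|) (fun _ _ => abs_nonneg _) (Finset.mem_univ p)
  have b2 : ∀ p, |M2 p| ≤ ∑ p, |M2 p| := fun p =>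
    Finset.single_le_sum (f := fun p => |M2 p|) (fun _ _ => abs_nonneg _) (Finset.mem_univ p)
  have b3 : ∀ p, |M3 p| ≤ ∑ p, |M3 p| := fun p =>
    Finset.single_le_sum (f := fun p => |M3 p|) (fun _ _ => abs_nonneg _) (Finset.mem_univ p)
  have n1 : 0 ≤ ∑ p, |M1 p| := Finset.sum_nonneg fun _ _ => abs_nonneg _
  have n2 : 0 ≤ ∑ p, |M2 p| := Finset.sum_nonneg fun _ _ => abs_nonneg _
  have n3 : 0 ≤ ∑ p, |M3 p| := Finset.sum_nonneg fun _ _ => abs_nonneg _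
  refine ⟨1 + ∑ p, |M1 p| + ∑ p, |M2 p| + ∑ p, |M3 p|, by linarith, fun j a y u hu => ?_,
    fun j l a y u hu => ?_, fun j a y u hu v hv => ?_⟩
  · have := hM1 (j, a, y) u hu
    rw [Real.norm_eq_abs] at this
    linarith [b1 (j, a, y), le_abs_self (M1 (j, a, y))]
  · have := hM2 (j, l, a, y) u hu
    rw [Real.norm_eq_abs] at this
    linarith [b2 (j, l, a, y), le_abs_self (M2 (j, l, a, y))]
  · have hconv : Convex ℝ (Bx k) :=
      (convex_Icc _ _).prod ((convex_Icc _ _).prod (convex_Icc _ _))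
    have := hconv.norm_image_sub_le_of_norm_fderiv_le (𝕜 := ℝ)
      (fun u hu => differentiableAt_gfun w j a y (hs hu)) (fun u hu => hM3 (j, a, y) u hu) hv hu
    rw [Real.norm_eq_abs] at this
    refine this.trans ?_
    have := norm_sub_le_dl u v
    gcongr
    linarith [b3 (j, a, y), le_abs_self (M3 (j, a, y))]

theorem abs_pv_sub_le {u v : ℝ × ℝ × ℝ} (hu : u ∈ Bx 0) (hv : v ∈ Bx 0) (a y : Bool) :
    |pv u a y - pv v a y| ≤ dl u v := by
  obtain ⟨⟨h1, h1'⟩, ⟨h2, h2'⟩, ⟨h3, h3'⟩⟩ := hu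
  obtain ⟨⟨g1, g1'⟩, ⟨g2, g2'⟩, ⟨g3, g3'⟩⟩ := hv
  have key : ∀ p q p' q' : ℝ, |q| ≤ 1 → |p'| ≤ 1 → |p * q - p' * q'| ≤ |q - q'| + |p - p'| := by
    intro p q p' q' hq hp'
    calc |p * q - p' * q'| = |p' * (q - q') + (p - p') * q| := by ring_nf
      _ ≤ |p'| * |q - q'| + |p - p'| * |q| := by
        rw [← abs_mul, ← abs_mul]; exact abs_add_le _ _
      _ ≤ 1 * |q - q'| + |p - p'| * 1 := by gcongr
      _ = _ := by ring
  have a1 : ∀ x z : ℝ, |1 - x - (1 - z)| = |x - z| := fun x z => by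
    rw [← abs_neg]; ring_nf
  have n1 := abs_nonneg (u.1 - v.1)
  have n2 := abs_nonneg (u.2.1 - v.2.1)
  unfold dl
  cases a <;> cases y <;> simp only [pv, if_true, Bool.false_eq_true, if_false] <;>
    refine (key _ _ _ _ (by rw [abs_le]; constructor <;> linarith)
      (by rw [abs_le]; constructor <;> linarith)).trans ?_ <;> (try rw [a1]) <;> (try rw [a1]) <;>
    linarith

end Path

/-! ### Orthogonality -/

/-- The estimating function, whose mean vanishes at the true parameter value. -/
noncomputable def mfun (lam : ℝ → ℝ) (ψ : ℝ) (a y : Bool) (u : ℝ × ℝ × ℝ) : ℝ :=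
  gfun lam 0 a y u + gfun lam 2 a y u - ψ * (gfun lam 1 a y u + gfun lam 3 a y u)

theorem Dfull_eq {d : ℕ} (lam : ℝ → ℝ) (Q : Measure (Cov d)) (U : Nuis d) (o : Obs d) :
    Dfull lam Q U o = (Omega lam Q U)⁻¹ * mfun lam (psi lam Q U) o.2.1 o.2.2 (nv U o.1) := by
  simp only [Dfull, mfun, gfun, nv, phi, Nuis.tau]
  ring

/-- Neyman orthogonality as an algebraic identity. Every term on the right is of second order in u -
v: errors of e times errors of q, the Taylor remainder of λ, and an error of e times an error of the
blip. -/
theorem sum4_pv_mfun (lam : ℝ → ℝ) (ψ : ℝ) {u v : ℝ × ℝ × ℝ} (h0 : u.2.2 ≠ 0)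
    (h1 : 1 - u.2.2 ≠ 0) :
    sum4 (fun a y => pv v a y * mfun lam ψ a y u) - lam v.2.2 * (v.1 - v.2.1 - ψ) =
      lam u.2.2 * ((v.2.2 - u.2.2) * u.2.2⁻¹ * (v.1 - u.1)
        + (v.2.2 - u.2.2) * (1 - u.2.2)⁻¹ * (v.2.1 - u.2.1))
      - (lam v.2.2 - lam u.2.2 - dotLam lam u.2.2 * (v.2.2 - u.2.2)) * (v.1 - v.2.1 - ψ)
      + dotLam lam u.2.2 * (v.2.2 - u.2.2) * ((u.1 - u.2.1) - (v.1 - v.2.1)) := by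
  simp [sum4, pv, mfun, gfun, val]
  field_simp
  ring

/-- The expansion point is interior, so that `dotLam` is the genuine derivative there, but the other
point may be an endpoint: the propensity scores of a submodel are only confined to the closed
interval. -/
theorem exists_taylor_weight {lam : ℝ → ℝ} {η : ℝ} (hη : 0 < η) (hη' : η < 1 / 2)
    (hs : ContDiffOn ℝ 3 lam (Icc η (1 - η))) :
    ∃ K, 0 ≤ K ∧ ∀ e ∈ Ioo η (1 - η), ∀ e' ∈ Icc η (1 - η),
      |lam e' - lam e - dotLam lam e * (e' - e)| ≤ K * (e' - e) ^ 2 := by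
  set S := Icc η (1 - η)
  have hu : UniqueDiffOn ℝ S := uniqueDiffOn_Icc (by linarith)
  have h2 : ContDiffOn ℝ 2 (derivWithin lam S) S :=
    ((contDiffOn_succ_iff_derivWithin (n := 2) hu).1 (by
      rwa [show (2 : WithTop ℕ∞) + 1 = 3 by norm_num])).2.2
  have h1 : ContDiffOn ℝ 1 (derivWithin (derivWithin lam S) S) S :=
    ((contDiffOn_succ_iff_derivWithin (n := 1) hu).1 (by
      rwa [show (1 : WithTop ℕ∞) + 1 = 2 by norm_num])).2.2
  obtain ⟨K, hK⟩ := isCompact_Icc.exists_bound_of_continuousOn h1.continuousOn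
  have hK0 : 0 ≤ K := (norm_nonneg _).trans (hK η ⟨le_rfl, by linarith⟩)
  have d0 : ∀ x ∈ S, HasDerivWithinAt lam (derivWithin lam S x) S x := fun x hx =>
    (hs.differentiableOn (by norm_num) x hx).hasDerivWithinAt
  have d1 : ∀ x ∈ S, HasDerivWithinAt (derivWithin lam S)
      (derivWithin (derivWithin lam S) S x) S x := fun x hx =>
    (h2.differentiableOn (by norm_num) x hx).hasDerivWithinAt
  refine ⟨K, hK0, fun e he e' he' => ?_⟩
  have heS : e ∈ S := Ioo_subset_Icc_self he
  have hde : dotLam lam e = derivWithin lam S e := by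
    rw [dotLam_eq_deriv ⟨by linarith [he.1], by linarith [he.2]⟩,
      derivWithin_of_mem_nhds (Icc_mem_nhds he.1 he.2)]
  have hsub : uIcc e e' ⊆ S := (convex_Icc η (1 - η)).ordConnected.uIcc_subset heS he'
  have := (convex_uIcc e e').norm_image_sub_le_of_norm_hasDerivWithin_le
    (f := fun r => lam r - r * dotLam lam e) (f' := fun r => derivWithin lam S r - 1 * dotLam lam e)
    (C := K * |e' - e|)
    (fun x hx => ((d0 x (hsub hx)).mono hsub).sub
      ((hasDerivWithinAt_id x _).mul_const (dotLam lam e)))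
    (fun x hx => by
      rw [one_mul, hde]
      refine ((convex_Icc η (1 - η)).norm_image_sub_le_of_norm_hasDerivWithin_le d1 hK heS
        (hsub hx)).trans ?_
      have := abs_sub_left_of_mem_uIcc hx
      rw [Real.norm_eq_abs]
      gcongr)
    left_mem_uIcc right_mem_uIcc
  simp only [Real.norm_eq_abs] at this
  calc _ = |lam e' - e' * dotLam lam e - (lam e - e * dotLam lam e)| := by ring_nf
    _ ≤ _ := this
    _ = _ := by rw [mul_assoc, ← sq, sq_abs]

/-- The hypotheses on `u` and `v` are asymmetric on purpose. The point `u`, where the estimating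
function is evaluated, needs a margin in e; the values `v` describe a law, possibly one of a
submodel, whose outcome means are only known to lie in [0,1]. -/
theorem exists_orthogonality {lam : ℝ → ℝ} {η k : ℝ} (hη : 0 < η) (hη' : η < 1 / 2)
    (hs : ContDiffOn ℝ 3 lam (Icc η (1 - η))) (hk : η < k) :
    ∃ K, 0 ≤ K ∧ ∀ ψ : ℝ, |ψ| ≤ 1 → ∀ u ∈ Bx 0, u.2.2 ∈ Icc k (1 - k) → ∀ v ∈ Bx 0,
      v.2.2 ∈ Icc η (1 - η) →
      |sum4 (fun a y => pv v a y * mfun lam ψ a y u) - lam v.2.2 * (v.1 - v.2.1 - ψ)|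
        ≤ K * dl u v ^ 2 := by
  obtain ⟨K1, hK1, h1⟩ := exists_taylor_weight hη hη' hs
  have hsub : Icc k (1 - k) ⊆ Ioo η (1 - η) := fun x hx =>
    ⟨hk.trans_le hx.1, hx.2.trans_lt (by linarith)⟩
  obtain ⟨K2, h2⟩ := isCompact_Icc.exists_bound_of_continuousOn
    (hs.continuousOn.mono (hsub.trans Ioo_subset_Icc_self))
  obtain ⟨K3, h3⟩ := isCompact_Icc.exists_bound_of_continuousOn
    ((dotLam_contDiffOn (n := 2) hη.le hs).continuousOn.mono hsub)
  refine ⟨|K2| * (2 * k⁻¹) + K1 * 2 + |K3| * 2, by have : 0 < k := hη.trans hk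
                                                   positivity, ?_⟩
  intro ψ hψ u hu hue v hv hve
  have hk0 : 0 < k := hη.trans hk
  have l0 : |lam u.2.2| ≤ |K2| := (h2 _ hue).trans (le_abs_self _)
  have l1 : |dotLam lam u.2.2| ≤ |K3| := (h3 _ hue).trans (le_abs_self _)
  have t := h1 _ (hsub hue) _ hve
  obtain ⟨i0, i1⟩ := abs_inv_le hk0 le_rfl hue
  rw [sum4_pv_mfun lam ψ (by linarith [hue.1] : 0 < u.2.2).ne'
    (sub_pos.2 (by linarith [hue.2] : u.2.2 < 1)).ne']
  have n1 := abs_nonneg (u.1 - v.1)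
  have n0 := abs_nonneg (u.2.1 - v.2.1)
  have ne := abs_nonneg (u.2.2 - v.2.2)
  set D := dl u v with hD
  have e1 : |v.1 - u.1| ≤ D := by rw [abs_sub_comm, hD, dl]; linarith
  have e0 : |v.2.1 - u.2.1| ≤ D := by rw [abs_sub_comm, hD, dl]; linarith
  have ee : |v.2.2 - u.2.2| ≤ D := by rw [abs_sub_comm, hD, dl]; linarith
  have eτ : |(u.1 - u.2.1) - (v.1 - v.2.1)| ≤ 2 * D := by
    calc _ = |(u.1 - v.1) - (u.2.1 - v.2.1)| := by ring_nf
      _ ≤ |u.1 - v.1| + |u.2.1 - v.2.1| := abs_sub _ _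
      _ ≤ 2 * D := by rw [hD, dl]; linarith
  have hτ : |v.1 - v.2.1 - ψ| ≤ 2 := by
    obtain ⟨⟨g1, g1'⟩, ⟨g2, g2'⟩, -⟩ := hv
    have := abs_le.1 hψ
    rw [abs_le]
    constructor <;> linarith
  have hD0 : 0 ≤ D := dl_nonneg _ _
  have hsq : (v.2.2 - u.2.2) ^ 2 ≤ D ^ 2 := sq_le_sq' (by linarith [abs_le.1 ee]) (abs_le.1 ee).2
  have hK2 := abs_nonneg K2
  have hK3 := abs_nonneg K3
  have p1 : |lam u.2.2 * ((v.2.2 - u.2.2) * u.2.2⁻¹ * (v.1 - u.1)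
        + (v.2.2 - u.2.2) * (1 - u.2.2)⁻¹ * (v.2.1 - u.2.1))| ≤ |K2| * (D * k⁻¹ * D + D * k⁻¹ * D) := by
    rw [abs_mul]
    refine mul_le_mul l0 ((abs_add_le _ _).trans ?_) (abs_nonneg _) hK2
    rw [abs_mul, abs_mul, abs_mul, abs_mul]
    gcongr
  have p2 : |(lam v.2.2 - lam u.2.2 - dotLam lam u.2.2 * (v.2.2 - u.2.2)) * (v.1 - v.2.1 - ψ)|
      ≤ K1 * D ^ 2 * 2 := by
    rw [abs_mul]
    refine mul_le_mul (t.trans ?_) hτ (abs_nonneg _) (by positivity)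
    gcongr
  have p3 : |dotLam lam u.2.2 * (v.2.2 - u.2.2) * ((u.1 - u.2.1) - (v.1 - v.2.1))|
      ≤ |K3| * D * (2 * D) := by
    rw [abs_mul, abs_mul]
    gcongr
  refine (abs_add_le _ _).trans ((add_le_add ((abs_sub _ _).trans (add_le_add p1 p2)) p3).trans ?_)
  apply le_of_eq
  ring

end WATE

namespace WATE

/-! ### Integration against laws with given nuisance functions -/

theorem integral_mul_comp_eq_of_condExp {α β : Type*} [MeasurableSpace α] [MeasurableSpace β]
    {P : Measure α} [IsProbabilityMeasure P] {φ : α → β} (hφ : Measurable φ) {f w : α → ℝ}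
    (hf : Measurable f) {B : ℝ} (hfB : ∀ o, |f o| ≤ B)
    (hw : w =ᵐ[P] P[f | MeasurableSpace.comap φ inferInstance])
    {h : β → ℝ} (hh : Measurable h) {C : ℝ} (hhC : ∀ x, |h x| ≤ C) :
    ∫ o, f o * h (φ o) ∂P = ∫ o, w o * h (φ o) ∂P := by
  have hm : MeasurableSpace.comap φ inferInstance ≤ (inferInstance : MeasurableSpace α) :=
    hφ.comap_le
  have hfi : Integrable f P := Integrable.of_bound hf.aestronglyMeasurable B
    (Eventually.of_forall hfB)
  have hsm : StronglyMeasurable[MeasurableSpace.comap φ inferInstance] (fun o => h (φ o)) :=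
    (hh.comp (comap_measurable φ)).stronglyMeasurable
  have hfh : Integrable (fun o => h (φ o) * f o) P := by
    refine Integrable.of_bound ((hh.comp hφ).mul hf).aestronglyMeasurable (C * B)
      (Eventually.of_forall fun o => ?_)
    rw [norm_mul]
    exact mul_le_mul (hhC _) (hfB _) (norm_nonneg _) ((abs_nonneg _).trans (hhC (φ o)))
  calc ∫ o, f o * h (φ o) ∂P = ∫ o, h (φ o) * f o ∂P := by simp only [mul_comm]
    _ = ∫ o, (P[fun o => h (φ o) * f o | MeasurableSpace.comap φ inferInstance]) o ∂P :=
      (integral_condExp hm).symm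
    _ = ∫ o, w o * h (φ o) ∂P := by
      refine integral_congr_ae ?_
      filter_upwards [condExp_mul_of_stronglyMeasurable_left hsm hfh hfi, hw] with o h1 h2
      rw [mul_comm, h2]
      exact h1

theorem measurable_val : Measurable val := measurable_of_finite val

theorem abs_val_le (a : Bool) : |val a| ≤ 1 :=
  abs_le.2 ⟨by linarith [val_nonneg a], val_le_one a⟩

section Nuisance

variable {d : ℕ} {P : Measure (Obs d)} [IsProbabilityMeasure P] {U : Nuis d}

theorem IsNuisanceOf.integral_val_fst (hU : IsNuisanceOf P U) {g : Cov d → ℝ} (hg : Measurable g)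
    {C : ℝ} (hC : ∀ x, |g x| ≤ C) :
    ∫ o, val o.2.1 * g o.1 ∂P = ∫ o, U.e o.1 * g o.1 ∂P :=
  integral_mul_comp_eq_of_condExp measurable_fst
    (measurable_val.comp (measurable_fst.comp measurable_snd)) (fun _ => abs_val_le _)
    hU.propensity hg hC

theorem IsNuisanceOf.integral_val_snd (hU : IsNuisanceOf P U) {g : Cov d × Bool → ℝ}
    (hg : Measurable g) {C : ℝ} (hC : ∀ x, |g x| ≤ C) :
    ∫ o, val o.2.2 * g (o.1, o.2.1) ∂P = ∫ o, U.q o.2.1 o.1 * g (o.1, o.2.1) ∂P :=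
  integral_mul_comp_eq_of_condExp (φ := fun o : Obs d => (o.1, o.2.1))
    (measurable_fst.prodMk (measurable_fst.comp measurable_snd))
    (measurable_val.comp (measurable_snd.comp measurable_snd)) (fun _ => abs_val_le _)
    hU.outcome hg hC

theorem measurable_obs_of_slices {β : Type*} [MeasurableSpace β] {f : Obs d → β}
    (h : ∀ a y, Measurable fun x => f (x, a, y)) : Measurable f :=
  measurable_from_prod_countable_left fun p => h p.1 p.2

theorem measurable_prod_bool_of_slices {β : Type*} [MeasurableSpace β] {f : Cov d × Bool → β}
    (h : ∀ a, Measurable fun x => f (x, a)) : Measurable f :=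
  measurable_from_prod_countable_left fun p => h p

theorem measurable_slice {β : Type*} [MeasurableSpace β] {f : Obs d → β} (hf : Measurable f)
    (a y : Bool) : Measurable fun x => f (x, a, y) :=
  hf.comp (measurable_id.prodMk measurable_const)

theorem integrable_of_bounded {α : Type*} [MeasurableSpace α] {P : Measure α} [IsFiniteMeasure P]
    {f : α → ℝ} (hf : Measurable f) {B : ℝ} (h : ∀ o, |f o| ≤ B) : Integrable f P :=
  Integrable.of_bound hf.aestronglyMeasurable B (Eventually.of_forall h)

theorem measurable_pv {U : Nuis d} (h1 : Measurable U.q1) (h0 : Measurable U.q0)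
    (he : Measurable U.e) (a y : Bool) : Measurable fun x => pv (nv U x) a y := by
  cases a <;> cases y <;> simp only [pv, nv, if_true, Bool.false_eq_true, if_false] <;> fun_prop

theorem measurable_sum4 {f : Cov d → Bool → Bool → ℝ} (h : ∀ a y, Measurable fun x => f x a y) :
    Measurable fun x => sum4 (f x) := by
  unfold sum4
  exact ((h _ _).add (h _ _)).add ((h _ _).add (h _ _))

theorem abs_sum4_pv_mul_le {u : ℝ × ℝ × ℝ} (hu : u ∈ Bx 0) {f : Bool → Bool → ℝ} {B : ℝ}
    (hB : ∀ a y, |f a y| ≤ B) : |sum4 fun a y => pv u a y * f a y| ≤ B := by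
  have h : ∀ a y, |pv u a y * f a y| ≤ pv u a y * B := fun a y => by
    rw [abs_mul, abs_of_nonneg (pv_mem hu a y).1]
    exact mul_le_mul_of_nonneg_left (hB a y) (pv_mem hu a y).1
  calc |sum4 fun a y => pv u a y * f a y|
      ≤ sum4 fun a y => |pv u a y * f a y| :=
        (abs_add_le _ _).trans (add_le_add (abs_add_le _ _) (abs_add_le _ _))
    _ ≤ sum4 fun a y => pv u a y * B :=
        add_le_add (add_le_add (h _ _) (h _ _)) (add_le_add (h _ _) (h _ _))
    _ = sum4 (pv u) * B := by simp only [sum4]; ring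
    _ = B := by rw [sum4_pv, one_mul]

theorem abs_nv_le {d : ℕ} {U : Nuis d} {x : Cov d} (h : nv U x ∈ Bx 0) :
    |U.q1 x| ≤ 1 ∧ |U.q0 x| ≤ 1 ∧ |U.e x| ≤ 1 := by
  have key : ∀ r : ℝ, r ∈ Icc (0 : ℝ) (1 - 0) → |r| ≤ 1 := fun r hr =>
    abs_le.2 ⟨by linarith [hr.1], by linarith [hr.2]⟩
  exact ⟨key _ h.1, key _ h.2.1, key _ h.2.2⟩

/-- Disintegration of a law along its nuisance functions. -/
theorem IsNuisanceOf.integral_eq (hU : IsNuisanceOf P U) (hb : ∀ x, nv U x ∈ Bx 0)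
    {f : Obs d → ℝ} (hf : Measurable f) {B : ℝ} (hB : ∀ o, |f o| ≤ B) :
    ∫ o, f o ∂P = ∫ o, sum4 (fun a y => pv (nv U o.1) a y * f (o.1, a, y)) ∂P := by
  have hq1 := hU.measurable_q1
  have hq0 := hU.measurable_q0
  have he := hU.measurable_e
  have hfs := measurable_slice hf
  have q1b : ∀ x, |U.q1 x| ≤ 1 := fun x => (abs_nv_le (hb x)).1
  have q0b : ∀ x, |U.q0 x| ≤ 1 := fun x => (abs_nv_le (hb x)).2.1
  have eb : ∀ x, |U.e x| ≤ 1 := fun x => (abs_nv_le (hb x)).2.2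
  have qb : ∀ a x, |U.q a x| ≤ 1 := fun a x => by cases a; exacts [q0b x, q1b x]
  have qm : ∀ a, Measurable (U.q a) := fun a => by cases a; exacts [hq0, hq1]
  -- integrate out `Y`
  let g : Cov d × Bool → ℝ := fun p => f (p.1, p.2, true) - f (p.1, p.2, false)
  have hg : Measurable g := measurable_prod_bool_of_slices fun a => (hfs a true).sub (hfs a false)
  have hgB : ∀ p, |g p| ≤ B + B := fun p => (abs_sub _ _).trans (add_le_add (hB _) (hB _))
  let G : Cov d × Bool → ℝ := fun p => f (p.1, p.2, false) + U.q p.2 p.1 * g p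
  have hG : Measurable G := measurable_prod_bool_of_slices fun a =>
    (hfs a false).add ((qm a).mul (hg.comp (measurable_id.prodMk measurable_const)))
  have hGB : ∀ p, |G p| ≤ B + 1 * (B + B) := fun p => by
    refine (abs_add_le _ _).trans (add_le_add (hB _) ?_)
    rw [abs_mul]
    exact mul_le_mul (qb _ _) (hgB _) (abs_nonneg _) zero_le_one
  have hB0 : 0 ≤ B := (abs_nonneg _).trans (hB ((fun _ => 0), false, false))
  have hpair : Measurable fun o : Obs d => (o.1, o.2.1) :=
    measurable_fst.prodMk (measurable_fst.comp measurable_snd)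
  have i1 : Integrable (fun o : Obs d => f (o.1, o.2.1, false)) P :=
    integrable_of_bounded (measurable_obs_of_slices fun a _ => hfs a false) fun _ => hB _
  have i2 : Integrable (fun o : Obs d => val o.2.2 * g (o.1, o.2.1)) P :=
    integrable_of_bounded (B := 1 * (B + B))
      ((measurable_val.comp (measurable_snd.comp measurable_snd)).mul (hg.comp hpair)) fun o => by
        rw [abs_mul]
        exact mul_le_mul (abs_val_le _) (hgB _) (abs_nonneg _) zero_le_one
  have i3 : Integrable (fun o : Obs d => U.q o.2.1 o.1 * g (o.1, o.2.1)) P :=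
    integrable_of_bounded (B := 1 * (B + B))
      ((measurable_obs_of_slices fun a _ => qm a).mul (hg.comp hpair)) fun o => by
        rw [abs_mul]
        exact mul_le_mul (qb _ _) (hgB _) (abs_nonneg _) zero_le_one
  have s1 : ∫ o, f o ∂P = ∫ o, G (o.1, o.2.1) ∂P := by
    calc ∫ o, f o ∂P = ∫ o, (f (o.1, o.2.1, false) + val o.2.2 * g (o.1, o.2.1)) ∂P := by
          congr 1; funext ⟨x, a, y⟩
          cases y <;> simp [val, g]
      _ = ∫ o, (f (o.1, o.2.1, false) + U.q o.2.1 o.1 * g (o.1, o.2.1)) ∂P := by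
          rw [integral_add i1 i2, hU.integral_val_snd hg hgB, ← integral_add i1 i3]
      _ = _ := rfl
  -- integrate out `A`
  let g' : Cov d → ℝ := fun x => G (x, true) - G (x, false)
  have hGs : ∀ a, Measurable fun x => G (x, a) := fun a =>
    hG.comp (measurable_id.prodMk measurable_const)
  have hg' : Measurable g' := (hGs true).sub (hGs false)
  have hg'B : ∀ x, |g' x| ≤ (B + 1 * (B + B)) + (B + 1 * (B + B)) := fun p =>
    (abs_sub _ _).trans (add_le_add (hGB _) (hGB _))
  have j1 : Integrable (fun o : Obs d => G (o.1, false)) P :=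
    integrable_of_bounded ((hGs false).comp measurable_fst) fun _ => hGB _
  have j2 : Integrable (fun o : Obs d => val o.2.1 * g' o.1) P :=
    integrable_of_bounded (B := 1 * ((B + 1 * (B + B)) + (B + 1 * (B + B))))
      ((measurable_val.comp (measurable_fst.comp measurable_snd)).mul
        (hg'.comp measurable_fst)) fun o => by
        rw [abs_mul]
        exact mul_le_mul (abs_val_le _) (hg'B _) (abs_nonneg _) zero_le_one
  have j3 : Integrable (fun o : Obs d => U.e o.1 * g' o.1) P :=
    integrable_of_bounded (B := 1 * ((B + 1 * (B + B)) + (B + 1 * (B + B))))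
      ((he.comp measurable_fst).mul (hg'.comp measurable_fst)) fun o => by
        rw [abs_mul]
        exact mul_le_mul (eb _) (hg'B _) (abs_nonneg _) zero_le_one
  rw [s1]
  calc ∫ o, G (o.1, o.2.1) ∂P = ∫ o, (G (o.1, false) + val o.2.1 * g' o.1) ∂P := by
        congr 1; funext ⟨x, a, y⟩
        cases a <;> simp [val, g']
    _ = ∫ o, (G (o.1, false) + U.e o.1 * g' o.1) ∂P := by
        rw [integral_add j1 j2, hU.integral_val_fst hg' hg'B, ← integral_add j1 j3]
    _ = _ := by
        congr 1; funext o
        simp only [sum4, pv, nv, G, g, g', Nuis.q, if_true, Bool.false_eq_true, if_false]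
        ring

theorem integral_margX {d : ℕ} {P : Measure (Obs d)} {f : Cov d → ℝ} (hf : Measurable f) :
    ∫ x, f x ∂(margX P) = ∫ o, f o.1 ∂P :=
  integral_map measurable_fst.aemeasurable hf.aestronglyMeasurable

instance {d : ℕ} {P : Measure (Obs d)} [IsProbabilityMeasure P] :
    IsProbabilityMeasure (margX P) :=
  Measure.isProbabilityMeasure_map measurable_fst.aemeasurable

/-- A triple along which the law disintegrates is a version of its nuisance functions. -/
theorem isNuisanceOf_of_integral_eq (h1 : Measurable U.q1) (h0 : Measurable U.q0)
    (he : Measurable U.e) (hb : ∀ x, nv U x ∈ Bx 0)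
    (H : ∀ f : Obs d → ℝ, Measurable f → (∀ o, |f o| ≤ 1) →
      ∫ o, f o ∂P = ∫ o, sum4 (fun a y => pv (nv U o.1) a y * f (o.1, a, y)) ∂P) :
    IsNuisanceOf P U := by
  have q1b : ∀ x, |U.q1 x| ≤ 1 := fun x => (abs_nv_le (hb x)).1
  have q0b : ∀ x, |U.q0 x| ≤ 1 := fun x => (abs_nv_le (hb x)).2.1
  have eb : ∀ x, |U.e x| ≤ 1 := fun x => (abs_nv_le (hb x)).2.2
  have qb : ∀ a x, |U.q a x| ≤ 1 := fun a x => by cases a; exacts [q0b x, q1b x]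
  have qm : ∀ a, Measurable (U.q a) := fun a => by cases a; exacts [h0, h1]
  have hpair : Measurable fun o : Obs d => (o.1, o.2.1) :=
    measurable_fst.prodMk (measurable_fst.comp measurable_snd)
  have mA : Measurable fun o : Obs d => val o.2.1 :=
    measurable_val.comp (measurable_fst.comp measurable_snd)
  have mY : Measurable fun o : Obs d => val o.2.2 :=
    measurable_val.comp (measurable_snd.comp measurable_snd)
  have mE : Measurable fun o : Obs d => U.e o.1 := he.comp measurable_fst
  have mq : Measurable fun o : Obs d => U.q o.2.1 o.1 := measurable_obs_of_slices fun a _ => qm a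
  have ind : ∀ (s : Set (Obs d)) (f : Obs d → ℝ), (∀ o, |f o| ≤ 1) → ∀ o, |s.indicator f o| ≤ 1 :=
    fun s f hf o => by
      by_cases ho : o ∈ s
      · rw [indicator_of_mem ho]; exact hf o
      · rw [indicator_of_notMem ho]; simp
  refine ⟨h1, h0, he, ?_, ?_⟩
  · refine ae_eq_condExp_of_forall_setIntegral_eq measurable_fst.comap_le
      (integrable_of_bounded mA fun _ => abs_val_le _)
      (fun s _ _ => (integrable_of_bounded (he.comp measurable_fst) fun _ => eb _).integrableOn)
      ?_ ((he.comp (comap_measurable _)).stronglyMeasurable.aestronglyMeasurable)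
    rintro s ⟨t, ht, rfl⟩ -
    have hs : MeasurableSet ((fun o : Obs d => o.1) ⁻¹' t) := measurable_fst ht
    rw [← integral_indicator hs, ← integral_indicator hs,
      H _ (mE.indicator hs) (ind _ _ fun _ => eb _),
      H _ (mA.indicator hs) (ind _ _ fun _ => abs_val_le _)]
    congr 1; funext o
    by_cases ho : o.1 ∈ t
    · simp [sum4, pv, nv, indicator, ho, val]; ring
    · simp [sum4, pv, nv, indicator, ho]
  · refine ae_eq_condExp_of_forall_setIntegral_eq hpair.comap_le
      (integrable_of_bounded mY fun _ => abs_val_le _)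
      (fun s _ _ => (integrable_of_bounded mq fun _ => qb _ _).integrableOn)
      ?_ ?_
    · rintro s ⟨t, ht, rfl⟩ -
      have hs : MeasurableSet ((fun o : Obs d => (o.1, o.2.1)) ⁻¹' t) := hpair ht
      rw [← integral_indicator hs, ← integral_indicator hs, H _ (mq.indicator hs)
        (ind _ _ fun _ => qb _ _), H _ (mY.indicator hs) (ind _ _ fun _ => abs_val_le _)]
      congr 1; funext o
      by_cases h1 : (o.1, true) ∈ t <;> by_cases h0 : (o.1, false) ∈ t <;>
        simp [sum4, pv, nv, indicator, h1, h0, val, Nuis.q] <;> ring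
    · have : Measurable fun p : Cov d × Bool => U.q p.2 p.1 :=
        measurable_prod_bool_of_slices fun a => qm a
      exact (this.comp (comap_measurable _)).stronglyMeasurable.aestronglyMeasurable

/-- Nuisance functions with propensity scores in `[η, 1-η]` have versions with values in `[0,1]`
everywhere. -/
theorem IsNuisanceOf.exists_version (hU : IsNuisanceOf P U) {η : ℝ} (hη : 0 < η)
    (hη' : η < 1 / 2) (he : ∀ᵐ x ∂(margX P), U.e x ∈ Icc η (1 - η)) :
    ∃ V : Nuis d, IsNuisanceOf P V ∧ (∀ x, nv V x ∈ Bx 0) ∧ (∀ x, V.e x ∈ Icc η (1 - η)) ∧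
      ∀ᵐ x ∂(margX P), nv V x = nv U x := by
  let cl : ℝ → ℝ := fun r => max 0 (min 1 r)
  have clm : Measurable cl := measurable_const.max (measurable_const.min measurable_id)
  have clmem : ∀ r, cl r ∈ Icc (0 : ℝ) (1 - 0) := fun r => by
    rw [sub_zero]
    exact ⟨le_max_left _ _, max_le zero_le_one (min_le_left _ _)⟩
  have cleq : ∀ r ∈ Icc (0 : ℝ) 1, cl r = r := fun r hr => by
    simp only [cl]
    rw [min_eq_right hr.2, max_eq_right hr.1]
  have cliff : ∀ r, cl r = r → r ∈ Icc (0 : ℝ) 1 := fun r hr => by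
    have := clmem r
    rw [hr, sub_zero] at this
    exact this
  let ce : ℝ → ℝ := fun r => max η (min (1 - η) r)
  have cem : Measurable ce := measurable_const.max (measurable_const.min measurable_id)
  have cemem : ∀ r, ce r ∈ Icc η (1 - η) := fun r =>
    ⟨le_max_left _ _, max_le (by linarith) (min_le_left _ _)⟩
  have ceeq : ∀ r ∈ Icc η (1 - η), ce r = r := fun r hr => by
    simp only [ce]
    rw [min_eq_right hr.2, max_eq_right hr.1]
  let V : Nuis d := ⟨fun x => cl (U.q1 x), fun x => cl (U.q0 x), fun x => ce (U.e x)⟩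
  have heo : ∀ᵐ o ∂P, U.e o.1 ∈ Icc η (1 - η) :=
    ae_of_ae_map measurable_fst.aemeasurable he
  -- The conditional mean determines q_a only at the observed arm; it lies in [0,1] there because
  -- the outcome does.
  have hqo : ∀ᵐ o ∂P, U.q o.2.1 o.1 ∈ Icc (0 : ℝ) 1 := by
    have mY : Measurable fun o : Obs d => val o.2.2 :=
      measurable_val.comp (measurable_snd.comp measurable_snd)
    have iY : Integrable (fun o : Obs d => val o.2.2) P :=
      integrable_of_bounded mY fun _ => abs_val_le _
    have hpair : Measurable fun o : Obs d => (o.1, o.2.1) :=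
      measurable_fst.prodMk (measurable_fst.comp measurable_snd)
    have lo := condExp_nonneg (m := MeasurableSpace.comap (fun o : Obs d => (o.1, o.2.1))
      inferInstance) (μ := P) (f := fun o : Obs d => val o.2.2)
      (Eventually.of_forall fun _ => val_nonneg _)
    have hi := condExp_mono (m := MeasurableSpace.comap (fun o : Obs d => (o.1, o.2.1))
      inferInstance) (μ := P) iY (integrable_const (1 : ℝ))
      (Eventually.of_forall fun _ => val_le_one _)
    rw [condExp_const hpair.comap_le] at hi
    filter_upwards [hU.outcome, lo, hi] with o h1 h2 h3
    rw [h1]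
    exact ⟨h2, h3⟩
  have hVq : ∀ᵐ o ∂P, V.q o.2.1 o.1 = U.q o.2.1 o.1 := by
    filter_upwards [hqo] with o ho
    rcases o with ⟨x, a, y⟩
    cases a
    · exact cleq _ ho
    · exact cleq _ ho
  have hVe : ∀ᵐ o ∂P, V.e o.1 = U.e o.1 := by
    filter_upwards [heo] with o ho
    exact ceeq _ ho
  have hV : IsNuisanceOf P V := by
    refine ⟨clm.comp hU.measurable_q1, clm.comp hU.measurable_q0, cem.comp hU.measurable_e, ?_, ?_⟩
    · filter_upwards [hVe, hU.propensity] with o h1 h2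
      rw [h1]; exact h2
    · filter_upwards [hVq, hU.outcome] with o h1 h2
      rw [h1]; exact h2
  refine ⟨V, hV, fun x => ⟨clmem _, clmem _, Icc_subset_Icc hη.le (by linarith) (cemem _)⟩,
    fun x => cemem _, ?_⟩
  -- the arms are both charged
  have key : ∀ B : Set (Cov d), MeasurableSet B → ∀ a0 : Bool,
      (∀ᵐ o ∂P, ¬ (o.1 ∈ B ∧ o.2.1 = a0)) → P ((fun o : Obs d => o.1) ⁻¹' B) = 0 := by
    intro B hB a0 hB0
    have hg : Measurable (B.indicator fun _ => (1 : ℝ)) := measurable_const.indicator hB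
    have hgb : ∀ x, |B.indicator (fun _ => (1 : ℝ)) x| ≤ 1 := fun x => by
      by_cases h : x ∈ B <;> simp [h]
    have h1 := hU.integral_val_fst hg hgb
    have iE : Integrable (fun o : Obs d => U.e o.1 * B.indicator (fun _ => (1 : ℝ)) o.1) P := by
      refine Integrable.of_bound ((hU.measurable_e.comp measurable_fst).mul
        (hg.comp measurable_fst)).aestronglyMeasurable (1 * 1) ?_
      filter_upwards [heo] with o ho
      rw [norm_mul]
      refine mul_le_mul ?_ (hgb _) (norm_nonneg _) zero_le_one
      rw [Real.norm_eq_abs, abs_le]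
      constructor <;> linarith [ho.1, ho.2]
    have iB : Integrable (fun o : Obs d => B.indicator (fun _ => (1 : ℝ)) o.1) P :=
      integrable_of_bounded (hg.comp measurable_fst) fun _ => hgb _
    have hBr : ∫ o, B.indicator (fun _ => (1 : ℝ)) o.1 ∂P = P.real ((fun o : Obs d => o.1) ⁻¹' B) := by
      rw [← integral_indicator_one (measurable_fst hB)]
      rfl
    -- If arm a0 is never observed over B, then the propensity bound makes at least the fraction η
    -- of the mass of B equal to zero. This transfers statements about the observed arm to both
    -- arms.
    have hle : η * P.real ((fun o : Obs d => o.1) ⁻¹' B) ≤ 0 := by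
      cases a0
      · have e1 : ∫ o, val o.2.1 * B.indicator (fun _ => (1 : ℝ)) o.1 ∂P
            = ∫ o, B.indicator (fun _ => (1 : ℝ)) o.1 ∂P := by
          refine integral_congr_ae ?_
          filter_upwards [hB0] with o ho
          by_cases hx : o.1 ∈ B
          · have : o.2.1 = true := by
              rcases h : o.2.1 with _ | _
              · exact absurd ⟨hx, h⟩ ho
              · rfl
            simp [this, val]
          · simp [hx]
        have e2 : ∫ o, U.e o.1 * B.indicator (fun _ => (1 : ℝ)) o.1 ∂P
            ≤ ∫ o, (1 - η) * B.indicator (fun _ => (1 : ℝ)) o.1 ∂P := by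
          refine integral_mono_ae iE (iB.const_mul _) ?_
          filter_upwards [heo] with o ho
          exact mul_le_mul_of_nonneg_right ho.2 (indicator_nonneg (fun _ _ => zero_le_one) _)
        rw [integral_const_mul, ← h1, e1, hBr] at e2
        linarith
      · have e1 : ∫ o, val o.2.1 * B.indicator (fun _ => (1 : ℝ)) o.1 ∂P = 0 := by
          refine integral_eq_zero_of_ae ?_
          filter_upwards [hB0] with o ho
          by_cases hx : o.1 ∈ B
          · have : o.2.1 = false := by
              rcases h : o.2.1 with _ | _
              · rfl
              · exact absurd ⟨hx, h⟩ ho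
            simp [this, val]
          · simp [hx]
        have e2 : ∫ o, η * B.indicator (fun _ => (1 : ℝ)) o.1 ∂P
            ≤ ∫ o, U.e o.1 * B.indicator (fun _ => (1 : ℝ)) o.1 ∂P := by
          refine integral_mono_ae (iB.const_mul _) iE ?_
          filter_upwards [heo] with o ho
          exact mul_le_mul_of_nonneg_right ho.1 (indicator_nonneg (fun _ _ => zero_le_one) _)
        rw [integral_const_mul, ← h1, e1, hBr] at e2
        exact e2
    have h0 : P.real ((fun o : Obs d => o.1) ⁻¹' B) = 0 := by
      have := measureReal_nonneg (μ := P) (s := (fun o : Obs d => o.1) ⁻¹' B)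
      nlinarith
    exact (measureReal_eq_zero_iff).1 h0
  have b1 : P ((fun o : Obs d => o.1) ⁻¹' {x | V.q1 x = U.q1 x}ᶜ) = 0 := by
    refine key _ (measurableSet_eq_fun (clm.comp hU.measurable_q1) hU.measurable_q1).compl true ?_
    filter_upwards [hVq] with o ho h
    rw [h.2] at ho
    exact h.1 ho
  have b0 : P ((fun o : Obs d => o.1) ⁻¹' {x | V.q0 x = U.q0 x}ᶜ) = 0 := by
    refine key _ (measurableSet_eq_fun (clm.comp hU.measurable_q0) hU.measurable_q0).compl false ?_
    filter_upwards [hVq] with o ho h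
    rw [h.2] at ho
    exact h.1 ho
  have c1 : ∀ᵐ x ∂(margX P), V.q1 x = U.q1 x := by
    rw [ae_iff, margX, Measure.map_apply measurable_fst]
    · exact b1
    · exact (measurableSet_eq_fun (clm.comp hU.measurable_q1) hU.measurable_q1).compl
  have c0 : ∀ᵐ x ∂(margX P), V.q0 x = U.q0 x := by
    rw [ae_iff, margX, Measure.map_apply measurable_fst]
    · exact b0
    · exact (measurableSet_eq_fun (clm.comp hU.measurable_q0) hU.measurable_q0).compl
  filter_upwards [c1, c0, he] with x h1 h0 h
  have : V.e x = U.e x := ceeq _ h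
  simp only [nv, h1, h0, this]

end Nuisance

end WATE

namespace WATE

/-! ### Hellinger distance -/

theorem abs_integral_mul_le {α : Type*} [MeasurableSpace α] {μ : Measure α} {f g : α → ℝ}
    (hf : MemLp f 2 μ) (hg : MemLp g 2 μ) :
    |∫ x, f x * g x ∂μ| ≤ √(∫ x, f x ^ 2 ∂μ) * √(∫ x, g x ^ 2 ∂μ) := by
  have h2 : ENNReal.ofReal 2 = 2 := by norm_num
  have h := integral_mul_norm_le_Lp_mul_Lq (μ := μ) Real.HolderConjugate.two_two (f := f) (g := g)
    (by rwa [h2]) (by rwa [h2])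
  simp only [Real.rpow_two, Real.norm_eq_abs, sq_abs, ← Real.sqrt_eq_rpow] at h
  refine (abs_integral_le_integral_abs).trans ?_
  simpa only [abs_mul] using h

section Hellinger

variable {d : ℕ} {P P0 P1 : Measure (Obs d)} [IsProbabilityMeasure P] [IsProbabilityMeasure P0]
  [IsProbabilityMeasure P1]

instance sigmaFinite_domMeasure (d : ℕ) : SigmaFinite (domMeasure d) := by
  unfold domMeasure; infer_instance

/-- The root density. -/
noncomputable def sd (P : Measure (Obs d)) (o : Obs d) : ℝ := √(dens P o)

theorem dens_nonneg (P : Measure (Obs d)) (o : Obs d) : 0 ≤ dens P o := ENNReal.toReal_nonneg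

theorem sd_sq (P : Measure (Obs d)) (o : Obs d) : sd P o ^ 2 = dens P o :=
  Real.sq_sqrt (dens_nonneg P o)

theorem measurable_dens (P : Measure (Obs d)) : Measurable (dens P) :=
  (Measure.measurable_rnDeriv _ _).ennreal_toReal

theorem measurable_sd (P : Measure (Obs d)) : Measurable (sd P) := (measurable_dens P).sqrt

theorem memLp_sd : MemLp (sd P) 2 (domMeasure d) := by
  rw [memLp_two_iff_integrable_sq (measurable_sd P).aestronglyMeasurable]
  simp only [sd_sq]
  exact Measure.integrable_toReal_rnDeriv

theorem integral_mul_sd_sq (hP : P ≪ domMeasure d) (g : Obs d → ℝ) :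
    ∫ o, g o * sd P o ^ 2 ∂(domMeasure d) = ∫ o, g o ∂P := by
  rw [← integral_rnDeriv_smul hP (f := g)]
  simp only [sd_sq, smul_eq_mul, dens, mul_comm]

theorem MemLp.bounded_mul {μ : Measure (Obs d)} {g f : Obs d → ℝ} (hg : Measurable g) {B : ℝ}
    (hB : ∀ o, |g o| ≤ B) (hf : MemLp f 2 μ) : MemLp (fun o => g o * f o) 2 μ :=
  hf.of_le_mul (c := B) (hg.aestronglyMeasurable.mul hf.1) (Eventually.of_forall fun o => by
    rw [norm_mul]
    exact mul_le_mul_of_nonneg_right (hB o) (norm_nonneg _))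

/-- The squared Hellinger distance. -/
noncomputable def hell (P0 P1 : Measure (Obs d)) : ℝ :=
  ∫ o, (sd P1 o - sd P0 o) ^ 2 ∂(domMeasure d)

theorem hell_nonneg (P0 P1 : Measure (Obs d)) : 0 ≤ hell P0 P1 :=
  integral_nonneg fun _ => sq_nonneg _

theorem integral_sub_integral_eq (h0 : P0 ≪ domMeasure d) (h1 : P1 ≪ domMeasure d)
    {g : Obs d → ℝ} (hg : Measurable g) {B : ℝ} (hB : ∀ o, |g o| ≤ B) :
    ∫ o, g o ∂P1 - ∫ o, g o ∂P0 =
      ∫ o, g o * (sd P1 o ^ 2 - sd P0 o ^ 2) ∂(domMeasure d) := by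
  have i : ∀ (P : Measure (Obs d)) [IsProbabilityMeasure P],
      Integrable (fun o => g o * sd P o ^ 2) (domMeasure d) := fun P _ => by
    have := (MemLp.bounded_mul hg hB (memLp_sd (P := P))).integrable_mul (memLp_sd (P := P))
    refine this.congr (Eventually.of_forall fun o => ?_)
    simp only [Pi.mul_apply]
    ring
  rw [← integral_mul_sd_sq h0, ← integral_mul_sd_sq h1, ← integral_sub (i P1) (i P0)]
  congr 1; funext o
  ring

theorem abs_integral_mul_sq_le {g f : Obs d → ℝ} {B : ℝ}
    (hB : ∀ o, |g o| ≤ B) {μ : Measure (Obs d)} (hf : MemLp f 2 μ) :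
    |∫ o, g o * f o ^ 2 ∂μ| ≤ B * ∫ o, f o ^ 2 ∂μ := by
  rw [← integral_const_mul]
  refine (abs_integral_le_integral_abs).trans (integral_mono_of_nonneg
    (Eventually.of_forall fun _ => abs_nonneg _) (hf.integrable_sq.const_mul B)
    (Eventually.of_forall fun o => ?_))
  simp only [abs_mul, abs_sq]
  exact mul_le_mul_of_nonneg_right (hB o) (sq_nonneg _)

/-- With root densities s₀ and s₁, s₁² - s₀² = 2s₁(s₁ - s₀) - (s₁ - s₀)², followed by
Cauchy–Schwarz. The second moment of `g` under P₁ is kept, rather than bounded by `B`, so that the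
estimate can be fed back into itself. -/
theorem abs_integral_sub_le (h0 : P0 ≪ domMeasure d) (h1 : P1 ≪ domMeasure d)
    {g : Obs d → ℝ} (hg : Measurable g) {B : ℝ} (hB : ∀ o, |g o| ≤ B) :
    |∫ o, g o ∂P1 - ∫ o, g o ∂P0| ≤
      2 * (√(∫ o, g o ^ 2 ∂P1) * √(hell P0 P1)) + B * hell P0 P1 := by
  have hΔ : MemLp (fun o => sd P1 o - sd P0 o) 2 (domMeasure d) :=
    (memLp_sd (P := P1)).sub (memLp_sd (P := P0))
  have hgs := MemLp.bounded_mul hg hB (memLp_sd (P := P1))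
  have hgΔ := MemLp.bounded_mul hg hB hΔ
  have i1 : Integrable (fun o => g o * sd P1 o * (sd P1 o - sd P0 o)) (domMeasure d) :=
    hgs.integrable_mul hΔ
  have i2 : Integrable (fun o => g o * (sd P1 o - sd P0 o) ^ 2) (domMeasure d) :=
    (hgΔ.integrable_mul hΔ).congr (Eventually.of_forall fun o => by
      simp only [Pi.mul_apply]; ring)
  rw [integral_sub_integral_eq h0 h1 hg hB]
  have e : ∫ o, g o * (sd P1 o ^ 2 - sd P0 o ^ 2) ∂(domMeasure d) =
      2 * ∫ o, g o * sd P1 o * (sd P1 o - sd P0 o) ∂(domMeasure d)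
        - ∫ o, g o * (sd P1 o - sd P0 o) ^ 2 ∂(domMeasure d) := by
    rw [← integral_const_mul, ← integral_sub (i1.const_mul 2) i2]
    congr 1; funext o
    ring
  rw [e]
  refine (abs_sub _ _).trans (add_le_add ?_ (abs_integral_mul_sq_le hB hΔ))
  rw [abs_mul, abs_two]
  refine mul_le_mul_of_nonneg_left ((abs_integral_mul_le hgs hΔ).trans_eq ?_) two_pos.le
  have e2 : ∫ o, (g o * sd P1 o) ^ 2 ∂(domMeasure d) = ∫ o, g o ^ 2 ∂P1 := by
    rw [← integral_mul_sd_sq h1]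
    congr 1; funext o
    ring
  rw [e2]
  rfl

theorem le_of_self_bound {x H : ℝ} (hx : 0 ≤ x) (hH : 0 ≤ H) (h : x ≤ 2 * (√x * √H) + H) :
    x ≤ 9 * H := by
  have a := Real.sq_sqrt hx
  have b := Real.sq_sqrt hH
  have pa := Real.sqrt_nonneg x
  have pb := Real.sqrt_nonneg H
  have : √x ≤ 3 * √H := by
    by_contra hlt
    push Not at hlt
    nlinarith
  nlinarith

/-- If `w` is the difference of two conditional means of a binary variable, then its second moment
is bounded by the Hellinger distance. -/
theorem integral_sq_le_hell (h0 : P0 ≪ domMeasure d) (h1 : P1 ≪ domMeasure d)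
    {w z : Obs d → ℝ} (hw : Measurable w) (hz : Measurable z) (hwB : ∀ o, |w o| ≤ 1)
    (hzB : ∀ o, |z o| ≤ 1) (e1 : ∫ o, w o * z o ∂P1 = ∫ o, w o ^ 2 ∂P1)
    (e0 : ∫ o, w o * z o ∂P0 = 0) : ∫ o, w o ^ 2 ∂P1 ≤ 9 * hell P0 P1 := by
  have hB : ∀ o, |w o * z o| ≤ 1 := fun o => by
    rw [abs_mul]; exact mul_le_one₀ (hwB o) (abs_nonneg _) (hzB o)
  have h := abs_integral_sub_le h0 h1 (hw.mul hz) hB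
  -- Since |z| ≤ 1, the unknown ∫w² appears on both sides of the estimate; with H the squared
  -- Hellinger distance, `le_of_self_bound` solves x ≤ 2√x√H + H.
  have hsq : ∫ o, (w o * z o) ^ 2 ∂P1 ≤ ∫ o, w o ^ 2 ∂P1 := by
    refine integral_mono (integrable_of_bounded ((hw.mul hz).pow_const 2) (B := 1) fun o => ?_)
      (integrable_of_bounded (hw.pow_const 2) (B := 1) fun o => ?_) fun o => ?_
    · rw [abs_pow]; exact pow_le_one₀ (abs_nonneg _) (hB o)
    · rw [abs_pow]; exact pow_le_one₀ (abs_nonneg _) (hwB o)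
    · simp only [mul_pow]
      have : z o ^ 2 ≤ 1 := by rw [← sq_abs]; exact pow_le_one₀ (abs_nonneg _) (hzB o)
      nlinarith [sq_nonneg (w o)]
  simp only [Pi.mul_apply] at h
  rw [e1, e0, sub_zero] at h
  have hn : 0 ≤ ∫ o, w o ^ 2 ∂P1 := integral_nonneg fun _ => sq_nonneg _
  refine le_of_self_bound hn (hell_nonneg _ _) ?_
  rw [abs_of_nonneg hn, one_mul] at h
  refine h.trans ?_
  gcongr

theorem dl_sq_le (u v : ℝ × ℝ × ℝ) :
    dl u v ^ 2 ≤ 3 * ((v.1 - u.1) ^ 2 + (v.2.1 - u.2.1) ^ 2 + (v.2.2 - u.2.2) ^ 2) := by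
  unfold dl
  have a := sq_abs (u.1 - v.1)
  have b := sq_abs (u.2.1 - v.2.1)
  have c := sq_abs (u.2.2 - v.2.2)
  nlinarith [sq_nonneg (|u.1 - v.1| - |u.2.1 - v.2.1|), sq_nonneg (|u.1 - v.1| - |u.2.2 - v.2.2|),
    sq_nonneg (|u.2.1 - v.2.1| - |u.2.2 - v.2.2|)]

theorem measurable_nv {U : Nuis d} (h1 : Measurable U.q1) (h0 : Measurable U.q0)
    (he : Measurable U.e) : Measurable (nv U) := h1.prodMk (h0.prodMk he)

theorem measurable_dl : Measurable fun p : (ℝ × ℝ × ℝ) × (ℝ × ℝ × ℝ) => dl p.1 p.2 := by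
  have : Continuous fun p : (ℝ × ℝ × ℝ) × (ℝ × ℝ × ℝ) => dl p.1 p.2 := by
    unfold dl; fun_prop
  exact this.measurable

theorem dl_le_three {u v : ℝ × ℝ × ℝ} (hu : u ∈ Bx 0) (hv : v ∈ Bx 0) : dl u v ≤ 3 := by
  obtain ⟨⟨h1, h1'⟩, ⟨h2, h2'⟩, ⟨h3, h3'⟩⟩ := hu
  obtain ⟨⟨g1, g1'⟩, ⟨g2, g2'⟩, ⟨g3, g3'⟩⟩ := hv
  have key : ∀ x y : ℝ, 0 ≤ x → x ≤ 1 - 0 → 0 ≤ y → y ≤ 1 - 0 → |x - y| ≤ 1 :=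
    fun x y a b c e => abs_le.2 ⟨by linarith, by linarith⟩
  unfold dl
  linarith [key _ _ h1 h1' g1 g1', key _ _ h2 h2' g2 g2', key _ _ h3 h3' g3 g3']

/-- The nuisance functions of a law are Lipschitz in Hellinger distance. -/
theorem integral_dl_sq_le_hell (h0 : P0 ≪ domMeasure d) (h1 : P1 ≪ domMeasure d) {U V : Nuis d}
    (hU : IsNuisanceOf P0 U) (hV : IsNuisanceOf P1 V) (hUb : ∀ x, nv U x ∈ Bx 0)
    (hVb : ∀ x, nv V x ∈ Bx 0) {η : ℝ} (hη : 0 < η) (hη' : η < 1 / 2)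
    (he : ∀ x, V.e x ∈ Icc η (1 - η)) :
    ∫ o, dl (nv U o.1) (nv V o.1) ^ 2 ∂P1 ≤ 54 / η * hell P0 P1 := by
  have sub1 : ∀ p q : ℝ, p ∈ Icc (0 : ℝ) (1 - 0) → q ∈ Icc (0 : ℝ) (1 - 0) → |p - q| ≤ 1 :=
    fun p q hp hq => abs_le.2 ⟨by linarith [hp.1, hp.2, hq.1, hq.2],
      by linarith [hp.1, hp.2, hq.1, hq.2]⟩
  have vmem : ∀ a, val a ∈ Icc (0 : ℝ) (1 - 0) := fun a => ⟨val_nonneg a, by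
    rw [sub_zero]; exact val_le_one a⟩
  have Uq : ∀ a x, U.q a x ∈ Icc (0 : ℝ) (1 - 0) := fun a x => by
    cases a; exacts [(hUb x).2.1, (hUb x).1]
  have Vq : ∀ a x, V.q a x ∈ Icc (0 : ℝ) (1 - 0) := fun a x => by
    cases a; exacts [(hVb x).2.1, (hVb x).1]
  have Uqm : ∀ a, Measurable (U.q a) := fun a => by
    cases a; exacts [hU.measurable_q0, hU.measurable_q1]
  have Vqm : ∀ a, Measurable (V.q a) := fun a => by
    cases a; exacts [hV.measurable_q0, hV.measurable_q1]
  have mA : Measurable fun o : Obs d => val o.2.1 :=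
    measurable_val.comp (measurable_fst.comp measurable_snd)
  have mY : Measurable fun o : Obs d => val o.2.2 :=
    measurable_val.comp (measurable_snd.comp measurable_snd)
  have int1 : ∀ (P : Measure (Obs d)) [IsProbabilityMeasure P] (f : Obs d → ℝ), Measurable f →
    (∀ o, |f o| ≤ 1) → Integrable f P := fun P _ f hf h => integrable_of_bounded hf h
  have mul1 : ∀ p q : ℝ, |p| ≤ 1 → |q| ≤ 1 → |p * q| ≤ 1 := fun p q hp hq => by
    rw [abs_mul]; exact mul_le_one₀ hp (abs_nonneg _) hq
  have mem1 : ∀ p : ℝ, p ∈ Icc (0 : ℝ) (1 - 0) → |p| ≤ 1 := fun p hp =>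
    abs_le.2 ⟨by linarith [hp.1], by linarith [hp.2]⟩
  -- propensity
  let we : Cov d → ℝ := fun x => V.e x - U.e x
  have wem : Measurable we := hV.measurable_e.sub hU.measurable_e
  have web : ∀ x, |we x| ≤ 1 := fun x => sub1 _ _ (hVb x).2.2 (hUb x).2.2
  have Ue1 : Measurable fun o : Obs d => U.e o.1 := hU.measurable_e.comp measurable_fst
  have Ve1 : Measurable fun o : Obs d => V.e o.1 := hV.measurable_e.comp measurable_fst
  have we1 : Measurable fun o : Obs d => we o.1 := wem.comp measurable_fst
  have prod_sub : ∀ (P : Measure (Obs d)) [IsProbabilityMeasure P] (W A B : Obs d → ℝ),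
      Measurable W → Measurable A → Measurable B → (∀ o, |W o| ≤ 1) → (∀ o, |A o| ≤ 1) →
      (∀ o, |B o| ≤ 1) →
      ∫ o, W o * (A o - B o) ∂P = ∫ o, A o * W o ∂P - ∫ o, B o * W o ∂P := by
    intro P _ W A B hW hA hB bW bA bB
    have iA : Integrable (fun o => A o * W o) P :=
      int1 P _ (hA.mul hW) fun o => mul1 _ _ (bA o) (bW o)
    have iB : Integrable (fun o => B o * W o) P :=
      int1 P _ (hB.mul hW) fun o => mul1 _ _ (bB o) (bW o)
    rw [← integral_sub iA iB]
    congr 1; funext o; ring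
  have Ie : ∫ o, we o.1 ^ 2 ∂P1 ≤ 9 * hell P0 P1 := by
    refine integral_sq_le_hell h0 h1 (w := fun o => we o.1) (z := fun o => val o.2.1 - U.e o.1)
      we1 (mA.sub Ue1) (fun _ => web _) (fun o => sub1 _ _ (vmem _) (hUb _).2.2) ?_ ?_
    · rw [prod_sub P1 (fun o => we o.1) (fun o => val o.2.1) (fun o => U.e o.1) we1 mA Ue1
        (fun _ => web _) (fun _ => abs_val_le _) (fun o => mem1 _ (hUb _).2.2),
        hV.integral_val_fst wem web,
        ← prod_sub P1 (fun o => we o.1) (fun o => V.e o.1) (fun o => U.e o.1) we1 Ve1 Ue1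
        (fun _ => web _) (fun o => mem1 _ (hVb _).2.2) (fun o => mem1 _ (hUb _).2.2)]
      congr 1; funext o
      simp only [we]; ring
    · rw [prod_sub P0 (fun o => we o.1) (fun o => val o.2.1) (fun o => U.e o.1) we1 mA Ue1
        (fun _ => web _) (fun _ => abs_val_le _) (fun o => mem1 _ (hUb _).2.2),
        hU.integral_val_fst wem web, sub_self]
  -- outcome
  let wq : Cov d × Bool → ℝ := fun p => V.q p.2 p.1 - U.q p.2 p.1
  have wqm : Measurable wq := measurable_prod_bool_of_slices fun a => (Vqm a).sub (Uqm a)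
  have wqb : ∀ p, |wq p| ≤ 1 := fun p => sub1 _ _ (Vq _ _) (Uq _ _)
  have hpair : Measurable fun o : Obs d => (o.1, o.2.1) :=
    measurable_fst.prodMk (measurable_fst.comp measurable_snd)
  have wq1 : Measurable fun o : Obs d => wq (o.1, o.2.1) := wqm.comp hpair
  have Uq1 : Measurable fun o : Obs d => U.q o.2.1 o.1 := measurable_obs_of_slices fun a _ => Uqm a
  have Vq1 : Measurable fun o : Obs d => V.q o.2.1 o.1 := measurable_obs_of_slices fun a _ => Vqm a
  have Iq : ∫ o, wq (o.1, o.2.1) ^ 2 ∂P1 ≤ 9 * hell P0 P1 := by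
    refine integral_sq_le_hell h0 h1 (w := fun o => wq (o.1, o.2.1))
      (z := fun o => val o.2.2 - U.q o.2.1 o.1)
      wq1 (mY.sub Uq1) (fun _ => wqb _) (fun o => sub1 _ _ (vmem _) (Uq _ _)) ?_ ?_
    · rw [prod_sub P1 (fun o => wq (o.1, o.2.1)) (fun o => val o.2.2) (fun o => U.q o.2.1 o.1)
        wq1 mY Uq1 (fun _ => wqb _) (fun _ => abs_val_le _) (fun o => mem1 _ (Uq _ _)),
        hV.integral_val_snd wqm wqb,
        ← prod_sub P1 (fun o => wq (o.1, o.2.1)) (fun o => V.q o.2.1 o.1)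
        (fun o => U.q o.2.1 o.1) wq1 Vq1 Uq1
        (fun _ => wqb _) (fun o => mem1 _ (Vq _ _)) (fun o => mem1 _ (Uq _ _))]
      congr 1; funext o
      simp only [wq]; ring
    · rw [prod_sub P0 (fun o => wq (o.1, o.2.1)) (fun o => val o.2.2) (fun o => U.q o.2.1 o.1)
        wq1 mY Uq1 (fun _ => wqb _) (fun _ => abs_val_le _) (fun o => mem1 _ (Uq _ _)),
        hU.integral_val_snd wqm wqb, sub_self]
  -- from the observed arm to both arms
  let r : Cov d → ℝ := fun x => wq (x, true) ^ 2 - wq (x, false) ^ 2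
  have sqb : ∀ p, wq p ^ 2 ∈ Icc (0 : ℝ) 1 := fun p => ⟨sq_nonneg _, by
    rw [← sq_abs]; exact pow_le_one₀ (abs_nonneg _) (wqb p)⟩
  have sqm : ∀ a, Measurable fun x => wq (x, a) ^ 2 := fun a =>
    (wqm.comp (measurable_id.prodMk measurable_const)).pow_const 2
  have rm : Measurable r := (sqm true).sub (sqm false)
  have rb : ∀ x, |r x| ≤ 1 := fun x => abs_le.2
    ⟨by linarith [(sqb (x, true)).1, (sqb (x, false)).2],
      by linarith [(sqb (x, false)).1, (sqb (x, true)).2]⟩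
  have i0 : Integrable (fun o : Obs d => wq (o.1, false) ^ 2) P1 :=
    int1 P1 _ ((sqm false).comp measurable_fst) fun o => abs_le.2
      ⟨by linarith [(sqb (o.1, false)).1], (sqb (o.1, false)).2⟩
  have i1 : Integrable (fun o : Obs d => wq (o.1, true) ^ 2) P1 :=
    int1 P1 _ ((sqm true).comp measurable_fst) fun o => abs_le.2
      ⟨by linarith [(sqb (o.1, true)).1], (sqb (o.1, true)).2⟩
  have i10 : Integrable (fun o : Obs d => wq (o.1, true) ^ 2 + wq (o.1, false) ^ 2) P1 := i1.add i0
  have iA : Integrable (fun o : Obs d => val o.2.1 * r o.1) P1 :=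
    int1 P1 _ (mA.mul (rm.comp measurable_fst)) fun o => mul1 _ _ (abs_val_le _) (rb _)
  have iE : Integrable (fun o : Obs d => V.e o.1 * r o.1) P1 :=
    int1 P1 _ (Ve1.mul (rm.comp measurable_fst)) fun o => mul1 _ _ (mem1 _ (hVb _).2.2) (rb _)
  have e2 : ∫ o, wq (o.1, o.2.1) ^ 2 ∂P1 =
      ∫ o, (wq (o.1, false) ^ 2 + V.e o.1 * r o.1) ∂P1 := by
    rw [integral_add i0 iE, ← hV.integral_val_fst rm rb, ← integral_add i0 iA]
    congr 1; funext ⟨x, a, y⟩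
    cases a <;> simp [val, r]
  have low : ∫ o, η * (wq (o.1, true) ^ 2 + wq (o.1, false) ^ 2) ∂P1 ≤ 9 * hell P0 P1 := by
    refine le_trans ?_ (e2 ▸ Iq)
    refine integral_mono (i10.const_mul η) (i0.add iE) fun o => ?_
    have a1 := (sqb (o.1, true)).1
    have a0 := (sqb (o.1, false)).1
    have := he o.1
    simp only [r]
    nlinarith [mul_nonneg a1 (sub_nonneg.2 this.1), mul_nonneg a0 (sub_nonneg.2 this.2)]
  rw [integral_const_mul] at low
  have ie : Integrable (fun o : Obs d => we o.1 ^ 2) P1 :=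
    int1 P1 _ (we1.pow_const 2) fun o => by
      rw [abs_pow]; exact pow_le_one₀ (abs_nonneg _) (web _)
  have fin : ∫ o, dl (nv U o.1) (nv V o.1) ^ 2 ∂P1 ≤
      ∫ o, 3 * ((wq (o.1, true) ^ 2 + wq (o.1, false) ^ 2) + we o.1 ^ 2) ∂P1 := by
    refine integral_mono_of_nonneg (Eventually.of_forall fun _ => sq_nonneg _)
      ((i10.add ie).const_mul 3) (Eventually.of_forall fun o => ?_)
    exact dl_sq_le (nv U o.1) (nv V o.1)
  rw [integral_const_mul, integral_add i10 ie] at fin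
  have hH := hell_nonneg P0 P1
  have q : ∫ o, (wq (o.1, true) ^ 2 + wq (o.1, false) ^ 2) ∂P1 ≤ 9 / η * hell P0 P1 := by
    rw [div_mul_eq_mul_div, le_div_iff₀ hη]
    linarith
  have q' : 9 * hell P0 P1 ≤ 9 / η * hell P0 P1 := by
    refine mul_le_mul_of_nonneg_right ?_ hH
    rw [le_div_iff₀ hη]; linarith
  calc _ ≤ _ := fin
    _ ≤ 3 * (9 / η * hell P0 P1 + 9 / η * hell P0 P1) := by gcongr; exact Ie.trans q'
    _ = _ := by ring

end Hellinger

end WATE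

namespace WATE

/-! ### The influence function at the true law -/

theorem InBox.nv_mem {d : ℕ} {k : ℝ} {U : CNuis d} (h : InBox k U) (x : Cov d) :
    nv U.fn x ∈ Bx k := h.cv_mem x

theorem continuous_nv {d : ℕ} (U : CNuis d) : Continuous fun x => nv U.fn x :=
  U.1.continuous.prodMk (U.2.1.continuous.prodMk U.2.2.continuous)

theorem abs_blip_le {u : ℝ × ℝ × ℝ} (hu : u ∈ Bx 0) : |u.1 - u.2.1| ≤ 1 := abs_le.2
  ⟨by linarith [hu.1.1, hu.2.1.2], by linarith [hu.1.2, hu.2.1.1]⟩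

theorem abs_blip_sub_le {u : ℝ × ℝ × ℝ} (hu : u ∈ Bx 0) {p : ℝ} (hp : |p| ≤ 1) :
    |u.1 - u.2.1 - p| ≤ 2 :=
  (abs_sub _ _).trans (by linarith [abs_blip_le hu])

section Weighted

variable {d : ℕ} {P : Measure (Obs d)} [IsProbabilityMeasure P] {lam : ℝ → ℝ} {η : ℝ} {V : Nuis d}

/-- λ is an arbitrary function off the interval, so it is replaced there by its constant continuous
extension. -/
theorem measurable_comp_of_continuousOn_Icc {α : Type*} [MeasurableSpace α] {f : ℝ → ℝ} {p q : ℝ}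
    (hpq : p ≤ q) (hf : ContinuousOn f (Icc p q)) {g : α → ℝ} (hg : Measurable g)
    (hm : ∀ x, g x ∈ Icc p q) : Measurable fun x => f (g x) := by
  have h : Continuous fun t : ℝ => IccExtend hpq (Set.domRestrict (Icc p q) f) t :=
    (continuousOn_iff_continuous_domRestrict.1 hf).Icc_extend'
  have e : (fun x => f (g x)) = fun x => IccExtend hpq (Set.domRestrict (Icc p q) f) (g x) := by
    funext x
    rw [IccExtend_of_mem hpq _ (hm x)]
    rfl
  rw [e]
  exact h.measurable.comp hg

/-- A weight function that is continuous and positive on `[η, 1-η]` is bounded there, above and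
away from zero. -/
theorem exists_weight_bounds (hη' : η < 1 / 2) (hf : ContinuousOn lam (Icc η (1 - η)))
    (hpos : ∀ u ∈ Icc η (1 - η), 0 < lam u) :
    ∃ l B, 0 < l ∧ ∀ u ∈ Icc η (1 - η), l ≤ lam u ∧ lam u ≤ B := by
  have ne : (Icc η (1 - η)).Nonempty := nonempty_Icc.2 (by linarith)
  obtain ⟨u0, hu0, h0⟩ := isCompact_Icc.exists_isMinOn ne hf
  obtain ⟨u1, hu1, h1⟩ := isCompact_Icc.exists_isMaxOn ne hf
  exact ⟨lam u0, lam u1, hpos u0 hu0, fun u hu => ⟨h0 hu, h1 hu⟩⟩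

/-- The last identity is what links the estimand to the right-hand side of the orthogonality bound:
the mean of λ(e)(τ - p) is Ω(ψ - p) for every candidate value p. -/
theorem weighted_facts (hη' : η < 1 / 2) (hf : ContinuousOn lam (Icc η (1 - η))) {l B : ℝ}
    (hl : 0 < l) (hlB : ∀ u ∈ Icc η (1 - η), l ≤ lam u ∧ lam u ≤ B)
    (m1 : Measurable V.q1) (m0 : Measurable V.q0) (me : Measurable V.e)
    (hVb : ∀ x, nv V x ∈ Bx 0) (he : ∀ x, V.e x ∈ Icc η (1 - η)) :
    (Measurable fun x => lam (V.e x)) ∧ l ≤ Omega lam (margX P) V ∧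
      |psi lam (margX P) V| ≤ 1 ∧ Omega lam (margX P) V = ∫ o, lam (V.e o.1) ∂P ∧
      ∀ p, ∫ o, lam (V.e o.1) * (V.q1 o.1 - V.q0 o.1 - p) ∂P =
        Omega lam (margX P) V * (psi lam (margX P) V - p) := by
  have hm : Measurable fun x => lam (V.e x) :=
    measurable_comp_of_continuousOn_Icc (by linarith) hf me he
  have hlam : ∀ x, |lam (V.e x)| ≤ B := fun x =>
    abs_le.2 ⟨by linarith [(hlB _ (he x)).1, (hlB _ (he x)).2], (hlB _ (he x)).2⟩
  have ht : ∀ x, |V.q1 x - V.q0 x| ≤ 1 := fun x => abs_blip_le (hVb x)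
  have hB0 : 0 ≤ B := by
    obtain ⟨x⟩ : Nonempty (Cov d) := ⟨fun _ => 0⟩
    exact (abs_nonneg _).trans (hlam x)
  have i1 : Integrable (fun x => lam (V.e x)) (margX P) := integrable_of_bounded hm hlam
  have i2 : Integrable (fun x => lam (V.e x) * V.tau x) (margX P) :=
    integrable_of_bounded (hm.mul (m1.sub m0)) (B := B * 1) fun x => by
      rw [abs_mul]
      exact mul_le_mul (hlam x) (ht x) (abs_nonneg _) hB0
  have hO : l ≤ Omega lam (margX P) V := by
    have := integral_mono (μ := margX P) (integrable_const l) i1 fun x => (hlB _ (he x)).1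
    rw [integral_const, probReal_univ, one_smul] at this
    exact this
  have hOp := hl.trans_le hO
  refine ⟨hm, hO, ?_, integral_margX hm, fun p => ?_⟩
  · rw [psi, abs_div, abs_of_pos hOp, div_le_one hOp]
    refine abs_integral_le_integral_abs.trans (integral_mono i2.abs i1 fun x => ?_)
    have := (hlB _ (he x)).1
    rw [abs_mul, abs_of_pos (by linarith)]
    exact mul_le_of_le_one_right (by linarith) (ht x)
  · have e : Omega lam (margX P) V * (psi lam (margX P) V - p) =
        ∫ x, lam (V.e x) * (V.q1 x - V.q0 x - p) ∂(margX P) := by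
      rw [mul_sub, psi, mul_div_cancel₀ _ hOp.ne', Omega, ← integral_mul_const,
        ← integral_sub i2 (i1.mul_const p)]
      congr 1; funext x
      simp only [Nuis.tau]; ring
    rw [e]
    exact (integral_margX (hm.mul ((m1.sub m0).sub_const p))).symm

end Weighted

section Truth

variable {d : ℕ} {P0 : Measure (Obs d)} [IsProbabilityMeasure P0] {lam : ℝ → ℝ} {b c k : ℝ}
  {Us : CNuis d}

theorem Weight.continuousOn (w : Weight lam b c) : ContinuousOn lam (Icc b (1 - b)) :=
  w.smooth.continuousOn

theorem Weight.pos (w : Weight lam b c) {u : ℝ} (hu : u ∈ Icc b (1 - b)) : 0 < lam u :=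
  w.c_pos.trans_le (w.lower u hu)

theorem Weight.b_pos (w : Weight lam b c) : 0 < b := w.c_pos.trans_le w.c_le

theorem continuous_gfun_nv (w : Weight lam b c) (hbk : b < k) (hbox : InBox k Us) (j : Fin 4)
    (a y : Bool) : Continuous fun x => gfun lam j a y (nv Us.fn x) :=
  (((contDiffOn_gfun w j a y).continuousOn.mono (Bx_subset_strip hbk)).comp_continuous
    (continuous_nv Us) fun x => hbox.nv_mem x)

theorem continuous_mfun_nv (w : Weight lam b c) (hbk : b < k) (hbox : InBox k Us) (ψ : ℝ)
    (a y : Bool) : Continuous fun x => mfun lam ψ a y (nv Us.fn x) := by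
  have h := continuous_gfun_nv w hbk hbox
  unfold mfun
  exact ((h 0 a y).add (h 2 a y)).sub (continuous_const.mul ((h 1 a y).add (h 3 a y)))

theorem measurable_mfun_nv (w : Weight lam b c) (hbk : b < k) (hbox : InBox k Us) (ψ : ℝ) :
    Measurable fun o : Obs d => mfun lam ψ o.2.1 o.2.2 (nv Us.fn o.1) :=
  measurable_obs_of_slices fun a y => (continuous_mfun_nv w hbk hbox ψ a y).measurable

theorem exists_bound_mfun (w : Weight lam b c) (hbk : b < k) :
    ∃ B, 1 ≤ B ∧ ∀ ψ, |ψ| ≤ 1 → ∀ a y, ∀ u ∈ Bx k, |mfun lam ψ a y u| ≤ B := by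
  obtain ⟨M, hM, h, -⟩ := exists_bound_gfun w hbk
  refine ⟨4 * M, by linarith, fun ψ hψ a y u hu => ?_⟩
  have h13 : |gfun lam 1 a y u + gfun lam 3 a y u| ≤ 2 * M :=
    (abs_add_le _ _).trans (by linarith [h 1 a y u hu, h 3 a y u hu])
  have : |ψ * (gfun lam 1 a y u + gfun lam 3 a y u)| ≤ 1 * (2 * M) := by
    rw [abs_mul]; exact mul_le_mul hψ h13 (abs_nonneg _) zero_le_one
  unfold mfun
  refine (abs_sub _ _).trans ?_
  linarith [abs_add_le (gfun lam 0 a y u) (gfun lam 2 a y u), h 0 a y u hu, h 2 a y u hu]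

theorem truth_facts (w : Weight lam b c) (hbk : b < k) (hbox : InBox k Us) (hk : k < 1 / 2) :
    c ≤ Omega lam (margX P0) Us.fn ∧ |psi lam (margX P0) Us.fn| ≤ 1 ∧
      Omega lam (margX P0) Us.fn = ∫ o, lam (Us.fn.e o.1) ∂P0 ∧
      ∀ p, ∫ o, lam (Us.fn.e o.1) * (Us.fn.q1 o.1 - Us.fn.q0 o.1 - p) ∂P0 =
        Omega lam (margX P0) Us.fn * (psi lam (margX P0) Us.fn - p) := by
  have hb := w.b_pos
  obtain ⟨B, hB⟩ := isCompact_Icc.exists_bound_of_continuousOn w.continuousOn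
  have h := weighted_facts (P := P0) (V := Us.fn) (l := c) (B := B) (by linarith) w.continuousOn
    w.c_pos (fun u hu => ⟨w.lower u hu, (le_abs_self _).trans (hB u hu)⟩)
    Us.1.continuous.measurable Us.2.1.continuous.measurable Us.2.2.continuous.measurable
    (fun x => Bx_mono (by linarith) (hbox.nv_mem x))
    (fun x => ⟨hbk.le.trans (hbox x).2.2.1, (hbox x).2.2.2.trans (by linarith)⟩)
  exact ⟨h.2.1, h.2.2.1, h.2.2.2⟩

theorem InBox.ne {U : CNuis d} (hk : 0 < k) (h : InBox k U) (x : Cov d) :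
    (nv U.fn x).2.2 ≠ 0 ∧ 1 - (nv U.fn x).2.2 ≠ 0 := by
  have := (h.nv_mem x).2.2
  exact ⟨by linarith [this.1], by linarith [this.2]⟩

/-- At u = v every error term of `sum4_pv_mfun` vanishes, and the mean of λ(e)(τ - ψ) is zero by the
definition of ψ. -/
theorem integral_mfun_true (w : Weight lam b c) (hbk : b < k) (hbox : InBox k Us) (hk : k < 1 / 2)
    (hU : IsNuisanceOf P0 Us.fn) :
    ∫ o, mfun lam (psi lam (margX P0) Us.fn) o.2.1 o.2.2 (nv Us.fn o.1) ∂P0 = 0 := by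
  have hb := w.b_pos
  obtain ⟨-, hψ, -, hI⟩ := truth_facts (P0 := P0) w hbk hbox hk
  obtain ⟨B, -, hB⟩ := exists_bound_mfun w hbk
  rw [hU.integral_eq (fun x => Bx_mono (by linarith) (hbox.nv_mem x))
    (measurable_mfun_nv w hbk hbox _) (fun o => hB _ hψ _ _ _ (hbox.nv_mem _))]
  have := hI (psi lam (margX P0) Us.fn)
  rw [sub_self, mul_zero] at this
  rw [← this]
  congr 1; funext o
  have e := sum4_pv_mfun lam (psi lam (margX P0) Us.fn) (v := nv Us.fn o.1)
    (hbox.ne (by linarith) o.1).1 (hbox.ne (by linarith) o.1).2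
  simp only [sub_self, zero_mul, mul_zero, add_zero] at e
  exact sub_eq_zero.1 e

theorem Dfull_true_facts (w : Weight lam b c) (hbk : b < k) (hbox : InBox k Us) (hk : k < 1 / 2)
    (hU : IsNuisanceOf P0 Us.fn) :
    (∀ a y, Continuous fun x => Dfull lam (margX P0) Us.fn (x, a, y)) ∧
      (∃ B, 1 ≤ B ∧ ∀ o, |Dfull lam (margX P0) Us.fn o| ≤ B) ∧
      ∫ o, Dfull lam (margX P0) Us.fn o ∂P0 = 0 := by
  obtain ⟨hO, hψ, -, -⟩ := truth_facts (P0 := P0) w hbk hbox hk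
  have hc := w.c_pos
  obtain ⟨B, hB1, hB⟩ := exists_bound_mfun w hbk
  refine ⟨fun a y => ?_, ⟨c⁻¹ * B, ?_, fun o => ?_⟩, ?_⟩
  · simp only [Dfull_eq]
    exact continuous_const.mul (continuous_mfun_nv w hbk hbox _ a y)
  · have := w.R_ge
    nlinarith
  · rw [Dfull_eq, abs_mul, abs_of_pos (inv_pos.2 (hc.trans_le hO))]
    exact mul_le_mul (inv_anti₀ hc hO) (hB _ hψ _ _ _ (hbox.nv_mem _)) (abs_nonneg _)
      (inv_pos.2 hc).le
  · simp only [Dfull_eq, integral_const_mul, integral_mfun_true w hbk hbox hk hU, mul_zero]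

/-- Second-order expansion of the estimand at another law. -/
theorem exists_expansion (w : Weight lam b c) (hbk : b < k) (hbox : InBox k Us) (hk : k < 1 / 2)
    (hU : IsNuisanceOf P0 Us.fn) (hac : P0 ≪ domMeasure d) {η : ℝ} (hη : η ∈ Ioo (0 : ℝ) (1 / 2))
    (hsm : ContDiffOn ℝ 3 lam (Icc η (1 - η))) (hpos : ∀ u ∈ Icc η (1 - η), 0 < lam u) :
    ∃ K, 0 ≤ K ∧ ∀ (P1 : Measure (Obs d)) (U1 : Nuis d), IsProbabilityMeasure P1 →
      P1 ≪ domMeasure d → IsNuisanceOf P1 U1 → (∀ᵐ x ∂(margX P1), U1.e x ∈ Icc η (1 - η)) →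
      0 < Omega lam (margX P1) U1 ∧
      |Omega lam (margX P1) U1 * (psi lam (margX P1) U1 - psi lam (margX P0) Us.fn) -
        ∫ o, mfun lam (psi lam (margX P0) Us.fn) o.2.1 o.2.2 (nv Us.fn o.1) ∂P1|
          ≤ K * hell P0 P1 ∧
      |Omega lam (margX P1) U1 - Omega lam (margX P0) Us.fn|
        ≤ K * (√(hell P0 P1) + hell P0 P1) := by
  have hb := w.b_pos
  set ψ := psi lam (margX P0) Us.fn with hψdef
  obtain ⟨hO, hψ, hOe, -⟩ := truth_facts (P0 := P0) w hbk hbox hk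
  obtain ⟨B, hB1, hB⟩ := exists_bound_mfun w hbk
  -- The intervals [η, 1-η] and [b, 1-b] are nested; the larger one contains the propensity scores
  -- of both laws and carries the smoothness and the positivity of λ.
  obtain ⟨η1, h1η, h1b, h1p, h1s, h1l⟩ : ∃ η1, η1 ≤ η ∧ η1 ≤ b ∧ 0 < η1 ∧
      ContDiffOn ℝ 3 lam (Icc η1 (1 - η1)) ∧ ∀ u ∈ Icc η1 (1 - η1), 0 < lam u := by
    rcases le_total η b with h | h
    · exact ⟨η, le_rfl, h, hη.1, hsm, hpos⟩
    · exact ⟨b, h, le_rfl, hb, w.smooth, fun u hu => w.pos hu⟩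
  have h1h : η1 < 1 / 2 := by linarith
  obtain ⟨l, Λ, hl, hlΛ⟩ := exists_weight_bounds h1h h1s.continuousOn h1l
  obtain ⟨K, hK, orth⟩ := exists_orthogonality h1p h1h h1s (h1b.trans_lt hbk)
  obtain ⟨L, hL⟩ := h1s.exists_lipschitzOnWith (by norm_num) (convex_Icc _ _) isCompact_Icc
  have hΛ : 0 ≤ Λ := by
    have := hlΛ η1 ⟨le_rfl, by linarith⟩
    linarith
  set G := √(54 / η1) with hG
  refine ⟨K * (54 / η1) + L * G + 2 * Λ, by positivity, fun P1 U1 hP1 hac1 hU1 he1 => ?_⟩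
  obtain ⟨V, hV, hVb, hVe, hVU⟩ := hU1.exists_version h1p h1h
    (he1.mono fun x hx => ⟨h1η.trans hx.1, hx.2.trans (by linarith)⟩)
  have eO : Omega lam (margX P1) U1 = Omega lam (margX P1) V :=
    integral_congr_ae (hVU.mono fun x hx => by
      have : V.e x = U1.e x := congrArg (fun p => p.2.2) hx
      simp only [this])
  have eψ : psi lam (margX P1) U1 = psi lam (margX P1) V := by
    rw [psi, psi, eO]
    congr 1
    refine integral_congr_ae (hVU.mono fun x hx => ?_)
    have e1 : V.e x = U1.e x := congrArg (fun p => p.2.2) hx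
    have e2 : V.q1 x = U1.q1 x := congrArg (fun p => p.1) hx
    have e3 : V.q0 x = U1.q0 x := congrArg (fun p => p.2.1) hx
    simp only [Nuis.tau, e1, e2, e3]
  obtain ⟨mV, hO1, -, hO1e, hI1⟩ := weighted_facts (P := P1) h1h h1s.continuousOn hl hlΛ
    hV.measurable_q1 hV.measurable_q0 hV.measurable_e hVb hVe
  have hUb : ∀ x, nv Us.fn x ∈ Bx 0 := fun x => Bx_mono (by linarith) (hbox.nv_mem x)
  have hH := hell_nonneg P0 P1
  have hdl := integral_dl_sq_le_hell hac hac1 hU hV hUb hVb h1p h1h hVe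
  have mdl : Measurable fun o : Obs d => dl (nv Us.fn o.1) (nv V o.1) :=
    measurable_dl.comp (((continuous_nv Us).measurable.comp measurable_fst).prodMk
      ((measurable_nv hV.measurable_q1 hV.measurable_q0 hV.measurable_e).comp measurable_fst))
  have bdl : ∀ o : Obs d, |dl (nv Us.fn o.1) (nv V o.1)| ≤ 3 := fun o => by
    rw [abs_of_nonneg (dl_nonneg _ _)]; exact dl_le_three (hUb _) (hVb _)
  have idl2 : Integrable (fun o : Obs d => dl (nv Us.fn o.1) (nv V o.1) ^ 2) P1 :=
    integrable_of_bounded (mdl.pow_const 2) (B := 3 ^ 2) fun o => by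
      rw [abs_pow]; exact pow_le_pow_left₀ (abs_nonneg _) (bdl o) 2
  have hUe : ∀ x, Us.fn.e x ∈ Icc η1 (1 - η1) := fun x =>
    ⟨(h1b.trans hbk.le).trans (hbox x).2.2.1, (hbox x).2.2.2.trans (by linarith)⟩
  have mU : Measurable fun x => lam (Us.fn.e x) :=
    measurable_comp_of_continuousOn_Icc (by linarith) h1s.continuousOn
      Us.2.2.continuous.measurable hUe
  have bl : ∀ u ∈ Icc η1 (1 - η1), |lam u| ≤ Λ := fun u hu =>
    abs_le.2 ⟨by linarith [(hlΛ u hu).1], (hlΛ u hu).2⟩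
  rw [eO, eψ]
  refine ⟨hl.trans_le hO1, ?_, ?_⟩
  · rw [← hI1 ψ, hV.integral_eq hVb (measurable_mfun_nv w hbk hbox ψ)
      (fun o => hB _ hψ _ _ _ (hbox.nv_mem _)), abs_sub_comm]
    have iM : Integrable (fun o : Obs d => sum4 fun a y =>
        pv (nv V o.1) a y * mfun lam ψ a y (nv Us.fn o.1)) P1 := by
      refine integrable_of_bounded (B := B) ?_ fun o =>
        abs_sum4_pv_mul_le (hVb _) fun a y => hB _ hψ _ _ _ (hbox.nv_mem _)
      exact (measurable_sum4 (f := fun x a y => pv (nv V x) a y * mfun lam ψ a y (nv Us.fn x))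
        fun a y => (measurable_pv hV.measurable_q1 hV.measurable_q0 hV.measurable_e a y).mul
          (continuous_mfun_nv w hbk hbox ψ a y).measurable).comp measurable_fst
    have iL : Integrable (fun o : Obs d => lam (V.e o.1) * (V.q1 o.1 - V.q0 o.1 - ψ)) P1 := by
      refine integrable_of_bounded (B := Λ * 2) ((mV.mul ((hV.measurable_q1.sub
        hV.measurable_q0).sub_const ψ)).comp measurable_fst) fun o => ?_
      rw [abs_mul]
      exact mul_le_mul (bl _ (hVe _)) (abs_blip_sub_le (hVb _) hψ) (abs_nonneg _) hΛ
    rw [← integral_sub iM iL]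
    calc _ ≤ ∫ o, |sum4 (fun a y => pv (nv V o.1) a y * mfun lam ψ a y (nv Us.fn o.1)) -
            lam (V.e o.1) * (V.q1 o.1 - V.q0 o.1 - ψ)| ∂P1 := abs_integral_le_integral_abs
      _ ≤ ∫ o, K * dl (nv Us.fn o.1) (nv V o.1) ^ 2 ∂P1 :=
          integral_mono (iM.sub iL).abs (idl2.const_mul K) fun o =>
            orth ψ hψ _ (hUb _) (hbox.nv_mem o.1).2.2 _ (hVb _) (hVe _)
      _ ≤ K * (54 / η1 * hell P0 P1) := by
          rw [integral_const_mul]; exact mul_le_mul_of_nonneg_left hdl hK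
      _ ≤ _ := by
          rw [← mul_assoc]
          refine mul_le_mul_of_nonneg_right ?_ hH
          have : 0 ≤ L * G + 2 * Λ := by positivity
          linarith
  -- The normalization changes in two ways: first the propensity score is exchanged under P₁, then
  -- the law is exchanged for the true propensity score.
  · have s1 : |∫ o, lam (V.e o.1) ∂P1 - ∫ o, lam (Us.fn.e o.1) ∂P1| ≤ L * G * √(hell P0 P1) := by
      have i1 : Integrable (fun o : Obs d => lam (V.e o.1)) P1 :=
        integrable_of_bounded (mV.comp measurable_fst) fun o => bl _ (hVe _)
      have i2 : Integrable (fun o : Obs d => lam (Us.fn.e o.1)) P1 :=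
        integrable_of_bounded (mU.comp measurable_fst) fun o => bl _ (hUe _)
      have cs := abs_integral_mul_le (μ := P1) (f := fun _ => (1 : ℝ))
        (g := fun o : Obs d => dl (nv Us.fn o.1) (nv V o.1)) (memLp_const 1)
        (MemLp.of_bound mdl.aestronglyMeasurable 3 (Eventually.of_forall bdl))
      simp only [one_mul, one_pow, integral_const, probReal_univ, smul_eq_mul, Real.sqrt_one,
        mul_one] at cs
      rw [← integral_sub i1 i2]
      calc _ ≤ ∫ o, |lam (V.e o.1) - lam (Us.fn.e o.1)| ∂P1 := abs_integral_le_integral_abs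
        _ ≤ ∫ o, L * dl (nv Us.fn o.1) (nv V o.1) ∂P1 := by
            refine integral_mono (i1.sub i2).abs
              ((integrable_of_bounded mdl bdl).const_mul (L : ℝ)) fun o => ?_
            have := hL.dist_le_mul _ (hVe o.1) _ (hUe o.1)
            rw [Real.dist_eq, Real.dist_eq] at this
            refine this.trans (mul_le_mul_of_nonneg_left ?_ L.2)
            rw [abs_sub_comm]
            simp only [dl, nv]
            linarith [abs_nonneg (Us.fn.q1 o.1 - V.q1 o.1), abs_nonneg (Us.fn.q0 o.1 - V.q0 o.1)]
        _ ≤ L * √(54 / η1 * hell P0 P1) := by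
            rw [integral_const_mul]
            refine mul_le_mul_of_nonneg_left ((le_abs_self _).trans (cs.trans ?_)) L.2
            exact Real.sqrt_le_sqrt hdl
        _ = _ := by rw [Real.sqrt_mul (by positivity), mul_assoc]
    have s2 := abs_integral_sub_le (P0 := P0) hac hac1 (g := fun o => lam (Us.fn.e o.1))
      (mU.comp measurable_fst) fun o => bl _ (hUe o.1)
    have s3 : √(∫ o, lam (Us.fn.e o.1) ^ 2 ∂P1) ≤ Λ := by
      rw [Real.sqrt_le_left hΛ]
      have := integral_mono (μ := P1) (f := fun o => lam (Us.fn.e o.1) ^ 2) (g := fun _ => Λ ^ 2)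
        (integrable_of_bounded ((mU.comp measurable_fst).pow_const 2) (B := Λ ^ 2) fun o => by
          simp only [abs_pow]
          exact pow_le_pow_left₀ (abs_nonneg _) (bl _ (hUe _)) 2)
        (integrable_const _) fun o => by
          simp only
          rw [← sq_abs]
          exact pow_le_pow_left₀ (abs_nonneg _) (bl _ (hUe _)) 2
      simpa using this
    rw [hO1e, hOe]
    have hs := Real.sqrt_nonneg (hell P0 P1)
    have t := abs_sub_le (∫ o, lam (V.e o.1) ∂P1) (∫ o, lam (Us.fn.e o.1) ∂P1)
      (∫ o, lam (Us.fn.e o.1) ∂P0)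
    have s4 := mul_le_mul_of_nonneg_right s3 hs
    have k1 : 0 ≤ K * (54 / η1) * √(hell P0 P1) := by positivity
    have k2 : 0 ≤ (K * (54 / η1) + L * G) * hell P0 P1 := by positivity
    have k3 : 0 ≤ Λ * hell P0 P1 := by positivity
    nlinarith

end Truth

end WATE

namespace WATE

/-! ### The efficient influence function -/

section Gradient

variable {d : ℕ} {P0 P1 : Measure (Obs d)} [IsProbabilityMeasure P0] [IsProbabilityMeasure P1]

/-- A P₀-null set need not be null for the dominating measure, but the root density vanishes on it
almost everywhere. Hence products with `sd P0` are insensitive to the choice of version. -/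
theorem ae_domMeasure_of_ae (hac : P0 ≪ domMeasure d) {p : Obs d → Prop} (h : ∀ᵐ o ∂P0, p o) :
    ∀ᵐ o ∂(domMeasure d), sd P0 o = 0 ∨ p o := by
  rw [← Measure.withDensity_rnDeriv_eq P0 (domMeasure d) hac,
    ae_withDensity_iff (Measure.measurable_rnDeriv _ _)] at h
  filter_upwards [h] with o ho
  by_cases h0 : P0.rnDeriv (domMeasure d) o = 0
  · left; simp [sd, dens, h0]
  · exact Or.inr (ho h0)

theorem memLp_mul_sd (hac : P0 ≪ domMeasure d) {h : Obs d → ℝ} (hh : MemLp h 2 P0) :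
    MemLp (fun o => h o * sd P0 o) 2 (domMeasure d) ∧
      ∫ o, (h o * sd P0 o) ^ 2 ∂(domMeasure d) = ∫ o, h o ^ 2 ∂P0 := by
  have hae : AEStronglyMeasurable (fun o => h o * sd P0 o) (domMeasure d) := by
    refine ⟨fun o => hh.1.mk h o * sd P0 o,
      hh.1.stronglyMeasurable_mk.mul (measurable_sd P0).stronglyMeasurable, ?_⟩
    filter_upwards [ae_domMeasure_of_ae hac hh.1.ae_eq_mk] with o ho
    rcases ho with ho | ho
    · rw [ho, mul_zero, mul_zero]
    · rw [ho]
  have e : ∀ o, (h o * sd P0 o) ^ 2 = (P0.rnDeriv (domMeasure d) o).toReal • h o ^ 2 := fun o => by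
    rw [mul_pow, sd_sq, smul_eq_mul, mul_comm]; rfl
  refine ⟨(memLp_two_iff_integrable_sq hae).2 ?_, ?_⟩
  · simp only [e]
    exact (integrable_rnDeriv_smul_iff hac).2 hh.integrable_sq
  · simp only [e]
    exact integral_rnDeriv_smul hac

/-- The remainder in the quadratic mean expansion of the root density. -/
noncomputable def qmd (P0 P1 : Measure (Obs d)) (h : Obs d → ℝ) (ε : ℝ) (o : Obs d) : ℝ :=
  sd P1 o - sd P0 o - ε / 2 * h o * sd P0 o

theorem memLp_qmd (hac : P0 ≪ domMeasure d) {h : Obs d → ℝ} (hh : MemLp h 2 P0) (ε : ℝ) :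
    MemLp (qmd P0 P1 h ε) 2 (domMeasure d) := by
  have := ((memLp_sd (P := P1)).sub (memLp_sd (P := P0))).sub
    ((memLp_mul_sd hac hh).1.const_mul (ε / 2))
  refine (memLp_congr_ae (Eventually.of_forall fun o => ?_)).1 this
  simp only [Pi.sub_apply, qmd]
  ring

/-- The increment of the root density is the remainder plus (ε/2)h times the root density; then
(x+y)² ≤ 2x² + 2y². -/
theorem hell_le_qmd (hac : P0 ≪ domMeasure d) {h : Obs d → ℝ} (hh : MemLp h 2 P0) (ε : ℝ) :
    hell P0 P1 ≤ 2 * ∫ o, qmd P0 P1 h ε o ^ 2 ∂(domMeasure d)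
      + ε ^ 2 / 2 * ∫ o, h o ^ 2 ∂P0 := by
  have i1 : Integrable (fun o => 2 * qmd P0 P1 h ε o ^ 2) (domMeasure d) :=
    (memLp_qmd hac hh ε).integrable_sq.const_mul 2
  have i2 : Integrable (fun o => ε ^ 2 / 2 * (h o * sd P0 o) ^ 2) (domMeasure d) :=
    (memLp_mul_sd hac hh).1.integrable_sq.const_mul _
  rw [← (memLp_mul_sd hac hh).2, ← integral_const_mul, ← integral_const_mul, ← integral_add i1 i2]
  refine integral_mono_of_nonneg (Eventually.of_forall fun _ => sq_nonneg _) (i1.add i2)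
    (Eventually.of_forall fun o => ?_)
  simp only [qmd]
  nlinarith [sq_nonneg (sd P1 o - sd P0 o - ε / 2 * h o * sd P0 o - ε / 2 * h o * sd P0 o)]

/-- With Δ = s₁ - s₀, s₁² - s₀² = Δ² + 2s₀Δ, and inserting the quadratic mean expansion of Δ in the
second term produces ε∫gh dP₀ exactly. What is left is a Hellinger term and the remainder of the
expansion. -/
theorem abs_integral_sub_sub_le (hac : P0 ≪ domMeasure d) (hac1 : P1 ≪ domMeasure d)
    {h g : Obs d → ℝ} (hh : MemLp h 2 P0) (hg : Measurable g) {B : ℝ} (hB : ∀ o, |g o| ≤ B)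
    (hB0 : 0 ≤ B) (ε : ℝ) :
    |∫ o, g o ∂P1 - ∫ o, g o ∂P0 - ε * ∫ o, g o * h o ∂P0| ≤
      B * hell P0 P1 + 2 * B * √(∫ o, qmd P0 P1 h ε o ^ 2 ∂(domMeasure d)) := by
  have hΔ : MemLp (fun o => sd P1 o - sd P0 o) 2 (domMeasure d) :=
    (memLp_sd (P := P1)).sub (memLp_sd (P := P0))
  have hgs := MemLp.bounded_mul hg hB (memLp_sd (P := P0))
  have hr := memLp_qmd (P1 := P1) hac hh ε
  have hhs := (memLp_mul_sd hac hh).1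
  have i1 : Integrable (fun o => g o * (sd P1 o - sd P0 o) ^ 2) (domMeasure d) :=
    ((MemLp.bounded_mul hg hB hΔ).integrable_mul hΔ).congr (Eventually.of_forall fun o => by
      simp only [Pi.mul_apply]; ring)
  have i2 : Integrable (fun o => 2 * (g o * sd P0 o * qmd P0 P1 h ε o)) (domMeasure d) :=
    (hgs.integrable_mul hr).const_mul 2
  have i3 : Integrable (fun o => ε * (g o * sd P0 o * (h o * sd P0 o))) (domMeasure d) :=
    (hgs.integrable_mul hhs).const_mul ε
  have e3 : ∫ o, ε * (g o * sd P0 o * (h o * sd P0 o)) ∂(domMeasure d) =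
      ε * ∫ o, g o * h o ∂P0 := by
    rw [integral_const_mul, ← integral_mul_sd_sq hac]
    congr 2; funext o; ring
  have i12 : Integrable (fun o => g o * (sd P1 o - sd P0 o) ^ 2
      + 2 * (g o * sd P0 o * qmd P0 P1 h ε o)) (domMeasure d) := i1.add i2
  have e : ∫ o, g o ∂P1 - ∫ o, g o ∂P0 =
      ∫ o, g o * (sd P1 o - sd P0 o) ^ 2 ∂(domMeasure d)
        + ∫ o, 2 * (g o * sd P0 o * qmd P0 P1 h ε o) ∂(domMeasure d)
        + ∫ o, ε * (g o * sd P0 o * (h o * sd P0 o)) ∂(domMeasure d) := by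
    rw [integral_sub_integral_eq hac hac1 hg hB, ← integral_add i1 i2, ← integral_add i12 i3]
    congr 1; funext o
    simp only [qmd]; ring
  rw [e, e3, add_sub_cancel_right, integral_const_mul]
  refine (abs_add_le _ _).trans (add_le_add (abs_integral_mul_sq_le hB hΔ) ?_)
  rw [abs_mul, abs_two, mul_assoc]
  refine mul_le_mul_of_nonneg_left ((abs_integral_mul_le hgs hr).trans ?_) two_pos.le
  refine mul_le_mul_of_nonneg_right ?_ (Real.sqrt_nonneg _)
  rw [Real.sqrt_le_left hB0]
  have e2 : ∫ o, (g o * sd P0 o) ^ 2 ∂(domMeasure d) = ∫ o, g o ^ 2 ∂P0 := by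
    rw [← integral_mul_sd_sq hac]
    congr 1; funext o; ring
  have hsq : ∀ o, g o ^ 2 ≤ B ^ 2 := fun o => by
    rw [← sq_abs]; exact pow_le_pow_left₀ (abs_nonneg _) (hB o) 2
  have := integral_mono (μ := P0) (f := fun o => g o ^ 2) (g := fun _ => B ^ 2)
    (integrable_of_bounded (hg.pow_const 2) (B := B ^ 2) fun o => by
      rw [abs_of_nonneg (sq_nonneg _)]; exact hsq o) (integrable_const _) hsq
  rw [e2]
  simpa using this

theorem tendsto_qmd (hac : P0 ≪ domMeasure d) {P : ℝ → Measure (Obs d)} {l : ℝ} (hl : 0 < l)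
    (hP : ∀ ε ∈ Ioo (-l) l, IsProbabilityMeasure (P ε)) {h : Obs d → ℝ} (hh : MemLp h 2 P0)
    (hq : Tendsto (fun ε : ℝ => (∫⁻ o, ENNReal.ofReal
      ((√(dens (P ε) o) - √(dens P0 o) - ε / 2 * h o * √(dens P0 o)) ^ 2) ∂(domMeasure d))
        / ENNReal.ofReal (ε ^ 2)) (𝓝[≠] 0) (𝓝 0)) :
    Tendsto (fun ε => (∫ o, qmd P0 (P ε) h ε o ^ 2 ∂(domMeasure d)) / ε ^ 2) (𝓝[≠] 0) (𝓝 0) := by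
  have := (ENNReal.tendsto_toReal ENNReal.zero_ne_top).comp hq
  refine Tendsto.congr' ?_ this
  filter_upwards [nhdsWithin_le_nhds (Ioo_mem_nhds (neg_lt_zero.2 hl) hl)] with ε hε
  have := hP ε hε
  simp only [Function.comp, ENNReal.toReal_div, ENNReal.toReal_ofReal (sq_nonneg ε)]
  congr 1
  rw [integral_eq_lintegral_of_nonneg_ae (Eventually.of_forall fun _ => sq_nonneg _)
    (memLp_qmd hac hh ε).integrable_sq.1]
  rfl

end Gradient

section EIF

variable {d : ℕ} {P0 : Measure (Obs d)} [IsProbabilityMeasure P0] {lam : ℝ → ℝ} {b c k : ℝ}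
  {Us : CNuis d}

/-- By `exists_expansion`, Ω_ε(ψ_ε - ψ) is the P_ε-mean of the estimating function up to the squared
Hellinger distance, which is o(|ε|). The mean itself is ε∫gh dP₀ + o(ε), and Ω_ε → Ω. At ε = 0 the
submodel may use another version of the nuisances; the same expansion, at distance zero, identifies
the value of the estimand. -/
theorem hasDerivAt_psi (w : Weight lam b c) (hbk : b < k) (hbox : InBox k Us) (hk : k < 1 / 2)
    (hU : IsNuisanceOf P0 Us.fn) (hac : P0 ≪ domMeasure d) {P : ℝ → Measure (Obs d)}
    {U : ℝ → Nuis d} {h : Obs d → ℝ} (hreg : IsRegularSubmodel lam P0 P U h) :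
    HasDerivAt (fun ε : ℝ => psi lam (margX (P ε)) (U ε))
      (∫ o, Dfull lam (margX P0) Us.fn o * h o ∂P0) 0 := by
  obtain ⟨hP0, hh, -, ⟨l, hl, η, hη, hsm, hpos, hmod⟩, hq⟩ := hreg
  obtain ⟨K, hK, hexp⟩ := exists_expansion w hbk hbox hk hU hac hη hsm hpos
  obtain ⟨hO, hψ, -, -⟩ := truth_facts (P0 := P0) w hbk hbox hk
  obtain ⟨B, hB1, hB⟩ := exists_bound_mfun w hbk
  have hO' := w.c_pos.trans_le hO
  set ψ := psi lam (margX P0) Us.fn with hψdef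
  set g : Obs d → ℝ := fun o => mfun lam ψ o.2.1 o.2.2 (nv Us.fn o.1) with hg
  have hgm : Measurable g := measurable_mfun_nv w hbk hbox ψ
  have hgB : ∀ o, |g o| ≤ B := fun o => hB _ hψ _ _ _ (hbox.nv_mem _)
  have hg0 : ∫ o, g o ∂P0 = 0 := integral_mfun_true w hbk hbox hk hU
  have hbq := tendsto_qmd hac hl (fun ε hε => (hmod ε hε).1) hh hq
  set β : ℝ → ℝ := fun ε => ∫ o, qmd P0 (P ε) h ε o ^ 2 ∂(domMeasure d) with hβ
  have hβ0 : ∀ ε, 0 ≤ β ε := fun ε => integral_nonneg fun _ => sq_nonneg _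
  set H := ∫ o, h o ^ 2 ∂P0 with hH
  have hH0 : 0 ≤ H := integral_nonneg fun _ => sq_nonneg _
  have hev : ∀ᶠ ε in 𝓝[≠] (0 : ℝ), ε ∈ Ioo (-l) l :=
    nhdsWithin_le_nhds (Ioo_mem_nhds (neg_lt_zero.2 hl) hl)
  have hne : ∀ᶠ ε in 𝓝[≠] (0 : ℝ), ε ≠ 0 := eventually_mem_nhdsWithin
  have hid : Tendsto (fun ε : ℝ => |ε|) (𝓝[≠] 0) (𝓝 0) := by
    have : Tendsto (fun ε : ℝ => |ε|) (𝓝 0) (𝓝 |(0 : ℝ)|) := continuous_abs.tendsto 0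
    rw [abs_zero] at this
    exact this.mono_left nhdsWithin_le_nhds
  -- Hellinger distance is `O(ε)`
  have hhell : Tendsto (fun ε => hell P0 (P ε) / |ε|) (𝓝[≠] 0) (𝓝 0) := by
    have up : Tendsto (fun ε => 2 * (|ε| * (β ε / ε ^ 2)) + |ε| * (H / 2)) (𝓝[≠] 0) (𝓝 0) := by
      have := ((hid.mul hbq).const_mul 2).add (hid.mul_const (H / 2))
      simpa using this
    refine squeeze_zero' (Eventually.of_forall fun ε =>
      div_nonneg (hell_nonneg _ _) (abs_nonneg _)) ?_ up
    filter_upwards [hev, hne] with ε hε hε0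
    have := (hmod ε hε).1
    have ha := abs_pos.2 hε0
    rw [div_le_iff₀ ha]
    refine (hell_le_qmd hac hh ε).trans_eq ?_
    rw [← sq_abs ε]
    field_simp
    rfl
  have hhell0 : Tendsto (fun ε => hell P0 (P ε)) (𝓝[≠] 0) (𝓝 0) := by
    have := hhell.mul hid
    rw [zero_mul] at this
    refine this.congr' ?_
    filter_upwards [hne] with ε hε
    exact div_mul_cancel₀ _ (abs_pos.2 hε).ne'
  -- the value at zero
  have hzero : psi lam (margX (P 0)) (U 0) = ψ := by
    obtain ⟨h1, h2, h3, h4⟩ := hmod 0 ⟨neg_lt_zero.2 hl, hl⟩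
    obtain ⟨e1, e2, -⟩ := hexp _ _ h1 h2 h3 h4
    have e3 : ∫ o, g o ∂(P 0) = 0 := by rw [hP0]; exact hg0
    have e4 : hell P0 (P 0) = 0 := by simp [hell, hP0]
    rw [e3, e4, mul_zero, sub_zero] at e2
    have := abs_nonpos_iff.1 e2
    rcases mul_eq_zero.1 this with h | h
    · exact absurd h e1.ne'
    · linarith
  -- the normalization is continuous
  have hΩ : Tendsto (fun ε => Omega lam (margX (P ε)) (U ε)) (𝓝[≠] 0)
      (𝓝 (Omega lam (margX P0) Us.fn)) := by
    rw [tendsto_iff_norm_sub_tendsto_zero]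
    have up : Tendsto (fun ε => K * (√(hell P0 (P ε)) + hell P0 (P ε))) (𝓝[≠] 0) (𝓝 0) := by
      have := ((hhell0.sqrt).add hhell0).const_mul K
      simpa using this
    refine squeeze_zero' (Eventually.of_forall fun _ => norm_nonneg _) ?_ up
    filter_upwards [hev] with ε hε
    obtain ⟨h1, h2, h3, h4⟩ := hmod ε hε
    exact (hexp _ _ h1 h2 h3 h4).2.2
  -- the numerator
  have hN : Tendsto (fun ε => Omega lam (margX (P ε)) (U ε) *
      (psi lam (margX (P ε)) (U ε) - ψ) / ε) (𝓝[≠] 0) (𝓝 (∫ o, g o * h o ∂P0)) := by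
    rw [tendsto_iff_norm_sub_tendsto_zero]
    have up : Tendsto (fun ε => (K + B) * (hell P0 (P ε) / |ε|) + 2 * B * √(β ε / ε ^ 2))
        (𝓝[≠] 0) (𝓝 0) := by
      have := (hhell.const_mul (K + B)).add (hbq.sqrt.const_mul (2 * B))
      simpa using this
    refine squeeze_zero' (Eventually.of_forall fun _ => norm_nonneg _) ?_ up
    filter_upwards [hev, hne] with ε hε hε0
    obtain ⟨h1, h2, h3, h4⟩ := hmod ε hε
    have x1 := (hexp _ _ h1 h2 h3 h4).2.1
    have x2 := abs_integral_sub_sub_le hac h2 hh hgm hgB (by linarith) ε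
    rw [hg0, sub_zero] at x2
    have ha := abs_pos.2 hε0
    have e : Omega lam (margX (P ε)) (U ε) * (psi lam (margX (P ε)) (U ε) - ψ) / ε
        - ∫ o, g o * h o ∂P0 = ((Omega lam (margX (P ε)) (U ε) *
          (psi lam (margX (P ε)) (U ε) - ψ) - ∫ o, g o ∂(P ε)) +
          (∫ o, g o ∂(P ε) - ε * ∫ o, g o * h o ∂P0)) / ε := by
      field_simp
      ring
    rw [e, Real.norm_eq_abs, abs_div, div_le_iff₀ ha]
    refine (abs_add_le _ _).trans ((add_le_add x1 x2).trans_eq ?_)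
    rw [Real.sqrt_div (hβ0 ε), Real.sqrt_sq_eq_abs]
    field_simp
    ring
  rw [hasDerivAt_iff_tendsto_slope]
  have hlim := (hΩ.inv₀ hO'.ne').mul hN
  have e : ∫ o, Dfull lam (margX P0) Us.fn o * h o ∂P0 =
      (Omega lam (margX P0) Us.fn)⁻¹ * ∫ o, g o * h o ∂P0 := by
    rw [← integral_const_mul]
    congr 1; funext o
    rw [Dfull_eq, mul_assoc]
  rw [e]
  refine hlim.congr' ?_
  filter_upwards [hev] with ε hε
  obtain ⟨h1, h2, h3, h4⟩ := hmod ε hε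
  have := (hexp _ _ h1 h2 h3 h4).1.ne'
  rw [slope_def_field, hzero, sub_zero]
  field_simp

end EIF

end WATE

namespace WATE

/-! ### A submodel with prescribed bounded score -/

/-- The tower property on four points: if `p` is the normalization of the masses `m`, replacing `f`
by its `p`-mean does not change its `m`-sum. -/
theorem sum4_mul_sum4 {p m f : Bool → Bool → ℝ} (h : ∀ a y, p a y * sum4 m = m a y) :
    sum4 (fun a y => m a y * f a y) = sum4 fun a y => m a y * sum4 fun a y => p a y * f a y := by
  have e : sum4 (fun a y => p a y * sum4 m * f a y) =
      sum4 fun a y => m a y * sum4 fun a y => p a y * f a y := by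
    simp only [sum4]
    ring
  rw [← e]
  simp only [h]

/-- The law with density `1 + εD`. -/
noncomputable def tilt {d : ℕ} (P0 : Measure (Obs d)) (D : Obs d → ℝ) (ε : ℝ) : Measure (Obs d) :=
  P0.withDensity fun o => ENNReal.ofReal (1 + ε * D o)

theorem integral_tilt {d : ℕ} {P0 : Measure (Obs d)} {D : Obs d → ℝ} (hD : Measurable D) {ε : ℝ} (h : ∀ o, 0 ≤ 1 + ε * D o) (f : Obs d → ℝ) :
    ∫ o, f o ∂(tilt P0 D ε) = ∫ o, (1 + ε * D o) * f o ∂P0 := by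
  have hm : Measurable fun o => ENNReal.ofReal (1 + ε * D o) :=
    ((hD.const_mul ε).const_add 1).ennreal_ofReal
  rw [tilt, integral_withDensity_eq_integral_toReal_smul hm (by simp)]
  simp only [ENNReal.toReal_ofReal (h _), smul_eq_mul]

section Tilt

variable {d : ℕ} {P0 : Measure (Obs d)} [IsProbabilityMeasure P0] {U : Nuis d}
  {D : Obs d → ℝ} {B k b : ℝ}

/-- The mass of the tilted law at `(a, y)` relative to the covariate law. -/
noncomputable def tiltMass (U : Nuis d) (D : Obs d → ℝ) (ε : ℝ) (x : Cov d) (a y : Bool) : ℝ :=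
  pv (nv U x) a y * (1 + ε * D (x, a, y))

/-- The nuisance functions of the tilted law. -/
noncomputable def tiltNuis (U : Nuis d) (D : Obs d → ℝ) (ε : ℝ) : Nuis d where
  q1 x := tiltMass U D ε x true true / (tiltMass U D ε x true true + tiltMass U D ε x true false)
  q0 x := tiltMass U D ε x false true /
    (tiltMass U D ε x false true + tiltMass U D ε x false false)
  e x := (tiltMass U D ε x true true + tiltMass U D ε x true false) / sum4 (tiltMass U D ε x)

theorem pv_tiltNuis {ε : ℝ} {x : Cov d} (hp : ∀ a y, 0 < tiltMass U D ε x a y) (a y : Bool) :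
    pv (nv (tiltNuis U D ε) x) a y * sum4 (tiltMass U D ε x) = tiltMass U D ε x a y := by
  have h11 := hp true true
  have h10 := hp true false
  have h01 := hp false true
  have h00 := hp false false
  cases a <;> cases y <;>
    simp only [pv, nv, tiltNuis, sum4, if_true, Bool.false_eq_true, if_false] <;>
    generalize tiltMass U D ε x true true = p at * <;>
    generalize tiltMass U D ε x true false = q at * <;>
    generalize tiltMass U D ε x false true = r at * <;>
    generalize tiltMass U D ε x false false = s at * <;>
    field_simp <;> ring

theorem tilt_factor_mem (hB : ∀ o, |D o| ≤ B) {ε s : ℝ} (hε : |ε| * B ≤ s) (o : Obs d) :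
    1 + ε * D o ∈ Icc (1 - s) (1 + s) := by
  have : |ε * D o| ≤ s := by
    rw [abs_mul]; exact (mul_le_mul_of_nonneg_left (hB o) (abs_nonneg _)).trans hε
  have := abs_le.1 this
  constructor <;> linarith

theorem tiltMass_bounds (hU : ∀ x, nv U x ∈ Bx k) (hk : 0 < k) (hB : ∀ o, |D o| ≤ B) {ε s : ℝ}
    (hs : s < 1) (hε : |ε| * B ≤ s) (x : Cov d) (a y : Bool) :
    0 < tiltMass U D ε x a y ∧ pv (nv U x) a y * (1 - s) ≤ tiltMass U D ε x a y ∧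
      tiltMass U D ε x a y ≤ pv (nv U x) a y * (1 + s) := by
  have hp := (pow_pos hk 2).trans_le (pv_pos hk (hU x) a y)
  have h := tilt_factor_mem hB hε (x, a, y)
  exact ⟨mul_pos hp (by linarith [h.1]), mul_le_mul_of_nonneg_left h.1 hp.le,
    mul_le_mul_of_nonneg_left h.2 hp.le⟩

theorem measurable_tiltMass (h1 : Measurable U.q1) (h0 : Measurable U.q0) (he : Measurable U.e)
    (hD : Measurable D) (ε : ℝ) (a y : Bool) : Measurable fun x => tiltMass U D ε x a y :=
  (measurable_pv h1 h0 he a y).mul (((measurable_slice hD a y).const_mul ε).const_add 1)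

theorem div_add_mem {p q : ℝ} (hp : 0 < p) (hq : 0 < q) : p / (p + q) ∈ Icc (0 : ℝ) (1 - 0) :=
  ⟨by positivity, by rw [sub_zero, div_le_one (by positivity)]; linarith⟩

theorem tiltNuis_mem {ε : ℝ} {x : Cov d} (hp : ∀ a y, 0 < tiltMass U D ε x a y) :
    nv (tiltNuis U D ε) x ∈ Bx 0 :=
  ⟨div_add_mem (hp _ _) (hp _ _), div_add_mem (hp _ _) (hp _ _),
    div_add_mem (add_pos (hp _ _) (hp _ _)) (add_pos (hp _ _) (hp _ _))⟩

/-- Tilting changes each mass by a factor between 1-s and 1+s, so a propensity score with margin k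
keeps the margin k(1-s)/(1+s), which is at least b. -/
theorem tiltNuis_e_mem (hU : ∀ x, nv U x ∈ Bx k) (hk : 0 < k) (hB : ∀ o, |D o| ≤ B) {ε s : ℝ}
    (hs : s < 1) (hε : |ε| * B ≤ s) (hb : b * (1 + s) ≤ k * (1 - s)) (x : Cov d) :
    (tiltNuis U D ε).e x ∈ Icc b (1 - b) := by
  have h := tiltMass_bounds hU hk hB hs hε x
  have hZ : sum4 (tiltMass U D ε x) ≤ 1 + s := by
    have e : sum4 (fun a y => pv (nv U x) a y * (1 + s)) = 1 + s := by
      have := sum4_pv (nv U x)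
      simp only [sum4] at this ⊢
      linear_combination (1 + s) * this
    rw [← e]
    simp only [sum4]
    linarith [(h true true).2.2, (h true false).2.2, (h false true).2.2, (h false false).2.2]
  have hp : 0 < sum4 (tiltMass U D ε x) := by
    simp only [sum4]
    linarith [(h true true).1, (h true false).1, (h false true).1, (h false false).1]
  have hs' : 0 < 1 - s := by linarith
  have hu := (hU x).2.2
  have pt : pv (nv U x) true true + pv (nv U x) true false = (nv U x).2.2 := by
    simp only [pv, if_true, Bool.false_eq_true, if_false]; ring
  have pf : pv (nv U x) false true + pv (nv U x) false false = 1 - (nv U x).2.2 := by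
    simp only [pv, if_true, Bool.false_eq_true, if_false]; ring
  have lt : k * (1 - s) ≤ tiltMass U D ε x true true + tiltMass U D ε x true false := by
    have : (nv U x).2.2 * (1 - s) ≤ tiltMass U D ε x true true + tiltMass U D ε x true false := by
      rw [← pt, add_mul]; exact add_le_add (h _ _).2.1 (h _ _).2.1
    exact (mul_le_mul_of_nonneg_right hu.1 hs'.le).trans this
  have lf : k * (1 - s) ≤ tiltMass U D ε x false true + tiltMass U D ε x false false := by
    have : (1 - (nv U x).2.2) * (1 - s) ≤
        tiltMass U D ε x false true + tiltMass U D ε x false false := by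
      rw [← pf, add_mul]; exact add_le_add (h _ _).2.1 (h _ _).2.1
    exact (mul_le_mul_of_nonneg_right (by linarith [hu.2]) hs'.le).trans this
  have hbZ : b * sum4 (tiltMass U D ε x) ≤ k * (1 - s) := by
    rcases le_total 0 b with h0 | h0
    · exact (mul_le_mul_of_nonneg_left hZ h0).trans hb
    · exact (mul_nonpos_of_nonpos_of_nonneg h0 hp.le).trans (by positivity)
  constructor
  · simp only [tiltNuis]
    rw [le_div_iff₀ hp]; linarith
  · simp only [tiltNuis]
    rw [div_le_iff₀ hp]
    simp only [sum4] at hbZ ⊢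
    linarith

theorem isProbabilityMeasure_tilt (hD : Measurable D) (hB : ∀ o, |D o| ≤ B)
    (h0 : ∫ o, D o ∂P0 = 0) {ε : ℝ} (h : ∀ o, 0 ≤ 1 + ε * D o) :
    IsProbabilityMeasure (tilt P0 D ε) := by
  have iD : Integrable D P0 := integrable_of_bounded hD hB
  refine ⟨?_⟩
  have i1 : Integrable (fun o => 1 + ε * D o) P0 := (integrable_const 1).add (iD.const_mul ε)
  rw [tilt, withDensity_apply _ MeasurableSet.univ, Measure.restrict_univ,
    ← ofReal_integral_eq_lintegral_ofReal i1 (Eventually.of_forall h), integral_add (integrable_const 1) (iD.const_mul ε),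
    integral_const_mul, h0]
  simp

/-- The candidates are checked through the disintegration formula rather than through conditional
expectations: under P₀ both sides reduce to sums weighted with the tilted masses, where
`sum4_mul_sum4` applies. -/
theorem isNuisanceOf_tilt (hN : IsNuisanceOf P0 U) (hU : ∀ x, nv U x ∈ Bx k) (hk : 0 < k)
    (hD : Measurable D) (hB : ∀ o, |D o| ≤ B) (h0 : ∫ o, D o ∂P0 = 0) {ε s : ℝ}
    (hs : s < 1) (hε : |ε| * B ≤ s) : IsNuisanceOf (tilt P0 D ε) (tiltNuis U D ε) := by
  have hm := measurable_tiltMass hN.measurable_q1 hN.measurable_q0 hN.measurable_e hD ε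
  have hpos := fun x a y => (tiltMass_bounds hU hk hB hs hε x a y).1
  have hf : ∀ o, 1 + ε * D o ∈ Icc (1 - s) (1 + s) := tilt_factor_mem hB hε
  have hf0 : ∀ o, 0 ≤ 1 + ε * D o := fun o => by linarith [(hf o).1]
  have hfm : Measurable fun o => 1 + ε * D o := (hD.const_mul ε).const_add 1
  have hfb : ∀ o, |1 + ε * D o| ≤ 1 + s := fun o => by
    rw [abs_of_nonneg (hf0 o)]; exact (hf o).2
  have := isProbabilityMeasure_tilt hD hB h0 hf0
  have hU0 : ∀ x, nv U x ∈ Bx 0 := fun x => Bx_mono hk.le (hU x)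
  have dis : ∀ f : Obs d → ℝ, Measurable f → (∀ o, |f o| ≤ 1) →
      ∫ o, (1 + ε * D o) * f o ∂P0 =
        ∫ o, sum4 (fun a y => tiltMass U D ε o.1 a y * f (o.1, a, y)) ∂P0 := by
    intro f hfm' hfb'
    rw [hN.integral_eq (f := fun o => (1 + ε * D o) * f o) hU0 (hfm.mul hfm')
      (B := (1 + s) * 1) fun o => by
        rw [abs_mul]
        exact mul_le_mul (hfb o) (hfb' o) (abs_nonneg _) ((abs_nonneg _).trans (hfb o))]
    congr 1; funext o
    simp only [tiltMass, mul_assoc]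
  have m1 : Measurable (tiltNuis U D ε).q1 := (hm _ _).div ((hm _ _).add (hm _ _))
  have m0 : Measurable (tiltNuis U D ε).q0 := (hm _ _).div ((hm _ _).add (hm _ _))
  have me : Measurable (tiltNuis U D ε).e :=
    ((hm _ _).add (hm _ _)).div (measurable_sum4 (f := tiltMass U D ε) hm)
  have hb := fun x => tiltNuis_mem (hpos x)
  refine isNuisanceOf_of_integral_eq m1 m0 me hb fun f hfm' hfb' => ?_
  have mG : Measurable fun o : Obs d =>
      sum4 (fun a y => pv (nv (tiltNuis U D ε) o.1) a y * f (o.1, a, y)) :=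
    (measurable_sum4 (f := fun x a y => pv (nv (tiltNuis U D ε) x) a y * f (x, a, y)) fun a y =>
      (measurable_pv m1 m0 me a y).mul (measurable_slice hfm' a y)).comp measurable_fst
  rw [integral_tilt hD hf0, integral_tilt hD hf0, dis f hfm' hfb',
    dis _ mG fun o => abs_sum4_pv_mul_le (hb _) fun a y => hfb' _]
  congr 1; funext o
  exact sum4_mul_sum4 (pv_tiltNuis (hpos o.1))

theorem dens_tilt (hac : P0 ≪ domMeasure d) (hD : Measurable D) {ε : ℝ}
    (h : ∀ o, 0 ≤ 1 + ε * D o) :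
    ∀ᵐ o ∂(domMeasure d), dens (tilt P0 D ε) o = (1 + ε * D o) * dens P0 o := by
  have hm : Measurable fun o => ENNReal.ofReal (1 + ε * D o) :=
    ((hD.const_mul ε).const_add 1).ennreal_ofReal
  have e : tilt P0 D ε = (domMeasure d).withDensity
      (P0.rnDeriv (domMeasure d) * fun o => ENNReal.ofReal (1 + ε * D o)) := by
    rw [withDensity_mul _ (Measure.measurable_rnDeriv _ _) hm,
      Measure.withDensity_rnDeriv_eq P0 _ hac, tilt]
  filter_upwards [Measure.rnDeriv_withDensity (domMeasure d)
    ((Measure.measurable_rnDeriv P0 (domMeasure d)).mul hm)] with o ho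
  rw [dens, e, ho, Pi.mul_apply, ENNReal.toReal_mul, ENNReal.toReal_ofReal (h o), dens, mul_comm]

/-- With r = √(1+x) one has x = (r-1)(r+1), and the quantity being squared is -(r-1)²/2. -/
theorem sq_sqrt_one_add_sub_le {x : ℝ} (hx : -1 ≤ x) : (√(1 + x) - 1 - x / 2) ^ 2 ≤ x ^ 4 := by
  have h0 : 0 ≤ 1 + x := by linarith
  have hs := Real.sq_sqrt h0
  have hn := Real.sqrt_nonneg (1 + x)
  set r := √(1 + x)
  have e : x = (r - 1) * (r + 1) := by nlinarith
  have e2 : r - 1 - x / 2 = -((r - 1) ^ 2 / 2) := by rw [e]; ring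
  have e4 : x ^ 4 = (r - 1) ^ 4 * (r + 1) ^ 4 := by rw [e]; ring
  have h1 : 1 ≤ (r + 1) ^ 4 := one_le_pow₀ (by linarith)
  have h4 : 0 ≤ (r - 1) ^ 4 := by positivity
  rw [e2, e4]
  nlinarith

/-- The root density of the tilt is √(1+εD) times that of P₀, so the squared remainder is at most
ε⁴B⁴ times the density of P₀. Its integral is O(ε⁴), against the normalization ε². -/
theorem tendsto_tilt_qmd (hac : P0 ≪ domMeasure d) (hD : Measurable D) (hB : ∀ o, |D o| ≤ B)
    (hB1 : 1 ≤ B) :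
    Tendsto (fun ε : ℝ => (∫⁻ o, ENNReal.ofReal
      ((√(dens (tilt P0 D ε) o) - √(dens P0 o) - ε / 2 * D o * √(dens P0 o)) ^ 2) ∂(domMeasure d))
        / ENNReal.ofReal (ε ^ 2)) (𝓝[≠] 0) (𝓝 0) := by
  have hB0 : 0 < B := by linarith
  have up : Tendsto (fun ε : ℝ => ENNReal.ofReal (ε ^ 2 * B ^ 4)) (𝓝[≠] 0) (𝓝 0) := by
    have : Tendsto (fun ε : ℝ => ENNReal.ofReal (ε ^ 2 * B ^ 4)) (𝓝 0)
        (𝓝 (ENNReal.ofReal ((0 : ℝ) ^ 2 * B ^ 4))) :=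
      (ENNReal.continuous_ofReal.comp (by fun_prop)).tendsto 0
    simp only [ne_eq, OfNat.ofNat_ne_zero, not_false_eq_true, zero_pow, zero_mul,
      ENNReal.ofReal_zero] at this
    exact this.mono_left nhdsWithin_le_nhds
  refine tendsto_of_tendsto_of_tendsto_of_le_of_le' tendsto_const_nhds up
    (Eventually.of_forall fun _ => zero_le) ?_
  filter_upwards [nhdsWithin_le_nhds (Ioo_mem_nhds (neg_lt_zero.2 (inv_pos.2 hB0))
    (inv_pos.2 hB0)), eventually_mem_nhdsWithin] with ε hε hε0
  have hεB : |ε| * B ≤ 1 := by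
    rw [← inv_mul_cancel₀ hB0.ne']
    exact mul_le_mul_of_nonneg_right (abs_lt.2 hε).le hB0.le
  have hf : ∀ o, 0 ≤ 1 + ε * D o := fun o => by linarith [(tilt_factor_mem hB hεB o).1]
  have hpos : 0 < ε ^ 2 := by
    have : ε ≠ 0 := hε0
    positivity
  refine ENNReal.div_le_of_le_mul ?_
  rw [← ENNReal.ofReal_mul (by positivity)]
  have step : ∫⁻ o, ENNReal.ofReal
      ((√(dens (tilt P0 D ε) o) - √(dens P0 o) - ε / 2 * D o * √(dens P0 o)) ^ 2) ∂(domMeasure d)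
      ≤ ∫⁻ o, ENNReal.ofReal (ε ^ 4 * B ^ 4) * P0.rnDeriv (domMeasure d) o ∂(domMeasure d) := by
    refine lintegral_mono_ae ?_
    filter_upwards [dens_tilt hac hD hf, Measure.rnDeriv_lt_top P0 (domMeasure d)] with o ho hfin
    have hr : P0.rnDeriv (domMeasure d) o = ENNReal.ofReal (dens P0 o) :=
      (ENNReal.ofReal_toReal hfin.ne).symm
    rw [hr, ← ENNReal.ofReal_mul (by positivity), ho, Real.sqrt_mul (hf o)]
    refine ENNReal.ofReal_le_ofReal ?_
    have e : (√(1 + ε * D o) * √(dens P0 o) - √(dens P0 o) - ε / 2 * D o * √(dens P0 o)) ^ 2 =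
        (√(1 + ε * D o) - 1 - ε * D o / 2) ^ 2 * dens P0 o := by
      rw [← Real.sq_sqrt (dens_nonneg P0 o), Real.sqrt_sq (Real.sqrt_nonneg _)]; ring
    rw [e]
    refine mul_le_mul_of_nonneg_right ((sq_sqrt_one_add_sub_le (by linarith [hf o])).trans ?_)
      (dens_nonneg P0 o)
    have h4 : D o ^ 4 ≤ B ^ 4 := by
      have := pow_le_pow_left₀ (abs_nonneg _) (hB o) 4
      rwa [Even.pow_abs (by decide)] at this
    rw [mul_pow]
    exact mul_le_mul_of_nonneg_left h4 (by positivity)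
  refine step.trans ?_
  rw [lintegral_const_mul _ (Measure.measurable_rnDeriv _ _),
    Measure.lintegral_rnDeriv hac, measure_univ, mul_one]
  refine ENNReal.ofReal_le_ofReal (le_of_eq ?_)
  ring

end Tilt

section EIF

variable {d : ℕ} {P0 : Measure (Obs d)} [IsProbabilityMeasure P0] {lam : ℝ → ℝ} {b c k : ℝ}
  {Us : CNuis d}

theorem isRegularSubmodel_tilt (w : Weight lam b c) (hbk : b < k) (hbox : InBox k Us)
    (hU : IsNuisanceOf P0 Us.fn) (hac : P0 ≪ domMeasure d) {D : Obs d → ℝ} (hD : Measurable D)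
    {B : ℝ} (hB1 : 1 ≤ B) (hB : ∀ o, |D o| ≤ B) (h0 : ∫ o, D o ∂P0 = 0) :
    IsRegularSubmodel lam P0 (tilt P0 D) (tiltNuis Us.fn D) D := by
  have hb := w.b_pos
  have hB0 : 0 < B := by linarith
  have hk0 : 0 < k := hb.trans hbk
  -- Solution of b(1+s) = k(1-s), the largest tilt that keeps the propensity scores in [b, 1-b].
  set s := (k - b) / (k + b) with hs
  have hs0 : 0 < s := div_pos (by linarith) (by linarith)
  have hs1 : s < 1 := by rw [hs, div_lt_one (by linarith)]; linarith
  have hbs : b * (1 + s) ≤ k * (1 - s) := by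
    rw [hs]; apply le_of_eq; field_simp; ring
  refine ⟨by simp [tilt], MemLp.of_bound hD.aestronglyMeasurable B (Eventually.of_forall hB), h0,
    ⟨s / B, by positivity, b, ⟨hb, by linarith [w.b_lt]⟩, w.smooth, fun u hu => w.pos hu,
      fun ε hε => ?_⟩, tendsto_tilt_qmd hac hD hB hB1⟩
  have hεB : |ε| * B ≤ s := by
    rw [← le_div_iff₀ hB0]; exact (abs_lt.2 hε).le
  have hf : ∀ o, 0 ≤ 1 + ε * D o := fun o => by linarith [(tilt_factor_mem hB hεB o).1]
  exact ⟨isProbabilityMeasure_tilt hD hB h0 hf, (withDensity_absolutelyContinuous _ _).trans hac,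
    isNuisanceOf_tilt hU (fun x => hbox.nv_mem x) hk0 hD hB h0 hs1 hεB,
    Eventually.of_forall (tiltNuis_e_mem (fun x => hbox.nv_mem x) hk0 hB hs1 hεB hbs)⟩

theorem isEIF_Dfull (w : Weight lam b c) (hbk : b < k) (hbox : InBox k Us) (hk : k < 1 / 2)
    (hU : IsNuisanceOf P0 Us.fn) (hac : P0 ≪ domMeasure d) :
    IsEIF lam P0 (Dfull lam (margX P0) Us.fn) := by
  obtain ⟨hc, ⟨B, hB1, hB⟩, h0⟩ := Dfull_true_facts w hbk hbox hk hU
  have hD : Measurable (Dfull lam (margX P0) Us.fn) :=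
    measurable_obs_of_slices fun a y => (hc a y).measurable
  exact
  { memLp := MemLp.of_bound hD.aestronglyMeasurable B (Eventually.of_forall hB)
    mean_zero := h0
    mem_tangent := fun δ hδ => ⟨_, _, _, isRegularSubmodel_tilt w hbk hbox hU hac hD hB1 hB h0, by
      simpa using hδ⟩
    gradient := fun P U h hreg => hasDerivAt_psi w hbk hbox hk hU hac hreg }

end EIF

end WATE

namespace WATE

/-! ### Empirical averages and their deviations -/

section Emp

variable {d m : ℕ} (s : Fin m → Obs d)

theorem emp_add (f g : Obs d → ℝ) : emp s (fun o => f o + g o) = emp s f + emp s g := by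
  simp only [emp, Finset.sum_add_distrib, mul_add]

theorem emp_sub (f g : Obs d → ℝ) : emp s (fun o => f o - g o) = emp s f - emp s g := by
  simp only [emp, Finset.sum_sub_distrib, mul_sub]

theorem emp_const_mul (r : ℝ) (f : Obs d → ℝ) : emp s (fun o => r * f o) = r * emp s f := by
  simp only [emp, ← Finset.mul_sum]
  ring

theorem abs_emp_sub_le {f g : Obs d → ℝ} {B : ℝ} (hB : 0 ≤ B) (h : ∀ o, |f o - g o| ≤ B) :
    |emp s f - emp s g| ≤ B := by
  rw [← emp_sub]; exact abs_emp_le s hB h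

end Emp

/-- The function `Φ` centered under the conditional mass function at its own argument. -/
noncomputable def cen (Φ : Bool → Bool → ℝ × ℝ × ℝ → ℝ) (a y : Bool) (u : ℝ × ℝ × ℝ) : ℝ :=
  Φ a y u - sum4 fun a' y' => pv u a' y' * Φ a' y' u

/-- The deviations of the empirical averages at the initial estimate `U₀` from their means, and the
distance of `U₀` to the truth, are at most `θ`. -/
structure Disc {d m : ℕ} (lam : ℝ → ℝ) (P0 : Measure (Obs d)) (Us U0 : CNuis d)
    (s : Fin m → Obs d) (θ : ℝ) : Prop where
  nonneg : 0 ≤ θ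
  le_one : θ ≤ 1
  g : ∀ j, |emp s (fun o => gfun lam j o.2.1 o.2.2 (cv U0 o.1)) -
    ∫ o, gfun lam j o.2.1 o.2.2 (cv U0 o.1) ∂P0| ≤ θ
  cg : ∀ j, |emp s (fun o => cen (gfun lam j) o.2.1 o.2.2 (cv U0 o.1)) -
    ∫ o, cen (gfun lam j) o.2.1 o.2.2 (cv U0 o.1) ∂P0| ≤ θ
  ch : ∀ j l, |emp s (fun o => cen (hfun lam j l) o.2.1 o.2.2 (cv U0 o.1)) -
    ∫ o, cen (hfun lam j l) o.2.1 o.2.2 (cv U0 o.1) ∂P0| ≤ θ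
  sq : |emp s (fun o => mfun lam (psi lam (margX P0) Us.fn) o.2.1 o.2.2 (cv U0 o.1) ^ 2) -
    ∫ o, mfun lam (psi lam (margX P0) Us.fn) o.2.1 o.2.2 (cv U0 o.1) ^ 2 ∂P0| ≤ θ
  truth : |emp s (fun o => mfun lam (psi lam (margX P0) Us.fn) o.2.1 o.2.2 (cv Us o.1))| ≤ θ
  dist : ∫ o, dl (cv U0 o.1) (cv Us o.1) ^ 2 ∂P0 ≤ θ ^ 2

section Dev

variable {d m : ℕ} {P0 : Measure (Obs d)} [IsProbabilityMeasure P0] {lam : ℝ → ℝ} {b c k : ℝ}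
  {Us U0 : CNuis d} {s : Fin m → Obs d} {θ : ℝ}

theorem continuous_cv {d : ℕ} (U : CNuis d) : Continuous (cv U) := continuous_nv U

theorem continuous_dl_cv (U V : CNuis d) : Continuous fun x => dl (cv U x) (cv V x) := by
  have h : Continuous fun p : (ℝ × ℝ × ℝ) × (ℝ × ℝ × ℝ) => dl p.1 p.2 := by unfold dl; fun_prop
  exact h.comp ((continuous_cv U).prodMk (continuous_cv V))

theorem dl_cv_le_three (hk : 0 ≤ k) (h0 : InBox k U0) (hs : InBox k Us) (x : Cov d) :
    dl (cv U0 x) (cv Us x) ≤ 3 :=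
  dl_le_three (Bx_mono hk (h0.cv_mem x)) (Bx_mono hk (hs.cv_mem x))

theorem integrable_dl (hk : 0 ≤ k) (h0 : InBox k U0) (hs : InBox k Us) :
    Integrable (fun o => dl (cv U0 o.1) (cv Us o.1)) P0 :=
  integrable_of_bounded ((continuous_dl_cv U0 Us).measurable.comp measurable_fst) (B := 3)
    fun o => by rw [abs_of_nonneg (dl_nonneg _ _)]; exact dl_cv_le_three hk h0 hs _

theorem integral_dl_le (hk : 0 ≤ k) (h0 : InBox k U0) (hs : InBox k Us) (hθ : 0 ≤ θ)
    (h : ∫ o, dl (cv U0 o.1) (cv Us o.1) ^ 2 ∂P0 ≤ θ ^ 2) :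
    ∫ o, dl (cv U0 o.1) (cv Us o.1) ∂P0 ≤ θ := by
  have cs := abs_integral_mul_le (μ := P0) (f := fun _ => (1 : ℝ))
    (g := fun o : Obs d => dl (cv U0 o.1) (cv Us o.1)) (memLp_const 1)
    (MemLp.of_bound (integrable_dl hk h0 hs).1 3 (Eventually.of_forall fun o => by
      rw [Real.norm_eq_abs, abs_of_nonneg (dl_nonneg _ _)]; exact dl_cv_le_three hk h0 hs _))
  simp only [one_mul, one_pow, integral_const, probReal_univ, smul_eq_mul, Real.sqrt_one,
    mul_one] at cs
  refine (le_abs_self _).trans (cs.trans ?_)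
  rw [Real.sqrt_le_left hθ]
  exact h

theorem abs_integral_le_of_le_dl (hk : 0 ≤ k) (h0 : InBox k U0) (hs : InBox k Us) (hθ : 0 ≤ θ)
    (h : ∫ o, dl (cv U0 o.1) (cv Us o.1) ^ 2 ∂P0 ≤ θ ^ 2) {f : Obs d → ℝ} {M : ℝ}
    (hM : 0 ≤ M) (hf : ∀ o, |f o| ≤ M * dl (cv U0 o.1) (cv Us o.1)) : |∫ o, f o ∂P0| ≤ M * θ :=
  calc |∫ o, f o ∂P0| ≤ ∫ o, |f o| ∂P0 := abs_integral_le_integral_abs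
    _ ≤ ∫ o, M * dl (cv U0 o.1) (cv Us o.1) ∂P0 :=
        integral_mono_of_nonneg (Eventually.of_forall fun _ => abs_nonneg _)
          ((integrable_dl hk h0 hs).const_mul M) (Eventually.of_forall hf)
    _ ≤ M * θ := by
        rw [integral_const_mul]
        exact mul_le_mul_of_nonneg_left (integral_dl_le hk h0 hs hθ h) hM

theorem abs_sum4_le {f : Bool → Bool → ℝ} {B : ℝ} (h : ∀ a y, |f a y| ≤ B) :
    |sum4 f| ≤ 4 * B := by
  unfold sum4
  refine (abs_add_le _ _).trans ?_
  linarith [abs_add_le (f true true) (f true false), abs_add_le (f false true) (f false false),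
    h true true, h true false, h false true, h false false]

theorem abs_cen_le {u : ℝ × ℝ × ℝ} (hu : u ∈ Bx 0) {Φ : Bool → Bool → ℝ × ℝ × ℝ → ℝ} {M : ℝ}
    (h : ∀ a y, |Φ a y u| ≤ M) (a y : Bool) : |cen Φ a y u| ≤ 2 * M := by
  unfold cen
  refine (abs_sub _ _).trans ?_
  linarith [h a y, abs_sum4_pv_mul_le hu h]

theorem measurable_cen_cv {Φ : Bool → Bool → ℝ × ℝ × ℝ → ℝ}
    (hΦ : ∀ a y, Measurable fun x => Φ a y (cv U0 x)) (a y : Bool) :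
    Measurable fun x => cen Φ a y (cv U0 x) :=
  (hΦ a y).sub (measurable_sum4 (f := fun x a y => pv (cv U0 x) a y * Φ a y (cv U0 x)) fun a y =>
    (measurable_pv (U := U0.fn) U0.1.continuous.measurable U0.2.1.continuous.measurable
      U0.2.2.continuous.measurable a y).mul (hΦ a y))

/-- A function centered under the estimated conditional law has, under the true one, the mean Σ(p* -
p₀)Φ. This is of the order of the nuisance error, so centered averages are O(θ) although the
averages themselves are not. -/
theorem abs_integral_cen_le (hk : 0 ≤ k) (h0 : InBox k U0) (hs : InBox k Us)
    (hU : IsNuisanceOf P0 Us.fn) (hθ : 0 ≤ θ)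
    (h : ∫ o, dl (cv U0 o.1) (cv Us o.1) ^ 2 ∂P0 ≤ θ ^ 2) {Φ : Bool → Bool → ℝ × ℝ × ℝ → ℝ}
    {M : ℝ} (hM : 0 ≤ M) (hb : ∀ a y, ∀ u ∈ Bx k, |Φ a y u| ≤ M)
    (hΦ : ∀ a y, Measurable fun x => Φ a y (cv U0 x)) :
    |∫ o, cen Φ o.2.1 o.2.2 (cv U0 o.1) ∂P0| ≤ 4 * M * θ := by
  rw [hU.integral_eq (f := fun o => cen Φ o.2.1 o.2.2 (cv U0 o.1))
    (fun x => Bx_mono hk (hs.cv_mem x))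
    (measurable_obs_of_slices fun a y => measurable_cen_cv hΦ a y) (B := 2 * M)
    fun o => abs_cen_le (Bx_mono hk (h0.cv_mem _)) (fun a y => hb a y _ (h0.cv_mem _)) _ _]
  refine abs_integral_le_of_le_dl hk h0 hs hθ h (by positivity) fun o => ?_
  have e : sum4 (fun a y => pv (nv Us.fn o.1) a y * cen Φ a y (cv U0 o.1)) =
      sum4 fun a y => (pv (cv Us o.1) a y - pv (cv U0 o.1) a y) * Φ a y (cv U0 o.1) := by
    have h1 := sum4_pv (cv Us o.1)
    have h2 : nv Us.fn o.1 = cv Us o.1 := rfl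
    rw [h2]
    simp only [cen, sum4] at h1 ⊢
    linear_combination (-(pv (cv U0 o.1) true true * Φ true true (cv U0 o.1)
      + pv (cv U0 o.1) true false * Φ true false (cv U0 o.1)
      + (pv (cv U0 o.1) false true * Φ false true (cv U0 o.1)
      + pv (cv U0 o.1) false false * Φ false false (cv U0 o.1)))) * h1
  rw [e]
  refine (abs_sum4_le (B := dl (cv U0 o.1) (cv Us o.1) * M) fun a y => ?_).trans_eq (by ring)
  rw [abs_mul]
  refine mul_le_mul ?_ (hb _ _ _ (h0.cv_mem _)) (abs_nonneg _) (dl_nonneg _ _)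
  rw [abs_sub_comm]
  exact abs_pv_sub_le (Bx_mono hk (h0.cv_mem _)) (Bx_mono hk (hs.cv_mem _)) a y

theorem measurable_gfun_cv (w : Weight lam b c) (hbk : b < k) (h0 : InBox k U0) (j : Fin 4)
    (a y : Bool) : Measurable fun x => gfun lam j a y (cv U0 x) :=
  (continuous_gfun_nv w hbk h0 j a y).measurable

theorem measurable_hfun_cv (w : Weight lam b c) (hbk : b < k) (h0 : InBox k U0) (j : Fin 4)
    (l : Fin 2) (a y : Bool) : Measurable fun x => hfun lam j l a y (cv U0 x) :=
  (((continuousOn_hfun w j l a y).mono (Bx_subset_strip hbk)).comp_continuous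
    (continuous_cv U0) fun x => h0.cv_mem x).measurable

/-- Empirical averages of centered functions are small. -/
theorem exists_emp_cen_le (w : Weight lam b c) (hbk : b < k) (hbox : InBox k Us)
    (hU : IsNuisanceOf P0 Us.fn) :
    ∃ K, 1 ≤ K ∧ ∀ {m : ℕ} {s : Fin m → Obs d} {U0 : CNuis d} {θ : ℝ}, InBox k U0 →
      Disc lam P0 Us U0 s θ →
      (∀ j, |emp s (fun o => cen (gfun lam j) o.2.1 o.2.2 (cv U0 o.1))| ≤ K * θ) ∧
      ∀ j l, |emp s (fun o => cen (hfun lam j l) o.2.1 o.2.2 (cv U0 o.1))| ≤ K * θ := by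
  obtain ⟨M, hM, hg, hh, -⟩ := exists_bound_gfun w hbk
  have hk : 0 ≤ k := w.b_pos.le.trans hbk.le
  refine ⟨4 * M + 1, by linarith, fun {m s U0 θ} h0 D => ⟨fun j => ?_, fun j l => ?_⟩⟩
  · have h1 := abs_integral_cen_le hk h0 hbox hU D.nonneg D.dist (by linarith) (hg j)
      (measurable_gfun_cv w hbk h0 j)
    have := abs_sub_abs_le_abs_sub (emp s fun o => cen (gfun lam j) o.2.1 o.2.2 (cv U0 o.1))
      (∫ o, cen (gfun lam j) o.2.1 o.2.2 (cv U0 o.1) ∂P0)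
    linarith [D.cg j]
  · have h1 := abs_integral_cen_le hk h0 hbox hU D.nonneg D.dist (by linarith) (hh j l)
      (measurable_hfun_cv w hbk h0 j l)
    have := abs_sub_abs_le_abs_sub (emp s fun o => cen (hfun lam j l) o.2.1 o.2.2 (cv U0 o.1))
      (∫ o, cen (hfun lam j l) o.2.1 o.2.2 (cv U0 o.1) ∂P0)
    linarith [D.ch j l]

end Dev

/-! ### The empirical score along the path -/

section Score

variable {d m : ℕ} {lam : ℝ → ℝ} {b c k T : ℝ} {s : Fin m → Obs d} {U : ℝ → CNuis d}

/-- The empirical score as a combination of averages of centered functions. -/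
theorem emp_Demp_eq (U0 : CNuis d) :
    emp s (Demp lam s U0) =
      al lam s U0 * emp s (fun o => cen (gfun lam 0) o.2.1 o.2.2 (cv U0 o.1)) +
      be lam s U0 * emp s (fun o => cen (gfun lam 1) o.2.1 o.2.2 (cv U0 o.1)) := by
  rw [← emp_const_mul, ← emp_const_mul, ← emp_add]
  congr 1; funext o
  have := sum4_pv_Demp (lam := lam) s U0 o.1
  simp only [Demp, cen, sum4] at this ⊢
  linear_combination this

theorem GoodPath.hasDerivAt_gfun (h : GoodPath lam b k c T s U) {t : ℝ} (ht : t ∈ Ioo (-T) T)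
    (j : Fin 4) (o : Obs d) :
    HasDerivAt (fun t => gfun lam j o.2.1 o.2.2 (cv (U t) o.1))
      (al lam s (U t) * hfun lam j 0 o.2.1 o.2.2 (cv (U t) o.1) +
        be lam s (U t) * hfun lam j 1 o.2.1 o.2.2 (cv (U t) o.1)) t := by
  rw [← h.deriv_gfun ht j o]
  exact ((h.coordBdd.bgfun j o).diff t ht).hasDerivAt

theorem GoodPath.bdd_score (h : GoodPath lam b k c T s U) :
    Bdd True (Ioo (-T) T) (fun t => emp s (Demp lam s (U t))) (15 * c⁻¹ ^ 5)
      (10 * c⁻¹ ^ 2 * (10 * c⁻¹ ^ 5)) :=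
  Bdd.average isOpen_Ioo h.hm fun i => h.coordBdd.bDemp s (s i)

theorem GoodPath.bdd_emp_gfun (h : GoodPath lam b k c T s U) (j : Fin 4) :
    Bdd True (Ioo (-T) T) (fun t => emp s fun o => gfun lam j o.2.1 o.2.2 (cv (U t) o.1))
      (5 * c⁻¹ ^ 2) (3 * c⁻¹ * (10 * c⁻¹ ^ 5)) :=
  Bdd.average isOpen_Ioo h.hm fun i => h.coordBdd.bgfun j (s i)

theorem GoodPath.deriv_emp_gfun (h : GoodPath lam b k c T s U) {t : ℝ} (ht : t ∈ Ioo (-T) T)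
    (j : Fin 4) :
    deriv (fun t => emp s fun o => gfun lam j o.2.1 o.2.2 (cv (U t) o.1)) t =
      al lam s (U t) * emp s (fun o => hfun lam j 0 o.2.1 o.2.2 (cv (U t) o.1)) +
        be lam s (U t) * emp s (fun o => hfun lam j 1 o.2.1 o.2.2 (cv (U t) o.1)) := by
  rw [← emp_const_mul, ← emp_const_mul, ← emp_add]
  exact ((HasDerivAt.fun_sum fun i _ => h.hasDerivAt_gfun ht j (s i)).const_mul _).deriv

/-- The derivative of the empirical score, centered, is a combination of averages of centered
functions. -/
theorem GoodPath.deriv_score_eq (h : GoodPath lam b k c T s U) {t : ℝ} (ht : t ∈ Ioo (-T) T) :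
    deriv (fun t => emp s (Demp lam s (U t))) t =
      -emp s (fun o => sum4 fun a y => pv (cv (U t) o.1) a y * Demp lam s (U t) (o.1, a, y) ^ 2)
      + (deriv (fun t => al lam s (U t)) t *
          emp s (fun o => cen (gfun lam 0) o.2.1 o.2.2 (cv (U t) o.1))
        + deriv (fun t => be lam s (U t)) t *
          emp s (fun o => cen (gfun lam 1) o.2.1 o.2.2 (cv (U t) o.1))
        + al lam s (U t) * (al lam s (U t) *
            emp s (fun o => cen (hfun lam 0 0) o.2.1 o.2.2 (cv (U t) o.1))
          + be lam s (U t) * emp s (fun o => cen (hfun lam 0 1) o.2.1 o.2.2 (cv (U t) o.1)))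
        + be lam s (U t) * (al lam s (U t) *
            emp s (fun o => cen (hfun lam 1 0) o.2.1 o.2.2 (cv (U t) o.1))
          + be lam s (U t) *
            emp s (fun o => cen (hfun lam 1 1) o.2.1 o.2.2 (cv (U t) o.1)))) := by
  have ha := ((h.coordBdd.bal s).diff t ht).hasDerivAt
  have hb := ((h.coordBdd.bbe s).diff t ht).hasDerivAt
  have hD : ∀ o, HasDerivAt (fun t => Demp lam s (U t) o)
      (deriv (fun t => al lam s (U t)) t * gfun lam 0 o.2.1 o.2.2 (cv (U t) o.1)
        + al lam s (U t) * (al lam s (U t) * hfun lam 0 0 o.2.1 o.2.2 (cv (U t) o.1) +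
          be lam s (U t) * hfun lam 0 1 o.2.1 o.2.2 (cv (U t) o.1))
        + (deriv (fun t => be lam s (U t)) t * gfun lam 1 o.2.1 o.2.2 (cv (U t) o.1)
        + be lam s (U t) * (al lam s (U t) * hfun lam 1 0 o.2.1 o.2.2 (cv (U t) o.1) +
          be lam s (U t) * hfun lam 1 1 o.2.1 o.2.2 (cv (U t) o.1)))) t := fun o =>
    (ha.mul (h.hasDerivAt_gfun ht 0 o)).add (hb.mul (h.hasDerivAt_gfun ht 1 o))
  have e1 : deriv (fun t => emp s (Demp lam s (U t))) t =
      emp s fun o => deriv (fun t => Demp lam s (U t) o) t :=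
    ((HasDerivAt.fun_sum fun i _ => (hD (s i)).differentiableAt.hasDerivAt).const_mul _).deriv
  have e2 : (fun o => deriv (fun t => Demp lam s (U t) o) t) = fun o =>
      -1 * (sum4 fun a y => pv (cv (U t) o.1) a y * Demp lam s (U t) (o.1, a, y) ^ 2)
      + (deriv (fun t => al lam s (U t)) t * cen (gfun lam 0) o.2.1 o.2.2 (cv (U t) o.1)
        + deriv (fun t => be lam s (U t)) t * cen (gfun lam 1) o.2.1 o.2.2 (cv (U t) o.1)
        + al lam s (U t) * (al lam s (U t) * cen (hfun lam 0 0) o.2.1 o.2.2 (cv (U t) o.1)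
          + be lam s (U t) * cen (hfun lam 0 1) o.2.1 o.2.2 (cv (U t) o.1))
        + be lam s (U t) * (al lam s (U t) * cen (hfun lam 1 0) o.2.1 o.2.2 (cv (U t) o.1)
          + be lam s (U t) * cen (hfun lam 1 1) o.2.1 o.2.2 (cv (U t) o.1))) := by
    funext o
    -- The derivative of D* equals its conditional mean, which is minus the conditional second
    -- moment, plus its centered part; the latter is linear in the centered building blocks.
    have := h.sum4_pv_deriv_Demp ht o.1
    rw [(hD o).deriv]
    simp only [(hD _).deriv] at this
    simp only [cen, sum4] at this ⊢
    linear_combination this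
  rw [e1, e2]
  simp only [emp_add, emp_const_mul]
  ring

end Score

/-- A function with derivative bounded away from zero and a small value at zero has a unique
zero. -/
theorem exists_unique_root {S S' : ℝ → ℝ} {κ δ : ℝ} (hκ : 0 < κ) (hδ : 0 < δ)
    (hS : ∀ t ∈ Icc (-δ) δ, HasDerivAt S (S' t) t) (hS' : ∀ t ∈ Icc (-δ) δ, S' t ≤ -κ)
    (h0 : |S 0| < κ * δ) :
    ∃ t ∈ Icc (-δ) δ, S t = 0 ∧ κ * |t| ≤ |S 0| ∧ ∀ r ∈ Icc (-δ) δ, S r = 0 → r = t := by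
  have key : ∀ p ∈ Icc (-δ) δ, ∀ q ∈ Icc (-δ) δ, p ≤ q → κ * (q - p) ≤ S p - S q := by
    intro p hp q hq hpq
    have := (convex_Icc (-δ) δ).mul_sub_le_image_sub_of_le_deriv (f := fun t => -S t) (C := κ)
      (fun t ht => (hS t ht).continuousAt.neg.continuousWithinAt)
      (fun t ht => (hS t (interior_subset ht)).differentiableAt.neg.differentiableWithinAt)
      (fun t ht => by
        have := (hS t (interior_subset ht)).neg.deriv
        have h2 := hS' t (interior_subset ht)
        change κ ≤ deriv (-S) t
        rw [this]; linarith) p hp q hq hpq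
    linarith
  have m0 : (0 : ℝ) ∈ Icc (-δ) δ := ⟨by linarith, hδ.le⟩
  have mδ : δ ∈ Icc (-δ) δ := ⟨by linarith, le_rfl⟩
  have mδ' : -δ ∈ Icc (-δ) δ := ⟨le_rfl, by linarith⟩
  have a1 := key 0 m0 δ mδ hδ.le
  have a2 := key (-δ) mδ' 0 m0 (by linarith)
  have b1 := abs_lt.1 h0
  obtain ⟨t, ht, hz⟩ := intermediate_value_Icc' (show -δ ≤ δ by linarith)
    (fun t ht => (hS t ht).continuousAt.continuousWithinAt)
    (show (0 : ℝ) ∈ Icc (S δ) (S (-δ)) from ⟨by linarith, by linarith⟩)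
  refine ⟨t, ht, hz, ?_, fun r hr hrz => ?_⟩
  · rcases le_total 0 t with h | h
    · rw [abs_of_nonneg h]
      linarith [key 0 m0 t ht h, le_abs_self (S 0)]
    · rw [abs_of_nonpos h]
      linarith [key t ht 0 m0 h, neg_le_abs (S 0)]
  · rcases le_total r t with h | h
    · have := key r hr t ht h
      rw [hz, hrz, sub_zero] at this
      nlinarith
    · have := key t ht r hr h
      rw [hz, hrz, sub_zero] at this
      nlinarith

end WATE

namespace WATE

/-! ### Existence and uniqueness of the root of the empirical score -/

theorem integral_count_prod_count (f : Bool × Bool → ℝ) :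
    ∫ p, f p ∂((Measure.count : Measure Bool).prod (Measure.count : Measure Bool)) =
      ∑ a, ∑ y, f (a, y) := by
  rw [integral_fintype (Integrable.of_finite), Fintype.sum_prod_type]
  refine Finset.sum_congr rfl fun a _ => Finset.sum_congr rfl fun y _ => ?_
  rw [Measure.real, ← Set.singleton_prod_singleton, Measure.prod_prod]
  simp

/-- It turns the lower bound `c_init` on the variance of D* in the local bracketing conditions into
a statement about an empirical average. -/
theorem integral_tildeP_empX {d m : ℕ} (s : Fin m → Obs d) {U : CNuis d}
    (hU : ∀ x, cv U x ∈ Bx 0) (f : Obs d → ℝ) :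
    ∫ o, f o ∂(tildeP (empX s) U.fn) =
      emp s fun o => sum4 fun a y => pv (cv U o.1) a y * f (o.1, a, y) := by
  have hm : Measurable fun o : Obs d => ENNReal.ofReal (condP U.fn o.2.1 o.2.2 o.1) :=
    (measurable_obs_of_slices fun a y => measurable_pv (U := U.fn) U.1.continuous.measurable
      U.2.1.continuous.measurable U.2.2.continuous.measurable a y).ennreal_ofReal
  have hn : ∀ o : Obs d, (ENNReal.ofReal (condP U.fn o.2.1 o.2.2 o.1)).toReal =
      pv (cv U o.1) o.2.1 o.2.2 := fun o => ENNReal.toReal_ofReal (pv_mem (hU o.1) _ _).1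
  have hemb : ∀ x : Cov d, MeasurableEmbedding (Prod.mk x : Bool × Bool → Obs d) := fun x =>
    MeasurableEmbedding.prodMk_left x MeasurableEmbedding.id
  rw [tildeP, integral_withDensity_eq_integral_toReal_smul hm (by simp)]
  simp only [hn, smul_eq_mul]
  rw [empX, Measure.prod_smul_left, integral_smul_measure, ← Measure.sum_fintype,
    Measure.prod_sum_left, Measure.sum_fintype, integral_finsetSum_measure]
  · simp only [Measure.dirac_prod, (hemb _).integral_map, integral_count_prod_count,
      sum_bool_eq_sum4, emp]
    simp
  · intro i _
    rw [Measure.dirac_prod, (hemb _).integrable_map_iff]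
    exact Integrable.of_finite

section Root

variable {d : ℕ} {P0 : Measure (Obs d)} [IsProbabilityMeasure P0] {lam : ℝ → ℝ} {b c k : ℝ}
  {Us : CNuis d}

/-- The number 150000·c⁻¹⁹ is the bound 15R⁵(100R⁷)², R = c⁻¹, for the second derivative of the
score. The search radius is such that the slope varies by at most c_init/4 over the search interval.
-/
theorem deltaInit_bounds {cinit : ℝ} (w : Weight lam b c) (hci : cinit ∈ Ioo (0 : ℝ) 1) :
    0 < deltaInit c cinit ∧ deltaInit c cinit < tOne c ∧ deltaInit c cinit ≤ 1 ∧
      150000 * c⁻¹ ^ 19 * deltaInit c cinit ≤ cinit / 4 := by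
  have hc := w.c_pos
  have hc4 : c ≤ 1 / 4 := by linarith [w.c_le, w.b_lt]
  have h6 : 0 < c ^ 6 := by positivity
  have h14 : c ^ 14 ≤ 1 := pow_le_one₀ hc.le (by linarith)
  have e20 : c ^ 20 = c ^ 14 * c ^ 6 := by ring
  have h20 : c ^ 20 ≤ c ^ 6 := by rw [e20]; nlinarith
  have h61 : c ^ 6 ≤ 1 := pow_le_one₀ hc.le (by linarith)
  have h20p : 0 < c ^ 20 := by positivity
  have hci' : cinit * c ^ 20 ≤ c ^ 6 := by nlinarith [hci.1, hci.2]
  refine ⟨?_, ?_, ?_, ?_⟩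
  · have := hci.1
    unfold deltaInit; positivity
  · unfold deltaInit tOne; linarith
  · unfold deltaInit; linarith
  · have e : 150000 * c⁻¹ ^ 19 * deltaInit c cinit = 15 / 100 * (c * cinit) := by
      unfold deltaInit; field_simp; ring
    rw [e]
    nlinarith [hci.1]

/-- The score is O(θ) at zero and its slope there is at most -c_init + O(θ), since all other
contributions are averages of centered functions. By the bound on the second derivative the slope
stays below -c_init/4 on the whole search interval, so the score is strictly decreasing and crosses
zero once, within O(θ) of the origin. -/
theorem exists_root {cinit : ℝ} (w : Weight lam b c) (hbk : b < k) (hbox : InBox k Us)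
    (hU : IsNuisanceOf P0 Us.fn) (hci : cinit ∈ Ioo (0 : ℝ) 1) :
    ∃ K ε0, 1 ≤ K ∧ 0 < ε0 ∧ ∀ {m : ℕ} {s : Fin m → Obs d} {U : ℝ → CNuis d} {θ : ℝ},
      GoodPath lam b k c (tOne c) s U → Disc lam P0 Us (U 0) s θ → θ ≤ ε0 →
      cinit ≤ emp s (fun o => sum4 fun a y =>
        pv (cv (U 0) o.1) a y * Demp lam s (U 0) (o.1, a, y) ^ 2) →
      ∃ t ∈ Icc (-deltaInit c cinit) (deltaInit c cinit), emp s (Demp lam s (U t)) = 0 ∧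
        |t| ≤ K * θ ∧ ∀ r ∈ Icc (-deltaInit c cinit) (deltaInit c cinit),
          emp s (Demp lam s (U r)) = 0 → r = t := by
  obtain ⟨K, hK, hcen⟩ := exists_emp_cen_le w hbk hbox hU
  obtain ⟨hδ, hδT, hδ1, hδc⟩ := deltaInit_bounds w hci
  set δ := deltaInit c cinit
  have hR := w.R_ge
  set R := c⁻¹ with hRdef
  have hR1 : 1 ≤ R := by linarith
  have hci0 := hci.1
  -- A generous common bound for the O(θ) terms in the score and in its slope; the largest
  -- coefficient that occurs is 40 + 180 + 16 after raising all powers of R to ten.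
  set A := 1000 * R ^ 10 * K with hA
  have hR10 : 1 ≤ R ^ 10 := one_le_pow₀ hR1
  have hA1 : 1 ≤ A := by rw [hA]; nlinarith
  have hA0 : 0 < A := by linarith
  set κ := cinit / 4 with hκ
  have hκ0 : 0 < κ := by positivity
  -- The smallness condition makes Aθ ≤ κδ/2. This leaves room in the slope and guarantees a sign
  -- change inside the search interval; dividing the score at zero by the slope κ bounds the root.
  refine ⟨A / κ, κ * δ / (2 * A), ?_, by positivity, fun {m s U θ} hp D hθ hcin => ?_⟩
  · rw [le_div_iff₀ hκ0]; linarith [hci.2]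
  have hT : 0 < tOne c := hδ.trans hδT
  have h0 : (0 : ℝ) ∈ Ioo (-tOne c) (tOne c) := ⟨by linarith, hT⟩
  have hb0 := hp.box 0 h0
  obtain ⟨hg, hh⟩ := hcen hb0 D
  have hθ0 := D.nonneg
  have hAθ : A * θ ≤ κ * δ / 2 := by
    have := mul_le_mul_of_nonneg_left hθ hA0.le
    have e : A * (κ * δ / (2 * A)) = κ * δ / 2 := by field_simp
    linarith
  have hα := abs_al_le (s := s) w hbk hp.hm hb0
  have hβ := abs_be_le (s := s) w hbk hp.hm hb0
  have hα' := (hp.coordBdd.bal s).bd1 0 h0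
  have hβ' := (hp.coordBdd.bbe s).bd1 0 h0
  set α := al lam s (U 0)
  set β := be lam s (U 0)
  set α' := deriv (fun t => al lam s (U t)) 0
  set β' := deriv (fun t => be lam s (U t)) 0
  have hKθ : 0 ≤ K * θ := by positivity
  have pR : ∀ n ≤ 10, R ^ n ≤ R ^ 10 := fun n hn => pow_le_pow_right₀ hR1 hn
  have hα1 : |α| ≤ 2 * R ^ 3 := hα.trans (by nlinarith [pow_le_pow_right₀ hR1 (show 1 ≤ 3 by lia)])
  have mulb : ∀ p x C : ℝ, |p| ≤ C → |x| ≤ K * θ → |p * x| ≤ C * (K * θ) := fun p x C h1 h2 => by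
    rw [abs_mul]; exact mul_le_mul h1 h2 (abs_nonneg _) ((abs_nonneg _).trans h1)
  have mulc : ∀ p x C : ℝ, |p| ≤ 2 * R ^ 3 → |x| ≤ C → |p * x| ≤ 2 * R ^ 3 * C :=
    fun p x C h1 h2 => by
      rw [abs_mul]; exact mul_le_mul h1 h2 (abs_nonneg _) ((abs_nonneg _).trans h1)
  have hS0 : |emp s (Demp lam s (U 0))| ≤ A * θ := by
    rw [emp_Demp_eq]
    refine (abs_add_le _ _).trans ((add_le_add (mulb _ _ _ hα1 (hg 0)) (mulb _ _ _ hβ (hg 1))).trans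
      ?_)
    have := mul_le_mul_of_nonneg_right (pR 3 (by lia)) hKθ
    have : 0 ≤ R ^ 10 * (K * θ) := by positivity
    rw [hA]; linarith
  have hS1 : deriv (fun t => emp s (Demp lam s (U t))) 0 ≤ -cinit + A * θ := by
    rw [hp.deriv_score_eq h0]
    refine add_le_add (neg_le_neg hcin) ((le_abs_self _).trans ?_)
    have x1 := mulb _ _ _ hα' (hg 0)
    have x2 := mulb _ _ _ hβ' (hg 1)
    have x3 := mulc _ _ _ hα1 ((abs_add_le _ _).trans
      (add_le_add (mulb _ _ _ hα1 (hh 0 0)) (mulb _ _ _ hβ (hh 0 1))))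
    have x4 := mulc _ _ _ hβ ((abs_add_le _ _).trans
      (add_le_add (mulb _ _ _ hα1 (hh 1 0)) (mulb _ _ _ hβ (hh 1 1))))
    refine (abs_add_le _ _).trans ((add_le_add ((abs_add_le _ _).trans (add_le_add
      ((abs_add_le _ _).trans (add_le_add x1 x2)) x3)) x4).trans ?_)
    have y8 := mul_le_mul_of_nonneg_right (pR 8 (by lia)) hKθ
    have y6 := mul_le_mul_of_nonneg_right (pR 6 (by lia)) hKθ
    have y10 : 0 ≤ R ^ 10 * (K * θ) := by positivity
    have e : R * (4 * R ^ 2 * (10 * R ^ 5)) * (K * θ) + 2 * R ^ 3 * (9 * R ^ 2 * (10 * R ^ 5)) *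
        (K * θ) + 2 * R ^ 3 * (2 * R ^ 3 * (K * θ) + 2 * R ^ 3 * (K * θ))
        + 2 * R ^ 3 * (2 * R ^ 3 * (K * θ) + 2 * R ^ 3 * (K * θ)) =
        40 * (R ^ 8 * (K * θ)) + 180 * (R ^ 10 * (K * θ)) + 16 * (R ^ 6 * (K * θ)) := by ring
    rw [e, hA]; linarith
  have hsub : ∀ t ∈ Icc (-δ) δ, t ∈ Ioo (-tOne c) (tOne c) := fun t ht =>
    ⟨by linarith [ht.1], by linarith [ht.2]⟩
  have hder : ∀ t ∈ Icc (-δ) δ, deriv (fun t => emp s (Demp lam s (U t))) t ≤ -κ := by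
    intro t ht
    have h1 := (hp.bdd_score.taylor (hsub t ht)).1
    have h2 : 15 * R ^ 5 * (10 * R ^ 2 * (10 * R ^ 5)) ^ 2 * |t| ≤ 150000 * R ^ 19 * δ := by
      have e : 15 * R ^ 5 * (10 * R ^ 2 * (10 * R ^ 5)) ^ 2 = 150000 * R ^ 19 := by ring
      rw [e]
      exact mul_le_mul_of_nonneg_left (abs_le.2 ht) (by positivity)
    have h3 := (abs_le.1 (h1.trans h2)).2
    have h4 : κ * δ ≤ κ * 1 := mul_le_mul_of_nonneg_left hδ1 hκ0.le
    linarith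
  obtain ⟨t, ht, hz, hb, hun⟩ := exists_unique_root hκ0 hδ
    (fun t ht => hp.bdd_score.h1 t (hsub t ht)) hder
    (hS0.trans_lt (by have : 0 < κ * δ := by positivity
                      linarith))
  refine ⟨t, ht, hz, ?_, hun⟩
  rw [div_mul_eq_mul_div, le_div_iff₀ hκ0]
  linarith

end Root

end WATE

namespace WATE

/-! ### Expansion of the targeted estimator -/

theorem abs_comb_le {ψ p q r s B : ℝ} (hψ : |ψ| ≤ 1) (hp : |p| ≤ B) (hq : |q| ≤ B)
    (hr : |r| ≤ B) (hs : |s| ≤ B) : |p + q - ψ * (r + s)| ≤ 4 * B := by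
  have h : |ψ * (r + s)| ≤ 1 * (B + B) := by
    rw [abs_mul]
    exact mul_le_mul hψ ((abs_add_le _ _).trans (add_le_add hr hs)) (abs_nonneg _) zero_le_one
  refine (abs_sub _ _).trans ((add_le_add ((abs_add_le _ _).trans (add_le_add hp hq)) h).trans
    (le_of_eq (by ring)))

section Orthogonality

variable {lam : ℝ → ℝ} {b c k : ℝ}

theorem Bx_mem_nhds {k1 : ℝ} (hk : k1 < k) {v : ℝ × ℝ × ℝ} (hv : v ∈ Bx k) : Bx k1 ∈ 𝓝 v := by
  have key : ∀ r ∈ Icc k (1 - k), Icc k1 (1 - k1) ∈ 𝓝 r := fun r hr =>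
    Icc_mem_nhds (hk.trans_le hr.1) (hr.2.trans_lt (by linarith))
  exact prod_mem_nhds (key _ hv.1) (prod_mem_nhds (key _ hv.2.1) (key _ hv.2.2))

theorem dl_le_norm (u v : ℝ × ℝ × ℝ) : dl u v ≤ 3 * ‖u - v‖ := by
  have h1 := norm_fst_le (u - v)
  have h2 := norm_snd_le (u - v)
  have h3 := (norm_fst_le (u - v).2).trans h2
  have h4 := (norm_snd_le (u - v).2).trans h2
  simp only [Prod.fst_sub, Prod.snd_sub, Real.norm_eq_abs] at h1 h3 h4
  unfold dl
  linarith

theorem hasFDerivAt_mfun (w : Weight lam b c) (ψ : ℝ) (a y : Bool) {u : ℝ × ℝ × ℝ}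
    (hu : u.2.2 ∈ Ioo b (1 - b)) :
    HasFDerivAt (mfun lam ψ a y) (fderiv ℝ (gfun lam 0 a y) u + fderiv ℝ (gfun lam 2 a y) u
      - ψ • (fderiv ℝ (gfun lam 1 a y) u + fderiv ℝ (gfun lam 3 a y) u)) u := by
  have h : ∀ j, HasFDerivAt (gfun lam j a y) (fderiv ℝ (gfun lam j a y) u) u := fun j =>
    (differentiableAt_gfun w j a y hu).hasFDerivAt
  exact ((h 0).add (h 2)).sub (((h 1).add (h 3)).const_mul ψ)

/-- Along the path, the derivative of the estimating function has conditional mean zero. -/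
theorem sum4_pv_deriv_mfun (w : Weight lam b c) (hbk : b < k) {ψ : ℝ} (hψ : |ψ| ≤ 1)
    {v : ℝ × ℝ × ℝ} (hv : v ∈ Bx k) (l : Fin 2) :
    sum4 (fun a y => pv v a y * (hfun lam 0 l a y v + hfun lam 2 l a y v
      - ψ * (hfun lam 1 l a y v + hfun lam 3 l a y v))) = 0 := by
  have hb := w.b_pos
  obtain ⟨K, hK, orth⟩ := exists_orthogonality hb (by linarith [w.b_lt]) w.smooth
    (show b < (b + k) / 2 by linarith)
  have hv0 : v ∈ Bx 0 := Bx_mono (by linarith) hv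
  have hvs := Bx_subset_strip hbk hv
  set f : ℝ × ℝ × ℝ → ℝ := fun u => sum4 (fun a y => pv v a y * mfun lam ψ a y u) -
    lam v.2.2 * (v.1 - v.2.1 - ψ) with hf
  -- Orthogonality makes the function quadratically small near u = v, so its derivative at v is
  -- zero. Computing the same derivative term by term gives the claim in the direction of the field,
  -- without differentiating λ by hand.
  have hO : f =O[𝓝 v] fun u => ‖u - v‖ ^ 2 := by
    refine Asymptotics.IsBigO.of_bound (K * 9) ?_
    filter_upwards [Bx_mem_nhds (show (b + k) / 2 < k by linarith) hv] with u hu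
    have h1 := orth ψ hψ u (Bx_mono (by linarith) hu) hu.2.2 v hv0 (Ioo_subset_Icc_self hvs)
    have h2 := pow_le_pow_left₀ (dl_nonneg u v) (dl_le_norm u v) 2
    rw [Real.norm_eq_abs, Real.norm_eq_abs, abs_of_nonneg (by positivity : 0 ≤ ‖u - v‖ ^ 2)]
    refine h1.trans ?_
    rw [mul_assoc]
    refine mul_le_mul_of_nonneg_left (h2.trans_eq (by ring)) hK
  have h0 : HasFDerivAt f (0 : ℝ × ℝ × ℝ →L[ℝ] ℝ) v := hO.hasFDerivAt one_lt_two
  have hd : ∀ a y : Bool, HasFDerivAt (fun u => pv v a y * mfun lam ψ a y u) (pv v a y •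
      (fderiv ℝ (gfun lam 0 a y) v + fderiv ℝ (gfun lam 2 a y) v
        - ψ • (fderiv ℝ (gfun lam 1 a y) v + fderiv ℝ (gfun lam 3 a y) v))) v := fun a y =>
    (hasFDerivAt_mfun w ψ a y hvs).const_mul (pv v a y)
  have h1 := ((((hd true true).add (hd true false)).add
    ((hd false true).add (hd false false))).sub_const (lam v.2.2 * (v.1 - v.2.1 - ψ)))
  have := congrArg (fun L : ℝ × ℝ × ℝ →L[ℝ] ℝ => L (Ffun lam l v)) (h1.unique h0)
  simpa [sum4, hfun, mul_add] using this

end Orthogonality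

section Fold

variable {d m : ℕ} {lam : ℝ → ℝ} {b c k T : ℝ} {s : Fin m → Obs d}

theorem emp_mfun_eq (ψ : ℝ) (U : CNuis d) :
    emp s (fun o => mfun lam ψ o.2.1 o.2.2 (cv U o.1)) =
      emp s (fun o => gfun lam 0 o.2.1 o.2.2 (cv U o.1))
        + emp s (fun o => gfun lam 2 o.2.1 o.2.2 (cv U o.1))
        - ψ * (emp s (fun o => gfun lam 1 o.2.1 o.2.2 (cv U o.1))
          + emp s (fun o => gfun lam 3 o.2.1 o.2.2 (cv U o.1))) := by
  simp only [mfun, emp_add, emp_sub, emp_const_mul]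

/-- At a root of the score, the estimator solves the estimating equation. -/
theorem emp_mfun_eq_of_score (w : Weight lam b c) (hbk : b < k) (hm : 0 < m) {U : CNuis d}
    (hU : InBox k U) (h : emp s (Demp lam s U) = 0) (p : ℝ) :
    emp s (fun o => mfun lam p o.2.1 o.2.2 (cv U o.1)) = (nm lam s U * al lam s U - p) *
      (emp s (fun o => gfun lam 1 o.2.1 o.2.2 (cv U o.1))
        + emp s (fun o => gfun lam 3 o.2.1 o.2.2 (cv U o.1))) := by
  have ha := (al_pos w hbk hm hU (s := s)).ne'
  have e3 : emp s (fun o => gfun lam 3 o.2.1 o.2.2 (cv U o.1)) = om lam s U := rfl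
  have e2 : emp s (fun o => gfun lam 2 o.2.1 o.2.2 (cv U o.1)) = nm lam s U := rfl
  have hao : al lam s U * om lam s U = 1 :=
    inv_mul_cancel₀ (w.c_pos.trans_le (om_ge w hbk hm hU)).ne'
  have h' : al lam s U * emp s (fun o => gfun lam 0 o.2.1 o.2.2 (cv U o.1)) +
      be lam s U * emp s (fun o => gfun lam 1 o.2.1 o.2.2 (cv U o.1)) = 0 := by
    rw [← emp_const_mul, ← emp_const_mul, ← emp_add]; exact h
  rw [be] at h'
  -- The score equation α·E₀ + β·E₁ = 0 with β = -ψ̂α says E₀ = ψ̂E₁, where E_j is the empirical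
  -- mean of g_j. Together with E₂ = ψ̂E₃, this is the estimating equation at ψ̂.
  have e0 : emp s (fun o => gfun lam 0 o.2.1 o.2.2 (cv U o.1)) =
      nm lam s U * al lam s U * emp s (fun o => gfun lam 1 o.2.1 o.2.2 (cv U o.1)) := by
    refine mul_left_cancel₀ ha ?_
    linear_combination h'
  rw [emp_mfun_eq, e0, e2, e3]
  linear_combination -(nm lam s U) * hao

variable {P0 : Measure (Obs d)} [IsProbabilityMeasure P0] {Us : CNuis d}

/-- Moving along the path for a time of order `θ` changes the empirical estimating function by
`O(θ²)`. -/
theorem exists_emp_mfun_path_le (w : Weight lam b c) (hbk : b < k) (hbox : InBox k Us)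
    (hU : IsNuisanceOf P0 Us.fn) (K1 : ℝ) (hK1 : 1 ≤ K1) :
    ∃ K, 1 ≤ K ∧ ∀ {m : ℕ} {s : Fin m → Obs d} {U : ℝ → CNuis d} {θ t ψ : ℝ},
      GoodPath lam b k c T s U → Disc lam P0 Us (U 0) s θ → t ∈ Ioo (-T) T → |t| ≤ K1 * θ →
      |ψ| ≤ 1 → |emp s (fun o => mfun lam ψ o.2.1 o.2.2 (cv (U t) o.1)) -
        emp s (fun o => mfun lam ψ o.2.1 o.2.2 (cv (U 0) o.1))| ≤ K * θ ^ 2 := by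
  obtain ⟨K, hK, hcen⟩ := exists_emp_cen_le w hbk hbox hU
  have hR := w.R_ge
  set R := c⁻¹ with hRdef
  refine ⟨4 * (5 * R ^ 2 * (3 * R * (10 * R ^ 5)) ^ 2) * K1 ^ 2 + K1 * (16 * R ^ 3 * K) + 1, ?_,
    fun {m s U θ t ψ} hp D ht htK hψ => ?_⟩
  · have : 0 ≤ 4 * (5 * R ^ 2 * (3 * R * (10 * R ^ 5)) ^ 2) * K1 ^ 2 + K1 * (16 * R ^ 3 * K) := by
      positivity
    linarith
  have hT : 0 < T := by
    have := ht.1.trans ht.2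
    linarith
  have h0 : (0 : ℝ) ∈ Ioo (-T) T := ⟨by linarith, hT⟩
  have hb0 := hp.box 0 h0
  obtain ⟨-, hh⟩ := hcen hb0 D
  have hθ := D.nonneg
  have ty := fun j => ((hp.bdd_emp_gfun j).taylor ht).2.1
  simp only [hp.deriv_emp_gfun h0] at ty
  rw [emp_mfun_eq, emp_mfun_eq]
  -- the derivative at zero
  set α := al lam s (U 0)
  set β := be lam s (U 0)
  have hE : ∀ l : Fin 2, |emp s (fun o => hfun lam 0 l o.2.1 o.2.2 (cv (U 0) o.1))
      + emp s (fun o => hfun lam 2 l o.2.1 o.2.2 (cv (U 0) o.1))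
      - ψ * (emp s (fun o => hfun lam 1 l o.2.1 o.2.2 (cv (U 0) o.1))
        + emp s (fun o => hfun lam 3 l o.2.1 o.2.2 (cv (U 0) o.1)))| ≤ 4 * (K * θ) := by
    intro l
    have e : emp s (fun o => hfun lam 0 l o.2.1 o.2.2 (cv (U 0) o.1))
      + emp s (fun o => hfun lam 2 l o.2.1 o.2.2 (cv (U 0) o.1))
      - ψ * (emp s (fun o => hfun lam 1 l o.2.1 o.2.2 (cv (U 0) o.1))
        + emp s (fun o => hfun lam 3 l o.2.1 o.2.2 (cv (U 0) o.1))) =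
      emp s (fun o => cen (hfun lam 0 l) o.2.1 o.2.2 (cv (U 0) o.1))
      + emp s (fun o => cen (hfun lam 2 l) o.2.1 o.2.2 (cv (U 0) o.1))
      - ψ * (emp s (fun o => cen (hfun lam 1 l) o.2.1 o.2.2 (cv (U 0) o.1))
        -- This combination of derivatives has conditional mean zero at the initial estimate, so
        -- centering it changes nothing. The linear Taylor term is therefore |t|·O(θ) = O(θ²), the
        -- same order as the quadratic one.
        + emp s (fun o => cen (hfun lam 3 l) o.2.1 o.2.2 (cv (U 0) o.1))) := by
      simp only [← emp_add, ← emp_const_mul, ← emp_sub]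
      congr 1; funext o
      have := sum4_pv_deriv_mfun w hbk hψ (hb0.cv_mem o.1) l
      simp only [cen, sum4] at this ⊢
      linear_combination this
    rw [e]
    exact abs_comb_le hψ (hh 0 l) (hh 2 l) (hh 1 l) (hh 3 l)
  have hα : |α| ≤ 2 * R ^ 3 := (abs_al_le w hbk hp.hm hb0).trans (by
    nlinarith [pow_le_pow_right₀ (show 1 ≤ R by linarith) (show 1 ≤ 3 by lia)])
  have hβ : |β| ≤ 2 * R ^ 3 := abs_be_le w hbk hp.hm hb0
  have hM : |t * (α * (emp s (fun o => hfun lam 0 0 o.2.1 o.2.2 (cv (U 0) o.1))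
      + emp s (fun o => hfun lam 2 0 o.2.1 o.2.2 (cv (U 0) o.1))
      - ψ * (emp s (fun o => hfun lam 1 0 o.2.1 o.2.2 (cv (U 0) o.1))
        + emp s (fun o => hfun lam 3 0 o.2.1 o.2.2 (cv (U 0) o.1))))
      + β * (emp s (fun o => hfun lam 0 1 o.2.1 o.2.2 (cv (U 0) o.1))
      + emp s (fun o => hfun lam 2 1 o.2.1 o.2.2 (cv (U 0) o.1))
      - ψ * (emp s (fun o => hfun lam 1 1 o.2.1 o.2.2 (cv (U 0) o.1))
        + emp s (fun o => hfun lam 3 1 o.2.1 o.2.2 (cv (U 0) o.1)))))| ≤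
      K1 * θ * (2 * R ^ 3 * (4 * (K * θ)) + 2 * R ^ 3 * (4 * (K * θ))) := by
    rw [abs_mul]
    refine mul_le_mul htK ((abs_add_le _ _).trans (add_le_add ?_ ?_)) (abs_nonneg _) (by positivity)
    · rw [abs_mul]; exact mul_le_mul hα (hE 0) (abs_nonneg _) (by positivity)
    · rw [abs_mul]; exact mul_le_mul hβ (hE 1) (abs_nonneg _) (by positivity)
  set C := 5 * R ^ 2 * (3 * R * (10 * R ^ 5)) ^ 2
  have ht2 : t ^ 2 ≤ K1 ^ 2 * θ ^ 2 := by
    rw [← mul_pow, ← sq_abs t]; exact pow_le_pow_left₀ (abs_nonneg _) htK 2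
  have hC : 0 ≤ C := by positivity
  have hCt := mul_le_mul_of_nonneg_left ht2 hC
  have hcomb := abs_comb_le hψ (ty 0) (ty 2) (ty 1) (ty 3)
  have e : ∀ G0 G1 G2 G3 H0 H1 H2 H3 p0 p1 p2 p3 q0 q1 q2 q3 : ℝ,
      G0 + G2 - ψ * (G1 + G3) - (H0 + H2 - ψ * (H1 + H3)) =
      (G0 - H0 - t * (α * p0 + β * q0)) + (G2 - H2 - t * (α * p2 + β * q2))
        - ψ * ((G1 - H1 - t * (α * p1 + β * q1)) + (G3 - H3 - t * (α * p3 + β * q3)))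
        + t * (α * (p0 + p2 - ψ * (p1 + p3)) + β * (q0 + q2 - ψ * (q1 + q3))) := by
    intros; ring
  rw [e]
  refine (abs_add_le _ _).trans ((add_le_add hcomb hM).trans ?_)
  have hθ2 : 0 ≤ θ ^ 2 := sq_nonneg θ
  nlinarith

end Fold

end WATE

/-! ### Linear expansion of the one-step estimator and its variance estimator on one fold. -/

namespace WATE

section Core

variable {d : ℕ} {P0 : Measure (Obs d)} [IsProbabilityMeasure P0] {lam : ℝ → ℝ} {b c k : ℝ}
  {Us : CNuis d}

theorem measurable_gfun_obs (w : Weight lam b c) (hbk : b < k) {U0 : CNuis d} (h0 : InBox k U0)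
    (j : Fin 4) : Measurable fun o : Obs d => gfun lam j o.2.1 o.2.2 (cv U0 o.1) :=
  measurable_obs_of_slices fun a y => measurable_gfun_cv w hbk h0 j a y

/-- The second use of orthogonality, now with u the estimate and v the truth: the bias of the
estimating function is quadratic in the L² nuisance error. -/
theorem exists_integral_mfun_le (w : Weight lam b c) (hbk : b < k) (hbox : InBox k Us)
    (hk : k < 1 / 2) (hU : IsNuisanceOf P0 Us.fn) :
    ∃ K, 1 ≤ K ∧ ∀ {U0 : CNuis d} {θ : ℝ}, InBox k U0 →
      ∫ o, dl (cv U0 o.1) (cv Us o.1) ^ 2 ∂P0 ≤ θ ^ 2 →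
      |∫ o, mfun lam (psi lam (margX P0) Us.fn) o.2.1 o.2.2 (cv U0 o.1) ∂P0| ≤ K * θ ^ 2 := by
  have hb := w.b_pos
  obtain ⟨-, hψ, -, hI⟩ := truth_facts (P0 := P0) w hbk hbox hk
  set ψ := psi lam (margX P0) Us.fn
  obtain ⟨B, hB1, hB⟩ := exists_bound_mfun w hbk
  obtain ⟨K, hK, orth⟩ := exists_orthogonality hb (by linarith) w.smooth hbk
  refine ⟨K + 1, by linarith, fun {U0 θ} h0 hd => ?_⟩
  have hk0 : 0 ≤ k := by linarith
  have hI0 := hI ψ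
  rw [sub_self, mul_zero] at hI0
  have hsb := fun x => Bx_mono hk0 (hbox.nv_mem x)
  have e : ∫ o, mfun lam ψ o.2.1 o.2.2 (cv U0 o.1) ∂P0 =
      ∫ o, sum4 (fun a y => pv (nv Us.fn o.1) a y * mfun lam ψ a y (cv U0 o.1)) ∂P0 :=
    hU.integral_eq (f := fun o => mfun lam ψ o.2.1 o.2.2 (cv U0 o.1)) hsb
      (measurable_mfun_nv w hbk h0 ψ) (fun o => hB _ hψ _ _ _ (h0.cv_mem _))
  have iM : Integrable (fun o : Obs d =>
      sum4 fun a y => pv (nv Us.fn o.1) a y * mfun lam ψ a y (cv U0 o.1)) P0 := by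
    refine integrable_of_bounded (B := B) ?_ fun o =>
      abs_sum4_pv_mul_le (hsb _) fun a y => hB _ hψ _ _ _ (h0.cv_mem _)
    exact (measurable_sum4 (f := fun x a y => pv (nv Us.fn x) a y * mfun lam ψ a y (cv U0 x))
      fun a y => (measurable_pv (U := Us.fn) Us.1.continuous.measurable
        Us.2.1.continuous.measurable Us.2.2.continuous.measurable a y).mul
        (continuous_mfun_nv w hbk h0 ψ a y).measurable).comp measurable_fst
  obtain ⟨Λ, hΛ⟩ := isCompact_Icc.exists_bound_of_continuousOn w.continuousOn
  have hUe : ∀ x, Us.fn.e x ∈ Icc b (1 - b) := fun x =>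
    ⟨hbk.le.trans (hbox x).2.2.1, (hbox x).2.2.2.trans (by linarith)⟩
  have mU : Measurable fun x => lam (Us.fn.e x) :=
    measurable_comp_of_continuousOn_Icc (by linarith) w.continuousOn
      Us.2.2.continuous.measurable hUe
  have iL : Integrable (fun o : Obs d => lam (Us.fn.e o.1) *
      (Us.fn.q1 o.1 - Us.fn.q0 o.1 - ψ)) P0 := by
    refine integrable_of_bounded (B := Λ * 2) ((mU.mul ((Us.1.continuous.measurable.sub
      Us.2.1.continuous.measurable).sub_const ψ)).comp measurable_fst) fun o => ?_
    rw [abs_mul]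
    exact mul_le_mul (hΛ _ (hUe _)) (abs_blip_sub_le (hsb _) hψ) (abs_nonneg _)
      ((norm_nonneg _).trans (hΛ _ (hUe o.1)))
  have idl : Integrable (fun o : Obs d => K * dl (cv U0 o.1) (cv Us o.1) ^ 2) P0 :=
    (integrable_of_bounded (((continuous_dl_cv U0 Us).measurable.comp measurable_fst).pow_const 2)
      (B := 3 ^ 2) fun o => by
        rw [abs_pow, Function.comp, abs_of_nonneg (dl_nonneg _ _)]
        exact pow_le_pow_left₀ (dl_nonneg _ _) (dl_cv_le_three hk0 h0 hbox _) 2).const_mul K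
  rw [e, ← sub_zero (∫ o, sum4 _ ∂P0), ← hI0, ← integral_sub iM iL]
  calc _ ≤ ∫ o, |sum4 (fun a y => pv (nv Us.fn o.1) a y * mfun lam ψ a y (cv U0 o.1)) -
            lam (Us.fn.e o.1) * (Us.fn.q1 o.1 - Us.fn.q0 o.1 - ψ)| ∂P0 :=
        abs_integral_le_integral_abs
    _ ≤ ∫ o, K * dl (cv U0 o.1) (cv Us o.1) ^ 2 ∂P0 :=
        integral_mono (iM.sub iL).abs idl fun o =>
          orth ψ hψ _ (Bx_mono hk0 (h0.cv_mem o.1)) (h0.cv_mem o.1).2.2 _ (hsb _) (hUe _)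
    _ ≤ K * θ ^ 2 := by rw [integral_const_mul]; exact mul_le_mul_of_nonneg_left hd hK
    _ ≤ _ := by nlinarith [sq_nonneg θ]

/-- These are the limits of the two averages forming the normalization of the estimating equation at
the root; their sum is Ω. -/
theorem integral_gfun_truth (w : Weight lam b c) (hbk : b < k) (hbox : InBox k Us)
    (hk : k < 1 / 2) (hU : IsNuisanceOf P0 Us.fn) :
    ∫ o, gfun lam 1 o.2.1 o.2.2 (cv Us o.1) ∂P0 = 0 ∧
      ∫ o, gfun lam 3 o.2.1 o.2.2 (cv Us o.1) ∂P0 = Omega lam (margX P0) Us.fn := by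
  obtain ⟨-, -, hO, -⟩ := truth_facts (P0 := P0) w hbk hbox hk
  obtain ⟨M, -, hM, -⟩ := exists_bound_gfun w hbk
  have hk0 : 0 ≤ k := w.b_pos.le.trans hbk.le
  refine ⟨?_, hO.symm⟩
  rw [hU.integral_eq (f := fun o => gfun lam 1 o.2.1 o.2.2 (cv Us o.1))
    (fun x => Bx_mono hk0 (hbox.nv_mem x)) (measurable_gfun_obs w hbk hbox 1)
    (fun o => hM _ _ _ _ (hbox.cv_mem _))]
  have e : ∀ o : Obs d,
      sum4 (fun a y => pv (nv Us.fn o.1) a y * gfun lam 1 a y (cv Us o.1)) = 0 := fun o => by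
    have := sum4_pv_gfun_one (lam := lam) (u := cv Us o.1) (v := cv Us o.1)
    rw [sub_self, mul_zero] at this
    exact this
  simp only [e, integral_zero]

set_option maxHeartbeats 1000000 in
/-- The one-step estimator and the variance estimator of one fold, in terms of the deviations of the
initial estimate. -/
theorem exists_fold_expansion {cinit : ℝ} (w : Weight lam b c) (hbk : b < k) (hbox : InBox k Us)
    (hk : k < 1 / 2) (hU : IsNuisanceOf P0 Us.fn) (hci : cinit ∈ Ioo (0 : ℝ) 1) :
    ∃ K ε0, 1 ≤ K ∧ 0 < ε0 ∧ ∀ {m : ℕ} {s : Fin m → Obs d} {U : ℝ → CNuis d} {θ : ℝ},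
      GoodPath lam b k c (tOne c) s U → Disc lam P0 Us (U 0) s θ → θ ≤ ε0 →
      cinit ≤ emp s (fun o => sum4 fun a y =>
        pv (cv (U 0) o.1) a y * Demp lam s (U 0) (o.1, a, y) ^ 2) →
      ∃ t ∈ Icc (-deltaInit c cinit) (deltaInit c cinit), emp s (Demp lam s (U t)) = 0 ∧
        (∀ r ∈ Icc (-deltaInit c cinit) (deltaInit c cinit),
          emp s (Demp lam s (U r)) = 0 → r = t) ∧
        |psi lam (empX s) (U t).fn - psi lam (margX P0) Us.fn -
          emp s (Dfull lam (margX P0) Us.fn)| ≤ K *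
          (|emp s (fun o => mfun lam (psi lam (margX P0) Us.fn) o.2.1 o.2.2 (cv (U 0) o.1)) -
            emp s (fun o => mfun lam (psi lam (margX P0) Us.fn) o.2.1 o.2.2 (cv Us o.1)) -
            ∫ o, mfun lam (psi lam (margX P0) Us.fn) o.2.1 o.2.2 (cv (U 0) o.1) ∂P0| + θ ^ 2) ∧
        |emp s (fun o => Dfull lam (empX s) (U t).fn o ^ 2) -
          ∫ o, Dfull lam (margX P0) Us.fn o ^ 2 ∂P0| ≤ K * θ := by
  have hb := w.b_pos
  have hk0 : 0 ≤ k := by linarith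
  obtain ⟨hO, hψ, -, -⟩ := truth_facts (P0 := P0) w hbk hbox hk
  obtain ⟨hg1, hg3⟩ := integral_gfun_truth w hbk hbox hk hU
  set ψ := psi lam (margX P0) Us.fn
  set Ω := Omega lam (margX P0) Us.fn
  have hc := w.c_pos
  have hΩ : 0 < Ω := hc.trans_le hO
  obtain ⟨M, hM1, hM, -, hMl⟩ := exists_bound_gfun w hbk
  obtain ⟨K1, ε1, hK1, hε1, hroot⟩ := exists_root w hbk hbox hU hci
  obtain ⟨hδ, hδT, -, -⟩ := deltaInit_bounds w hci
  obtain ⟨K2, hK2, hpath⟩ := exists_emp_mfun_path_le (T := tOne c) w hbk hbox hU K1 hK1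
  obtain ⟨K3, hK3, hint⟩ := exists_integral_mfun_le w hbk hbox hk hU
  have hR := w.R_ge
  set R := c⁻¹ with hRdef
  have hR1 : 1 ≤ R := by linarith
  have hΩR : Ω⁻¹ ≤ R := inv_anti₀ hc hO
  have hΩi : 0 < Ω⁻¹ := inv_pos.2 hΩ
  -- Lipschitz constant of the path
  obtain ⟨L, hL⟩ : ∃ x, x = 150 * R ^ 8 * K1 := ⟨_, rfl⟩
  have hL1 : 1 ≤ L := by
    have : 1 ≤ R ^ 8 := one_le_pow₀ hR1
    rw [hL]; nlinarith
  obtain ⟨K4, hK4⟩ : ∃ x, x = 2 * L + 2 + 2 * M := ⟨_, rfl⟩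
  have hK41 : 1 ≤ K4 := by linarith
  obtain ⟨K5, hK5⟩ : ∃ x, x = 2 * R * (K2 + K3 + 5) := ⟨_, rfl⟩
  have hK51 : 1 ≤ K5 := by rw [hK5]; nlinarith
  obtain ⟨B, hB⟩ : ∃ x, x = 4 * M := ⟨_, rfl⟩
  obtain ⟨K6, hK6⟩ : ∃ x, x = R * (4 * L + K5 * (2 * M)) + K4 * R * R * B := ⟨_, rfl⟩
  have hL0 : 0 ≤ L := by linarith
  have hK40 : 0 ≤ K4 := by linarith
  have hK50 : 0 ≤ K5 := by linarith
  have hB0 : 0 ≤ B := by rw [hB]; positivity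
  have hK60 : 0 ≤ K6 := by rw [hK6]; positivity
  obtain ⟨K7, hK7⟩ : ∃ x, x = K6 * (2 * (R * B)) + R * R * (1 + 2 * B * B) := ⟨_, rfl⟩
  have hK70 : 0 ≤ K7 := by rw [hK7]; positivity
  obtain ⟨K8, hK8⟩ : ∃ x, x = 2 * R * (1 + K2 + K3 + K4 * R) := ⟨_, rfl⟩
  have hK81 : 1 ≤ K8 := by
    have : 0 ≤ K2 + K3 + K4 * R := by positivity
    rw [hK8]; nlinarith
  -- The second bound on θ keeps the normalization N, which is within K4·θ of Ω ≥ c, above c/2.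
  refine ⟨K8 + K7, min ε1 (c / (2 * K4)), by linarith, lt_min hε1 (by positivity),
    fun {m s U θ} hp D hθ hcin => ?_⟩
  have hθ0 := D.nonneg
  have hθ1 := D.le_one
  have hK4e : K4 * θ = (2 * L + 2 + 2 * M) * θ := by rw [hK4]
  obtain ⟨t, ht, hz, htK, hun⟩ := hroot hp D (hθ.trans (min_le_left _ _)) hcin
  have htT : t ∈ Ioo (-tOne c) (tOne c) := ⟨by linarith [ht.1], by linarith [ht.2]⟩
  have h0T : (0 : ℝ) ∈ Ioo (-tOne c) (tOne c) := ⟨by linarith, by linarith⟩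
  have hb0 := hp.box 0 h0T
  have hbt := hp.box t htT
  have hθ2 : θ ^ 2 ≤ θ := by nlinarith
  have hK4θ : K4 * θ ≤ c / 2 := by
    have := mul_le_mul_of_nonneg_left (hθ.trans (min_le_right _ _)) (by linarith : 0 ≤ K4)
    have e : K4 * (c / (2 * K4)) = c / 2 := by field_simp
    linarith
  have hdl := fun f M' => abs_integral_le_of_le_dl (P0 := P0) hk0 hb0 hbox hθ0 D.dist (f := f)
    (M := M')
  -- pointwise movement along the path
  have hmove : ∀ (j : Fin 4) (o : Obs d), |gfun lam j o.2.1 o.2.2 (cv (U t) o.1) -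
      gfun lam j o.2.1 o.2.2 (cv (U 0) o.1)| ≤ L * θ := fun j o => by
    refine ((hp.coordBdd.bgfun j o).taylor htT).2.2.trans ?_
    have e : 5 * R ^ 2 * (3 * R * (10 * R ^ 5)) * |t| = 150 * R ^ 8 * |t| := by ring
    rw [← hRdef, e, hL, mul_assoc _ K1 θ]
    exact mul_le_mul_of_nonneg_left htK (by positivity)
  have hemove : ∀ j, |emp s (fun o => gfun lam j o.2.1 o.2.2 (cv (U t) o.1)) -
      emp s (fun o => gfun lam j o.2.1 o.2.2 (cv (U 0) o.1))| ≤ L * θ := fun j =>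
    abs_emp_sub_le s (by positivity) (hmove j)
  have hinti : ∀ {V : CNuis d} (j), InBox k V →
      Integrable (fun o => gfun lam j o.2.1 o.2.2 (cv V o.1)) P0 := fun j hV =>
    integrable_of_bounded (measurable_gfun_obs w hbk hV j) (B := M) fun o =>
      hM _ _ _ _ (hV.cv_mem _)
  have hgint : ∀ j, |∫ o, gfun lam j o.2.1 o.2.2 (cv (U 0) o.1) ∂P0 -
      ∫ o, gfun lam j o.2.1 o.2.2 (cv Us o.1) ∂P0| ≤ M * θ := fun j => by
    rw [← integral_sub (hinti j hb0) (hinti j hbox)]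
    exact hdl _ M (by linarith) fun o => hMl _ _ _ _ (hb0.cv_mem _) _ (hbox.cv_mem _)
  -- the normalization
  have hone : ∀ j, |emp s (fun o => gfun lam j o.2.1 o.2.2 (cv (U t) o.1)) -
      ∫ o, gfun lam j o.2.1 o.2.2 (cv Us o.1) ∂P0| ≤ (L + 1 + M) * θ := fun j => by
    have a1 := abs_le.1 (hemove j)
    have a2 := abs_le.1 (D.g j)
    have a3 := abs_le.1 (hgint j)
    exact abs_le.2 ⟨by linarith, by linarith⟩
  set N := emp s (fun o => gfun lam 1 o.2.1 o.2.2 (cv (U t) o.1))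
    + emp s (fun o => gfun lam 3 o.2.1 o.2.2 (cv (U t) o.1)) with hN
  have h3 := hone 3
  have h1 := hone 1
  rw [hg3] at h3
  rw [hg1, sub_zero] at h1
  have hNΩ : |N - Ω| ≤ K4 * θ := by
    have a1 := abs_le.1 h1
    have a3 := abs_le.1 h3
    exact abs_le.2 ⟨by linarith, by linarith⟩
  have hNc : c / 2 ≤ N := by linarith [(abs_le.1 hNΩ).1]
  have hNp : 0 < N := by linarith
  have hNi : N⁻¹ ≤ 2 * R := by
    rw [hRdef, ← div_eq_mul_inv, ← inv_div]
    exact inv_anti₀ (by positivity) hNc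
  -- the estimating function
  set E := emp s (fun o => mfun lam ψ o.2.1 o.2.2 (cv Us o.1)) with hE
  set E0 := emp s (fun o => mfun lam ψ o.2.1 o.2.2 (cv (U 0) o.1)) with hE0
  set J0 := ∫ o, mfun lam ψ o.2.1 o.2.2 (cv (U 0) o.1) ∂P0 with hJ0
  have hest := emp_mfun_eq_of_score w hbk hp.hm hbt hz ψ
  rw [← hN, ← psi_empX] at hest
  set ψt := psi lam (empX s) (U t).fn
  have hMt := hpath hp D htT htK hψ
  rw [hest, ← hE0] at hMt
  have hJ := hint hb0 D.dist
  rw [← hJ0] at hJ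
  have hEθ : |E| ≤ θ := D.truth
  have hD : ∀ o, Dfull lam (margX P0) Us.fn o = Ω⁻¹ * mfun lam ψ o.2.1 o.2.2 (cv Us o.1) :=
    fun o => Dfull_eq _ _ _ _
  have hDe : emp s (Dfull lam (margX P0) Us.fn) = Ω⁻¹ * E := by
    rw [hE, ← emp_const_mul]
    congr 1; funext o
    exact hD o
  have hΩE : |Ω⁻¹ * E| ≤ R * θ := by
    rw [abs_mul, abs_of_pos hΩi]
    exact mul_le_mul hΩR hEθ (abs_nonneg _) (by linarith)
  have hdivN : ∀ x y : ℝ, |x * N| ≤ y → |x| ≤ 2 * R * y := fun x y h => by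
    have e : x = N⁻¹ * (x * N) := by field_simp
    rw [e, abs_mul, abs_of_pos (inv_pos.2 hNp)]
    exact mul_le_mul hNi h (abs_nonneg _) (by positivity)
  have hlin : |ψt - ψ - emp s (Dfull lam (margX P0) Us.fn)| ≤
      K8 * (|E0 - E - J0| + θ ^ 2) := by
    have key : |(ψt - ψ - Ω⁻¹ * E) * N| ≤ |E0 - E - J0| + (K2 + K3 + K4 * R) * θ ^ 2 := by
      -- Four sources of error: the move along the path, the empirical process increment, the bias
      -- at the initial estimate, and the replacement of N by Ω. All but the second are O(θ²), the
      -- last as a product of two O(θ) terms.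
      have e : (ψt - ψ - Ω⁻¹ * E) * N = ((ψt - ψ) * N - E0) + (E0 - E - J0) + J0
          - (N - Ω) * (Ω⁻¹ * E) := by
        field_simp
        ring
      have h4 : |(N - Ω) * (Ω⁻¹ * E)| ≤ K4 * θ * (R * θ) := by
        rw [abs_mul]; exact mul_le_mul hNΩ hΩE (abs_nonneg _) (by positivity)
      rw [e]
      refine (abs_sub _ _).trans ((add_le_add ((abs_add_le _ _).trans (add_le_add
        ((abs_add_le _ _).trans (add_le_add hMt le_rfl)) hJ)) h4).trans (le_of_eq (by ring)))
    rw [hDe]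
    refine (hdivN _ _ key).trans ?_
    rw [hK8, mul_assoc (2 * R)]
    refine mul_le_mul_of_nonneg_left ?_ (by positivity)
    have y1 := abs_nonneg (E0 - E - J0)
    have y2 : 0 ≤ (K2 + K3 + K4 * R) * |E0 - E - J0| := by positivity
    nlinarith [sq_nonneg θ]
  -- A crude first-order bound is enough for the variance estimator; it comes from the deviations of
  -- the `gfun` averages and avoids the empirical process increment.
  have hψt : |ψt - ψ| ≤ K5 * θ := by
    have hE0b : |E0 - J0| ≤ 4 * θ := by
      have e : J0 = ∫ o, gfun lam 0 o.2.1 o.2.2 (cv (U 0) o.1) ∂P0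
          + ∫ o, gfun lam 2 o.2.1 o.2.2 (cv (U 0) o.1) ∂P0
          - ψ * (∫ o, gfun lam 1 o.2.1 o.2.2 (cv (U 0) o.1) ∂P0
            + ∫ o, gfun lam 3 o.2.1 o.2.2 (cv (U 0) o.1) ∂P0) := by
        have i := fun j => hinti (V := U 0) j hb0
        have i02 : Integrable (fun o => gfun lam 0 o.2.1 o.2.2 (cv (U 0) o.1)
          + gfun lam 2 o.2.1 o.2.2 (cv (U 0) o.1)) P0 := (i 0).add (i 2)
        have i13 : Integrable (fun o => ψ * (gfun lam 1 o.2.1 o.2.2 (cv (U 0) o.1)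
          + gfun lam 3 o.2.1 o.2.2 (cv (U 0) o.1))) P0 := ((i 1).add (i 3)).const_mul ψ
        rw [← integral_add (i 0) (i 2), ← integral_add (i 1) (i 3), ← integral_const_mul,
          ← integral_sub i02 i13]
        rfl
      have := abs_comb_le hψ (D.g 0) (D.g 2) (D.g 1) (D.g 3)
      rw [hE0, emp_mfun_eq, e]
      refine (le_of_eq ?_).trans this
      congr 1; ring
    have key : |(ψt - ψ) * N| ≤ (K2 + K3 + 5) * θ := by
      have a1 := abs_le.1 hMt
      have a2 := abs_le.1 hE0b
      have a3 := abs_le.1 hJ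
      have a4 := mul_le_mul_of_nonneg_left hθ2 (by linarith : 0 ≤ K2)
      have a5 := mul_le_mul_of_nonneg_left hθ2 (by linarith : 0 ≤ K3)
      exact abs_le.2 ⟨by linarith, by linarith⟩
    refine (hdivN _ _ key).trans (le_of_eq ?_)
    rw [hK5]; ring
  refine ⟨t, ht, hz, hun, hlin.trans ?_, ?_⟩
  · exact mul_le_mul_of_nonneg_right (le_add_of_nonneg_right hK70)
      (add_nonneg (abs_nonneg _) (sq_nonneg θ))
  -- the variance estimator
  have hmB : ∀ {V : CNuis d}, InBox k V → ∀ o : Obs d,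
      |mfun lam ψ o.2.1 o.2.2 (cv V o.1)| ≤ B := fun hV o =>
    (abs_comb_le hψ (hM _ _ _ _ (hV.cv_mem _)) (hM _ _ _ _ (hV.cv_mem _))
      (hM _ _ _ _ (hV.cv_mem _)) (hM _ _ _ _ (hV.cv_mem _))).trans_eq hB.symm
  have hal := al_pos w hbk hp.hm hbt (s := s)
  have halR : al lam s (U t) ≤ R := (le_abs_self _).trans (abs_al_le w hbk hp.hm hbt)
  have halΩ : |al lam s (U t) - Ω⁻¹| ≤ K4 * θ * R * R := by
    have hom := w.c_pos.trans_le (om_ge w hbk hp.hm hbt (s := s))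
    have e : al lam s (U t) - Ω⁻¹ = (Ω - om lam s (U t)) * al lam s (U t) * Ω⁻¹ := by
      rw [al]; field_simp
    rw [e, abs_mul, abs_mul, abs_of_pos hal, abs_of_pos hΩi]
    have h3' : |Ω - om lam s (U t)| ≤ K4 * θ := by
      rw [abs_sub_comm]
      refine (show |om lam s (U t) - Ω| ≤ _ from h3).trans ?_
      exact mul_le_mul_of_nonneg_right (by linarith) hθ0
    exact mul_le_mul (mul_le_mul h3' halR hal.le (by positivity)) hΩR hΩi.le (by positivity)
  -- The estimated influence function depends on the evaluation fold. It is compared pointwise with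
  -- a function that depends on the training fold only, for which a law of large numbers is
  -- available.
  have hpt : ∀ o, |Dfull lam (empX s) (U t).fn o -
      Ω⁻¹ * mfun lam ψ o.2.1 o.2.2 (cv (U 0) o.1)| ≤ K6 * θ := by
    intro o
    have eD : Dfull lam (empX s) (U t).fn o =
        al lam s (U t) * mfun lam ψt o.2.1 o.2.2 (cv (U t) o.1) := by
      rw [Dfull_eq, Omega_empX]; rfl
    have e : al lam s (U t) * mfun lam ψt o.2.1 o.2.2 (cv (U t) o.1) -
        Ω⁻¹ * mfun lam ψ o.2.1 o.2.2 (cv (U 0) o.1) =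
        al lam s (U t) * (((gfun lam 0 o.2.1 o.2.2 (cv (U t) o.1)
            - gfun lam 0 o.2.1 o.2.2 (cv (U 0) o.1)) + (gfun lam 2 o.2.1 o.2.2 (cv (U t) o.1)
            - gfun lam 2 o.2.1 o.2.2 (cv (U 0) o.1))
          - ψ * ((gfun lam 1 o.2.1 o.2.2 (cv (U t) o.1)
            - gfun lam 1 o.2.1 o.2.2 (cv (U 0) o.1)) + (gfun lam 3 o.2.1 o.2.2 (cv (U t) o.1)
            - gfun lam 3 o.2.1 o.2.2 (cv (U 0) o.1))))
          - (ψt - ψ) * (gfun lam 1 o.2.1 o.2.2 (cv (U t) o.1)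
            + gfun lam 3 o.2.1 o.2.2 (cv (U t) o.1)))
        + (al lam s (U t) - Ω⁻¹) * mfun lam ψ o.2.1 o.2.2 (cv (U 0) o.1) := by
      simp only [mfun]; ring
    have x1 := abs_comb_le hψ (hmove 0 o) (hmove 2 o) (hmove 1 o) (hmove 3 o)
    have x2 : |(ψt - ψ) * (gfun lam 1 o.2.1 o.2.2 (cv (U t) o.1)
        + gfun lam 3 o.2.1 o.2.2 (cv (U t) o.1))| ≤ K5 * θ * (M + M) := by
      rw [abs_mul]
      exact mul_le_mul hψt ((abs_add_le _ _).trans (add_le_add (hM _ _ _ _ (hbt.cv_mem _))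
        (hM _ _ _ _ (hbt.cv_mem _)))) (abs_nonneg _) (by positivity)
    have x3 : |(al lam s (U t) - Ω⁻¹) * mfun lam ψ o.2.1 o.2.2 (cv (U 0) o.1)| ≤
        K4 * θ * R * R * B := by
      rw [abs_mul]; exact mul_le_mul halΩ (hmB hb0 o) (abs_nonneg _) (by positivity)
    rw [eD, e]
    refine (abs_add_le _ _).trans ((add_le_add ?_ x3).trans_eq
      (show R * (4 * (L * θ) + K5 * θ * (M + M)) + K4 * θ * R * R * B = K6 * θ by rw [hK6]; ring))
    rw [abs_mul, abs_of_pos hal]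
    exact mul_le_mul halR ((abs_sub _ _).trans (add_le_add x1 x2)) (abs_nonneg _) (by linarith)
  have hsqd : ∀ x y C A : ℝ, |x - y| ≤ C → |x| ≤ A → |y| ≤ A → |x ^ 2 - y ^ 2| ≤ C * (2 * A) := by
    intro x y C A h hx hy
    have e : x ^ 2 - y ^ 2 = (x - y) * (x + y) := by ring
    rw [e, abs_mul]
    exact mul_le_mul h ((abs_add_le _ _).trans (by linarith)) (abs_nonneg _)
      ((abs_nonneg _).trans h)
  have hmBt : ∀ o : Obs d, |mfun lam ψt o.2.1 o.2.2 (cv (U t) o.1)| ≤ B := by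
    have hψt1 : |ψt| ≤ 1 := by
      have hom := w.c_pos.trans_le (om_ge w hbk hp.hm hbt (s := s))
      have e : ψt = nm lam s (U t) * (om lam s (U t))⁻¹ := psi_empX _ _ _
      rw [e, abs_mul, abs_of_pos (inv_pos.2 hom), ← div_eq_mul_inv, div_le_one hom]
      have : ∀ o : Obs d, |lam ((U t).2.2 o.1) * ((U t).1 o.1 - (U t).2.1 o.1)| ≤
          lam ((U t).2.2 o.1) := fun o => by
        have hl := w.pos (Ioo_subset_Icc_self (hbt.e_mem hbk o.1))
        rw [abs_mul, abs_of_pos hl]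
        exact mul_le_of_le_one_right hl.le (abs_tau_le hbt hk0 o.1)
      unfold nm om emp
      rw [abs_mul, abs_of_nonneg (by positivity : (0 : ℝ) ≤ 1 / (m : ℝ))]
      refine mul_le_mul_of_nonneg_left ((Finset.abs_sum_le_sum_abs _ _).trans
        (Finset.sum_le_sum fun i _ => this _)) (by positivity)
    exact fun o => (abs_comb_le hψt1 (hM _ _ _ _ (hbt.cv_mem _)) (hM _ _ _ _ (hbt.cv_mem _))
      (hM _ _ _ _ (hbt.cv_mem _)) (hM _ _ _ _ (hbt.cv_mem _))).trans_eq hB.symm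
  have s1 : |emp s (fun o => Dfull lam (empX s) (U t).fn o ^ 2) -
      emp s (fun o => (Ω⁻¹ * mfun lam ψ o.2.1 o.2.2 (cv (U 0) o.1)) ^ 2)| ≤
      K6 * θ * (2 * (R * B)) := by
    refine abs_emp_sub_le s (by positivity) fun o => hsqd _ _ _ _ (hpt o) ?_ ?_
    · rw [Dfull_eq, Omega_empX, abs_mul, abs_of_pos (show 0 < (om lam s (U t))⁻¹ from hal)]
      exact mul_le_mul halR (hmBt o) (abs_nonneg _) (by linarith)
    · rw [abs_mul, abs_of_pos hΩi]
      exact mul_le_mul hΩR (hmB hb0 o) (abs_nonneg _) (by linarith)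
  have s2 : |emp s (fun o => mfun lam ψ o.2.1 o.2.2 (cv (U 0) o.1) ^ 2) -
      ∫ o, mfun lam ψ o.2.1 o.2.2 (cv Us o.1) ^ 2 ∂P0| ≤ (1 + 2 * B * B) * θ := by
    have i : ∀ {V : CNuis d}, InBox k V →
        Integrable (fun o => mfun lam ψ o.2.1 o.2.2 (cv V o.1) ^ 2) P0 := fun hV =>
      integrable_of_bounded ((measurable_mfun_nv w hbk hV ψ).pow_const 2) (B := B ^ 2) fun o => by
        rw [abs_pow]; exact pow_le_pow_left₀ (abs_nonneg _) (hmB hV o) 2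
    have h2 : |∫ o, mfun lam ψ o.2.1 o.2.2 (cv (U 0) o.1) ^ 2 ∂P0 -
        ∫ o, mfun lam ψ o.2.1 o.2.2 (cv Us o.1) ^ 2 ∂P0| ≤ 2 * B * B * θ := by
      rw [← integral_sub (i hb0) (i hbox)]
      refine hdl _ (2 * B * B) (by positivity) fun o => ?_
      have hl := fun j => hMl j o.2.1 o.2.2 _ (hb0.cv_mem o.1) _ (hbox.cv_mem o.1)
      have hd : |mfun lam ψ o.2.1 o.2.2 (cv (U 0) o.1) - mfun lam ψ o.2.1 o.2.2 (cv Us o.1)| ≤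
          4 * (M * dl (cv (U 0) o.1) (cv Us o.1)) := by
        refine (le_of_eq ?_).trans (abs_comb_le hψ (hl 0) (hl 2) (hl 1) (hl 3))
        congr 1
        simp only [mfun]; ring
      refine (hsqd _ _ _ _ hd (hmB hb0 o) (hmB hbox o)).trans (le_of_eq ?_)
      rw [hB]; ring
    have a1 := abs_le.1 D.sq
    have a2 := abs_le.1 h2
    exact abs_le.2 ⟨by linarith, by linarith⟩
  have s3 : |emp s (fun o => (Ω⁻¹ * mfun lam ψ o.2.1 o.2.2 (cv (U 0) o.1)) ^ 2) -
      ∫ o, Dfull lam (margX P0) Us.fn o ^ 2 ∂P0| ≤ R * R * (1 + 2 * B * B) * θ := by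
    simp only [hD, mul_pow]
    rw [emp_const_mul, integral_const_mul, ← mul_sub, abs_mul, abs_of_pos (by positivity), sq,
      mul_assoc (R * R)]
    exact mul_le_mul (mul_le_mul hΩR hΩR hΩi.le (by linarith)) s2 (abs_nonneg _) (by positivity)
  have s4 := (abs_sub_le _ _ _).trans (add_le_add s1 s3)
  refine s4.trans ?_
  have e : K6 * θ * (2 * (R * B)) + R * R * (1 + 2 * B * B) * θ = K7 * θ := by rw [hK7]; ring
  rw [e]
  exact mul_le_mul_of_nonneg_right (by linarith) hθ0

end Core

end WATE

/-! ### From an abstract solution and root to the estimators of one fold. -/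

namespace WATE

section FoldCore

variable {d : ℕ} {P0 : Measure (Obs d)} [IsProbabilityMeasure P0] {lam : ℝ → ℝ} {b c k : ℝ}
  {Us : CNuis d}

/-- The estimator is defined through choices: a solution of the path equations and a zero of the
score. Every solution is a `GoodPath`, and the zero is unique, so the expansion applies to whatever
was chosen; in particular the fallback value 0 does not occur. -/
theorem exists_fold_bounds {cinit : ℝ} (w : Weight lam b c) (hbk : b < k)
    (hk2 : ∀ (U0 : CNuis d) (η : ℝ), Positivity lam U0 η → IsScale lam η c → k ≤ 2 * η)
    (hbox : InBox k Us) (hk : k < 1 / 2) (hU : IsNuisanceOf P0 Us.fn)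
    (hci : cinit ∈ Ioo (0 : ℝ) 1) :
    ∃ K ε0, 1 ≤ K ∧ 0 < ε0 ∧ ∀ {m : ℕ} {s : Fin m → Obs d} {U0 : CNuis d} {θ : ℝ}, 0 < m →
      GoodFold lam Us c cinit s U0 → Disc lam P0 Us U0 s θ → θ ≤ ε0 →
        |foldPsi lam Us c cinit s U0 - psi lam (margX P0) Us.fn -
          emp s (Dfull lam (margX P0) Us.fn)| ≤ K *
          (|emp s (fun o => mfun lam (psi lam (margX P0) Us.fn) o.2.1 o.2.2 (cv U0 o.1)) -
            emp s (fun o => mfun lam (psi lam (margX P0) Us.fn) o.2.1 o.2.2 (cv Us o.1)) -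
            ∫ o, mfun lam (psi lam (margX P0) Us.fn) o.2.1 o.2.2 (cv U0 o.1) ∂P0| + θ ^ 2) ∧
        |(1 / (m : ℝ)) * ∑ i, foldEIF lam Us c cinit s U0 i ^ 2 -
          ∫ o, Dfull lam (margX P0) Us.fn o ^ 2 ∂P0| ≤ K * θ := by
  obtain ⟨K, ε0, hK, hε0, H⟩ := exists_fold_expansion w hbk hbox hk hU hci
  refine ⟨K, ε0, hK, hε0, fun {m s U0 θ} hm hgood D hθ => ?_⟩
  obtain ⟨η, hp, hs, -, -, hcin, -⟩ := id hgood
  have hex := exists_isPath hm hp hs (s := s)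
  have hpathdef : foldPath lam Us c cinit s U0 = path lam c (empX s) U0 := if_pos hgood
  have hPdef : path lam c (empX s) U0 = hex.choose := dif_pos hex
  set U := foldPath lam Us c cinit s U0 with hUdef
  have hIs : IsPath lam c (empX s) U0 U := by
    rw [hpathdef, hPdef]; exact hex.choose_spec
  have hU0 : U 0 = U0 := hIs.1
  have hgp := goodPath_of_isPath hm w hbk hk2 hIs
  have hk0 : 0 ≤ k := w.b_pos.le.trans hbk.le
  have hT : 0 < tOne c := by
    have := w.c_pos
    unfold tOne; positivity
  have hb0 : InBox k U0 := hU0 ▸ hgp.box 0 ⟨by linarith, hT⟩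
  rw [integral_tildeP_empX s fun x => Bx_mono hk0 (hb0.cv_mem x)] at hcin
  simp only [Dstar_empX] at hcin
  obtain ⟨t, ht, hz, hun, h1, h2⟩ := H hgp (hU0.symm ▸ D) hθ (by rw [hU0]; exact hcin)
  obtain ⟨-, hδT, -, -⟩ := deltaInit_bounds w hci
  have hsub : ∀ r ∈ Icc (-deltaInit c cinit) (deltaInit c cinit),
      r ∈ Ioo (-tOne c) (tOne c) := fun r hr => ⟨by linarith [hr.1], by linarith [hr.2]⟩
  have hder : ∀ r ∈ Icc (-deltaInit c cinit) (deltaInit c cinit),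
      deriv (foldLoss lam Us c cinit s U0) r = emp s (Demp lam s (U r)) := fun r hr =>
    (hgp.hasDerivAt_loglik (hsub r hr)).deriv
  have hroot : RootFold lam Us c cinit s U0 :=
    ⟨hgood, t, ⟨ht, by rw [hder t ht]; exact hz⟩, fun r hr =>
      hun r hr.1 (by rw [← hder r hr.1]; exact hr.2)⟩
  have htime : foldTime lam Us c cinit s U0 = t := by
    -- The chosen zero and the constructed root agree by uniqueness.
    have e : foldTime lam Us c cinit s U0 = hroot.2.exists.choose := dif_pos hroot
    have hsp := hroot.2.exists.choose_spec
    rw [e]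
    exact hun _ hsp.1 (by rw [← hder _ hsp.1]; exact hsp.2)
  have htar : foldTarget lam Us c cinit s U0 = U t := by rw [foldTarget, htime]
  have hpsi : foldPsi lam Us c cinit s U0 = psi lam (empX s) (U t).fn := by
    rw [foldPsi, if_pos hroot, htar]
  have heif : ∀ i, foldEIF lam Us c cinit s U0 i = Dfull lam (empX s) (U t).fn (s i) := fun i => by
    rw [foldEIF, if_pos hroot, htar]
  rw [hU0] at h1
  rw [hpsi]
  refine ⟨h1, ?_⟩
  simp only [heif]
  exact h2

end FoldCore

end WATE

namespace WATE

/-! ### Events whose probability tends to one -/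

section Whp

variable {Ω : Type*} [MeasurableSpace Ω] {Pr : Measure Ω} {p q : ℕ → Ω → Prop}

/-- The events `p m` have (outer) probability tending to one. -/
def Whp (Pr : Measure Ω) (p : ℕ → Ω → Prop) : Prop :=
  Tendsto (fun m => Pr {ω | ¬ p m ω}) atTop (𝓝 0)

theorem Whp.mono (hp : Whp Pr p) (h : ∀ᶠ m in atTop, ∀ ω, p m ω → q m ω) : Whp Pr q :=
  tendsto_of_tendsto_of_tendsto_of_le_of_le' tendsto_const_nhds hp
    (Eventually.of_forall fun _ => zero_le)
    (h.mono fun m hm => measure_mono fun ω hω hpω => hω (hm ω hpω))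

theorem Whp.and (hp : Whp Pr p) (hq : Whp Pr q) : Whp Pr fun m ω => p m ω ∧ q m ω := by
  have h := hp.add hq
  rw [add_zero] at h
  refine tendsto_of_tendsto_of_tendsto_of_le_of_le tendsto_const_nhds h (fun _ => zero_le)
    fun m => (measure_mono fun ω hω => ?_).trans (measure_union_le _ _)
  by_contra hc
  simp only [mem_union, mem_ofPred_eq, not_or, not_not] at hc
  exact hω hc

theorem Whp.forall {ι : Type*} [Fintype ι] {p : ι → ℕ → Ω → Prop} (h : ∀ i, Whp Pr (p i)) :
    Whp Pr fun m ω => ∀ i, p i m ω := by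
  have hs : Tendsto (fun m => ∑ i, Pr {ω | ¬ p i m ω}) atTop (𝓝 (∑ _i : ι, 0)) :=
    tendsto_finsetSum _ fun i _ => h i
  rw [Finset.sum_const_zero] at hs
  refine tendsto_of_tendsto_of_tendsto_of_le_of_le tendsto_const_nhds hs (fun _ => zero_le)
    fun m => ?_
  refine (measure_mono fun ω hω => ?_).trans (measure_iUnion_fintype_le Pr _)
  simpa using hω

theorem tendstoInMeasure_of_whp {f : ℕ → Ω → ℝ} {r : ℝ}
    (h : ∀ ε > 0, Whp Pr fun m ω => |f m ω - r| < ε) :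
    TendstoInMeasure Pr f atTop fun _ => r := by
  rw [tendstoInMeasure_iff_norm]
  intro ε hε
  simpa only [Whp, not_lt, Real.norm_eq_abs] using h ε hε

theorem whp_of_tendstoInMeasure {f : ℕ → Ω → ℝ} {r : ℝ}
    (h : TendstoInMeasure Pr f atTop fun _ => r) {ε : ℝ} (hε : 0 < ε) :
    Whp Pr fun m ω => |f m ω - r| < ε := by
  rw [tendstoInMeasure_iff_norm] at h
  simpa only [Whp, not_lt, Real.norm_eq_abs] using h ε hε

end Whp

/-! ### The law of the folds -/

section Folds

variable {d : ℕ} {Ω : Type*} [MeasurableSpace Ω] {Pr : Measure Ω} [IsProbabilityMeasure Pr]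
  {O : ℕ → Ω → Obs d} {P0 : Measure (Obs d)} [IsProbabilityMeasure P0]

/-- The law of a sample of size `m`. -/
noncomputable abbrev sampleLaw (P0 : Measure (Obs d)) (m : ℕ) : Measure (Fin m → Obs d) :=
  Measure.pi fun _ => P0

theorem measurable_fold (hmeas : ∀ i, Measurable (O i)) (m : ℕ) (k : Fin 2) :
    Measurable (fold O m k) := measurable_pi_lambda _ fun _ => hmeas _

theorem map_fold (hmeas : ∀ i, Measurable (O i)) (hindep : iIndepFun O Pr)
    (hlaw : ∀ i, Pr.map (O i) = P0) (m : ℕ) (k : Fin 2) :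
    Pr.map (fold O m k) = sampleLaw P0 m := by
  have hinj : Function.Injective fun i : Fin m => k.val * m + i.val := fun i j h => by
    have : k.val * m + i.val = k.val * m + j.val := h
    exact Fin.ext (by lia)
  have h := (iIndepFun_iff_map_fun_eq_pi_map fun i : Fin m =>
    (hmeas (k.val * m + i.val)).aemeasurable).1 (hindep.precomp hinj)
  simp only [hlaw] at h
  exact h

/-- The two folds use disjoint blocks of indices. -/
theorem indepFun_fold (hmeas : ∀ i, Measurable (O i)) (hindep : iIndepFun O Pr) (m : ℕ)
    (k : Fin 2) : IndepFun (fold O m (1 - k)) (fold O m k) Pr := by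
  have hr : ∀ (j : Fin 2) (i : Fin m), j.val * m + i.val ∈ Finset.Ico (j.val * m)
      (j.val * m + m) := fun j i => Finset.mem_Ico.2 ⟨by lia, by lia⟩
  have hdis : Disjoint (Finset.Ico ((1 - k).val * m) ((1 - k).val * m + m))
      (Finset.Ico (k.val * m) (k.val * m + m)) := by
    rw [Finset.disjoint_left]
    intro x hx hy
    rw [Finset.mem_Ico] at hx hy
    fin_cases k <;> simp at hx hy <;> lia
  have h := hindep.indepFun_finset _ _ hdis hmeas
  exact h.comp (φ := fun x (i : Fin m) => x ⟨(1 - k).val * m + i.val, hr _ i⟩)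
    (ψ := fun x (i : Fin m) => x ⟨k.val * m + i.val, hr _ i⟩)
    (measurable_pi_lambda _ fun i => measurable_pi_apply _)
    (measurable_pi_lambda _ fun i => measurable_pi_apply _)

theorem map_fold_prod (hmeas : ∀ i, Measurable (O i)) (hindep : iIndepFun O Pr)
    (hlaw : ∀ i, Pr.map (O i) = P0) (m : ℕ) (k : Fin 2) :
    Pr.map (fun ω => (fold O m (1 - k) ω, fold O m k ω)) =
      (sampleLaw P0 m).prod (sampleLaw P0 m) := by
  rw [(indepFun_iff_map_prod_eq_prod_map_map (measurable_fold hmeas m _).aemeasurable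
    (measurable_fold hmeas m _).aemeasurable).1 (indepFun_fold hmeas hindep m k),
    map_fold hmeas hindep hlaw, map_fold hmeas hindep hlaw]

end Folds

/-! ### Chebyshev's inequality with an independent training sample -/

section Chebyshev

variable {d m : ℕ} {P0 : Measure (Obs d)} [IsProbabilityMeasure P0]

theorem integral_eval_sampleLaw {f : Obs d → ℝ} (hf : Measurable f) (i : Fin m) :
    ∫ s, f (s i) ∂(sampleLaw P0 m) = ∫ o, f o ∂P0 := by
  have h := (measurePreserving_eval (fun _ : Fin m => P0) i).map_eq
  conv_rhs => rw [← h]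
  rw [integral_map (measurable_pi_apply i).aemeasurable hf.aestronglyMeasurable]

theorem measurable_emp {f : Obs d → ℝ} (hf : Measurable f) :
    Measurable fun s : Fin m → Obs d => emp s f := by
  unfold emp
  exact (Finset.measurable_fun_sum _ fun i _ => hf.comp (measurable_pi_apply i)).const_mul _

/-- Chebyshev, with the variance bounded by the second moment: for small increments the second
moment is what the nuisance error controls. -/
theorem sampleLaw_deviation_le (hm : 0 < m) {f : Obs d → ℝ} (hf : Measurable f) {M : ℝ}
    (hM : ∀ o, |f o| ≤ M) {a : ℝ} (ha : 0 < a) :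
    sampleLaw P0 m {s | a ≤ |emp s f - ∫ o, f o ∂P0|} ≤
      ENNReal.ofReal ((∫ o, f o ^ 2 ∂P0) / (m * a ^ 2)) := by
  have hm' : (0 : ℝ) < m := by exact_mod_cast hm
  have hL2 : MemLp f 2 P0 := MemLp.of_bound hf.aestronglyMeasurable M (Eventually.of_forall hM)
  have hint : ∀ i : Fin m, Integrable (fun s : Fin m → Obs d => f (s i)) (sampleLaw P0 m) :=
    fun i => integrable_of_bounded (hf.comp (measurable_pi_apply i)) fun s => hM _
  have hmean : ∫ s, emp s f ∂(sampleLaw P0 m) = ∫ o, f o ∂P0 := by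
    unfold emp
    rw [integral_const_mul, integral_finsetSum _ fun i _ => hint i]
    simp only [integral_eval_sampleLaw hf]
    simp
    field_simp
  have hemp : MemLp (fun s : Fin m → Obs d => emp s f) 2 (sampleLaw P0 m) := by
    obtain ⟨o⟩ : Nonempty (Obs d) := ⟨(fun _ => 0, true, true)⟩
    exact MemLp.of_bound (measurable_emp hf).aestronglyMeasurable M
      (Eventually.of_forall fun s => abs_emp_le s ((abs_nonneg _).trans (hM o)) hM)
  have hvar : variance (fun s : Fin m → Obs d => emp s f) (sampleLaw P0 m) ≤
      (∫ o, f o ^ 2 ∂P0) / m := by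
    have h1 := variance_sum_pi (μ := fun _ : Fin m => P0) (X := fun _ => f) fun _ => hL2
    have e : (fun s : Fin m → Obs d => emp s f) =
        fun s => (1 / (m : ℝ)) * (∑ i, fun s : Fin m → Obs d => f (s i)) s := by
      funext s
      simp [emp]
    rw [e, variance_const_mul, h1]
    have h2 := variance_le_expectation_sq (μ := P0) hf.aestronglyMeasurable
    simp only [Finset.sum_const, Finset.card_univ, Fintype.card_fin, nsmul_eq_mul]
    simp only [Pi.pow_apply] at h2
    have e2 : (1 / (m : ℝ)) ^ 2 * (m * variance f P0) = variance f P0 / m := by field_simp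
    rw [e2]
    gcongr
  have h := meas_ge_le_variance_div_sq hemp ha
  rw [hmean] at h
  refine h.trans (ENNReal.ofReal_le_ofReal ?_)
  rw [← div_div]
  gcongr

theorem measurable_emp_uncurry {F : (Fin m → Obs d) → Obs d → ℝ}
    (hF : Measurable (Function.uncurry F)) :
    Measurable fun p : (Fin m → Obs d) × (Fin m → Obs d) => emp p.2 (F p.1) := by
  unfold emp
  refine (Finset.measurable_fun_sum _ fun i _ => ?_).const_mul _
  exact hF.comp (measurable_fst.prodMk ((measurable_pi_apply i).comp measurable_snd))

theorem measurable_integral_uncurry {α β : Type*} [MeasurableSpace α] [MeasurableSpace β]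
    {P : Measure β} [SFinite P] {F : α → β → ℝ} (hF : Measurable (Function.uncurry F)) :
    Measurable fun u => ∫ o, F u o ∂P :=
  (StronglyMeasurable.integral_prod_right hF.stronglyMeasurable).measurable

/-- Conditioning on the training sample is Fubini's theorem for the product of the two sample laws.
-/
theorem crossfit_deviation_le (hm : 0 < m) {F : (Fin m → Obs d) → Obs d → ℝ}
    (hF : Measurable (Function.uncurry F)) {M : ℝ} (hM : ∀ u o, |F u o| ≤ M) {a : ℝ}
    (ha : 0 < a) :
    ((sampleLaw P0 m).prod (sampleLaw P0 m))
        {p | a ≤ |emp p.2 (F p.1) - ∫ o, F p.1 o ∂P0|} ≤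
      ∫⁻ u, ENNReal.ofReal ((∫ o, F u o ^ 2 ∂P0) / (m * a ^ 2)) ∂(sampleLaw P0 m) := by
  have hms : MeasurableSet {p : (Fin m → Obs d) × (Fin m → Obs d) |
      a ≤ |emp p.2 (F p.1) - ∫ o, F p.1 o ∂P0|} :=
    measurableSet_le measurable_const (((measurable_emp_uncurry hF).sub
      ((measurable_integral_uncurry hF).comp measurable_fst)).abs)
  rw [Measure.prod_apply hms]
  exact lintegral_mono fun u =>
    sampleLaw_deviation_le hm (hF.comp (measurable_const.prodMk measurable_id)) (hM u) ha

end Chebyshev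

end WATE

namespace WATE

/-! ### Cross-fitted empirical averages -/

/-- Measurability and range of a nuisance estimator. -/
structure RegularEstimator {d : ℕ} (est : Estimator d) : Prop where
  meas : ∀ n x, Measurable (fun s => (est n s).fn.q1 x) ∧
    Measurable (fun s => (est n s).fn.q0 x) ∧ Measurable (fun s => (est n s).fn.e x)
  mem : ∀ n s x, (est n s).fn.q1 x ∈ Icc (0 : ℝ) 1 ∧
    (est n s).fn.q0 x ∈ Icc (0 : ℝ) 1 ∧ (est n s).fn.e x ∈ Icc (0 : ℝ) 1

/-- The observations are independent with law `P0`. -/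
structure IIDSample {d : ℕ} {Ω : Type*} [MeasurableSpace Ω] (Pr : Measure Ω) (O : ℕ → Ω → Obs d)
    (P0 : Measure (Obs d)) : Prop where
  meas : ∀ i, Measurable (O i)
  indep : iIndepFun O Pr
  law : ∀ i, Pr.map (O i) = P0

section CrossFit

variable {d : ℕ} {P0 : Measure (Obs d)} [IsProbabilityMeasure P0] {est : Estimator d} {k : ℝ}
  {Us : CNuis d}

/-- `Φ(A, Y; ·)` at the estimated and the true nuisance values, truncated to values in the box. -/
noncomputable def tfun (k : ℝ) (est : Estimator d) (Us : CNuis d)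
    (Φ : Bool → Bool → (ℝ × ℝ × ℝ) × ℝ × ℝ × ℝ → ℝ) (m : ℕ) (u : Fin m → Obs d) (o : Obs d) : ℝ :=
  (Bx k ×ˢ Bx k).indicator (Φ o.2.1 o.2.2) (cv (est m u) o.1, cv Us o.1)

theorem measurable_cv_est (he : RegularEstimator est) (m : ℕ) :
    Measurable fun p : (Fin m → Obs d) × Obs d => cv (est m p.1) p.2.1 := by
  have h := measurable_uncurry_of_continuous_of_measurable
    (u := fun (x : Cov d) (u : Fin m → Obs d) => cv (est m u) x)
    (fun u => continuous_cv (est m u))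
    (fun x => (he.meas m x).1.prodMk ((he.meas m x).2.1.prodMk (he.meas m x).2.2))
  exact h.comp ((measurable_fst.comp measurable_snd).prodMk measurable_fst)

theorem measurable_tfun (he : RegularEstimator est) {Φ : Bool → Bool → (ℝ × ℝ × ℝ) × ℝ × ℝ × ℝ → ℝ}
    (hΦ : ∀ a y, ContinuousOn (Φ a y) (Bx k ×ˢ Bx k)) (m : ℕ) :
    Measurable (Function.uncurry (tfun k est Us Φ m)) := by
  have hms : MeasurableSet (Bx k ×ˢ Bx k) :=
    ((isCompact_Bx k).prod (isCompact_Bx k)).isClosed.measurableSet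
  have hs : Measurable fun q : ((ℝ × ℝ × ℝ) × ℝ × ℝ × ℝ) × Bool × Bool =>
      (Bx k ×ˢ Bx k).indicator (Φ q.2.1 q.2.2) q.1 := by
    refine measurable_from_prod_countable_left fun ay => ?_
    classical
    have h : Measurable ((Bx k ×ˢ Bx k).piecewise (Φ ay.1 ay.2) fun _ => 0) :=
      (hΦ ay.1 ay.2).measurable_piecewise (g := fun _ => (0 : ℝ)) continuousOn_const hms
    convert h using 1
    funext x
    simp only [piecewise, indicator]
  have h2 : Measurable fun p : (Fin m → Obs d) × Obs d => cv Us p.2.1 :=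
    (continuous_cv Us).measurable.comp (measurable_fst.comp measurable_snd)
  exact hs.comp (((measurable_cv_est he m).prodMk h2).prodMk
    (measurable_snd.comp measurable_snd))

theorem exists_bound_tfun {Φ : Bool → Bool → (ℝ × ℝ × ℝ) × ℝ × ℝ × ℝ → ℝ}
    (hΦ : ∀ a y, ContinuousOn (Φ a y) (Bx k ×ˢ Bx k)) :
    ∃ M, 0 ≤ M ∧ ∀ m u o, |tfun k est Us Φ m u o| ≤ M := by
  choose M hM using fun (p : Bool × Bool) =>
    ((isCompact_Bx k).prod (isCompact_Bx k)).exists_bound_of_continuousOn (hΦ p.1 p.2)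
  have hnn : 0 ≤ ∑ p, |M p| := Finset.sum_nonneg fun p _ => abs_nonneg _
  refine ⟨∑ p, |M p|, hnn, fun m u o => ?_⟩
  unfold tfun
  by_cases h : (cv (est m u) o.1, cv Us o.1) ∈ Bx k ×ˢ Bx k
  · rw [indicator_of_mem h]
    exact (hM (o.2.1, o.2.2) _ h).trans ((le_abs_self _).trans
      (Finset.single_le_sum (f := fun p => |M p|) (fun p _ => abs_nonneg _) (Finset.mem_univ _)))
  · rw [indicator_of_notMem h, abs_zero]; exact hnn

/-- Chebyshev needs functions that are measurable and bounded for every training sample, while the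
building blocks are controlled only on the box; on the good event the truncation has no effect. -/
theorem tfun_eq {Φ : Bool → Bool → (ℝ × ℝ × ℝ) × ℝ × ℝ × ℝ → ℝ} {m : ℕ} {u : Fin m → Obs d}
    (h0 : InBox k (est m u)) (hs : InBox k Us) :
    tfun k est Us Φ m u = fun o => Φ o.2.1 o.2.2 (cv (est m u) o.1, cv Us o.1) :=
  funext fun o => indicator_of_mem (mk_mem_prod (h0.cv_mem _) (hs.cv_mem _)) _

variable {Ω : Type*} [MeasurableSpace Ω] {Pr : Measure Ω} [IsProbabilityMeasure Pr]
  {O : ℕ → Ω → Obs d}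

theorem whp_crossfit (hO : IIDSample Pr O P0) {F : (m : ℕ) → (Fin m → Obs d) → Obs d → ℝ}
    (hF : ∀ m, Measurable (Function.uncurry (F m))) {M : ℝ} (hM : ∀ m u o, |F m u o| ≤ M)
    {a : ℕ → ℝ} (ha : ∀ m, 0 < m → 0 < a m)
    (hlim : Tendsto (fun m : ℕ => ∫⁻ u, ENNReal.ofReal ((∫ o, F m u o ^ 2 ∂P0) / (m * a m ^ 2))
      ∂(sampleLaw P0 m)) atTop (𝓝 0)) (j : Fin 2) :
    Whp Pr fun m ω => |emp (fold O m j ω) (F m (fold O m (1 - j) ω)) -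
      ∫ o, F m (fold O m (1 - j) ω) o ∂P0| ≤ a m := by
  refine tendsto_of_tendsto_of_tendsto_of_le_of_le' tendsto_const_nhds hlim
    (Eventually.of_forall fun _ => zero_le) ?_
  filter_upwards [eventually_gt_atTop 0] with m hm
  refine le_trans ?_ (crossfit_deviation_le hm (hF m) (hM m) (ha m hm))
  have hms : MeasurableSet {p : (Fin m → Obs d) × (Fin m → Obs d) |
      a m ≤ |emp p.2 (F m p.1) - ∫ o, F m p.1 o ∂P0|} :=
    measurableSet_le measurable_const (((measurable_emp_uncurry (hF m)).sub
      ((measurable_integral_uncurry (hF m)).comp measurable_fst)).abs)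
  rw [← map_fold_prod hO.meas hO.indep hO.law m j, Measure.map_apply
    ((measurable_fold hO.meas m _).prodMk (measurable_fold hO.meas m _)) hms]
  exact measure_mono fun ω hω => (not_le.1 hω).le

/-- The variance is O(1/m) and the squared threshold is κ²m^{-1/2}, so the exceptional probability
is O(m^{-1/2}). -/
theorem whp_deviation (hO : IIDSample Pr O P0) (he : RegularEstimator est) (hbox : InBox k Us) {Φ : Bool → Bool → (ℝ × ℝ × ℝ) × ℝ × ℝ × ℝ → ℝ}
    (hΦ : ∀ a y, ContinuousOn (Φ a y) (Bx k ×ˢ Bx k)) {κ : ℝ} (hκ : 0 < κ) (j : Fin 2) :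
    Whp Pr fun m ω => InBox k (initEst est O m (1 - j) ω) →
      |emp (fold O m j ω) (fun o => Φ o.2.1 o.2.2 (cv (initEst est O m (1 - j) ω) o.1, cv Us o.1)) -
        ∫ o, Φ o.2.1 o.2.2 (cv (initEst est O m (1 - j) ω) o.1, cv Us o.1) ∂P0| ≤
          κ / (m : ℝ) ^ (1 / 4 : ℝ) := by
  obtain ⟨M, hM0, hM⟩ := exists_bound_tfun (est := est) (Us := Us) hΦ
  have hlim : Tendsto (fun m : ℕ => ENNReal.ofReal (M ^ 2 / κ ^ 2 * ((m : ℝ) ^ (1 / 2 : ℝ))⁻¹))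
      atTop (𝓝 0) := by
    rw [← ENNReal.ofReal_zero]
    refine ENNReal.tendsto_ofReal ?_
    have h := (tendsto_rpow_atTop (y := (1 / 2 : ℝ)) (by norm_num)).comp
      tendsto_natCast_atTop_atTop
    simpa using h.inv_tendsto_atTop.const_mul (M ^ 2 / κ ^ 2)
  have h := whp_crossfit hO (F := tfun k est Us Φ)
    (measurable_tfun he hΦ) hM (a := fun m => κ / (m : ℝ) ^ (1 / 4 : ℝ))
    (fun m hm => div_pos hκ (Real.rpow_pos_of_pos (by exact_mod_cast hm) _)) ?_ j
  · refine h.mono (Eventually.of_forall fun m ω hω hb => ?_)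
    rwa [tfun_eq hb hbox] at hω
  · refine tendsto_of_tendsto_of_tendsto_of_le_of_le' tendsto_const_nhds hlim
      (Eventually.of_forall fun _ => zero_le) ?_
    filter_upwards [eventually_gt_atTop 0] with m hm
    have hm' : (0 : ℝ) < m := by exact_mod_cast hm
    refine (lintegral_mono (g := fun _ => ENNReal.ofReal (M ^ 2 / κ ^ 2 *
      ((m : ℝ) ^ (1 / 2 : ℝ))⁻¹)) fun u => ENNReal.ofReal_le_ofReal ?_).trans (by simp)
    have e : (m : ℝ) * (κ / (m : ℝ) ^ (1 / 4 : ℝ)) ^ 2 = κ ^ 2 * (m : ℝ) ^ (1 / 2 : ℝ) := by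
      rw [div_pow, ← Real.rpow_natCast, ← Real.rpow_natCast, ← Real.rpow_mul hm'.le]
      have : (m : ℝ) = (m : ℝ) ^ (1 / 2 : ℝ) * (m : ℝ) ^ (1 / 2 : ℝ) := by
        rw [← Real.rpow_add hm']; norm_num
      norm_num
      rw [mul_div_assoc', mul_comm, div_eq_iff (Real.rpow_pos_of_pos hm' _).ne']
      norm_num at this
      linear_combination κ ^ 2 * this
    have hsq : ∫ o, tfun k est Us Φ m u o ^ 2 ∂P0 ≤ M ^ 2 := by
      refine (integral_mono_of_nonneg (Eventually.of_forall fun o => sq_nonneg _)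
        (integrable_const (M ^ 2)) (Eventually.of_forall fun o => ?_)).trans (by simp)
      exact sq_le_sq' (abs_le.1 (hM m u o)).1 (abs_le.1 (hM m u o)).2
    rw [e, ← div_div, div_eq_mul_inv _ ((m : ℝ) ^ (1 / 2 : ℝ))]
    gcongr

/-- The squared `L²` distance of the estimated nuisance values to the true ones. -/
noncomputable def dsq (P0 : Measure (Obs d)) (est : Estimator d) (Us : CNuis d) (m : ℕ)
    (u : Fin m → Obs d) : ℝ :=
  ∫ o, dl (cv (est m u) o.1) (cv Us o.1) ^ 2 ∂P0

theorem measurable_dl_est (he : RegularEstimator est) (m : ℕ) : Measurable fun p : (Fin m → Obs d) × Obs d =>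
    dl (cv (est m p.1) p.2.1) (cv Us p.2.1) :=
  measurable_dl.comp ((measurable_cv_est he m).prodMk
    ((continuous_cv Us).measurable.comp (measurable_fst.comp measurable_snd)))

theorem measurable_dsq (he : RegularEstimator est) (m : ℕ) : Measurable (dsq P0 est Us m) :=
  measurable_integral_uncurry (F := fun u (o : Obs d) => dl (cv (est m u) o.1) (cv Us o.1) ^ 2)
    ((measurable_dl_est he m).pow_const 2)

theorem inBox_zero_est (he : RegularEstimator est) (m : ℕ) (u : Fin m → Obs d) : InBox 0 (est m u) := fun x => by
  have := he.mem m u x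
  simpa [CNuis.fn] using this

theorem dsq_le_nine (he : RegularEstimator est) (hs : InBox 0 Us) (m : ℕ) (u : Fin m → Obs d) : dsq P0 est Us m u ≤ 9 := by
  have h3 := dl_cv_le_three le_rfl (inBox_zero_est he m u) hs
  have h : ∫ o, dl (cv (est m u) o.1) (cv Us o.1) ^ 2 ∂P0 ≤ ∫ _o, (9 : ℝ) ∂P0 := by
    refine integral_mono_of_nonneg (Eventually.of_forall fun o => sq_nonneg _)
      (integrable_const _) (Eventually.of_forall fun o => ?_)
    have := h3 o.1
    have := dl_nonneg (cv (est m u) o.1) (cv Us o.1)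
    show _ ^ 2 ≤ (9 : ℝ)
    nlinarith
  simpa [dsq] using h

theorem l2norm_sq {Q : Measure (Cov d)} [IsFiniteMeasure Q] {f : Cov d → ℝ} (hf : Continuous f) :
    l2norm Q f ^ 2 = ∫ x, f x ^ 2 ∂Q := by
  obtain ⟨B, hB⟩ := isCompact_univ.exists_bound_of_continuousOn hf.continuousOn
  have hL : MemLp f 2 Q := MemLp.of_bound hf.aestronglyMeasurable B
    (Eventually.of_forall fun x => hB x (mem_univ _))
  rw [l2norm, hL.eLpNorm_eq_integral_rpow_norm two_ne_zero ENNReal.ofNat_ne_top,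
    ENNReal.toReal_ofReal (Real.rpow_nonneg (integral_nonneg fun _ => by positivity) _)]
  simp only [ENNReal.toReal_ofNat, Real.rpow_ofNat, Real.norm_eq_abs, sq_abs]
  rw [← one_div, ← Real.sqrt_eq_rpow, Real.sq_sqrt (integral_nonneg fun _ => sq_nonneg _)]

theorem dsq_le (m : ℕ) (u : Fin m → Obs d) : dsq P0 est Us m u ≤
    3 * (l2norm (margX P0) (fun x => (est m u).fn.q1 x - Us.fn.q1 x) ^ 2 +
      l2norm (margX P0) (fun x => (est m u).fn.q0 x - Us.fn.q0 x) ^ 2 +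
      l2norm (margX P0) (fun x => (est m u).fn.e x - Us.fn.e x) ^ 2) := by
  have c1 : Continuous fun x => (est m u).fn.q1 x - Us.fn.q1 x :=
    (est m u).1.continuous.sub Us.1.continuous
  have c0 : Continuous fun x => (est m u).fn.q0 x - Us.fn.q0 x :=
    (est m u).2.1.continuous.sub Us.2.1.continuous
  have ce : Continuous fun x => (est m u).fn.e x - Us.fn.e x :=
    (est m u).2.2.continuous.sub Us.2.2.continuous
  have hI : ∀ {f : Cov d → ℝ}, Continuous f → Integrable (fun o : Obs d => f o.1 ^ 2) P0 :=
    fun {f} hf => by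
      obtain ⟨B, hB⟩ := isCompact_univ.exists_bound_of_continuousOn (hf.pow 2).continuousOn
      exact integrable_of_bounded ((hf.pow 2).measurable.comp measurable_fst)
        fun o => hB o.1 (mem_univ _)
  have e : ∀ {f : Cov d → ℝ}, Continuous f → l2norm (margX P0) f ^ 2 = ∫ o, f o.1 ^ 2 ∂P0 :=
    fun {f} hf => (l2norm_sq hf).trans (integral_margX (hf.pow 2).measurable)
  have i2 : Integrable (fun o : Obs d => ((est m u).fn.q1 o.1 - Us.fn.q1 o.1) ^ 2 +
      ((est m u).fn.q0 o.1 - Us.fn.q0 o.1) ^ 2) P0 := (hI c1).add (hI c0)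
  rw [e c1, e c0, e ce, ← integral_add (hI c1) (hI c0), ← integral_add i2 (hI ce),
    ← integral_const_mul]
  refine integral_mono_of_nonneg (Eventually.of_forall fun o => sq_nonneg _)
    ((i2.add (hI ce)).const_mul 3) (Eventually.of_forall fun o => ?_)
  refine (dl_sq_le _ _).trans_eq ?_
  simp only [cv, CNuis.fn]
  ring

/-- The rates are assumed for the estimator computed from the first observations, that is from fold
0. Phrasing them under the law of a sample makes them available for the other fold as well. -/
theorem tendsto_dsq (hO : IIDSample Pr O P0) (he : RegularEstimator est)
    (h1 : IsLittleOpQuarter Pr fun n ω => l2norm (margX P0)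
      fun x => (est n fun i => O i ω).fn.q1 x - Us.fn.q1 x)
    (h0 : IsLittleOpQuarter Pr fun n ω => l2norm (margX P0)
      fun x => (est n fun i => O i ω).fn.q0 x - Us.fn.q0 x)
    (h2 : IsLittleOpQuarter Pr fun n ω => l2norm (margX P0)
      fun x => (est n fun i => O i ω).fn.e x - Us.fn.e x) {κ : ℝ} (hκ : 0 < κ) :
    Tendsto (fun m => sampleLaw P0 m {u | ¬ dsq P0 est Us m u ≤ (κ / (m : ℝ) ^ (1 / 4 : ℝ)) ^ 2})
      atTop (𝓝 0) := by
  have hκ3 : 0 < κ / 3 := by positivity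
  have h := ((whp_of_tendstoInMeasure h1 hκ3).and (whp_of_tendstoInMeasure h0 hκ3)).and
    (whp_of_tendstoInMeasure h2 hκ3)
  have hw : Whp Pr fun m ω => dsq P0 est Us m (fold O m 0 ω) ≤
      (κ / (m : ℝ) ^ (1 / 4 : ℝ)) ^ 2 := by
    refine h.mono ((eventually_gt_atTop 0).mono fun m hm ω ⟨⟨b1, b0⟩, b2⟩ => ?_)
    have hr : 0 < (m : ℝ) ^ (1 / 4 : ℝ) := Real.rpow_pos_of_pos (by exact_mod_cast hm) _
    have hf : fold O m 0 ω = fun i : Fin m => O i ω := by funext i; simp [fold]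
    have key : ∀ {f : Cov d → ℝ}, |(m : ℝ) ^ (1 / 4 : ℝ) * l2norm (margX P0) f - 0| < κ / 3 →
        l2norm (margX P0) f ^ 2 ≤ (κ / (m : ℝ) ^ (1 / 4 : ℝ)) ^ 2 / 9 := fun {f} hb => by
      have hn : 0 ≤ l2norm (margX P0) f := ENNReal.toReal_nonneg
      rw [sub_zero, abs_of_nonneg (by positivity)] at hb
      have : l2norm (margX P0) f ≤ κ / (m : ℝ) ^ (1 / 4 : ℝ) / 3 := by
        rw [div_right_comm, le_div_iff₀ hr]; linarith
      calc _ ≤ (κ / (m : ℝ) ^ (1 / 4 : ℝ) / 3) ^ 2 := by gcongr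
        _ = _ := by ring
    rw [hf]
    refine (dsq_le m _).trans ?_
    linarith [key b1, key b0, key b2]
  refine hw.congr fun m => ?_
  rw [← map_fold hO.meas hO.indep hO.law m 0, Measure.map_apply (measurable_fold hO.meas m 0)]
  · rfl
  · exact (measurableSet_le (measurable_dsq he m) measurable_const).compl

theorem whp_dsq (hO : IIDSample Pr O P0) (he : RegularEstimator est) {κ : ℝ}
    (h : Tendsto (fun m => sampleLaw P0 m
      {u | ¬ dsq P0 est Us m u ≤ (κ / (m : ℝ) ^ (1 / 4 : ℝ)) ^ 2}) atTop (𝓝 0)) (j : Fin 2) :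
    Whp Pr fun m ω => dsq P0 est Us m (fold O m j ω) ≤ (κ / (m : ℝ) ^ (1 / 4 : ℝ)) ^ 2 := by
  refine h.congr fun m => ?_
  rw [← map_fold hO.meas hO.indep hO.law m j, Measure.map_apply (measurable_fold hO.meas m j)]
  · rfl
  · exact (measurableSet_le (measurable_dsq he m) measurable_const).compl

/-- Differences of size `dl` have empirical fluctuations of order `o_p(m^{-1/2})`. -/
theorem whp_small_deviation (hO : IIDSample Pr O P0) (he : RegularEstimator est)
    (hk : 0 ≤ k) (hbox : InBox k Us) {Φ : Bool → Bool → (ℝ × ℝ × ℝ) × ℝ × ℝ × ℝ → ℝ}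
    (hΦ : ∀ a y, ContinuousOn (Φ a y) (Bx k ×ˢ Bx k)) {C : ℝ}
    (hC : ∀ a y, ∀ p ∈ Bx k ×ˢ Bx k, |Φ a y p| ≤ C * dl p.1 p.2)
    (hd : Tendsto (fun m => sampleLaw P0 m
      {u | ¬ dsq P0 est Us m u ≤ (1 / (m : ℝ) ^ (1 / 4 : ℝ)) ^ 2}) atTop (𝓝 0))
    {κ : ℝ} (hκ : 0 < κ) (j : Fin 2) :
    Whp Pr fun m ω => InBox k (initEst est O m (1 - j) ω) →
      |emp (fold O m j ω) (fun o => Φ o.2.1 o.2.2 (cv (initEst est O m (1 - j) ω) o.1, cv Us o.1)) -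
        ∫ o, Φ o.2.1 o.2.2 (cv (initEst est O m (1 - j) ω) o.1, cv Us o.1) ∂P0| ≤
          κ / √(m : ℝ) := by
  obtain ⟨M, hM0, hM⟩ := exists_bound_tfun (est := est) (Us := Us) hΦ
  have h := whp_crossfit hO (F := tfun k est Us Φ) (measurable_tfun he hΦ) hM
    (a := fun m => κ / √(m : ℝ))
    (fun m hm => div_pos hκ (Real.sqrt_pos.2 (by exact_mod_cast hm))) ?_ j
  · refine h.mono (Eventually.of_forall fun m ω hω hb => ?_)
    rwa [tfun_eq hb hbox] at hω
  have hs : InBox 0 Us := hbox.mono hk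
  -- The Chebyshev bound is C²κ⁻² times the squared nuisance error, integrated over the training
  -- sample. That error is small only with high probability, so the integral is split; on the
  -- exceptional set the crude bound 9 suffices.
  have hlim : Tendsto (fun m : ℕ => ENNReal.ofReal (C ^ 2 / κ ^ 2 * (1 / (m : ℝ) ^ (1 / 4 : ℝ)) ^ 2)
      + ENNReal.ofReal (9 * C ^ 2 / κ ^ 2) * sampleLaw P0 m
        {u | ¬ dsq P0 est Us m u ≤ (1 / (m : ℝ) ^ (1 / 4 : ℝ)) ^ 2}) atTop (𝓝 0) := by
    have h1 : Tendsto (fun m : ℕ => C ^ 2 / κ ^ 2 * (1 / (m : ℝ) ^ (1 / 4 : ℝ)) ^ 2)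
        atTop (𝓝 0) := by
      have h := (tendsto_rpow_atTop (y := (1 / 4 : ℝ)) (by norm_num)).comp
        tendsto_natCast_atTop_atTop
      simpa using (h.inv_tendsto_atTop.pow 2).const_mul (C ^ 2 / κ ^ 2)
    have h2 := (ENNReal.tendsto_ofReal h1).add (ENNReal.Tendsto.const_mul hd
      (Or.inr (ENNReal.ofReal_ne_top (r := 9 * C ^ 2 / κ ^ 2))))
    simpa using h2
  refine tendsto_of_tendsto_of_tendsto_of_le_of_le' tendsto_const_nhds hlim
    (Eventually.of_forall fun _ => zero_le) ?_
  filter_upwards [eventually_gt_atTop 0] with m hm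
  have hm' : (0 : ℝ) < m := by exact_mod_cast hm
  have e : (m : ℝ) * (κ / √(m : ℝ)) ^ 2 = κ ^ 2 := by
    rw [div_pow, Real.sq_sqrt hm'.le]; field_simp
  have hsq : ∀ u, (∫ o, tfun k est Us Φ m u o ^ 2 ∂P0) / (m * (κ / √(m : ℝ)) ^ 2) ≤
      C ^ 2 / κ ^ 2 * dsq P0 est Us m u := fun u => by
    have hI : Integrable (fun o : Obs d => C ^ 2 * dl (cv (est m u) o.1) (cv Us o.1) ^ 2) P0 :=
      integrable_of_bounded ((((continuous_dl_cv _ _).measurable.comp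
        measurable_fst).pow_const 2).const_mul _) (B := C ^ 2 * 9) fun o => by
          have := dl_cv_le_three le_rfl (inBox_zero_est he m u) hs o.1
          have := dl_nonneg (cv (est m u) o.1) (cv Us o.1)
          rw [abs_of_nonneg (by positivity)]
          gcongr
          nlinarith
    have : ∫ o, tfun k est Us Φ m u o ^ 2 ∂P0 ≤ C ^ 2 * dsq P0 est Us m u := by
      rw [dsq, ← integral_const_mul]
      refine integral_mono_of_nonneg (Eventually.of_forall fun o => sq_nonneg _) hI
        (Eventually.of_forall fun o => ?_)
      show tfun k est Us Φ m u o ^ 2 ≤ C ^ 2 * dl (cv (est m u) o.1) (cv Us o.1) ^ 2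
      unfold tfun
      by_cases h : (cv (est m u) o.1, cv Us o.1) ∈ Bx k ×ˢ Bx k
      · rw [indicator_of_mem h, ← mul_pow, ← sq_abs]
        have := hC o.2.1 o.2.2 _ h
        gcongr
      · rw [indicator_of_notMem h, zero_pow two_ne_zero]
        positivity
    rw [e, div_mul_eq_mul_div]
    gcongr
  set A : Set (Fin m → Obs d) := {u | ¬ dsq P0 est Us m u ≤ (1 / (m : ℝ) ^ (1 / 4 : ℝ)) ^ 2}
  have hA : MeasurableSet A := (measurableSet_le (measurable_dsq he m) measurable_const).compl
  calc _ ≤ ∫⁻ u, (ENNReal.ofReal (C ^ 2 / κ ^ 2 * (1 / (m : ℝ) ^ (1 / 4 : ℝ)) ^ 2) +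
        A.indicator (fun _ => ENNReal.ofReal (9 * C ^ 2 / κ ^ 2)) u) ∂(sampleLaw P0 m) := by
        refine lintegral_mono fun u => (ENNReal.ofReal_le_ofReal (hsq u)).trans ?_
        by_cases hu : u ∈ A
        · rw [indicator_of_mem hu]
          refine le_add_left (ENNReal.ofReal_le_ofReal ?_)
          have := dsq_le_nine (P0 := P0) he hs m u
          rw [mul_comm 9, mul_div_right_comm]
          gcongr
        · rw [indicator_of_notMem hu, add_zero]
          have := not_not.1 hu
          exact ENNReal.ofReal_le_ofReal (by gcongr)
    _ = _ := by
        rw [lintegral_add_left measurable_const, lintegral_const, measure_univ, mul_one,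
          lintegral_indicator_const hA]

end CrossFit

end WATE

/-! ### High-probability control of all deviations at once. -/

namespace WATE

section WhpDisc

variable {d : ℕ} {P0 : Measure (Obs d)} [IsProbabilityMeasure P0] {lam : ℝ → ℝ} {b c k : ℝ}
  {Us : CNuis d}

theorem continuousOn_gfun_Bx (w : Weight lam b c) (hbk : b < k) (i : Fin 4) (a y : Bool) :
    ContinuousOn (gfun lam i a y) (Bx k) :=
  (contDiffOn_gfun w i a y).continuousOn.mono (Bx_subset_strip hbk)

theorem continuousOn_cen {Φ : Bool → Bool → ℝ × ℝ × ℝ → ℝ}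
    (hΦ : ∀ a y, ContinuousOn (Φ a y) (Bx k)) (a y : Bool) : ContinuousOn (cen Φ a y) (Bx k) := by
  have hpv : ∀ a y, Continuous fun u : ℝ × ℝ × ℝ => pv u a y := fun a y => by
    cases a <;> cases y <;> simp only [pv, if_true, Bool.false_eq_true, if_false] <;> fun_prop
  have h : ∀ a y, ContinuousOn (fun u => pv u a y * Φ a y u) (Bx k) := fun a y =>
    (hpv a y).continuousOn.mul (hΦ a y)
  unfold cen sum4
  exact (hΦ a y).sub (((h true true).add (h true false)).add ((h false true).add (h false false)))

theorem continuousOn_mfun_Bx (w : Weight lam b c) (hbk : b < k) (ψ : ℝ) (a y : Bool) :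
    ContinuousOn (mfun lam ψ a y) (Bx k) := by
  have h := fun i => continuousOn_gfun_Bx w hbk i a y
  unfold mfun
  exact ((h 0).add (h 2)).sub (continuousOn_const.mul ((h 1).add (h 3)))

theorem exists_lipschitz_mfun (w : Weight lam b c) (hbk : b < k) :
    ∃ C, ∀ ψ, |ψ| ≤ 1 → ∀ a y, ∀ u ∈ Bx k, ∀ v ∈ Bx k,
      |mfun lam ψ a y u - mfun lam ψ a y v| ≤ C * dl u v := by
  obtain ⟨M, hM, -, -, h⟩ := exists_bound_gfun w hbk
  refine ⟨4 * M, fun ψ hψ a y u hu v hv => ?_⟩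
  have e : mfun lam ψ a y u - mfun lam ψ a y v = (gfun lam 0 a y u - gfun lam 0 a y v) +
      (gfun lam 2 a y u - gfun lam 2 a y v) - ψ * ((gfun lam 1 a y u - gfun lam 1 a y v) +
      (gfun lam 3 a y u - gfun lam 3 a y v)) := by unfold mfun; ring
  have h13 : |(gfun lam 1 a y u - gfun lam 1 a y v) + (gfun lam 3 a y u - gfun lam 3 a y v)| ≤
      2 * (M * dl u v) := (abs_add_le _ _).trans (by linarith [h 1 a y u hu v hv, h 3 a y u hu v hv])
  have := mul_le_mul hψ h13 (abs_nonneg _) zero_le_one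
  rw [← abs_mul] at this
  rw [e]
  refine (abs_sub _ _).trans ?_
  linarith [abs_add_le (gfun lam 0 a y u - gfun lam 0 a y v) (gfun lam 2 a y u - gfun lam 2 a y v),
    h 0 a y u hu v hv, h 2 a y u hu v hv]

variable {est : Estimator d} {Ω : Type*} [MeasurableSpace Ω] {Pr : Measure Ω}
  [IsProbabilityMeasure Pr] {O : ℕ → Ω → Obs d}

/-- An intersection of finitely many events. The threshold κm^{-1/4} is used for averages and the
finer κm^{-1/2} only for the increment between estimated and true nuisances, where the variance
tends to zero. -/
theorem whp_disc {cinit : ℝ} (hO : IIDSample Pr O P0) (he : RegularEstimator est)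
    (w : Weight lam b c) (hbk : b < k)
    (hk2 : ∀ (U0 : CNuis d) (η : ℝ), Positivity lam U0 η → IsScale lam η c → k ≤ 2 * η)
    (hbox : InBox k Us) (hk : k < 1 / 2) (hU : IsNuisanceOf P0 Us.fn)
    (hgood : Whp Pr fun m ω => ∀ j : Fin 2,
      GoodFold lam Us c cinit (fold O m j ω) (initEst est O m (1 - j) ω))
    (hd : ∀ κ : ℝ, 0 < κ → Tendsto (fun m => sampleLaw P0 m
      {u | ¬ dsq P0 est Us m u ≤ (κ / (m : ℝ) ^ (1 / 4 : ℝ)) ^ 2}) atTop (𝓝 0))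
    {κ : ℝ} (hκ : 0 < κ) (hκ1 : κ ≤ 1) :
    Whp Pr fun m ω => ∀ j : Fin 2,
      GoodFold lam Us c cinit (fold O m j ω) (initEst est O m (1 - j) ω) ∧
      Disc lam P0 Us (initEst est O m (1 - j) ω) (fold O m j ω) (κ / (m : ℝ) ^ (1 / 4 : ℝ)) ∧
      |emp (fold O m j ω) (fun o => mfun lam (psi lam (margX P0) Us.fn) o.2.1 o.2.2
            (cv (initEst est O m (1 - j) ω) o.1)) -
          emp (fold O m j ω)
            (fun o => mfun lam (psi lam (margX P0) Us.fn) o.2.1 o.2.2 (cv Us o.1)) -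
          ∫ o, mfun lam (psi lam (margX P0) Us.fn) o.2.1 o.2.2
            (cv (initEst est O m (1 - j) ω) o.1) ∂P0| ≤ κ / √(m : ℝ) := by
  have hk0 : 0 ≤ k := w.b_pos.le.trans hbk.le
  obtain ⟨-, hψ, -, -⟩ := truth_facts (P0 := P0) w hbk hbox hk
  have hmz := integral_mfun_true w hbk hbox hk hU
  obtain ⟨ψ, hψd⟩ : ∃ ψ, ψ = psi lam (margX P0) Us.fn := ⟨_, rfl⟩
  obtain ⟨C, hC⟩ := exists_lipschitz_mfun w hbk
  obtain ⟨B, -, hB⟩ := exists_bound_mfun w hbk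
  rw [← hψd] at hψ hmz ⊢
  have hfst : MapsTo (Prod.fst : (ℝ × ℝ × ℝ) × ℝ × ℝ × ℝ → ℝ × ℝ × ℝ) (Bx k ×ˢ Bx k) (Bx k) :=
    fun p hp => hp.1
  have hsnd : MapsTo (Prod.snd : (ℝ × ℝ × ℝ) × ℝ × ℝ × ℝ → ℝ × ℝ × ℝ) (Bx k ×ˢ Bx k) (Bx k) :=
    fun p hp => hp.2
  have first : ∀ {Φ : Bool → Bool → ℝ × ℝ × ℝ → ℝ}, (∀ a y, ContinuousOn (Φ a y) (Bx k)) →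
      ∀ a y, ContinuousOn (fun p : (ℝ × ℝ × ℝ) × ℝ × ℝ × ℝ => Φ a y p.1) (Bx k ×ˢ Bx k) :=
    fun h a y => (h a y).comp continuousOn_fst hfst
  have second : ∀ {Φ : Bool → Bool → ℝ × ℝ × ℝ → ℝ}, (∀ a y, ContinuousOn (Φ a y) (Bx k)) →
      ∀ a y, ContinuousOn (fun p : (ℝ × ℝ × ℝ) × ℝ × ℝ × ℝ => Φ a y p.2) (Bx k ×ˢ Bx k) :=
    fun h a y => (h a y).comp continuousOn_snd hsnd
  have cg := fun i => continuousOn_gfun_Bx w hbk i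
  have chh : ∀ i l a y, ContinuousOn (hfun lam i l a y) (Bx k) := fun i l a y =>
    (continuousOn_hfun w i l a y).mono (Bx_subset_strip hbk)
  have cm := continuousOn_mfun_Bx w hbk ψ
  have h1 := Whp.forall fun j : Fin 2 => Whp.forall fun i : Fin 4 =>
    whp_deviation hO he hbox (first (cg i)) hκ j
  have h2 := Whp.forall fun j : Fin 2 => Whp.forall fun i : Fin 4 =>
    whp_deviation hO he hbox (first (continuousOn_cen (cg i))) hκ j
  have h3 := Whp.forall fun j : Fin 2 => Whp.forall fun i : Fin 4 => Whp.forall fun l : Fin 2 =>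
    whp_deviation hO he hbox (first (continuousOn_cen (chh i l))) hκ j
  have h4 := Whp.forall fun j : Fin 2 =>
    whp_deviation hO he hbox (first fun a y => (cm a y).pow 2) hκ j
  have h5 := Whp.forall fun j : Fin 2 => whp_deviation hO he hbox (second cm) hκ j
  have h6 := Whp.forall fun j : Fin 2 => whp_dsq hO he (hd κ hκ) j
  have h7 := Whp.forall fun j : Fin 2 => whp_small_deviation hO he hk0 hbox
    (Φ := fun a y p => mfun lam ψ a y p.1 - mfun lam ψ a y p.2)
    (fun a y => (first cm a y).sub (second cm a y))
    (fun a y p hp => hC ψ hψ a y p.1 hp.1 p.2 hp.2) (hd 1 one_pos) hκ j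
  refine ((hgood.and (h1.and (h2.and h3))).and ((h4.and h5).and (h6.and h7))).mono
    ((eventually_ge_atTop 1).mono fun m hm ω hω j => ?_)
  obtain ⟨⟨g0, g1, g2, g3⟩, ⟨g4, g5⟩, g6, g7⟩ := hω
  have hr : 1 ≤ (m : ℝ) ^ (1 / 4 : ℝ) :=
    Real.one_le_rpow (by exact_mod_cast hm) (by norm_num)
  -- The deviation bounds are conditional on the initial estimate lying in the box; the local
  -- bracketing conditions provide this.
  have hb0 : InBox k (initEst est O m (1 - j) ω) := by
    obtain ⟨η, hp, hs, -⟩ := g0 j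
    exact (hp.inBox (Metric.mem_closedBall_self hp.eta_mem.1.le)).mono (hk2 _ _ hp hs)
  refine ⟨g0 j, ⟨by positivity, ?_, fun i => g1 j i hb0, fun i => g2 j i hb0,
    fun i l => g3 j i l hb0, ?_, ?_, ?_⟩, ?_⟩
  · exact (div_le_self hκ.le hr).trans hκ1
  · rw [← hψd]; exact g4 j hb0
  · have := g5 j hb0
    rw [← hψd]
    have hz : ∫ o, mfun lam ψ o.2.1 o.2.2 (cv Us o.1) ∂P0 = 0 := hmz
    rwa [hz, sub_zero] at this
  · have : initEst est O m (1 - j) ω = est m (fold O m (1 - j) ω) := rfl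
    rw [this]
    exact g6 (1 - j)
  · have := g7 j hb0
    have i1 : Integrable (fun o : Obs d => mfun lam ψ o.2.1 o.2.2
        (cv (initEst est O m (1 - j) ω) o.1)) P0 :=
      integrable_of_bounded (measurable_mfun_nv w hbk hb0 ψ) fun o => hB ψ hψ _ _ _ (hb0.cv_mem _)
    have i2 : Integrable (fun o : Obs d => mfun lam ψ o.2.1 o.2.2 (cv Us o.1)) P0 :=
      integrable_of_bounded (measurable_mfun_nv w hbk hbox ψ) fun o => hB ψ hψ _ _ _ (hbox.cv_mem _)
    have hz : ∫ o, mfun lam ψ o.2.1 o.2.2 (cv Us o.1) ∂P0 = 0 := hmz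
    rwa [emp_sub, integral_sub i1 i2, hz, sub_zero] at this

end WhpDisc

end WATE

/-! ### Limit laws without measurability, and normal quantiles. -/

namespace WATE

section Limits

variable {Ω : Type*} [MeasurableSpace Ω] {Pr : Measure Ω}

/-- A Slutsky argument for outer probabilities: up to vanishing probability, `C m` lies between two
approximating events with known limits, and continuity of `G` closes the gap. It is used because the
estimator involves arbitrary choices and is not known to be measurable. -/
theorem tendsto_measure_of_sandwich {C : ℕ → Set Ω} {A : ℝ → ℕ → Set Ω} {G : ℝ → ℝ≥0∞} {z : ℝ}
    (hG : ContinuousAt G z) (hA : ∀ x, Tendsto (fun m => Pr (A x m)) atTop (𝓝 (G x)))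
    (h : ∀ ε > 0, Whp Pr fun m ω =>
      (ω ∈ A (z - ε) m → ω ∈ C m) ∧ (ω ∈ C m → ω ∈ A (z + ε) m)) :
    Tendsto (fun m => Pr (C m)) atTop (𝓝 (G z)) := by
  have key : ∀ {U : Set ℝ≥0∞}, IsOpen U → G z ∈ U → ∃ ε > 0, G (z - ε) ∈ U ∧ G (z + ε) ∈ U := by
    intro U hU hz
    obtain ⟨δ, hδ, hb⟩ := Metric.mem_nhds_iff.1 (hG.preimage_mem_nhds (hU.mem_nhds hz))
    refine ⟨δ / 2, by positivity, hb ?_, hb ?_⟩ <;>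
      simp [Metric.mem_ball, abs_of_pos hδ] <;> linarith
  refine tendsto_order.2 ⟨fun a ha => ?_, fun a ha => ?_⟩
  · obtain ⟨ε, hε, h1, -⟩ := key isOpen_Ioi ha
    have ht := ENNReal.Tendsto.sub (hA (z - ε)) (h ε hε) (Or.inr ENNReal.zero_ne_top)
    rw [tsub_zero] at ht
    filter_upwards [ht.eventually_const_lt h1] with m hm
    refine hm.trans_le (tsub_le_iff_right.2 ((measure_mono fun ω hω => ?_).trans
      (measure_union_le _ _)))
    by_cases hc : ω ∈ C m
    · exact Or.inl hc
    · exact Or.inr fun hh => hc (hh.1 hω)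
  · obtain ⟨ε, hε, -, h1⟩ := key isOpen_Iio ha
    have ht := (hA (z + ε)).add (h ε hε)
    rw [add_zero] at ht
    filter_upwards [ht.eventually_lt_const h1] with m hm
    refine ((measure_mono fun ω hω => ?_).trans (measure_union_le _ _)).trans_lt hm
    by_cases hc : ω ∈ A (z + ε) m
    · exact Or.inl hc
    · exact Or.inr fun hh => hc (hh.2 hω)

theorem continuous_cdf (μ : Measure ℝ) [IsProbabilityMeasure μ] [NullSingletonClass μ] :
    Continuous (cdf μ) := by
  refine continuous_iff_continuousAt.2 fun x => ?_
  rw [(monotone_cdf μ).continuousAt_iff_leftLim_eq_rightLim, StieltjesFunction.rightLim_eq]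
  refine le_antisymm ((monotone_cdf μ).leftLim_le le_rfl) ?_
  have h := (cdf μ).measure_singleton x
  rw [measure_cdf, measure_singleton, eq_comm, ENNReal.ofReal_eq_zero] at h
  linarith

theorem measure_Icc_eq_cdf (μ : Measure ℝ) [IsProbabilityMeasure μ] [NullSingletonClass μ]
    (p q : ℝ) : μ (Icc p q) = ENNReal.ofReal (cdf μ q - cdf μ p) := by
  have h := (cdf μ).measure_Icc p q
  rw [measure_cdf] at h
  rw [h, ((monotone_cdf μ).continuousAt_iff_leftLim_eq_rightLim.1
    (continuous_cdf μ).continuousAt), StieltjesFunction.rightLim_eq]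

instance : NullSingletonClass (gaussianReal 0 1) := nullSingletonClass_gaussianReal one_ne_zero

/-- The infimum is attained because the distribution function is continuous; values to its left are
below γ, and continuity gives the reverse inequality. -/
theorem cdf_normalQuantile {γ : ℝ} (hγ : γ ∈ Ioo (0 : ℝ) 1) :
    cdf (gaussianReal 0 1) (normalQuantile γ) = γ := by
  set F := cdf (gaussianReal 0 1)
  have hF : Continuous F := continuous_cdf _
  set S : Set ℝ := {z | γ ≤ F z}
  have hne : S.Nonempty := by
    obtain ⟨z, hz⟩ := ((tendsto_cdf_atTop (gaussianReal 0 1)).eventually_const_lt hγ.2).exists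
    exact ⟨z, hz.le⟩
  have hbdd : BddBelow S := by
    obtain ⟨z, hz⟩ := ((tendsto_cdf_atBot (gaussianReal 0 1)).eventually_lt_const hγ.1).exists
    refine ⟨z, fun x hx => ?_⟩
    by_contra hlt
    exact absurd ((monotone_cdf (gaussianReal 0 1)) (not_le.1 hlt).le) (not_le.2 (hz.trans_le hx))
  have hcl : IsClosed S := isClosed_le continuous_const hF
  refine le_antisymm ?_ (hcl.csInf_mem hne hbdd)
  refine le_of_tendsto (f := F) (x := 𝓝[<] (normalQuantile γ))
    (hF.continuousAt.tendsto.mono_left nhdsWithin_le_nhds) ?_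
  filter_upwards [self_mem_nhdsWithin] with z hz
  by_contra hlt
  exact absurd (csInf_le hbdd (not_le.1 hlt).le) (not_le.2 hz)

theorem cdf_gaussian_neg (x : ℝ) :
    cdf (gaussianReal 0 1) (-x) = 1 - cdf (gaussianReal 0 1) x := by
  have h1 : (gaussianReal 0 1).map (fun x => -x) = gaussianReal 0 1 := by
    rw [gaussianReal_map_neg, neg_zero]
  have h2 : gaussianReal 0 1 (Iic (-x)) = gaussianReal 0 1 (Ici x) := by
    conv_lhs => rw [← h1, Measure.map_apply measurable_neg measurableSet_Iic]
    congr 1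
    ext y; simp
  rw [cdf_eq_real, cdf_eq_real, Measure.real, h2, ← Measure.real,
    ← probReal_compl_eq_one_sub measurableSet_Iic, compl_Iic, Measure.real, Measure.real,
    measure_congr Ioi_ae_eq_Ici]

/-- The central interval of a centered normal law. -/
theorem gaussian_central_interval {σ : ℝ} (hσ : 0 < σ) {α : ℝ} (hα : α ∈ Ioo (0 : ℝ) 1) :
    gaussianReal 0 (σ ^ 2).toNNReal (Icc (-(normalQuantile (1 - α / 2) * σ))
      (normalQuantile (1 - α / 2) * σ)) = ENNReal.ofReal (1 - α) := by
  have hs : (gaussianReal 0 1).map (fun x => σ * x) = gaussianReal 0 (σ ^ 2).toNNReal := by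
    rw [gaussianReal_map_const_mul, mul_zero, mul_one]
    congr 1
    ext
    simp [sq_nonneg]
  rw [← hs, Measure.map_apply (measurable_const_mul σ) measurableSet_Icc]
  have e : (fun x => σ * x) ⁻¹' Icc (-(normalQuantile (1 - α / 2) * σ))
      (normalQuantile (1 - α / 2) * σ) =
      Icc (-normalQuantile (1 - α / 2)) (normalQuantile (1 - α / 2)) := by
    ext x
    simp only [mem_preimage, mem_Icc]
    rw [mul_comm σ x, ← neg_mul, mul_le_mul_iff_left₀ hσ, mul_le_mul_iff_left₀ hσ]
  rw [e, measure_Icc_eq_cdf, cdf_gaussian_neg, cdf_normalQuantile ⟨by linarith [hα.2],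
    by linarith [hα.1]⟩]
  congr 1; ring

/-- Limits in distribution give limits of the probabilities of closed intervals. -/
theorem TendstoInDistribution.tendsto_preimage [IsProbabilityMeasure Pr] {X : ℕ → Ω → ℝ}
    {μ : Measure ℝ} [IsProbabilityMeasure μ]
    (h : TendstoInDistribution X atTop id (fun _ => Pr) μ) {E : Set ℝ} (hE : MeasurableSet E)
    (hf : μ (frontier E) = 0) : Tendsto (fun m => Pr (X m ⁻¹' E)) atTop (𝓝 (μ E)) := by
  have ht := ProbabilityMeasure.tendsto_measure_of_null_frontier_of_tendsto' h.tendsto (E := E)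
    (by simpa using hf)
  simp only [ProbabilityMeasure.coe_mk, Measure.map_id] at ht
  refine ht.congr fun m => ?_
  exact Measure.map_apply_of_aemeasurable (h.forall_aemeasurable m) hE

end Limits

end WATE

/-! ### Nondegeneracy, asymptotic linearity and the central limit theorem. -/

namespace WATE

section Final

variable {d : ℕ} {P0 : Measure (Obs d)} [IsProbabilityMeasure P0] {lam : ℝ → ℝ} {b c k : ℝ}
  {Us : CNuis d}

/-- The efficient influence function is not degenerate. -/
theorem integral_Dfull_sq_pos (w : Weight lam b c) (hbk : b < k) (hbox : InBox k Us)
    (hk : k < 1 / 2) (hU : IsNuisanceOf P0 Us.fn) :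
    0 < ∫ o, Dfull lam (margX P0) Us.fn o ^ 2 ∂P0 := by
  have hb := w.b_pos
  have hk0 : 0 < k := hb.trans hbk
  have hc := w.c_pos
  obtain ⟨hO, -, -, -⟩ := truth_facts (P0 := P0) w hbk hbox hk
  obtain ⟨hcont, ⟨B, hB1, hB⟩, -⟩ := Dfull_true_facts w hbk hbox hk hU
  set Om := Omega lam (margX P0) Us.fn with hOm
  set D := Dfull lam (margX P0) Us.fn with hD
  have hOpos : 0 < Om := hc.trans_le hO
  have hDm : Measurable D := measurable_obs_of_slices fun a y => (hcont a y).measurable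
  have hnn : 0 < k ^ 2 * ((c / Om) ^ 2 / 2) := by positivity
  have hsq : ∀ o, |D o ^ 2| ≤ B ^ 2 := fun o => by
    rw [abs_pow]
    exact pow_le_pow_left₀ (abs_nonneg _) (hB o) 2
  rw [hU.integral_eq (f := fun o => D o ^ 2) (fun x => Bx_mono hk0.le (hbox.nv_mem x))
    (hDm.pow_const 2) hsq]
  have hpt : ∀ o : Obs d, k ^ 2 * ((c / Om) ^ 2 / 2) ≤
      sum4 fun a y => pv (nv Us.fn o.1) a y * D (o.1, a, y) ^ 2 := fun o => by
    have hp := fun a y => pv_pos hk0 (hbox.nv_mem o.1) a y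
    obtain ⟨he0, he1⟩ := (hbox o.1).2.2
    -- Only the residual depends on the outcome. For treated units the two outcomes give values
    -- differing by λ/(Ωe) ≥ c/Ω, so they cannot both be small; the probability of each is at least
    -- k².
    have hdiff : D (o.1, true, true) - D (o.1, true, false) =
        lam (Us.2.2 o.1) / Om * (Us.2.2 o.1)⁻¹ := by
      simp [hD, Dfull, phi, val, CNuis.fn, hOm]
      ring
    have hge : c / Om ≤ D (o.1, true, true) - D (o.1, true, false) := by
      rw [hdiff]
      have h1 : c ≤ lam (Us.2.2 o.1) := w.lower _ ⟨by linarith, by linarith⟩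
      have h2 : 1 ≤ (Us.2.2 o.1)⁻¹ := (one_le_inv₀ (hk0.trans_le he0)).2 (by linarith)
      calc c / Om = c / Om * 1 := (mul_one _).symm
        _ ≤ _ := mul_le_mul (by gcongr) h2 zero_le_one (div_nonneg (hc.le.trans h1) hOpos.le)
    have h0 : 0 ≤ c / Om := by positivity
    have h4 : (c / Om) ^ 2 / 2 ≤ D (o.1, true, true) ^ 2 + D (o.1, true, false) ^ 2 := by
      nlinarith [sq_nonneg (D (o.1, true, true) + D (o.1, true, false))]
    have q := fun a y => mul_le_mul_of_nonneg_right (hp a y) (sq_nonneg (D (o.1, a, y)))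
    have q3 : 0 ≤ k ^ 2 * D (o.1, false, true) ^ 2 := by positivity
    have q4 : 0 ≤ k ^ 2 * D (o.1, false, false) ^ 2 := by positivity
    have h5 := mul_le_mul_of_nonneg_left h4 (sq_nonneg k)
    unfold sum4
    linarith [q true true, q true false, q false true, q false false]
  have hint : Integrable (fun o : Obs d => sum4 fun a y => pv (nv Us.fn o.1) a y *
      D (o.1, a, y) ^ 2) P0 := by
    have hm : Measurable fun x : Cov d => sum4 fun a y => pv (nv Us.fn x) a y * D (x, a, y) ^ 2 :=
      measurable_sum4 fun a y => (measurable_pv (U := Us.fn) Us.1.continuous.measurable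
        Us.2.1.continuous.measurable Us.2.2.continuous.measurable a y).mul
        ((hcont a y).measurable.pow_const 2)
    exact integrable_of_bounded (hm.comp measurable_fst) fun o =>
      abs_sum4_pv_mul_le (Bx_mono hk0.le (hbox.nv_mem o.1)) fun a y => hsq _
  have h := integral_mono (integrable_const (k ^ 2 * ((c / Om) ^ 2 / 2))) hint hpt
  simp only [integral_const, probReal_univ, one_smul] at h
  exact hnn.trans_le h

variable {est : Estimator d} {Ω : Type*} [MeasurableSpace Ω] {Pr : Measure Ω}
  [IsProbabilityMeasure Pr] {O : ℕ → Ω → Obs d}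

theorem sum_range_eq_emp {m : ℕ} (hm : 0 < m) (D : Obs d → ℝ) (ω : Ω) :
    ∑ i ∈ Finset.range (2 * m), D (O i ω) = m * ∑ j : Fin 2, emp (fold O m j ω) D := by
  have hm' : (m : ℝ) ≠ 0 := by positivity
  rw [two_mul, Finset.sum_range_add, Finset.sum_range, Finset.sum_range, Fin.sum_univ_two, mul_add]
  simp only [emp, fold]
  rw [← mul_assoc, ← mul_assoc, mul_one_div_cancel hm', one_mul, one_mul]
  simp

/-- On an event of probability tending to one, the cross-fitted estimator is linear up to `ε`, and
the variance estimator is within `ε` of its target. -/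
theorem whp_crossfit_linear {cinit : ℝ} (hO : IIDSample Pr O P0) (he : RegularEstimator est)
    (w : Weight lam b c) (hbk : b < k)
    (hk2 : ∀ (U0 : CNuis d) (η : ℝ), Positivity lam U0 η → IsScale lam η c → k ≤ 2 * η)
    (hbox : InBox k Us) (hk : k < 1 / 2) (hU : IsNuisanceOf P0 Us.fn)
    (hci : cinit ∈ Ioo (0 : ℝ) 1)
    (hgood : Whp Pr fun m ω => ∀ j : Fin 2,
      GoodFold lam Us c cinit (fold O m j ω) (initEst est O m (1 - j) ω))
    (hd : ∀ κ : ℝ, 0 < κ → Tendsto (fun m => sampleLaw P0 m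
      {u | ¬ dsq P0 est Us m u ≤ (κ / (m : ℝ) ^ (1 / 4 : ℝ)) ^ 2}) atTop (𝓝 0))
    {ε : ℝ} (hε : 0 < ε) :
    Whp Pr fun m ω =>
      |√(2 * (m : ℝ)) * (psiCF lam Us c cinit est O m ω - psi lam (margX P0) Us.fn) -
        (1 / √(2 * (m : ℝ))) *
          ∑ i ∈ Finset.range (2 * m), Dfull lam (margX P0) Us.fn (O i ω)| < ε ∧
      |sigmaSqCF lam Us c cinit est O m ω - ∫ o, Dfull lam (margX P0) Us.fn o ^ 2 ∂P0| < ε := by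
  obtain ⟨K, ε0, hK, hε0, H⟩ := exists_fold_bounds w hbk hk2 hbox hk hU hci
  -- Each fold contributes at most K(κ + κ²)/√m ≤ 2Kκ/√m, and √(2m) ≤ 2√m, whence the requirement
  -- 4Kκ < ε.
  obtain ⟨κ, hκ, hκ1, hκ2, hκ3⟩ : ∃ κ : ℝ, 0 < κ ∧ κ ≤ 1 ∧ κ ≤ ε0 ∧ 4 * (K * κ) < ε := by
    refine ⟨min (min 1 ε0) (ε / (8 * K)), by positivity, (min_le_left _ _).trans (min_le_left _ _),
      (min_le_left _ _).trans (min_le_right _ _), ?_⟩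
    have h := min_le_right (min 1 ε0) (ε / (8 * K))
    rw [le_div_iff₀ (by positivity)] at h
    linarith
  refine (whp_disc hO he w hbk hk2 hbox hk hU hgood hd hκ hκ1).mono
    ((eventually_ge_atTop 1).mono fun m hm ω hω => ?_)
  have hm' : (1 : ℝ) ≤ m := by exact_mod_cast hm
  have hm0 : (0 : ℝ) < m := by linarith
  have hr : 1 ≤ (m : ℝ) ^ (1 / 4 : ℝ) := Real.one_le_rpow hm' (by norm_num)
  have hθκ : κ / (m : ℝ) ^ (1 / 4 : ℝ) ≤ κ := div_le_self hκ.le hr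
  have hr2 : ((m : ℝ) ^ (1 / 4 : ℝ)) ^ 2 = √(m : ℝ) := by
    rw [← Real.rpow_natCast, ← Real.rpow_mul hm0.le, Real.sqrt_eq_rpow]
    norm_num
  have hs : 0 < √(m : ℝ) := Real.sqrt_pos.2 hm0
  have hB : ∀ j : Fin 2,
      |foldPsi lam Us c cinit (fold O m j ω) (initEst est O m (1 - j) ω) -
        psi lam (margX P0) Us.fn - emp (fold O m j ω) (Dfull lam (margX P0) Us.fn)| ≤
          2 * (K * κ) / √(m : ℝ) ∧
      |(1 / (m : ℝ)) * ∑ i, foldEIF lam Us c cinit (fold O m j ω) (initEst est O m (1 - j) ω) i ^ 2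
        - ∫ o, Dfull lam (margX P0) Us.fn o ^ 2 ∂P0| ≤ K * κ := fun j => by
    obtain ⟨h1, h2, h3⟩ := hω j
    obtain ⟨b1, b2⟩ := H (by lia) h1 h2 (hθκ.trans hκ2)
    refine ⟨b1.trans ?_, b2.trans (by gcongr)⟩
    have e : (κ / (m : ℝ) ^ (1 / 4 : ℝ)) ^ 2 = κ ^ 2 / √(m : ℝ) := by rw [div_pow, hr2]
    have h4 : κ ^ 2 / √(m : ℝ) ≤ κ / √(m : ℝ) := by gcongr; nlinarith
    rw [e]
    calc _ ≤ K * (κ / √(m : ℝ) + κ / √(m : ℝ)) := by gcongr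
      _ = _ := by ring
  have h0 := hB 0
  have h1 := hB 1
  constructor
  · rw [sum_range_eq_emp (by lia), psiCF, Fin.sum_univ_two, Fin.sum_univ_two]
    obtain ⟨x0, hx0⟩ : ∃ x, x = foldPsi lam Us c cinit (fold O m 0 ω) (initEst est O m (1 - 0) ω) :=
      ⟨_, rfl⟩
    obtain ⟨x1, hx1⟩ : ∃ x, x = foldPsi lam Us c cinit (fold O m 1 ω) (initEst est O m (1 - 1) ω) :=
      ⟨_, rfl⟩
    obtain ⟨y0, hy0⟩ : ∃ x, x = emp (fold O m 0 ω) (Dfull lam (margX P0) Us.fn) := ⟨_, rfl⟩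
    obtain ⟨y1, hy1⟩ : ∃ x, x = emp (fold O m 1 ω) (Dfull lam (margX P0) Us.fn) := ⟨_, rfl⟩
    obtain ⟨p, hp⟩ : ∃ x, x = psi lam (margX P0) Us.fn := ⟨_, rfl⟩
    rw [← hx0, ← hy0, ← hp] at h0
    rw [← hx1, ← hy1, ← hp] at h1
    rw [← hx0, ← hx1, ← hy0, ← hy1, ← hp]
    have hq : √(2 * (m : ℝ)) ^ 2 = 2 * m := Real.sq_sqrt (by positivity)
    have hqpos : 0 < √(2 * (m : ℝ)) := Real.sqrt_pos.2 (by positivity)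
    have hq2 : 1 / √(2 * (m : ℝ)) * (m * (y0 + y1)) = √(2 * (m : ℝ)) * (1 / 2 * (y0 + y1)) := by
      field_simp
      rw [hq]
    have e : √(2 * (m : ℝ)) * (1 / 2 * (x0 + x1) - p) - 1 / √(2 * (m : ℝ)) * (m * (y0 + y1)) =
        √(2 * (m : ℝ)) * (1 / 2 * ((x0 - p - y0) + (x1 - p - y1))) := by rw [hq2]; ring
    have h2 : |1 / 2 * ((x0 - p - y0) + (x1 - p - y1))| ≤ 2 * (K * κ) / √(m : ℝ) := by
      rw [abs_mul, abs_of_pos (by norm_num : (0 : ℝ) < 1 / 2)]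
      linarith [abs_add_le (x0 - p - y0) (x1 - p - y1), h0.1, h1.1]
    have h3 : √(2 * (m : ℝ)) ≤ 2 * √(m : ℝ) := by
      rw [Real.sqrt_mul zero_le_two]
      gcongr
      rw [Real.sqrt_le_left zero_le_two]; norm_num
    rw [e, abs_mul, abs_of_pos hqpos]
    calc _ ≤ 2 * √(m : ℝ) * (2 * (K * κ) / √(m : ℝ)) := by gcongr
      _ = 4 * (K * κ) := by field_simp; ring
      _ < ε := hκ3
  · have e : sigmaSqCF lam Us c cinit est O m ω - ∫ o, Dfull lam (margX P0) Us.fn o ^ 2 ∂P0 =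
        1 / 2 * (((1 / (m : ℝ)) * ∑ i, foldEIF lam Us c cinit (fold O m 0 ω)
          (initEst est O m (1 - 0) ω) i ^ 2 - ∫ o, Dfull lam (margX P0) Us.fn o ^ 2 ∂P0) +
        ((1 / (m : ℝ)) * ∑ i, foldEIF lam Us c cinit (fold O m 1 ω)
          (initEst est O m (1 - 1) ω) i ^ 2 - ∫ o, Dfull lam (margX P0) Us.fn o ^ 2 ∂P0)) := by
      rw [sigmaSqCF, Fin.sum_univ_two]
      field_simp
      ring
    rw [e, abs_mul, abs_of_pos (by norm_num : (0 : ℝ) < 1 / 2)]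
    have hKκ : 0 < K * κ := by positivity
    refine lt_of_le_of_lt (mul_le_mul_of_nonneg_left (abs_add_le _ _) (by norm_num)) ?_
    linarith [h0.2, h1.2]

/-- The central limit theorem along even sample sizes. -/
theorem tendsto_clt (hO : IIDSample Pr O P0) {D : Obs d → ℝ} (hD : Measurable D)
    (hL : MemLp D 2 P0) (h0 : ∫ o, D o ∂P0 = 0) (hpos : variance D P0 ≠ 0) {E : Set ℝ}
    (hE : MeasurableSet E) (hf : (frontier E).Countable) :
    Tendsto (fun m : ℕ => Pr {ω | (1 / √(2 * (m : ℝ))) *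
      ∑ i ∈ Finset.range (2 * m), D (O i ω) ∈ E}) atTop
      (𝓝 (gaussianReal 0 (variance D P0).toNNReal E)) := by
  have hvar : Var[fun ω => D (O 0 ω); Pr] = variance D P0 := by
    have h := variance_map (μ := Pr) (X := D) (Y := O 0)
      (by rw [hO.law]; exact hD.aemeasurable) (hO.meas 0).aemeasurable
    rw [hO.law] at h
    exact h.symm
  have hmean : ∫ ω, D (O 0 ω) ∂Pr = 0 := by
    rw [← h0, ← hO.law 0, integral_map (hO.meas 0).aemeasurable hD.aestronglyMeasurable]
  have hv : 0 < variance D P0 := (variance_nonneg _ _).lt_of_ne' hpos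
  have : NullSingletonClass (gaussianReal 0 (variance D P0).toNNReal) :=
    nullSingletonClass_gaussianReal (by simpa using hv)
  have hclt := tendstoInDistribution_inv_sqrt_mul_sum_sub (P := Pr) (X := fun i ω => D (O i ω))
    (Y := id) (P' := gaussianReal 0 (variance D P0).toNNReal)
    (by rw [hvar]; exact HasLaw.id)
    (by
      have h := hO.law 0 ▸ hL
      exact (memLp_map_measure_iff hD.aestronglyMeasurable (hO.meas 0).aemeasurable).1 h)
    (hO.indep.comp _ fun _ => hD)
    (fun i => ⟨(hD.comp (hO.meas i)).aemeasurable, (hD.comp (hO.meas 0)).aemeasurable, by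
      have h : ∀ i, Pr.map (fun ω => D (O i ω)) = P0.map D := fun i => by
        rw [← hO.law i, Measure.map_map hD (hO.meas i)]; rfl
      rw [h, h]⟩)
  -- The limit theorem for all sample sizes is restricted to the subsequence n = 2m.
  have h2 := (TendstoInDistribution.tendsto_preimage hclt hE (hf.measure_zero _)).comp
    (tendsto_id.const_mul_atTop' (r := 2) two_pos)
  refine h2.congr fun m => ?_
  have e : (fun ω => (√((2 * m : ℕ) : ℝ))⁻¹ * (∑ i ∈ Finset.range (2 * m), D (O i ω) -
      ((2 * m : ℕ) : ℝ) * ∫ ω, D (O 0 ω) ∂Pr)) ⁻¹' E = {ω | (1 / √(2 * (m : ℝ))) *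
      ∑ i ∈ Finset.range (2 * m), D (O i ω) ∈ E} := by
    ext ω
    simp [hmean]
  exact congrArg Pr e

end Final

end WATE

/-! ### Assembly of the theorem. -/

theorem mainTheorem3 {d : ℕ} (hd : 0 < d)
    -- the weight function on `[0,1]`
    (lam : ℝ → ℝ) (hlam : ∀ t ∈ Icc (0 : ℝ) 1, 0 ≤ lam t)
    -- the true law and its continuous nuisance functions
    (Pstar : Measure (WATE.Obs d)) [IsProbabilityMeasure Pstar]
    (hac : Pstar ≪ WATE.domMeasure d)
    (Ustar : WATE.CNuis d) (hUstar : WATE.IsNuisanceOf Pstar Ustar.fn)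
    -- the i.i.d. observations
    {Ω : Type*} [MeasurableSpace Ω] (Pr : Measure Ω) [IsProbabilityMeasure Pr]
    (O : ℕ → Ω → WATE.Obs d) (hmeas : ∀ i, Measurable (O i)) (hindep : iIndepFun O Pr)
    (hlaw : ∀ i, Pr.map (O i) = Pstar)
    -- the nuisance estimators, measurable and with values in `[0,1]`
    (est : WATE.Estimator d)
    (hest_meas : ∀ n x, Measurable (fun s => (est n s).fn.q1 x) ∧
      Measurable (fun s => (est n s).fn.q0 x) ∧ Measurable (fun s => (est n s).fn.e x))
    (hest_mem : ∀ n s x, (est n s).fn.q1 x ∈ Icc (0 : ℝ) 1 ∧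
      (est n s).fn.q0 x ∈ Icc (0 : ℝ) 1 ∧ (est n s).fn.e x ∈ Icc (0 : ℝ) 1)
    (c cinit : ℝ) (hc : 0 < c) (hcinit : 0 < cinit)
    -- with probability tending to one, the local bracketing conditions hold on both folds
    (hbracket : Tendsto (fun m : ℕ => Pr {ω | ¬ ∀ k : Fin 2,
      WATE.LocalBracketing lam Ustar c cinit (WATE.empX (WATE.fold O m k ω))
        (WATE.initEst est O m (1 - k) ω)}) atTop (𝓝 0))
    -- the nuisance estimators converge at rate `o_p(n^{-1/4})` in `L²(P_X*)`
    (hrate_q1 : WATE.IsLittleOpQuarter Pr (fun n ω => WATE.l2norm (WATE.margX Pstar)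
      (fun x => (est n (fun i => O i ω)).fn.q1 x - Ustar.fn.q1 x)))
    (hrate_q0 : WATE.IsLittleOpQuarter Pr (fun n ω => WATE.l2norm (WATE.margX Pstar)
      (fun x => (est n (fun i => O i ω)).fn.q0 x - Ustar.fn.q0 x)))
    (hrate_e : WATE.IsLittleOpQuarter Pr (fun n ω => WATE.l2norm (WATE.margX Pstar)
      (fun x => (est n (fun i => O i ω)).fn.e x - Ustar.fn.e x))) :
    let psiStar : ℝ := WATE.psi lam (WATE.margX Pstar) Ustar.fn
    let D : WATE.Obs d → ℝ := WATE.Dfull lam (WATE.margX Pstar) Ustar.fn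
    let sigmaSq : ℝ := variance D Pstar
    let psiHat : ℕ → Ω → ℝ := WATE.psiCF lam Ustar c cinit est O
    let sigmaSqHat : ℕ → Ω → ℝ := WATE.sigmaSqCF lam Ustar c cinit est O
    -- the influence function is the full-model efficient influence function
    WATE.IsEIF lam Pstar D ∧
    -- asymptotic linearity, with sample size `n = 2m`
    TendstoInMeasure Pr (fun (m : ℕ) ω => √(2 * (m : ℝ)) * (psiHat m ω - psiStar)
        - (1 / √(2 * (m : ℝ))) * ∑ i ∈ Finset.range (2 * m), D (O i ω))
      atTop (fun _ => 0) ∧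
    -- consistency of the plug-in variance estimator
    TendstoInMeasure Pr sigmaSqHat atTop (fun _ => sigmaSq) ∧
    -- positivity of the asymptotic variance
    0 < sigmaSq ∧
    -- convergence in distribution to `N(0, σ²)`
    (∀ z : ℝ, Tendsto (fun m : ℕ => Pr {ω | √(2 * (m : ℝ)) * (psiHat m ω - psiStar) ≤ z})
      atTop (𝓝 (gaussianReal 0 sigmaSq.toNNReal (Iic z)))) ∧
    -- asymptotic coverage of the Wald interval
    (∀ α ∈ Ioo (0 : ℝ) 1, Tendsto (fun m : ℕ => Pr {ω | psiStar ∈ Icc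
        (psiHat m ω - WATE.normalQuantile (1 - α / 2) * (√(sigmaSqHat m ω) / √(2 * (m : ℝ))))
        (psiHat m ω + WATE.normalQuantile (1 - α / 2) * (√(sigmaSqHat m ω) / √(2 * (m : ℝ))))})
      atTop (𝓝 (ENNReal.ofReal (1 - α)))) := by
  intro psiStar D sigmaSq psiHat sigmaSqHat
  have hO : WATE.IIDSample Pr O Pstar := ⟨hmeas, hindep, hlaw⟩
  have he : WATE.RegularEstimator est := ⟨hest_meas, hest_mem⟩
  -- A single good realization exists because the bad event has probability below one for some m. It
  -- fixes the deterministic data: c_init < 1, a smoothness interval for λ, and a box containing the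
  -- true nuisances.
  obtain ⟨ω0, m0, hω0⟩ : ∃ ω m, ∀ k : Fin 2, WATE.LocalBracketing lam Ustar c cinit
      (WATE.empX (WATE.fold O m k ω)) (WATE.initEst est O m (1 - k) ω) := by
    obtain ⟨m, hm⟩ := (hbracket.eventually_lt_const zero_lt_one).exists
    by_contra hcon
    push Not at hcon
    refine absurd hm (not_lt.2 ?_)
    rw [eq_univ_of_forall (s := {ω | ¬ ∀ k : Fin 2, WATE.LocalBracketing lam Ustar c cinit
      (WATE.empX (WATE.fold O m k ω)) (WATE.initEst est O m (1 - k) ω)}) fun ω => by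
        exact not_forall.2 (hcon ω m), measure_univ]
  obtain ⟨η, hp, hs, -, hci, -, hball, -⟩ := hω0 0
  obtain ⟨b, k, w, hbk, hk2⟩ := WATE.exists_common_box hp hs
  have hkη := hk2 _ _ hp hs
  have hk : k < 1 / 2 := by linarith [hp.eta_mem.2]
  have hbox : WATE.InBox k Ustar := (hp.inBox hball).mono hkη
  have hgood : WATE.Whp Pr fun m ω => ∀ j : Fin 2,
      WATE.GoodFold lam Ustar c cinit (WATE.fold O m j ω) (WATE.initEst est O m (1 - j) ω) :=
    hbracket
  have hd := fun (κ : ℝ) (hκ : 0 < κ) => WATE.tendsto_dsq hO he hrate_q1 hrate_q0 hrate_e hκ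
  have hmain := fun (ε : ℝ) (hε : 0 < ε) =>
    WATE.whp_crossfit_linear hO he w hbk hk2 hbox hk hUstar hci hgood hd hε
  obtain ⟨hcont, ⟨B, -, hB⟩, hD0⟩ := WATE.Dfull_true_facts w hbk hbox hk hUstar
  have hDm : Measurable D := WATE.measurable_obs_of_slices fun a y => (hcont a y).measurable
  have hL : MemLp D 2 Pstar := MemLp.of_bound hDm.aestronglyMeasurable B (Eventually.of_forall hB)
  have hvar : sigmaSq = ∫ o, D o ^ 2 ∂Pstar := variance_of_integral_eq_zero hDm.aemeasurable hD0
  have hpos : 0 < sigmaSq := hvar ▸ WATE.integral_Dfull_sq_pos w hbk hbox hk hUstar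
  have hcons : TendstoInMeasure Pr sigmaSqHat atTop fun _ => sigmaSq :=
    WATE.tendstoInMeasure_of_whp fun ε hε => (hmain ε hε).mono
      (Eventually.of_forall fun m ω h => by rw [hvar]; exact h.2)
  have hlin := fun (ε : ℝ) (hε : 0 < ε) => (hmain ε hε).mono
    (Eventually.of_forall fun m ω h => h.1)
  obtain ⟨T, hT⟩ : ∃ T : ℕ → Ω → ℝ, T = fun (m : ℕ) ω => √(2 * (m : ℝ)) * (psiHat m ω - psiStar) :=
    ⟨_, rfl⟩
  obtain ⟨Z, hZ⟩ : ∃ Z : ℕ → Ω → ℝ, Z = fun (m : ℕ) ω =>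
    (1 / √(2 * (m : ℝ))) * ∑ i ∈ Finset.range (2 * m), D (O i ω) := ⟨_, rfl⟩
  have hTZ : ∀ ε > 0, WATE.Whp Pr fun m ω => |T m ω - Z m ω| < ε := by
    rw [hT, hZ]; exact hlin
  have : NullSingletonClass (gaussianReal 0 sigmaSq.toNNReal) :=
    nullSingletonClass_gaussianReal (by simpa using hpos)
  have hF := WATE.continuous_cdf (gaussianReal 0 sigmaSq.toNNReal)
  have hclt : ∀ E : Set ℝ, MeasurableSet E → (frontier E).Countable →
      Tendsto (fun m => Pr {ω | Z m ω ∈ E}) atTop (𝓝 (gaussianReal 0 sigmaSq.toNNReal E)) := by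
    rw [hZ]
    exact fun E hE hf => WATE.tendsto_clt hO hDm hL hD0 hpos.ne' hE hf
  refine ⟨WATE.isEIF_Dfull w hbk hbox hk hUstar hac, ?_, hcons, hpos, fun z => ?_, fun α hα => ?_⟩
  · exact WATE.tendstoInMeasure_of_whp fun ε hε => (hlin ε hε).mono
      (Eventually.of_forall fun m ω h => by rw [sub_zero]; exact h)
  -- The event {T ≤ z} is caught between {Z ≤ z - ε} and {Z ≤ z + ε}, and the normal distribution
  -- function is continuous.
  · have h := WATE.tendsto_measure_of_sandwich (Pr := Pr) (C := fun m => {ω | T m ω ≤ z})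
      (A := fun x m => {ω | Z m ω ∈ Iic x})
      (G := fun x => gaussianReal 0 sigmaSq.toNNReal (Iic x)) (z := z) ?_
      (fun x => hclt _ measurableSet_Iic (by rw [frontier_Iic]; exact countable_singleton x)) ?_
    · rw [hT] at h; exact h
    · simp only [← ofReal_cdf]
      exact (ENNReal.continuous_ofReal.comp hF).continuousAt
    · refine fun ε hε => (hTZ ε hε).mono (Eventually.of_forall fun m ω h => ?_)
      rw [abs_lt] at h
      simp only [mem_ofPred_eq, mem_Iic]
      exact ⟨fun hz => by linarith [h.2], fun hz => by linarith [h.1]⟩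
  · set q := WATE.normalQuantile (1 - α / 2) with hq
    have hσ : 0 < √sigmaSq := Real.sqrt_pos.2 hpos
    have hσhat : ∀ ε > 0, WATE.Whp Pr fun m ω => |√(sigmaSqHat m ω) - √sigmaSq| < ε := by
      intro ε hε
      obtain ⟨δ, hδ, h⟩ := Metric.continuousAt_iff.1
        (Real.continuous_sqrt.continuousAt (x := sigmaSq)) ε hε
      exact (WATE.whp_of_tendstoInMeasure hcons hδ).mono
        (Eventually.of_forall fun m ω hω => h hω)
    -- Coverage is rewritten as |T| ≤ q·σ̂, which avoids dividing by the estimated standard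
    -- deviation, and is compared with |Z| ≤ qσ ± ε.
    have h := WATE.tendsto_measure_of_sandwich (Pr := Pr)
      (C := fun m => {ω | |T m ω| ≤ q * √(sigmaSqHat m ω)})
      (A := fun x m => {ω | Z m ω ∈ Icc (-x) x})
      (G := fun x => gaussianReal 0 sigmaSq.toNNReal (Icc (-x) x)) (z := q * √sigmaSq) ?_
      (fun x => hclt _ measurableSet_Icc ?_) ?_
    · have hg := WATE.gaussian_central_interval hσ hα
      rw [Real.sq_sqrt hpos.le] at hg
      rw [hg] at h
      -- The rewriting multiplies by √(2m), so m = 0 has to be excluded.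
      refine h.congr' ((eventually_gt_atTop 0).mono fun m hm => congrArg Pr ?_)
      have hn : 0 < √(2 * (m : ℝ)) := Real.sqrt_pos.2 (by positivity)
      ext ω
      have e : q * (√(sigmaSqHat m ω) / √(2 * (m : ℝ))) =
          q * √(sigmaSqHat m ω) / √(2 * (m : ℝ)) := mul_div_assoc' _ _ _
      simp only [hT, mem_ofPred_eq, mem_Icc]
      rw [e, abs_mul, abs_of_pos hn, mul_comm, ← le_div_iff₀ hn, abs_le]
      constructor
      · intro h
        exact ⟨by linarith [h.2], by linarith [h.1]⟩
      · intro h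
        exact ⟨by linarith [h.2], by linarith [h.1]⟩
    · simp only [WATE.measure_Icc_eq_cdf]
      exact (ENNReal.continuous_ofReal.comp (hF.sub (hF.comp continuous_neg))).continuousAt
    · rcases le_or_gt (-x) x with hx | hx
      · rw [frontier_Icc hx]; exact (countable_singleton _).insert _
      · rw [Icc_eq_empty hx.not_ge, frontier_empty]; exact countable_empty
    · intro ε hε
      -- The tolerance is shared: one part for the linear approximation and |q| parts for the
      -- standard deviation, which add up to ε.
      have hq1 : 0 < 1 + |q| := by positivity
      have hε' : 0 < ε / (1 + |q|) := by positivity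
      refine ((hTZ _ hε').and (hσhat _ hε')).mono (Eventually.of_forall fun m ω h => ?_)
      have h2 : |q * √(sigmaSqHat m ω) - q * √sigmaSq| ≤ |q| * (ε / (1 + |q|)) := by
        rw [← mul_sub, abs_mul]
        exact mul_le_mul_of_nonneg_left h.2.le (abs_nonneg _)
      have h3 : ε / (1 + |q|) + |q| * (ε / (1 + |q|)) = ε := by field_simp
      have h1 := h.1
      rw [abs_lt] at h1
      rw [abs_le] at h2
      simp only [mem_ofPred_eq, mem_Icc, abs_le]
      exact ⟨fun hz => ⟨by linarith [hz.1], by linarith [hz.2]⟩,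
        fun hz => ⟨by linarith [hz.1], by linarith [hz.2]⟩⟩
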